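/- All manifolds are smooth, finite-dimensional, Hausdorff and without boundary; Lie groups are finite-dimensional. Let $M$ be a manifold and $\mathcal G=(\partial\colon E\to G,\triangleright)$ a Lie crossed module: $\partial$ is a smooth homomorphism of Lie groups, $\triangleright$ a smooth left action of $G$ on $E$ by automorphisms, $\partial(g\triangleright e)=g\,\partial(e)\,g^{-1}$ and $\partial(e)\triangleright f=efe^{-1}$. Write $\mathfrak g,\mathfrak e$ for the Lie algebras. **Thin homotopy double groupoid.** A 1-path is a smooth map $\gamma\colon[0,1]\to M$ that is constant near each end point. A 2-path is a smooth map $\Gamma\colon[0,1]^2\to M$, $(t,s)\mapsto\Gamma(t,s)$, that for some $\epsilon>0$ does not depend on $t$ for $t\le\epsilon$ and for $t\ge 1-\epsilon$, and does not depend on $s$ for $s\le\epsilon$ and for $s\ge 1-\epsilon$. Its faces are $\partial_l\Gamma=\Gamma(0,\cdot)$, $\partial_r\Gamma=\Gamma(1,\cdot)$, $\partial_d\Gamma=\Gamma(\cdot,0)$, $\partial_u\Gamma=\Gamma(\cdot,1)$. A rank-1 homotopy from $\phi$ to $\gamma$ is a 2-path $K$ with constant left and right faces, $\partial_dK=\phi$,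 $\partial_uK=\gamma$, and derivative of rank $\le1$ everywhere. A rank-2 homotopy from $\Gamma$ to $\Gamma'$ is a smooth $J\colon[0,1]^3\to M$ with a product structure close to the boundary, $J(\cdot,\cdot,0)=\Gamma$, $J(\cdot,\cdot,1)=\Gamma'$, whose restriction to each of the four other faces of the cube is a rank-1 homotopy from the corresponding face of $\Gamma$ to that of $\Gamma'$, and whose derivative has rank $\le2$ everywhere. $\mathcal S_2(M)$ has the points of $M$ as objects, the 1-paths modulo rank-1 homotopy as edges and the 2-paths modulo rank-2 homotopy as squares. Faces, degeneracies and the composition of edges are induced by those of paths; if $J$ is any rank-1 homotopy from $\partial_u\Gamma$ to $\partial_d\Gamma'$, then $[\Gamma]\circ_{\rm v}[\Gamma']=[(\Gamma\circ_{\rm v}J)\circ_{\rm v}\Gamma']$, and likewise for horizontal composition; a square is thin if it has a representative with derivative of rank $\le 1$; the symmetry group $D_4$ of the square acts by $r[\Gamma]=[\Gamma\circ r^{-1}]$. By a morphism of double groupoids with thin structure we mean maps of objects, edges and squares that preserve source, target, faces, degeneracies, all compositions and thin squares; it is $D_4$-equivariant if it commutes with the $D_4$-actions on squares. **Part 1 (bundles).**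 Let $\pi\colon P\to M$ be a smooth principal $G$-bundle with a $\mathcal G$-categorical connection $(\omega,m)$: $\omega$ is a connection 1-form, $m$ is a horizontal $\mathfrak e$-valued 2-form on $P$ with $R_g^*m=g^{-1}\triangleright m$, and $\partial(m)=d\omega+\frac12\omega\wedge^{\rm ad}\omega$. Let $\mathcal H_\omega(\gamma,t,u)$ denote parallel transport of $u\in P_{\gamma(0)}$ along $\gamma$ up to time $t$, write $\widetilde X$ for horizontal lifts, and for a 2-path $\Gamma$ put $\gamma_s(t)=\gamma^t(s)=\Gamma(t,s)$. For $u\in P_{\Gamma(0,0)}$ let $u_s=\mathcal H_\omega(\gamma^0,s,u)$ and let $e_\Gamma(u)\in E$ be the value at $s=1$ of the solution of $$\frac{d}{ds}e(s)=e(s)\int_0^1 m\Big(\widetilde{\tfrac{\partial}{\partial t}\gamma_s(t)},\widetilde{\tfrac{\partial}{\partial s}\gamma_s(t)}\Big)_{\mathcal H_\omega(\gamma_s,t,u_s)}dt,\qquad e(0)=1_E .$$ Let $\mathcal D^2(P)$ have the points of $M$ as objects and the right $G$-equivariant maps $P_x\to P_y$ as edges; its squares consist of equivariant maps $a\colon P_x\to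 P_y$ (bottom), $b\colon P_y\to P_w$ (right), $c\colon P_x\to P_z$ (left), $d\colon P_z\to P_w$ (top) and a smooth map $f\colon P_x\to E$ with $f(ug)=g^{-1}\triangleright f(u)$ and $b(a(u))\,\partial(f(u))=d(c(u))$. If the right edge of a first square is the left edge of a second one, with maps $f$ and $f'$, then their horizontal composite has the map $u\mapsto f'(a(u))f(u)$; if the top edge of the first is the bottom edge of the second, then their vertical composite has the map $u\mapsto f(u)f'(c(u))$. A square is thin if $f\equiv1_E$. $D_4$ acts through the horizontal reversion $(a,b,c,d,f)\mapsto(a^{-1},c,b,d^{-1},(f\circ a^{-1})^{-1})$, the vertical reversion $(d,b^{-1},c^{-1},a,(f\circ c^{-1})^{-1})$ and the interchange of coordinates $(c,d,a,b,f^{-1})$, where $f^{-1}(u)=f(u)^{-1}$. (a) If $\Gamma$ and $\Gamma'$ are rank-2 homotopic 2-paths, then $e_\Gamma(u)=e_{\Gamma'}(u)$ for every $u\in P_{\Gamma(0,0)}$. (b) There is a $D_4$-equivariant morphism of double groupoids with thin structure $\mathcal S_2(M)\to\mathcal D^2(P)$ that is the identity on objects, sends $[\gamma]$ to $u\mapsto\mathcal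 H_\omega(\gamma,1,u)$, and sends $[\Gamma]$ to the square with $f=e_\Gamma$. **Part 2 (local form).** Let $A$ be a smooth $\mathfrak g$-valued 1-form and $B$ a smooth $\mathfrak e$-valued 2-form on $M$ with $\partial(B)=dA+\frac12A\wedge^{\rm ad}A$. For a 1-path $\gamma$ let $g_\gamma(t)$ be the solution of $\frac{d}{dt}g_\gamma(t)=g_\gamma(t)A(\gamma'(t))$, $g_\gamma(0)=1_G$, and for a 2-path $\Gamma$ let $e_\Gamma\in E$ be the value at $s=1$ of the solution of $$\frac{d}{ds}e(s)=e(s)\int_0^1\big(g_{\gamma^0}(s)\,g_{\gamma_s}(t)\big)\triangleright B\Big(\tfrac{\partial}{\partial t}\gamma_s(t),\tfrac{\partial}{\partial s}\gamma_s(t)\Big)dt,\qquad e(0)=1_E .$$ Let $\mathcal D^2(\mathcal G)$ be the double groupoid with one object, the elements of $G$ as edges (composed by the product), and as squares the tuples $(X,Y,Z,W,e)$ with bottom, right, left, top edges $X,Y,Z,W\in G$ and $e\in E$ such that $\partial(e)^{-1}XY=ZW$. The horizontal composite of $(X,Y,Z,W,e)$ and $(X',Y',Y,W',e')$ has the element $(X\triangleright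 e')e$, the vertical composite of $(X,Y,Z,W,e)$ (below) and $(W,Y',Z',W',e')$ has the element $e\,(Z\triangleright e')$. A square is thin if $e=1_E$. $D_4$ acts through the horizontal reversion $(X^{-1},Z,Y,W^{-1},X^{-1}\triangleright e^{-1})$, the vertical reversion $(W,Y^{-1},Z^{-1},X,Z^{-1}\triangleright e^{-1})$ and the interchange of coordinates $(Z,W,X,Y,e^{-1})$. (a) If $\Gamma$ and $\Gamma'$ are rank-2 homotopic 2-paths, then $e_\Gamma=e_{\Gamma'}$. (b) There is a $D_4$-equivariant morphism of double groupoids with thin structure $\mathcal S_2(M)\to\mathcal D^2(\mathcal G)$ that sends $[\gamma]$ to $g_\gamma(1)$ and $[\Gamma]$ to the square with element $e_\Gamma$. -/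

import Mathlib

open scoped Manifold ContDiff

noncomputable section

namespace ThinHolonomy

/-! ## Derivatives and differential forms on manifolds

All manifolds are modelled on finite-dimensional real vector spaces, without boundary. In Mathlib
the tangent space at every point of a manifold modelled on `V` is `V` (read in the preferred chart
at the point), so that a tangent vector at `p` is an element of `V`. -/

section Calculus

variable (V : Type*) [NormedAddCommGroup V] [NormedSpace ℝ V]
  (W : Type*) [NormedAddCommGroup W] [NormedSpace ℝ W]
  {N : Type*} [TopologicalSpace N] [ChartedSpace V N]
  {N' : Type*} [TopologicalSpace N'] [ChartedSpace W N']

/-- The derivative `T_x N → T_{f x} N'` of a map of manifolds. -/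
def tmap (f : N → N') (x : N) : V →L[ℝ] W := mfderiv 𝓘(ℝ, V) 𝓘(ℝ, W) f x

/-- The curve `c` is differentiable at `t` with derivative `v`. -/
def HasVelocity (c : ℝ → N) (t : ℝ) (v : V) : Prop :=
  HasMFDerivAt 𝓘(ℝ, ℝ) 𝓘(ℝ, V) c t (ContinuousLinearMap.toSpanSingleton ℝ v)

/-- The velocity of a curve. -/
def velocity (c : ℝ → N) (t : ℝ) : V := tmap ℝ V c t 1

variable (N) in
/-- `W`-valued differential `n`-forms on `N` (smoothness is the predicate `DiffForm.Smooth`). -/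
abbrev DiffForm (n : ℕ) : Type _ := ∀ _ : N, V [⋀^Fin n]→L[ℝ] W

variable {V W} {n : ℕ}

/-- The expression of a form in the chart around `p`, i.e. its pullback under the inverse of
that chart. -/
def DiffForm.inChart (α : DiffForm V W N n) (p : N) : V → V [⋀^Fin n]→L[ℝ] W := fun y =>
  (α ((chartAt V p).symm y)).compContinuousLinearMap (tmap V V (chartAt V p).symm y)

/-- A form is smooth if its expression in each preferred chart is. -/
def DiffForm.Smooth (α : DiffForm V W N n) : Prop :=
  ∀ p : N, ContDiffOn ℝ ∞ (α.inChart p) (chartAt V p).target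

/-- The exterior derivative of a form, computed at `p` in the chart around `p`
(`dα(X, Y) = X α(Y) - Y α(X) - α([X, Y])` for 1-forms). -/
def DiffForm.d (α : DiffForm V W N n) : DiffForm V W N (n + 1) := fun p =>
  (extDeriv (α.inChart p) (chartAt V p p)).compContinuousLinearMap
    (tmap V V (chartAt V p) p)

end Calculus

/-! ## Paths, 2-paths and thin homotopy

A smooth map on the cube `[0,1]ⁿ` which has a product structure close to the boundary is recorded
as its extension to `ℝⁿ` by clamping each coordinate to `[0,1]`. The extension is again smooth, and
in this way such maps correspond bijectively to smooth maps on `ℝⁿ` that satisfy the conditions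
below (for `t ≤ ε` instead of `0 ≤ t ≤ ε`, and so on). -/

section Paths

variable (V : Type*) [NormedAddCommGroup V] [NormedSpace ℝ V]
  (M : Type*) [TopologicalSpace M] [ChartedSpace V M]

/-- 1-paths: smooth paths with sitting instants at both ends. -/
@[ext] structure OnePath where
  toFun : ℝ → M
  smooth : ContMDiff 𝓘(ℝ, ℝ) 𝓘(ℝ, V) ∞ toFun
  sitting : ∃ ε > 0, (∀ t ≤ ε, toFun t = toFun 0) ∧ (∀ t ≥ 1 - ε, toFun t = toFun 1)

/-- 2-paths: smooth squares `Γ(t,s)` with a product structure close to the boundary. -/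
@[ext] structure TwoPath where
  toFun : ℝ × ℝ → M
  smooth : ContMDiff 𝓘(ℝ, ℝ × ℝ) 𝓘(ℝ, V) ∞ toFun
  product : ∃ ε > 0,
    (∀ t ≤ ε, ∀ s, toFun (t, s) = toFun (0, s)) ∧
    (∀ t ≥ 1 - ε, ∀ s, toFun (t, s) = toFun (1, s)) ∧
    (∀ s ≤ ε, ∀ t, toFun (t, s) = toFun (t, 0)) ∧
    (∀ s ≥ 1 - ε, ∀ t, toFun (t, s) = toFun (t, 1))

variable {V M}

instance : CoeFun (OnePath V M) (fun _ => ℝ → M) := ⟨OnePath.toFun⟩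
instance : CoeFun (TwoPath V M) (fun _ => ℝ × ℝ → M) := ⟨TwoPath.toFun⟩

/-- A map from a vector space to `M` whose derivative has rank at most `k` everywhere. -/
def RankLE {U : Type*} [NormedAddCommGroup U] [NormedSpace ℝ U] (k : ℕ) (f : U → M) : Prop :=
  ∀ v : U, Module.finrank ℝ (LinearMap.range (tmap U V f v : U →ₗ[ℝ] V)) ≤ k

theorem RankLE.comp [FiniteDimensional ℝ V] {U U' : Type*}
    [NormedAddCommGroup U] [NormedSpace ℝ U] [NormedAddCommGroup U'] [NormedSpace ℝ U']
    {k : ℕ} {f : U → M} (hf : RankLE (V := V) k f) (hs : ContMDiff 𝓘(ℝ, U) 𝓘(ℝ, V) ∞ f)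
    {g : U' → U} (hg : ContDiff ℝ ∞ g) : RankLE (V := V) k (f ∘ g) := by
  intro v
  have h1 : MDifferentiableAt 𝓘(ℝ, U) 𝓘(ℝ, V) f (g v) := hs.mdifferentiableAt (by simp)
  have h2 : MDifferentiableAt 𝓘(ℝ, U') 𝓘(ℝ, U) g v :=
    hg.contMDiff.mdifferentiableAt (by simp)
  have h3 : tmap U' V (f ∘ g) v = (tmap U V f (g v)).comp (tmap U' U g v) :=
    mfderiv_comp v h1 h2
  refine le_trans (Submodule.finrank_mono ?_) (hf (g v))
  rw [h3]
  rintro _ ⟨x, rfl⟩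
  exact ⟨tmap U' U g v x, rfl⟩

/-- The path `γ_s(t) = Γ(t,s)`. -/
def TwoPath.hslice (Γ : TwoPath V M) (s : ℝ) : OnePath V M where
  toFun t := Γ (t, s)
  smooth := Γ.smooth.comp
    (ContDiff.contMDiff (by fun_prop : ContDiff ℝ ∞ fun t : ℝ => (t, s)))
  sitting := by
    obtain ⟨ε, h0, h1, h2, -, -⟩ := Γ.product
    exact ⟨ε, h0, fun t ht => h1 t ht s, fun t ht => h2 t ht s⟩

/-- The path `γᵗ(s) = Γ(t,s)`. -/
def TwoPath.vslice (Γ : TwoPath V M) (t : ℝ) : OnePath V M where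
  toFun s := Γ (t, s)
  smooth := Γ.smooth.comp
    (ContDiff.contMDiff (by fun_prop : ContDiff ℝ ∞ fun s : ℝ => (t, s)))
  sitting := by
    obtain ⟨ε, h0, -, -, h1, h2⟩ := Γ.product
    exact ⟨ε, h0, fun s hs => h1 s hs t, fun s hs => h2 s hs t⟩

/-- The four faces of a 2-path. -/
def TwoPath.left (Γ : TwoPath V M) : OnePath V M := Γ.vslice 0
def TwoPath.right (Γ : TwoPath V M) : OnePath V M := Γ.vslice 1
def TwoPath.down (Γ : TwoPath V M) : OnePath V M := Γ.hslice 0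
def TwoPath.up (Γ : TwoPath V M) : OnePath V M := Γ.hslice 1

/-- `∂Γ/∂t` and `∂Γ/∂s`. -/
def TwoPath.dt (Γ : TwoPath V M) (t s : ℝ) : V := tmap (ℝ × ℝ) V Γ (t, s) (1, 0)
def TwoPath.ds (Γ : TwoPath V M) (t s : ℝ) : V := tmap (ℝ × ℝ) V Γ (t, s) (0, 1)

/-- The constant 1-path. -/
def OnePath.const (x : M) : OnePath V M where
  toFun _ := x
  smooth := contMDiff_const
  sitting := ⟨1, one_pos, fun _ _ => rfl, fun _ _ => rfl⟩

/-- Concatenation of 1-paths. -/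
def OnePath.concat (γ φ : OnePath V M) (h : γ 1 = φ 0) : OnePath V M where
  toFun t := if t ≤ 1 / 2 then γ (2 * t) else φ (2 * t - 1)
  smooth := by
    obtain ⟨ε, h0, -, h1⟩ := γ.sitting
    obtain ⟨δ, k0, k1, -⟩ := φ.sitting
    intro t
    rcases lt_trichotomy t (1 / 2) with ht | ht | ht
    · have hs : ContMDiff 𝓘(ℝ, ℝ) 𝓘(ℝ, V) ∞ (fun t : ℝ => γ (2 * t)) :=
        γ.smooth.comp (ContDiff.contMDiff (by fun_prop : ContDiff ℝ ∞ fun t : ℝ => 2 * t))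
      refine (hs t).congr_of_eventuallyEq ?_
      filter_upwards [Iio_mem_nhds ht] with x hx
      rw [if_pos (le_of_lt hx)]
    · refine (contMDiffAt_const (c := γ 1)).congr_of_eventuallyEq ?_
      filter_upwards [Ioo_mem_nhds (a := (1 - ε) / 2) (b := (1 + δ) / 2) (x := t)
        (by linarith) (by linarith)] with x hx
      split_ifs with hc
      · exact h1 _ (by linarith [hx.1])
      · rw [h]; exact k1 _ (by linarith [hx.2])
    · have hs : ContMDiff 𝓘(ℝ, ℝ) 𝓘(ℝ, V) ∞ (fun t : ℝ => φ (2 * t - 1)) :=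
        φ.smooth.comp (ContDiff.contMDiff (by fun_prop : ContDiff ℝ ∞ fun t : ℝ => 2 * t - 1))
      refine (hs t).congr_of_eventuallyEq ?_
      filter_upwards [Ioi_mem_nhds ht] with x hx
      rw [if_neg (not_le.2 hx)]
  sitting := by
    obtain ⟨ε, h0, h1, -⟩ := γ.sitting
    obtain ⟨δ, k0, -, k1⟩ := φ.sitting
    refine ⟨min (min ε δ / 2) (1 / 4), by positivity, fun t ht => ?_, fun t ht => ?_⟩
    · have a1 := le_trans ht (min_le_left _ _)
      have a2 := le_trans ht (min_le_right _ _)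
      have a3 := min_le_left ε δ
      rw [if_pos (by linarith), if_pos (by norm_num), mul_zero, h1 _ (by linarith)]
    · have a1 := min_le_left (min ε δ / 2) (1 / 4)
      have a2 := min_le_right (min ε δ / 2) (1 / 4)
      have a3 := min_le_right ε δ
      rw [if_neg (by linarith), if_neg (by norm_num), k1 _ (by linarith)]
      norm_num

/-- The interchange of coordinates, `(t,s) ↦ Γ(s,t)`. -/
def TwoPath.transp (Γ : TwoPath V M) : TwoPath V M where
  toFun p := Γ (p.2, p.1)
  smooth := Γ.smooth.comp
    (ContDiff.contMDiff (by fun_prop : ContDiff ℝ ∞ fun p : ℝ × ℝ => (p.2, p.1)))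
  product := by
    obtain ⟨ε, h0, h1, h2, h3, h4⟩ := Γ.product
    exact ⟨ε, h0, h3, h4, h1, h2⟩

/-- The horizontal reversion, `(t,s) ↦ Γ(1-t,s)`. -/
def TwoPath.hrev (Γ : TwoPath V M) : TwoPath V M where
  toFun p := Γ (1 - p.1, p.2)
  smooth := Γ.smooth.comp
    (ContDiff.contMDiff (by fun_prop : ContDiff ℝ ∞ fun p : ℝ × ℝ => (1 - p.1, p.2)))
  product := by
    obtain ⟨ε, h0, h1, h2, h3, h4⟩ := Γ.product
    refine ⟨ε, h0, fun t ht s => ?_, fun t ht s => ?_, fun s hs t => h3 s hs _,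
      fun s hs t => h4 s hs _⟩
    · simp only [sub_zero]; exact h2 _ (by linarith) s
    · simp only [sub_self]; exact h1 _ (by linarith) s

/-- The vertical reversion, `(t,s) ↦ Γ(t,1-s)`. -/
def TwoPath.vrev (Γ : TwoPath V M) : TwoPath V M where
  toFun p := Γ (p.1, 1 - p.2)
  smooth := Γ.smooth.comp
    (ContDiff.contMDiff (by fun_prop : ContDiff ℝ ∞ fun p : ℝ × ℝ => (p.1, 1 - p.2)))
  product := by
    obtain ⟨ε, h0, h1, h2, h3, h4⟩ := Γ.product
    refine ⟨ε, h0, fun t ht s => h1 t ht _, fun t ht s => h2 t ht _, fun s hs t => ?_,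
      fun s hs t => ?_⟩
    · simp only [sub_zero]; exact h4 _ (by linarith) t
    · simp only [sub_self]; exact h3 _ (by linarith) t

/-- Horizontal concatenation of 2-paths. -/
def TwoPath.hconcat (Γ Γ' : TwoPath V M) (h : Γ.right = Γ'.left) : TwoPath V M where
  toFun p := if p.1 ≤ 1 / 2 then Γ (2 * p.1, p.2) else Γ' (2 * p.1 - 1, p.2)
  smooth := by
    have hh : ∀ s, Γ (1, s) = Γ' (0, s) := fun s => congrArg (fun c : OnePath V M => c s) h
    obtain ⟨ε, h0, -, h1, -, -⟩ := Γ.product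
    obtain ⟨δ, k0, k1, -, -, -⟩ := Γ'.product
    intro p
    rcases lt_trichotomy p.1 (1 / 2) with ht | ht | ht
    · have hs : ContMDiff 𝓘(ℝ, ℝ × ℝ) 𝓘(ℝ, V) ∞ (fun p : ℝ × ℝ => Γ (2 * p.1, p.2)) :=
        Γ.smooth.comp
          (ContDiff.contMDiff (by fun_prop : ContDiff ℝ ∞ fun p : ℝ × ℝ => (2 * p.1, p.2)))
      refine (hs p).congr_of_eventuallyEq ?_
      filter_upwards [continuous_fst.continuousAt.preimage_mem_nhds (Iio_mem_nhds ht)] with x hx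
      rw [if_pos (le_of_lt hx)]
    · have hs : ContMDiff 𝓘(ℝ, ℝ × ℝ) 𝓘(ℝ, V) ∞ (fun p : ℝ × ℝ => Γ (1, p.2)) :=
        Γ.smooth.comp
          (ContDiff.contMDiff (by fun_prop : ContDiff ℝ ∞ fun p : ℝ × ℝ => ((1 : ℝ), p.2)))
      refine (hs p).congr_of_eventuallyEq ?_
      filter_upwards [continuous_fst.continuousAt.preimage_mem_nhds
        (Ioo_mem_nhds (a := (1 - ε) / 2) (b := (1 + δ) / 2) (x := p.1)
        (by linarith) (by linarith))] with x hx
      have hx1 : (1 - ε) / 2 < x.1 := hx.1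
      have hx2 : x.1 < (1 + δ) / 2 := hx.2
      split_ifs with hc
      · exact h1 _ (by linarith) _
      · rw [hh]; exact k1 _ (by linarith) _
    · have hs : ContMDiff 𝓘(ℝ, ℝ × ℝ) 𝓘(ℝ, V) ∞ (fun p : ℝ × ℝ => Γ' (2 * p.1 - 1, p.2)) :=
        Γ'.smooth.comp
          (ContDiff.contMDiff (by fun_prop : ContDiff ℝ ∞ fun p : ℝ × ℝ => (2 * p.1 - 1, p.2)))
      refine (hs p).congr_of_eventuallyEq ?_
      filter_upwards [continuous_fst.continuousAt.preimage_mem_nhds (Ioi_mem_nhds ht)] with x hx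
      rw [if_neg (not_le.2 hx)]
  product := by
    obtain ⟨ε, h0, h1, -, h3, h4⟩ := Γ.product
    obtain ⟨δ, k0, -, k2, k3, k4⟩ := Γ'.product
    have a3 := min_le_left ε δ
    have a4 := min_le_right ε δ
    have a1 := min_le_left (min ε δ / 2) (1 / 4)
    have a2 := min_le_right (min ε δ / 2) (1 / 4)
    have a5 : 0 < min ε δ := lt_min h0 k0
    refine ⟨min (min ε δ / 2) (1 / 4), by positivity, fun t ht s => ?_, fun t ht s => ?_,
      fun s hs t => ?_, fun s hs t => ?_⟩
    · simp only
      rw [if_pos (by linarith), if_pos (by norm_num), mul_zero, h1 _ (by linarith)]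
    · simp only
      rw [if_neg (by linarith), if_neg (by norm_num), k2 _ (by linarith)]
      norm_num
    · simp only
      split_ifs
      · exact h3 _ (by linarith) _
      · exact k3 _ (by linarith) _
    · simp only
      split_ifs
      · exact h4 _ (by linarith) _
      · exact k4 _ (by linarith) _

/-- Vertical concatenation of 2-paths: `Γ` below `Γ'`. -/
def TwoPath.vconcat (Γ Γ' : TwoPath V M) (h : Γ.up = Γ'.down) : TwoPath V M :=
  (Γ.transp.hconcat Γ'.transp h).transp

theorem TwoPath.vconcat_apply (Γ Γ' : TwoPath V M) (h : Γ.up = Γ'.down) (t s : ℝ) :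
    Γ.vconcat Γ' h (t, s) = if s ≤ 1 / 2 then Γ (t, 2 * s) else Γ' (t, 2 * s - 1) := rfl

/-- The 2-path `(t,s) ↦ γ(s)`. -/
def OnePath.deg₁ (γ : OnePath V M) : TwoPath V M where
  toFun p := γ p.2
  smooth := γ.smooth.comp
    (ContDiff.contMDiff (by fun_prop : ContDiff ℝ ∞ fun p : ℝ × ℝ => p.2))
  product := by
    obtain ⟨ε, h0, h1, h2⟩ := γ.sitting
    exact ⟨ε, h0, fun _ _ _ => rfl, fun _ _ _ => rfl, fun s hs _ => h1 s hs,
      fun s hs _ => h2 s hs⟩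

/-- The 2-path `(t,s) ↦ γ(t)`. -/
def OnePath.deg₂ (γ : OnePath V M) : TwoPath V M := γ.deg₁.transp

/-- `Γ` is a rank-1 homotopy from `φ` to `γ`. -/
structure IsRankOneHomotopy (Γ : TwoPath V M) (φ γ : OnePath V M) : Prop where
  left_const : ∀ s, Γ.left s = Γ.left 0
  right_const : ∀ s, Γ.right s = Γ.right 0
  down_eq : Γ.down = φ
  up_eq : Γ.up = γ
  rank : RankLE (V := V) 1 Γ.toFun

/-- `φ ≅₁ γ`. -/
def RankOneHomotopic (φ γ : OnePath V M) : Prop := ∃ Γ, IsRankOneHomotopy Γ φ γ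

/-- `J(t,s,x)` is a rank-2 homotopy from `Γ` to `Γ'`. -/
structure IsRankTwoHomotopy (J : ℝ × ℝ × ℝ → M) (Γ Γ' : TwoPath V M) : Prop where
  smooth : ContMDiff 𝓘(ℝ, ℝ × ℝ × ℝ) 𝓘(ℝ, V) ∞ J
  start : ∀ t s, J (t, s, 0) = Γ (t, s)
  finish : ∀ t s, J (t, s, 1) = Γ' (t, s)
  left : ∃ K : TwoPath V M, (∀ s x, K (s, x) = J (0, s, x)) ∧
    IsRankOneHomotopy K Γ.left Γ'.left
  right : ∃ K : TwoPath V M, (∀ s x, K (s, x) = J (1, s, x)) ∧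
    IsRankOneHomotopy K Γ.right Γ'.right
  down : ∃ K : TwoPath V M, (∀ t x, K (t, x) = J (t, 0, x)) ∧
    IsRankOneHomotopy K Γ.down Γ'.down
  up : ∃ K : TwoPath V M, (∀ t x, K (t, x) = J (t, 1, x)) ∧
    IsRankOneHomotopy K Γ.up Γ'.up
  product : ∃ ε > 0,
    (∀ t ≤ ε, ∀ s x, J (t, s, x) = J (0, s, x)) ∧
    (∀ t ≥ 1 - ε, ∀ s x, J (t, s, x) = J (1, s, x)) ∧
    (∀ s ≤ ε, ∀ t x, J (t, s, x) = J (t, 0, x)) ∧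
    (∀ s ≥ 1 - ε, ∀ t x, J (t, s, x) = J (t, 1, x)) ∧
    (∀ x ≤ ε, ∀ t s, J (t, s, x) = J (t, s, 0)) ∧
    (∀ x ≥ 1 - ε, ∀ t s, J (t, s, x) = J (t, s, 1))
  rank : RankLE (V := V) 2 J

/-- `Γ ≅₂ Γ'`. -/
def RankTwoHomotopic (Γ Γ' : TwoPath V M) : Prop := ∃ J, IsRankTwoHomotopy J Γ Γ'

variable (V M) in
/-- 1-tracks: 1-paths up to rank-1 homotopy. -/
def OneTrack : Type _ := Quot (RankOneHomotopic (V := V) (M := M))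

variable (V M) in
/-- 2-tracks: 2-paths up to rank-2 homotopy. -/
def TwoTrack : Type _ := Quot (RankTwoHomotopic (V := V) (M := M))

/-- The class of a 1-path. -/
def OnePath.track (γ : OnePath V M) : OneTrack V M := Quot.mk _ γ

/-- The class of a 2-path. -/
def TwoPath.track (Γ : TwoPath V M) : TwoTrack V M := Quot.mk _ Γ

end Paths

/-! ## The dihedral group of the square -/

section Dihedral

variable {α : Type*}

/-- The eight elements of the symmetry group of the square in terms of the reflection `h` of the
first coordinate, the reflection `v` of the second coordinate and the interchange `t` of
coordinates: `r 1 = h ∘ t` is the anticlockwise rotation by `90` degrees, and `sr 0 = t`. -/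
def d4Fun (h v t : α → α) : DihedralGroup 4 → α → α
  | .r i => (![id, h ∘ t, h ∘ v, t ∘ h] : Fin 4 → α → α) i
  | .sr i => (![t, v, t ∘ h ∘ v, h] : Fin 4 → α → α) i

/-- The action of the dihedral group of the square that is determined by the action of the two
reflections and of the interchange. -/
@[reducible] def d4Action (h v t : α → α) (hh : ∀ x, h (h x) = x) (vv : ∀ x, v (v x) = x)
    (tt : ∀ x, t (t x) = x) (hv : ∀ x, h (v x) = v (h x)) (th : ∀ x, t (h x) = v (t x)) :
    MulAction (DihedralGroup 4) α where
  smul := d4Fun h v t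
  one_smul _ := rfl
  mul_smul := by
    have tv : ∀ x, t (v x) = h (t x) := fun x => by rw [← tt x, ← th, tt, tt]
    rintro ((i : Fin 4) | (i : Fin 4)) ((j : Fin 4) | (j : Fin 4)) x
    · change (![id, h ∘ t, h ∘ v, t ∘ h] (i + j) : α → α) x =
        (![id, h ∘ t, h ∘ v, t ∘ h] i : α → α) ((![id, h ∘ t, h ∘ v, t ∘ h] j : α → α) x)
      fin_cases i <;> fin_cases j <;> simp [hh, vv, tt, hv, th, tv]
    · change (![t, v, t ∘ h ∘ v, h] (j - i) : α → α) x =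
        (![id, h ∘ t, h ∘ v, t ∘ h] i : α → α) ((![t, v, t ∘ h ∘ v, h] j : α → α) x)
      fin_cases i <;> fin_cases j <;> simp [hh, vv, tt, hv, th, tv]
    · change (![t, v, t ∘ h ∘ v, h] (i + j) : α → α) x =
        (![t, v, t ∘ h ∘ v, h] i : α → α) ((![id, h ∘ t, h ∘ v, t ∘ h] j : α → α) x)
      fin_cases i <;> fin_cases j <;> simp [hh, vv, tt, hv, th, tv]
    · change (![id, h ∘ t, h ∘ v, t ∘ h] (j - i) : α → α) x =
        (![t, v, t ∘ h ∘ v, h] i : α → α) ((![t, v, t ∘ h ∘ v, h] j : α → α) x)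
      fin_cases i <;> fin_cases j <;> simp [hh, vv, tt, hv, th, tv]

end Dihedral

/-- Reflection of the square `[0,1]²` in the first coordinate. -/
def flip₁ (p : ℝ × ℝ) : ℝ × ℝ := (1 - p.1, p.2)
/-- Reflection of the square `[0,1]²` in the second coordinate. -/
def flip₂ (p : ℝ × ℝ) : ℝ × ℝ := (p.1, 1 - p.2)

/-- The geometric action of the dihedral group on the square `[0,1]²` (and on its plane). -/
@[reducible] def squareAction : MulAction (DihedralGroup 4) (ℝ × ℝ) :=
  d4Action flip₁ flip₂ Prod.swap (fun x => by simp [flip₁]) (fun x => by simp [flip₂])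
    (fun x => by simp) (fun x => by simp [flip₁, flip₂]) (fun x => by simp [flip₁, flip₂])

/-! ## Double groupoids -/

/-- The structure maps of an edge symmetric double groupoid with thin structure and dihedral
symmetry. The compositions, which are partially defined, are given by their graphs: `Comp a b c`
means that `c` is the composite of `a` and `b`. In a square the bottom and top edges go from left
to right, and the left and right edges go from bottom to top. -/
structure DoubleGroupoidOps where
  /-- objects -/
  Obj : Type*
  /-- 1-morphisms -/
  Edge : Type*
  /-- 2-morphisms -/
  Sq : Type*
  /-- source of a 1-morphism -/
  src : Edge → Obj
  /-- target of a 1-morphism -/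
  tgt : Edge → Obj
  /-- identity 1-morphisms, i.e. degenerate edges -/
  one : Obj → Edge
  /-- `Comp a b c`: first `a`, then `b`, gives `c` -/
  Comp : Edge → Edge → Edge → Prop
  /-- the face `∂₁⁻` -/
  left : Sq → Edge
  /-- the face `∂₁⁺` -/
  right : Sq → Edge
  /-- the face `∂₂⁻` -/
  down : Sq → Edge
  /-- the face `∂₂⁺` -/
  up : Sq → Edge
  /-- the degenerate square with the given left and right edge -/
  deg₁ : Edge → Sq
  /-- the degenerate square with the given bottom and top edge -/
  deg₂ : Edge → Sq
  /-- `HComp k k' k''`: `k` to the left of `k'` gives `k''` -/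
  HComp : Sq → Sq → Sq → Prop
  /-- `VComp k k' k''`: `k` below `k'` gives `k''` -/
  VComp : Sq → Sq → Sq → Prop
  /-- the thin squares -/
  Thin : Sq → Prop
  /-- the action of the dihedral group of the square -/
  d4 : MulAction (DihedralGroup 4) Sq

attribute [instance] DoubleGroupoidOps.d4

/-- A `D₄`-equivariant morphism of double groupoids with thin structure. -/
structure DoubleGroupoidOps.Hom (A B : DoubleGroupoidOps) where
  obj : A.Obj → B.Obj
  edge : A.Edge → B.Edge
  sq : A.Sq → B.Sq
  map_src : ∀ a, B.src (edge a) = obj (A.src a)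
  map_tgt : ∀ a, B.tgt (edge a) = obj (A.tgt a)
  map_one : ∀ x, edge (A.one x) = B.one (obj x)
  map_comp : ∀ a b c, A.Comp a b c → B.Comp (edge a) (edge b) (edge c)
  map_left : ∀ k, B.left (sq k) = edge (A.left k)
  map_right : ∀ k, B.right (sq k) = edge (A.right k)
  map_down : ∀ k, B.down (sq k) = edge (A.down k)
  map_up : ∀ k, B.up (sq k) = edge (A.up k)
  map_deg₁ : ∀ a, sq (A.deg₁ a) = B.deg₁ (edge a)
  map_deg₂ : ∀ a, sq (A.deg₂ a) = B.deg₂ (edge a)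
  map_hcomp : ∀ k k' k'', A.HComp k k' k'' → B.HComp (sq k) (sq k') (sq k'')
  map_vcomp : ∀ k k' k'', A.VComp k k' k'' → B.VComp (sq k) (sq k') (sq k'')
  map_thin : ∀ k, A.Thin k → B.Thin (sq k)
  map_d4 : ∀ (g : DihedralGroup 4) k, sq (g • k) = g • sq k

/-! ## The thin homotopy double groupoid of a manifold -/

section Tracks

variable {V : Type*} [NormedAddCommGroup V] [NormedSpace ℝ V]
  {M : Type*} [TopologicalSpace M] [ChartedSpace V M]

/-- The dihedral group acts on 2-paths. -/
instance : MulAction (DihedralGroup 4) (TwoPath V M) :=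
  d4Action TwoPath.hrev TwoPath.vrev TwoPath.transp
    (fun Γ => by ext; simp [TwoPath.hrev]) (fun Γ => by ext; simp [TwoPath.vrev])
    (fun Γ => rfl) (fun Γ => rfl) (fun Γ => rfl)

/-- The action on 2-paths is `g • Γ = Γ ∘ g⁻¹`. -/
theorem TwoPath.smul_apply (g : DihedralGroup 4) (Γ : TwoPath V M) (p : ℝ × ℝ) :
    (g • Γ) p = Γ (squareAction.smul g⁻¹ p) := by
  rcases g with ((i : Fin 4) | (i : Fin 4)) <;> fin_cases i <;> rfl

variable [FiniteDimensional ℝ V]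

theorem IsRankOneHomotopy.hrev {K : TwoPath V M} {Γ Γ' : TwoPath V M}
    (h : IsRankOneHomotopy K Γ.down Γ'.down) :
    IsRankOneHomotopy K.hrev Γ.hrev.down Γ'.hrev.down where
  left_const s := by
    have := h.right_const s
    simpa [TwoPath.left, TwoPath.right, TwoPath.vslice, TwoPath.hrev] using this
  right_const s := by
    have := h.left_const s
    simpa [TwoPath.left, TwoPath.right, TwoPath.vslice, TwoPath.hrev] using this
  down_eq := by
    ext t; exact congrArg (fun c : OnePath V M => c (1 - t)) h.down_eq
  up_eq := by
    ext t; exact congrArg (fun c : OnePath V M => c (1 - t)) h.up_eq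
  rank := h.rank.comp K.smooth (by fun_prop : ContDiff ℝ ∞ fun p : ℝ × ℝ => (1 - p.1, p.2))

theorem RankTwoHomotopic.hrev {Γ Γ' : TwoPath V M} (h : RankTwoHomotopic Γ Γ') :
    RankTwoHomotopic Γ.hrev Γ'.hrev := by
  obtain ⟨J, h⟩ := h
  have hc : ContDiff ℝ ∞ fun p : ℝ × ℝ × ℝ => (1 - p.1, p.2) := by fun_prop
  refine ⟨fun p => J (1 - p.1, p.2), h.smooth.comp hc.contMDiff, fun t s => h.start _ s,
    fun t s => h.finish _ s, ?_, ?_, ?_, ?_, ?_, h.rank.comp h.smooth hc⟩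
  · obtain ⟨K, h1, h2⟩ := h.right
    refine ⟨K, fun s x => by simp [h1], ?_⟩
    convert h2 using 1 <;> ext <;>
      simp [TwoPath.left, TwoPath.right, TwoPath.vslice, TwoPath.hrev]
  · obtain ⟨K, h1, h2⟩ := h.left
    refine ⟨K, fun s x => by simp [h1], ?_⟩
    convert h2 using 1 <;> ext <;>
      simp [TwoPath.left, TwoPath.right, TwoPath.vslice, TwoPath.hrev]
  · obtain ⟨K, h1, h2⟩ := h.down
    exact ⟨K.hrev, fun s x => h1 _ _, h2.hrev⟩
  · obtain ⟨K, h1, h2⟩ := h.up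
    refine ⟨K.hrev, fun s x => h1 _ _, ?_⟩
    have h3 : IsRankOneHomotopy K Γ.vrev.down Γ'.vrev.down := by
      convert h2 using 1 <;> ext <;>
        simp [TwoPath.down, TwoPath.up, TwoPath.hslice, TwoPath.vrev]
    convert h3.hrev using 1 <;> ext <;>
      simp [TwoPath.down, TwoPath.up, TwoPath.hslice, TwoPath.vrev, TwoPath.hrev]
  · obtain ⟨ε, h0, h1, h2, h3, h4, h5, h6⟩ := h.product
    refine ⟨ε, h0, fun t ht s x => ?_, fun t ht s x => ?_, fun s hs t x => h3 s hs _ x,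
      fun s hs t x => h4 s hs _ x, fun x hx t s => h5 x hx _ s, fun x hx t s => h6 x hx _ s⟩
    · simp only [sub_zero]; exact h2 _ (by linarith) s x
    · simp only [sub_self]; exact h1 _ (by linarith) s x

theorem RankTwoHomotopic.transp {Γ Γ' : TwoPath V M} (h : RankTwoHomotopic Γ Γ') :
    RankTwoHomotopic Γ.transp Γ'.transp := by
  obtain ⟨J, h⟩ := h
  have hc : ContDiff ℝ ∞ fun p : ℝ × ℝ × ℝ => (p.2.1, p.1, p.2.2) := by fun_prop
  refine ⟨fun p => J (p.2.1, p.1, p.2.2), h.smooth.comp hc.contMDiff, fun t s => h.start s t,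
    fun t s => h.finish s t, h.down, h.up, h.left, h.right, ?_, h.rank.comp h.smooth hc⟩
  obtain ⟨ε, h0, h1, h2, h3, h4, h5, h6⟩ := h.product
  exact ⟨ε, h0, fun t ht s x => h3 t ht s x, fun t ht s x => h4 t ht s x,
    fun t ht s x => h1 t ht s x, fun t ht s x => h2 t ht s x, fun x hx t s => h5 x hx s t,
    fun x hx t s => h6 x hx s t⟩

theorem RankOneHomotopic.deg₁ {φ γ : OnePath V M} (h : RankOneHomotopic φ γ) :
    RankTwoHomotopic φ.deg₁ γ.deg₁ := by
  obtain ⟨K, h⟩ := h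
  have hd : ∀ t, K (t, 0) = φ t := fun t => congrArg (fun c : OnePath V M => c t) h.down_eq
  have hu : ∀ t, K (t, 1) = γ t := fun t => congrArg (fun c : OnePath V M => c t) h.up_eq
  have hK : IsRankOneHomotopy K φ γ := h
  have hc : ContDiff ℝ ∞ fun p : ℝ × ℝ × ℝ => p.2 := by fun_prop
  have side : ∀ r : ℝ, (∀ s, K (r, s) = K (r, 0)) →
      IsRankOneHomotopy (K.vslice r).deg₁ (OnePath.const (φ r)) (OnePath.const (γ r)) :=
    fun r hr =>
    { left_const := hr
      right_const := hr
      down_eq := by ext t; exact hd r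
      up_eq := by ext t; exact hu r
      rank := h.rank.comp K.smooth (by fun_prop : ContDiff ℝ ∞ fun p : ℝ × ℝ => (r, p.2)) }
  refine ⟨fun p => K p.2, K.smooth.comp hc.contMDiff, fun t s => hd s, fun t s => hu s,
    ⟨K, fun _ _ => rfl, h⟩, ⟨K, fun _ _ => rfl, h⟩,
    ⟨(K.vslice 0).deg₁, fun _ _ => rfl, side 0 h.left_const⟩,
    ⟨(K.vslice 1).deg₁, fun _ _ => rfl, side 1 h.right_const⟩, ?_,
    fun v => (h.rank.comp K.smooth hc v).trans one_le_two⟩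
  obtain ⟨ε, h0, h1, h2, h3, h4⟩ := K.product
  exact ⟨ε, h0, fun _ _ _ _ => rfl, fun _ _ _ _ => rfl, fun s hs _ x => h1 s hs x,
    fun s hs _ x => h2 s hs x, fun x hx _ s => h3 x hx s, fun x hx _ s => h4 x hx s⟩

/-- Horizontal reversion of 2-tracks. -/
def TwoTrack.hrev : TwoTrack V M → TwoTrack V M := Quot.map TwoPath.hrev fun _ _ h => h.hrev
/-- Interchange of the coordinates of 2-tracks. -/
def TwoTrack.transp : TwoTrack V M → TwoTrack V M :=
  Quot.map TwoPath.transp fun _ _ h => h.transp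
/-- Vertical reversion of 2-tracks. -/
def TwoTrack.vrev : TwoTrack V M → TwoTrack V M :=
  Quot.map TwoPath.vrev fun _ _ h => h.transp.hrev.transp

/-- The dihedral group acts on 2-tracks. -/
instance : MulAction (DihedralGroup 4) (TwoTrack V M) :=
  d4Action TwoTrack.hrev TwoTrack.vrev TwoTrack.transp
    (fun k => by
      induction k using Quot.ind with
      | mk Γ => exact congrArg _ (show Γ.hrev.hrev = Γ by ext; simp [TwoPath.hrev]))
    (fun k => by
      induction k using Quot.ind with
      | mk Γ => exact congrArg _ (show Γ.vrev.vrev = Γ by ext; simp [TwoPath.vrev]))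
    (fun k => by induction k using Quot.ind; rfl) (fun k => by induction k using Quot.ind; rfl)
    (fun k => by induction k using Quot.ind; rfl)

/-- The action on 2-tracks is induced by the one on 2-paths. -/
theorem TwoPath.track_smul (g : DihedralGroup 4) (Γ : TwoPath V M) :
    g • Γ.track = (g • Γ).track := by
  rcases g with ((i : Fin 4) | (i : Fin 4)) <;> fin_cases i <;> rfl

variable (V M) in
/-- The thin homotopy double groupoid of `M`. If the top edge of `Γ` and the bottom edge of `Γ'`
agree up to rank-1 homotopy, then the vertical composite of their classes is the class of
`(Γ ∘ J) ∘ Γ'` for any rank-1 homotopy `J` between these edges; similarly for the horizontal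
composite. -/
def thinDoubleGroupoid : DoubleGroupoidOps where
  Obj := M
  Edge := OneTrack V M
  Sq := TwoTrack V M
  src := Quot.lift (fun γ => γ 0) (by
    rintro φ γ ⟨K, h⟩
    have hd : K (0, 0) = φ 0 := congrArg (fun c : OnePath V M => c 0) h.down_eq
    have hu : K (0, 1) = γ 0 := congrArg (fun c : OnePath V M => c 0) h.up_eq
    exact hd.symm.trans ((h.left_const 1).symm.trans hu))
  tgt := Quot.lift (fun γ => γ 1) (by
    rintro φ γ ⟨K, h⟩
    have hd : K (1, 0) = φ 1 := congrArg (fun c : OnePath V M => c 1) h.down_eq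
    have hu : K (1, 1) = γ 1 := congrArg (fun c : OnePath V M => c 1) h.up_eq
    exact hd.symm.trans ((h.right_const 1).symm.trans hu))
  one x := (OnePath.const x).track
  Comp a b c := ∃ (γ φ : OnePath V M) (h : γ 1 = φ 0),
    a = γ.track ∧ b = φ.track ∧ c = (γ.concat φ h).track
  left := Quot.map TwoPath.left (by rintro _ _ ⟨J, h⟩; exact ⟨_, h.left.choose_spec.2⟩)
  right := Quot.map TwoPath.right (by rintro _ _ ⟨J, h⟩; exact ⟨_, h.right.choose_spec.2⟩)
  down := Quot.map TwoPath.down (by rintro _ _ ⟨J, h⟩; exact ⟨_, h.down.choose_spec.2⟩)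
  up := Quot.map TwoPath.up (by rintro _ _ ⟨J, h⟩; exact ⟨_, h.up.choose_spec.2⟩)
  deg₁ := Quot.map OnePath.deg₁ fun _ _ h => h.deg₁
  deg₂ := Quot.map OnePath.deg₂ fun _ _ h => h.deg₁.transp
  HComp k k' k'' := ∃ (Γ J Γ' : TwoPath V M) (h : Γ.right = J.transp.left)
    (h' : (Γ.hconcat J.transp h).right = Γ'.left), IsRankOneHomotopy J Γ.right Γ'.left ∧
    k = Γ.track ∧ k' = Γ'.track ∧ k'' = ((Γ.hconcat J.transp h).hconcat Γ' h').track
  VComp k k' k'' := ∃ (Γ J Γ' : TwoPath V M) (h : Γ.up = J.down)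
    (h' : (Γ.vconcat J h).up = Γ'.down), IsRankOneHomotopy J Γ.up Γ'.down ∧
    k = Γ.track ∧ k' = Γ'.track ∧ k'' = ((Γ.vconcat J h).vconcat Γ' h').track
  Thin k := ∃ Γ : TwoPath V M, RankLE (V := V) 1 Γ.toFun ∧ k = Γ.track
  d4 := inferInstance

end Tracks

/-! ## Lie crossed modules and their double groupoids -/

section CrossedModules

/-- A Lie crossed module `(∂ : E → G, ▷)`. The models `VG` and `VE` of `G` and `E` are the underlying
vector spaces of the Lie algebras. -/
structure LieCrossedModule
    (VG : Type*) [NormedAddCommGroup VG] [NormedSpace ℝ VG]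
    (G : Type*) [TopologicalSpace G] [ChartedSpace VG G] [Group G]
    (VE : Type*) [NormedAddCommGroup VE] [NormedSpace ℝ VE]
    (E : Type*) [TopologicalSpace E] [ChartedSpace VE E] [Group E] where
  /-- the boundary map `∂` -/
  bd : E →* G
  /-- the left action `▷` by automorphisms -/
  act : G →* MulAut E
  bd_smooth : ContMDiff 𝓘(ℝ, VE) 𝓘(ℝ, VG) ∞ bd
  act_smooth : ContMDiff (𝓘(ℝ, VG).prod 𝓘(ℝ, VE)) 𝓘(ℝ, VE) ∞ fun x : G × E => act x.1 x.2
  bd_act : ∀ g e, bd (act g e) = g * bd e * g⁻¹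
  peiffer : ∀ e f, act (bd e) f = e * f * e⁻¹

variable {VG : Type*} [NormedAddCommGroup VG] [NormedSpace ℝ VG]
  {G : Type*} [TopologicalSpace G] [ChartedSpace VG G] [Group G]
  {VE : Type*} [NormedAddCommGroup VE] [NormedSpace ℝ VE]
  {E : Type*} [TopologicalSpace E] [ChartedSpace VE E] [Group E]

variable (VG G) in
/-- The adjoint action of `G` on its Lie algebra. -/
def adj (g : G) : VG →L[ℝ] VG := tmap VG VG (fun h : G => g * h * g⁻¹) 1

variable (VG G) in
/-- The bracket of the Lie algebra of `G`. -/
def lieBr (X Y : GroupLieAlgebra 𝓘(ℝ, VG) G) : VG :=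
  (⁅X, Y⁆ : GroupLieAlgebra 𝓘(ℝ, VG) G)

namespace LieCrossedModule

variable (𝒢 : LieCrossedModule VG G VE E)

/-- The Lie algebra map induced by `∂`. -/
def bdLie : VE →L[ℝ] VG := tmap VE VG 𝒢.bd 1

/-- The action of `G` on the Lie algebra of `E` induced by `▷`. -/
def actLie (g : G) : VE →L[ℝ] VE := tmap VE VE (fun e : E => 𝒢.act g e) 1

/-- Squares in `𝒢`, with bottom, right, left and top edges `X`, `Y`, `Z`, `W`. -/
@[ext] structure Square where
  X : G
  Y : G
  Z : G
  W : G
  e : E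
  comm : (𝒢.bd e)⁻¹ * X * Y = Z * W

variable {𝒢}

namespace Square

/-- Horizontal composition: `k` to the left of `k'`. -/
def hcomp (k k' : 𝒢.Square) (h : k.Y = k'.Z) : 𝒢.Square where
  X := k.X * k'.X
  Y := k'.Y
  Z := k.Z
  W := k.W * k'.W
  e := 𝒢.act k.X k'.e * k.e
  comm := by
    have h1 := k.comm
    have h2 := k'.comm
    rw [← h] at h2
    calc (𝒢.bd (𝒢.act k.X k'.e * k.e))⁻¹ * (k.X * k'.X) * k'.Y
        = (𝒢.bd k.e)⁻¹ * k.X * ((𝒢.bd k'.e)⁻¹ * k'.X * k'.Y) := by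
          rw [map_mul, 𝒢.bd_act]; group
      _ = k.Z * (k.W * k'.W) := by rw [h2, ← mul_assoc, h1, mul_assoc]

/-- Vertical composition: `k` below `k'`. -/
def vcomp (k k' : 𝒢.Square) (h : k.W = k'.X) : 𝒢.Square where
  X := k.X
  Y := k.Y * k'.Y
  Z := k.Z * k'.Z
  W := k'.W
  e := k.e * 𝒢.act k.Z k'.e
  comm := by
    have h1 := k.comm
    have h2 := k'.comm
    rw [← h] at h2
    calc (𝒢.bd (k.e * 𝒢.act k.Z k'.e))⁻¹ * k.X * (k.Y * k'.Y)
        = k.Z * (𝒢.bd k'.e)⁻¹ * k.Z⁻¹ * ((𝒢.bd k.e)⁻¹ * k.X * k.Y) * k'.Y := by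
          rw [map_mul, 𝒢.bd_act]; group
      _ = k.Z * ((𝒢.bd k'.e)⁻¹ * k.W * k'.Y) := by rw [h1]; group
      _ = k.Z * k'.Z * k'.W := by rw [h2, mul_assoc]

/-- Horizontal reversion. -/
def hrev (k : 𝒢.Square) : 𝒢.Square where
  X := k.X⁻¹
  Y := k.Z
  Z := k.Y
  W := k.W⁻¹
  e := 𝒢.act k.X⁻¹ k.e⁻¹
  comm := by
    have h : k.Z = (𝒢.bd k.e)⁻¹ * k.X * k.Y * k.W⁻¹ := by rw [k.comm]; group
    rw [𝒢.bd_act, map_inv, h]; group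

/-- Vertical reversion. -/
def vrev (k : 𝒢.Square) : 𝒢.Square where
  X := k.W
  Y := k.Y⁻¹
  Z := k.Z⁻¹
  W := k.X
  e := 𝒢.act k.Z⁻¹ k.e⁻¹
  comm := by
    have h : k.W = k.Z⁻¹ * ((𝒢.bd k.e)⁻¹ * k.X * k.Y) := by rw [k.comm]; group
    rw [𝒢.bd_act, map_inv, h]; group

/-- Interchange of coordinates. -/
def transp (k : 𝒢.Square) : 𝒢.Square where
  X := k.Z
  Y := k.W
  Z := k.X
  W := k.Y
  e := k.e⁻¹
  comm := by
    rw [map_inv, inv_inv, mul_assoc, ← k.comm]; group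

theorem act_act_eq (k : 𝒢.Square) :
    𝒢.act k.W⁻¹ (𝒢.act k.Z⁻¹ k.e) = 𝒢.act k.Y⁻¹ (𝒢.act k.X⁻¹ k.e) := by
  have h : k.Y⁻¹ * k.X⁻¹ = k.W⁻¹ * k.Z⁻¹ * 𝒢.bd k.e⁻¹ := by
    have h1 : k.W⁻¹ * k.Z⁻¹ = (k.Z * k.W)⁻¹ := by group
    rw [h1, ← k.comm, map_inv]; group
  have h2 : 𝒢.act (𝒢.bd k.e⁻¹) k.e = k.e := by rw [𝒢.peiffer]; group
  calc 𝒢.act k.W⁻¹ (𝒢.act k.Z⁻¹ k.e)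
      = 𝒢.act k.W⁻¹ (𝒢.act k.Z⁻¹ (𝒢.act (𝒢.bd k.e⁻¹) k.e)) := by rw [h2]
    _ = 𝒢.act (k.W⁻¹ * k.Z⁻¹ * 𝒢.bd k.e⁻¹) k.e := by
      rw [map_mul, map_mul, MulAut.mul_apply, MulAut.mul_apply]
    _ = 𝒢.act k.Y⁻¹ (𝒢.act k.X⁻¹ k.e) := by rw [← h, map_mul, MulAut.mul_apply]

instance : MulAction (DihedralGroup 4) 𝒢.Square :=
  d4Action hrev vrev transp
    (fun k => by ext <;> simp [hrev]) (fun k => by ext <;> simp [vrev])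
    (fun k => by ext <;> simp [transp])
    (fun k => by
      ext <;> simp only [hrev, vrev]
      rw [map_inv (𝒢.act k.Z⁻¹), map_inv (𝒢.act k.X⁻¹), inv_inv, inv_inv, act_act_eq]) (fun k => by ext <;> simp [transp, hrev, vrev])

end Square

variable (𝒢) in
/-- The double groupoid `𝒟(𝒢)`, with a single object. -/
def doubleGroupoid : DoubleGroupoidOps where
  Obj := Unit
  Edge := G
  Sq := 𝒢.Square
  src _ := ()
  tgt _ := ()
  one _ := 1
  Comp a b c := a * b = c
  left := Square.Z
  right := Square.Y
  down := Square.X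
  up := Square.W
  deg₁ a := ⟨1, a, a, 1, 1, by simp⟩
  deg₂ a := ⟨a, 1, 1, a, 1, by simp⟩
  HComp k k' k'' := ∃ h, k.hcomp k' h = k''
  VComp k k' k'' := ∃ h, k.vcomp k' h = k''
  Thin k := k.e = 1
  d4 := inferInstance

end LieCrossedModule

end CrossedModules

/-! ## Principal bundles and their double groupoids -/

section Bundles

/-- A smooth (right) principal `G`-bundle `P → M`. -/
structure PrincipalBundle
    (VM : Type*) [NormedAddCommGroup VM] [NormedSpace ℝ VM]
    (M : Type*) [TopologicalSpace M] [ChartedSpace VM M]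
    (VG : Type*) [NormedAddCommGroup VG] [NormedSpace ℝ VG]
    (G : Type*) [TopologicalSpace G] [ChartedSpace VG G] [Group G]
    (VP : Type*) [NormedAddCommGroup VP] [NormedSpace ℝ VP]
    (P : Type*) [TopologicalSpace P] [ChartedSpace VP P] where
  /-- the projection -/
  proj : P → M
  /-- the right action of `G` -/
  act : P → G → P
  proj_smooth : ContMDiff 𝓘(ℝ, VP) 𝓘(ℝ, VM) ∞ proj
  act_smooth : ContMDiff (𝓘(ℝ, VP).prod 𝓘(ℝ, VG)) 𝓘(ℝ, VP) ∞ fun x : P × G => act x.1 x.2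
  act_one : ∀ p, act p 1 = p
  act_mul : ∀ p g h, act p (g * h) = act (act p g) h
  proj_act : ∀ p g, proj (act p g) = proj p
  /-- around every point of `M` there is an equivariant local trivialisation -/
  locTriv : ∀ x : M, ∃ (U : Set M) (Φ : OpenPartialHomeomorph P (M × G)),
    IsOpen U ∧ x ∈ U ∧ Φ.source = proj ⁻¹' U ∧ Φ.target = U ×ˢ Set.univ ∧
    ContMDiffOn 𝓘(ℝ, VP) (𝓘(ℝ, VM).prod 𝓘(ℝ, VG)) ∞ Φ Φ.source ∧
    ContMDiffOn (𝓘(ℝ, VM).prod 𝓘(ℝ, VG)) 𝓘(ℝ, VP) ∞ Φ.symm Φ.target ∧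
    ∀ p ∈ Φ.source, (Φ p).1 = proj p ∧ ∀ g, Φ (act p g) = ((Φ p).1, (Φ p).2 * g)

variable {VM : Type*} [NormedAddCommGroup VM] [NormedSpace ℝ VM]
  {M : Type*} [TopologicalSpace M] [ChartedSpace VM M]
  {VG : Type*} [NormedAddCommGroup VG] [NormedSpace ℝ VG]
  {G : Type*} [TopologicalSpace G] [ChartedSpace VG G] [Group G]
  {VE : Type*} [NormedAddCommGroup VE] [NormedSpace ℝ VE]
  {E : Type*} [TopologicalSpace E] [ChartedSpace VE E] [Group E]
  {VP : Type*} [NormedAddCommGroup VP] [NormedSpace ℝ VP]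
  {P : Type*} [TopologicalSpace P] [ChartedSpace VP P]

namespace PrincipalBundle

variable (B : PrincipalBundle VM M VG G VP P)

theorem exists_act_eq {p q : P} (h : B.proj p = B.proj q) : ∃ g, B.act p g = q := by
  obtain ⟨U, Φ, -, hx, hs, -, -, -, hΦ⟩ := B.locTriv (B.proj p)
  have hp : p ∈ Φ.source := by rw [hs]; exact hx
  have hq : q ∈ Φ.source := by rw [hs, Set.mem_preimage, ← h]; exact hx
  refine ⟨(Φ p).2⁻¹ * (Φ q).2, Φ.injOn ?_ hq ?_⟩
  · rw [hs, Set.mem_preimage, B.proj_act]; exact hx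
  · rw [(hΦ p hp).2, mul_inv_cancel_left, (hΦ p hp).1, h, ← (hΦ q hq).1]

theorem act_free {p : P} {g : G} (h : B.act p g = p) : g = 1 := by
  obtain ⟨U, Φ, -, hx, hs, -, -, -, hΦ⟩ := B.locTriv (B.proj p)
  have hp : p ∈ Φ.source := by rw [hs]; exact hx
  have h1 := congrArg Prod.snd ((hΦ p hp).2 g)
  rw [h] at h1
  exact (mul_eq_left.1 h1.symm)

theorem proj_surjective : Function.Surjective B.proj := by
  intro x
  obtain ⟨U, Φ, -, hx, hs, ht, -, -, hΦ⟩ := B.locTriv x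
  have hm : (x, (1 : G)) ∈ Φ.target := by rw [ht]; exact ⟨hx, trivial⟩
  refine ⟨Φ.symm (x, 1), ?_⟩
  rw [← (hΦ _ (Φ.map_target hm)).1, Φ.right_inv hm]

/-- The fibre `P_x`. -/
def Fibre (x : M) : Type _ := {p : P // B.proj p = x}

variable {B}

/-- The action of `G` on a fibre. -/
def Fibre.act {x : M} (u : B.Fibre x) (g : G) : B.Fibre x :=
  ⟨B.act u.1 g, (B.proj_act _ _).trans u.2⟩

theorem Fibre.act_one {x : M} (u : B.Fibre x) : u.act 1 = u := Subtype.ext (B.act_one _)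

theorem Fibre.act_mul {x : M} (u : B.Fibre x) (g h : G) : u.act (g * h) = (u.act g).act h :=
  Subtype.ext (B.act_mul _ _ _)

variable (B) in
/-- Right `G`-equivariant maps `P_x → P_y`. -/
@[ext] structure FibreMap (x y : M) where
  toFun : B.Fibre x → B.Fibre y
  map_act : ∀ u g, toFun (u.act g) = (toFun u).act g

namespace FibreMap

variable {x y z : M}

instance : CoeFun (B.FibreMap x y) (fun _ => B.Fibre x → B.Fibre y) := ⟨FibreMap.toFun⟩

/-- The identity of a fibre. -/
def id (x : M) : B.FibreMap x x := ⟨fun u => u, fun _ _ => rfl⟩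

/-- Composition in diagrammatic order: first `a`, then `b`. -/
def comp (a : B.FibreMap x y) (b : B.FibreMap y z) : B.FibreMap x z :=
  ⟨fun u => b (a u), fun u g => by rw [a.map_act, b.map_act]⟩

theorem bijective (a : B.FibreMap x y) : Function.Bijective a.toFun := by
  constructor
  · intro u v h
    obtain ⟨g, hg⟩ := B.exists_act_eq (u.2.trans v.2.symm)
    have hg' : u.act g = v := Subtype.ext hg
    have h1 : (a u).act g = a u := by rw [← a.map_act, hg']; exact h.symm
    have h2 : g = 1 := B.act_free (congrArg Subtype.val h1)
    rw [← hg', h2, Fibre.act_one]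
  · intro w
    obtain ⟨p, hp⟩ := B.proj_surjective x
    let u : B.Fibre x := ⟨p, hp⟩
    obtain ⟨g, hg⟩ := B.exists_act_eq ((a u).2.trans w.2.symm)
    exact ⟨u.act g, (a.map_act u g).trans (Subtype.ext hg)⟩

/-- An equivariant map of fibres is bijective; this is its inverse. -/
def inv (a : B.FibreMap x y) : B.FibreMap y x where
  toFun := (Equiv.ofBijective _ a.bijective).symm
  map_act u g := by
    apply a.bijective.1
    rw [a.map_act]
    exact (Equiv.ofBijective_apply_symm_apply _ a.bijective _).trans
      (congrArg (fun w => Fibre.act w g)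
        (Equiv.ofBijective_apply_symm_apply _ a.bijective u)).symm

theorem apply_inv (a : B.FibreMap x y) (u : B.Fibre y) : a (a.inv u) = u :=
  Equiv.ofBijective_apply_symm_apply _ a.bijective u

theorem inv_apply (a : B.FibreMap x y) (u : B.Fibre x) : a.inv (a u) = u :=
  Equiv.ofBijective_symm_apply_apply _ a.bijective u

theorem inv_inv (a : B.FibreMap x y) : a.inv.inv = a := by
  have h : ∀ u, a.inv.inv u = a u := fun u =>
    a.inv.bijective.1 ((a.inv.apply_inv u).trans (a.inv_apply u).symm)
  exact FibreMap.ext (funext h)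

end FibreMap

variable (B) in
/-- The 1-morphisms of the double groupoid of `P`. -/
structure Edge where
  src : M
  tgt : M
  map : B.FibreMap src tgt

/-- Composition of 1-morphisms. -/
inductive Edge.Comp : B.Edge → B.Edge → B.Edge → Prop
  | mk {x y z : M} (a : B.FibreMap x y) (b : B.FibreMap y z) :
      Edge.Comp ⟨x, y, a⟩ ⟨y, z, b⟩ ⟨x, z, a.comp b⟩

/-- Fillers `f : P_x → E` of a square with bottom, right, left and top edges `a`, `b`, `c`, `d`.
(Smoothness of `f` on the fibre is automatic, see `Filler.smooth`.) -/
structure Filler (𝒢 : LieCrossedModule VG G VE E) (B : PrincipalBundle VM M VG G VP P)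
    {x y z w : M} (a : B.FibreMap x y) (b : B.FibreMap y w)
    (c : B.FibreMap x z) (d : B.FibreMap z w) where
  f : B.Fibre x → E
  map_act : ∀ u g, f (u.act g) = 𝒢.act g⁻¹ (f u)
  comm : ∀ u, (b (a u)).act (𝒢.bd (f u)) = d (c u)

variable {𝒢 : LieCrossedModule VG G VE E}

namespace Filler

variable {x y z w y' w' z' : M} {a : B.FibreMap x y} {b : B.FibreMap y w}
  {c : B.FibreMap x z} {d : B.FibreMap z w}

/-- In the parametrisation `g ↦ u g` of the fibre, the map `f` of a square is smooth. -/
theorem smooth [LieGroup 𝓘(ℝ, VG) ∞ G] (F : Filler 𝒢 B a b c d) (u : B.Fibre x) :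
    ContMDiff 𝓘(ℝ, VG) 𝓘(ℝ, VE) ∞ fun g : G => F.f (u.act g) := by
  simp_rw [F.map_act]
  exact 𝒢.act_smooth.comp ((contMDiff_inv 𝓘(ℝ, VG) ∞).prodMk contMDiff_const)

/-- Horizontal composition. -/
def hcomp {a' : B.FibreMap y y'} {b' : B.FibreMap y' w'} {d' : B.FibreMap w w'}
    (F : Filler 𝒢 B a b c d) (F' : Filler 𝒢 B a' b' b d') :
    Filler 𝒢 B (a.comp a') b' c (d.comp d') where
  f u := F'.f (a u) * F.f u
  map_act u g := by rw [a.map_act, F'.map_act, F.map_act, map_mul]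
  comm u := by
    change (b' (a' (a u))).act _ = d' (d (c u))
    rw [map_mul, Fibre.act_mul, F'.comm, ← d'.map_act, F.comm]

/-- Vertical composition. -/
def vcomp {b' : B.FibreMap w w'} {c' : B.FibreMap z z'} {d' : B.FibreMap z' w'}
    (F : Filler 𝒢 B a b c d) (F' : Filler 𝒢 B d b' c' d') :
    Filler 𝒢 B a (b.comp b') (c.comp c') d' where
  f u := F.f u * F'.f (c u)
  map_act u g := by rw [c.map_act, F'.map_act, F.map_act, map_mul]
  comm u := by
    change (b' (b (a u))).act _ = d' (c' (c u))
    rw [map_mul, Fibre.act_mul, ← b'.map_act, F.comm, F'.comm]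

/-- Horizontal reversion. -/
def hrev (F : Filler 𝒢 B a b c d) : Filler 𝒢 B a.inv c b d.inv where
  f v := (F.f (a.inv v))⁻¹
  map_act v g := by rw [a.inv.map_act, F.map_act, map_inv (𝒢.act g⁻¹)]
  comm v := by
    apply d.bijective.1
    rw [d.map_act, d.apply_inv, ← F.comm, ← Fibre.act_mul, map_inv, mul_inv_cancel,
      Fibre.act_one, a.apply_inv]

/-- Vertical reversion. -/
def vrev (F : Filler 𝒢 B a b c d) : Filler 𝒢 B d b.inv c.inv a where
  f v := (F.f (c.inv v))⁻¹
  map_act v g := by rw [c.inv.map_act, F.map_act, map_inv (𝒢.act g⁻¹)]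
  comm v := by
    apply b.bijective.1
    rw [b.map_act, b.apply_inv]
    have h := F.comm (c.inv v)
    rw [c.apply_inv] at h
    rw [← h, ← Fibre.act_mul, map_inv, mul_inv_cancel, Fibre.act_one]

theorem f_corner (F : Filler 𝒢 B a b c d) (v : B.Fibre w) :
    F.f (c.inv (d.inv v)) = F.f (a.inv (b.inv v)) := by
  have h := F.comm (c.inv (d.inv v))
  rw [c.apply_inv, d.apply_inv] at h
  have h1 : a.inv (b.inv v) = (c.inv (d.inv v)).act (𝒢.bd (F.f (c.inv (d.inv v)))) := by
    conv_lhs => rw [← h]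
    rw [b.inv.map_act, b.inv_apply, a.inv.map_act, a.inv_apply]
  rw [h1, F.map_act, ← map_inv 𝒢.bd, 𝒢.peiffer]
  group

/-- Interchange of coordinates. -/
def transp (F : Filler 𝒢 B a b c d) : Filler 𝒢 B c d a b where
  f u := (F.f u)⁻¹
  map_act u g := by rw [F.map_act, map_inv (𝒢.act g⁻¹)]
  comm u := by rw [← F.comm, ← Fibre.act_mul, map_inv, mul_inv_cancel, Fibre.act_one]

end Filler

variable (𝒢 B) in
/-- The 2-morphisms of the double groupoid of `P`. -/
structure Square where
  {x y z w : M}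
  {a : B.FibreMap x y}
  {b : B.FibreMap y w}
  {c : B.FibreMap x z}
  {d : B.FibreMap z w}
  filler : Filler 𝒢 B a b c d

namespace Square

theorem mk_congr {x y z w : M} {a a' : B.FibreMap x y} {b b' : B.FibreMap y w}
    {c c' : B.FibreMap x z} {d d' : B.FibreMap z w} (F : Filler 𝒢 B a b c d)
    (F' : Filler 𝒢 B a' b' c' d') (ha : a = a') (hb : b = b') (hc : c = c') (hd : d = d')
    (hf : ∀ u, F.f u = F'.f u) : (⟨F⟩ : Square B 𝒢) = ⟨F'⟩ := by
  subst ha hb hc hd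
  obtain ⟨f, _, _⟩ := F
  obtain ⟨f', _, _⟩ := F'
  obtain rfl : f = f' := funext hf
  rfl

/-- Graph of the horizontal composition. -/
inductive HComp : Square B 𝒢 → Square B 𝒢 → Square B 𝒢 → Prop
  | mk {x y z w y' w' : M} {a : B.FibreMap x y} {b : B.FibreMap y w} {c : B.FibreMap x z}
      {d : B.FibreMap z w} {a' : B.FibreMap y y'} {b' : B.FibreMap y' w'}
      {d' : B.FibreMap w w'} (F : Filler 𝒢 B a b c d) (F' : Filler 𝒢 B a' b' b d') :
      HComp ⟨F⟩ ⟨F'⟩ ⟨F.hcomp F'⟩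

/-- Graph of the vertical composition. -/
inductive VComp : Square B 𝒢 → Square B 𝒢 → Square B 𝒢 → Prop
  | mk {x y z w z' w' : M} {a : B.FibreMap x y} {b : B.FibreMap y w} {c : B.FibreMap x z}
      {d : B.FibreMap z w} {b' : B.FibreMap w w'} {c' : B.FibreMap z z'}
      {d' : B.FibreMap z' w'} (F : Filler 𝒢 B a b c d) (F' : Filler 𝒢 B d b' c' d') :
      VComp ⟨F⟩ ⟨F'⟩ ⟨F.vcomp F'⟩

instance : MulAction (DihedralGroup 4) (Square B 𝒢) :=
  d4Action (fun k => ⟨k.filler.hrev⟩) (fun k => ⟨k.filler.vrev⟩) (fun k => ⟨k.filler.transp⟩)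
    (fun k => mk_congr _ k.filler k.a.inv_inv rfl rfl k.d.inv_inv fun u => by
      simp [Filler.hrev, FibreMap.inv_inv, FibreMap.inv_apply])
    (fun k => mk_congr _ k.filler rfl k.b.inv_inv k.c.inv_inv rfl fun u => by
      simp [Filler.vrev, FibreMap.inv_inv, FibreMap.inv_apply])
    (fun k => mk_congr _ k.filler rfl rfl rfl rfl fun u => by simp [Filler.transp])
    (fun k => mk_congr _ _ rfl rfl rfl rfl fun u => by
      simp only [Filler.hrev, Filler.vrev, inv_inv]
      exact k.filler.f_corner u)
    (fun k => mk_congr _ _ rfl rfl rfl rfl fun u => by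
      simp only [Filler.hrev, Filler.vrev, Filler.transp])

end Square

variable (𝒢 B) in
/-- The double groupoid `𝒟²(P)`. -/
def doubleGroupoid : DoubleGroupoidOps where
  Obj := M
  Edge := B.Edge
  Sq := Square B 𝒢
  src := Edge.src
  tgt := Edge.tgt
  one x := ⟨x, x, FibreMap.id x⟩
  Comp := Edge.Comp
  left k := ⟨k.x, k.z, k.c⟩
  right k := ⟨k.y, k.w, k.b⟩
  down k := ⟨k.x, k.y, k.a⟩
  up k := ⟨k.z, k.w, k.d⟩
  deg₁ e := ⟨(⟨fun _ => 1, fun _ _ => (map_one _).symm, fun u => by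
    rw [map_one]; exact Fibre.act_one _⟩ :
      Filler 𝒢 B (FibreMap.id e.src) e.map e.map (FibreMap.id e.tgt))⟩
  deg₂ e := ⟨(⟨fun _ => 1, fun _ _ => (map_one _).symm, fun u => by
    rw [map_one]; exact Fibre.act_one _⟩ :
      Filler 𝒢 B e.map (FibreMap.id e.tgt) (FibreMap.id e.src) e.map)⟩
  HComp := Square.HComp
  VComp := Square.VComp
  Thin k := ∀ u, k.filler.f u = 1
  d4 := inferInstance

/-- The vertical vector `A^#` at `p` associated to `A` in the Lie algebra of `G`. -/
def vert (B : PrincipalBundle VM M VG G VP P) (p : P) (A : VG) : VP :=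
  tmap VG VP (fun g : G => B.act p g) 1 A

end PrincipalBundle

/-! ## Categorical connections and their holonomy -/

/-- The curvature `dA + ½ A ∧^ad A` of a 1-form with values in the Lie algebra of `G`, evaluated on
two tangent vectors. -/
def curvature (G : Type*) [TopologicalSpace G] [ChartedSpace VG G] [Group G]
    (A : DiffForm VP VG P 1) (p : P) (X Y : VP) : VG :=
  A.d p ![X, Y] + lieBr VG G (A p ![X]) (A p ![Y])

/-- A `𝒢`-categorical connection on a principal bundle. -/
structure CategoricalConnection (𝒢 : LieCrossedModule VG G VE E)
    (B : PrincipalBundle VM M VG G VP P) where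
  /-- the connection 1-form -/
  conn : DiffForm VP VG P 1
  /-- the `Lie E`-valued 2-form -/
  m : DiffForm VP VE P 2
  conn_smooth : conn.Smooth
  m_smooth : m.Smooth
  conn_equivariant : ∀ g p X,
    conn (B.act p g) ![tmap VP VP (fun q => B.act q g) p X] = adj VG G g⁻¹ (conn p ![X])
  conn_vert : ∀ p A, conn p ![B.vert p A] = A
  m_equivariant : ∀ g p X Y,
    m (B.act p g) ![tmap VP VP (fun q => B.act q g) p X, tmap VP VP (fun q => B.act q g) p Y] =
      𝒢.actLie g⁻¹ (m p ![X, Y])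
  /-- `m(X, Y) = m(X^H, Y^H)` -/
  m_horizontal : ∀ p X Y,
    m p ![X, Y] = m p ![X - B.vert p (conn p ![X]), Y - B.vert p (conn p ![Y])]
  /-- vanishing of the fake curvature -/
  fake : ∀ p X Y, 𝒢.bdLie (m p ![X, Y]) = curvature G conn p X Y

/-- `c` solves `c' = c A`, `c(0) = 1` in the Lie group `G`. -/
def IsOrderedExp (A : ℝ → VG) (c : ℝ → G) : Prop :=
  c 0 = 1 ∧ ∀ t, HasVelocity VG c t (tmap VG VG (fun h : G => c t * h) 1 (A t))

open Classical in
variable (G) in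
/-- The solution of `c' = c A`, `c(0) = 1` in the Lie group `G`. -/
def orderedExp (A : ℝ → VG) : ℝ → G :=
  if h : ∃ c : ℝ → G, IsOrderedExp A c then h.choose else 1

namespace CategoricalConnection

variable {𝒢 : LieCrossedModule VG G VE E} {B : PrincipalBundle VM M VG G VP P}
  (c : CategoricalConnection 𝒢 B)

open Classical in
/-- The horizontal lift to `p` of a tangent vector at the projection of `p`. -/
def horLift (p : P) (v : VM) : VP :=
  if h : ∃ X : VP, tmap VP VM B.proj p X = v ∧ c.conn p ![X] = 0 then h.choose else 0

/-- `q` is the horizontal lift of `γ` with `q(0) = u`. -/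
def IsTransport (γ : OnePath VM M) (u : P) (q : ℝ → P) : Prop :=
  q 0 = u ∧ ∀ t, B.proj (q t) = γ t ∧
    HasVelocity VP q t (c.horLift (q t) (velocity VM γ t))

open Classical in
/-- The parallel transport `t ↦ ℋ(γ, t, u)`, for `u` in the fibre at `γ(0)`. -/
def transport (γ : OnePath VM M) (u : P) : ℝ → P :=
  if h : ∃ q, c.IsTransport γ u q then h.choose else fun _ => u

/-- The map `s ↦ e_Γ(u, t, s)`, for `u` in the fibre at `Γ(0,0)`: the solution of
`∂e/∂s = e ∫₀ᵗ m(∂γ_s/∂t', ∂γ_s/∂s) dt'`, where `m` is evaluated on horizontal lifts at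
`ℋ(γ_s, t', u_s)`, with `u_s = ℋ(γ⁰, s, u)`. -/
def catHolAt (Γ : TwoPath VM M) (u : P) (t : ℝ) : ℝ → E :=
  orderedExp E fun s => ∫ t' in (0 : ℝ)..t,
    (let q := c.transport (Γ.hslice s) (c.transport Γ.left u s) t'
     c.m q ![c.horLift q (Γ.dt t' s), c.horLift q (Γ.ds t' s)])

/-- The categorical holonomy `e_Γ(u)`. -/
def catHol (Γ : TwoPath VM M) (u : P) : E := c.catHolAt Γ u 1 1

end CategoricalConnection

/-- A local connection pair on `M`: `A` and `B` with `∂(B) = dA + ½ A ∧^ad A`. -/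
structure LocalConnectionPair (𝒢 : LieCrossedModule VG G VE E)
    (VM : Type*) [NormedAddCommGroup VM] [NormedSpace ℝ VM]
    (M : Type*) [TopologicalSpace M] [ChartedSpace VM M] where
  A : DiffForm VM VG M 1
  B : DiffForm VM VE M 2
  A_smooth : A.Smooth
  B_smooth : B.Smooth
  fake : ∀ x X Y, 𝒢.bdLie (B x ![X, Y]) = curvature G A x X Y

namespace LocalConnectionPair

variable {𝒢 : LieCrossedModule VG G VE E} (c : LocalConnectionPair 𝒢 VM M)

/-- The path ordered exponential `t ↦ P exp ∫₀ᵗ A(γ')`. -/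
def pathExp (γ : OnePath VM M) : ℝ → G :=
  orderedExp G fun t => c.A (γ t) ![velocity VM γ t]

/-- The surface ordered exponential `s ↦ e_Γ(t, s)`: the solution of
`∂e/∂s = e ∫₀ᵗ (g_{γ⁰}(s) g_{γ_s}(t')) ▷ B(∂γ_s/∂t', ∂γ_s/∂s) dt'`. -/
def surfaceExpAt (Γ : TwoPath VM M) (t : ℝ) : ℝ → E :=
  orderedExp E fun s => ∫ t' in (0 : ℝ)..t,
    𝒢.actLie (c.pathExp Γ.left s * c.pathExp (Γ.hslice s) t')
      (c.B (Γ (t', s)) ![Γ.dt t' s, Γ.ds t' s])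

/-- The surface ordered exponential `e_Γ = e_Γ(1, 1)`. -/
def surfaceExp (Γ : TwoPath VM M) : E := c.surfaceExpAt Γ 1 1

end LocalConnectionPair

end Bundles

end ThinHolonomy

end

/-!
Everything is reduced to logarithmic derivatives `k⁻¹ dk` of maps `k` from a vector space to a Lie
group. They determine a map up to left translation (`eq_mul_of_hasLogVelocity`), satisfy the
Maurer–Cartan equation (`maurerCartan`), and turn the equations of the statement into
`k⁻¹ dk = A dt`. Such equations have global solutions (`exists_isOrderedExp`), which depend smoothly
on parameters (`contMDiff_solution`).

*Non-abelian Stokes theorem.* Pulling the forms back along a 2-path gives functions `a₁`, `a₂`, `b`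
on `ℝ²` that satisfy `∂₁a₂ - ∂₂a₁ + [a₁, a₂] = ∂(b)`. Let `K(t,s)` be the transport from the origin
to `(t,s)`, first along `t = 0` and then in the direction of `t`. It has the logarithmic derivative
`a₁` in the direction of `t`; in the other one the curvature, integrated, gives
`Ad_K (a₂ - (K⁻¹dK)₂) = ∂(η)`, where `η = ∫₀ᵗ K ▷ b` is the coefficient of the equation that defines
`e_Γ` (`PlanePair.defect_eq`). Hence `∂(e) K` solves the equation of the transport along the other
two sides of the rectangle, which is the boundary condition of a square
(`PlanePair.bd_planeExp_mul_frame`). By the Peiffer identity the same computation for `e` itself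
shows that the interchange of coordinates inverts `e` (`PlanePair.planeExp_swap`). Vertical
composition and reversion are reparametrisations of the equation for `e`; the horizontal ones follow
by interchanging the coordinates.

*Homotopy invariance.* For a map on `ℝ³` the integrals `η₂ = ∫₀ᵗ K ▷ b₁₂` and `η₃ = ∫₀ᵗ K ▷ b₁₃`
are the coefficients of a connection with values in the Lie algebra of `E`. If the curvature 3-form
`dB + A ∧^▷ B` vanishes, then its curvature is `K ▷ b₂₃` (`SpacePair.curvature_flux`). On the face
`t = 1` of a homotopy through thin faces this is zero, and `η₃` vanishes at the ends `s = 0, 1`; so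
the ordered exponential of `η₂` over `0 ≤ s ≤ 1` does not depend on the third coordinate
(`SpacePair.planeExp_eq`). A derivative of rank `≤ 2` kills every 3-form and one of rank `≤ 1` every
2-form, so this applies to rank-2 homotopies. The invariance of transport under rank-1 homotopies is
the boundary condition with `e = 1`.

*Bundles.* The forms `ω` and `m` on the total space are themselves a local connection pair
(`CategoricalConnection.pair`). If `σ` lifts a path or a 2-path to `P`, then parallel transport is
`σ` corrected by the path ordered exponential of `σ` (`transport_eq`), and `e_Γ` is the surface
ordered exponential of `σ` (`catHol_eq`). All maps of the plane or of space lift: lift horizontally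
along the rays from the origin (`exists_lift`); reparametrising by a map that fixes the middle of
`[0,1]` restores the product structure close to the boundary (`IsClamp`). Thus the properties of the
bundle holonomy follow from those of the local one on `P`. The lift of a rank-2 homotopy may have
rank 3, but its derivative maps some nonzero vector to a vertical one, and the curvature 3-form of
`(ω, m)` vanishes on vertical vectors because `m` is equivariant (`curv₃_vert`).
-/


section

open scoped Topology
open Set Filter

set_option linter.unusedSectionVars false

noncomputable section

namespace ThinHolonomy

/-! ### Derivatives of maps of manifolds -/

section TDeriv

variable {V : Type*} [NormedAddCommGroup V] [NormedSpace ℝ V]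
  {W : Type*} [NormedAddCommGroup W] [NormedSpace ℝ W]
  {V' : Type*} [NormedAddCommGroup V'] [NormedSpace ℝ V']
  {W' : Type*} [NormedAddCommGroup W'] [NormedSpace ℝ W']
  {N : Type*} [TopologicalSpace N] [ChartedSpace V N]
  {N' : Type*} [TopologicalSpace N'] [ChartedSpace W N']
  {N₁ : Type*} [TopologicalSpace N₁] [ChartedSpace V' N₁]
  {N₂ : Type*} [TopologicalSpace N₂] [ChartedSpace W' N₂]

/-- `L` is the derivative of `f : N → N'` at `x`, where tangent vectors are elements of the model
spaces. -/
def HasTDeriv (f : N → N') (x : N) (L : V →L[ℝ] W) : Prop :=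
  HasMFDerivAt 𝓘(ℝ, V) 𝓘(ℝ, W) f x L

/-- Differentiability of a map of manifolds. -/
def TDiff (V W : Type*) [NormedAddCommGroup V] [NormedSpace ℝ V]
    [NormedAddCommGroup W] [NormedSpace ℝ W] [ChartedSpace V N] [ChartedSpace W N']
    (f : N → N') (x : N) : Prop :=
  MDifferentiableAt 𝓘(ℝ, V) 𝓘(ℝ, W) f x

theorem HasTDeriv.comp {g : N' → N₁} {f : N → N'} {x : N} {y : N'} {L' : W →L[ℝ] V'}
    {L : V →L[ℝ] W} (hg : HasTDeriv g y L') (hf : HasTDeriv f x L) (h : f x = y) :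
    HasTDeriv (fun z => g (f z)) x (L'.comp L) := by
  subst h
  exact HasMFDerivAt.comp x hg hf

theorem HasTDeriv.tmap_eq {f : N → N'} {x : N} {L : V →L[ℝ] W} (h : HasTDeriv f x L) :
    tmap V W f x = L := h.mfderiv

theorem TDiff.hasTDeriv {f : N → N'} {x : N} (h : TDiff V W f x) :
    HasTDeriv f x (tmap V W f x) := MDifferentiableAt.hasMFDerivAt h

theorem HasTDeriv.tDiff {f : N → N'} {x : N} {L : V →L[ℝ] W} (h : HasTDeriv f x L) :
    TDiff V W f x := h.mdifferentiableAt

theorem HasTDeriv.continuousAt {f : N → N'} {x : N} {L : V →L[ℝ] W} (h : HasTDeriv f x L) :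
    ContinuousAt f x := HasMFDerivAt.continuousAt h

theorem HasTDeriv.unique {f : N → N'} {x : N} {L L' : V →L[ℝ] W} (h : HasTDeriv f x L)
    (h' : HasTDeriv f x L') : L = L' := h.tmap_eq.symm.trans h'.tmap_eq

theorem tDiff_of_contMDiffAt {f : N → N'} {x : N} {n : WithTop ℕ∞}
    (h : ContMDiffAt 𝓘(ℝ, V) 𝓘(ℝ, W) n f x) (hn : n ≠ 0) : TDiff V W f x :=
  h.mdifferentiableAt hn

theorem HasTDeriv.congr {f g : N → N'} {x : N} {L : V →L[ℝ] W} (h : HasTDeriv f x L)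
    (hg : g =ᶠ[𝓝 x] f) : HasTDeriv g x L := HasMFDerivAt.congr_of_eventuallyEq h hg

theorem hasTDeriv_iff_hasFDerivAt {f : V → W} {x : V} {L : V →L[ℝ] W} :
    HasTDeriv f x L ↔ HasFDerivAt f L x := hasMFDerivAt_iff_hasFDerivAt

theorem hasTDeriv_const (c : N') (x : N) : HasTDeriv (fun _ : N => c) x (0 : V →L[ℝ] W) :=
  hasMFDerivAt_const c x

theorem hasTDeriv_id (x : N) : HasTDeriv (fun y : N => y) x (ContinuousLinearMap.id ℝ V) :=
  hasMFDerivAt_id x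

theorem hasVelocity_iff {c : ℝ → N} {t : ℝ} {v : V} :
    HasVelocity V c t v ↔ HasTDeriv c t (ContinuousLinearMap.toSpanSingleton ℝ v) := Iff.rfl

theorem TDiff.hasVelocity {c : ℝ → N} {t : ℝ} (h : TDiff ℝ V c t) :
    HasVelocity V c t (velocity V c t) := by
  have h1 := h.hasTDeriv
  have h2 : tmap ℝ V c t = ContinuousLinearMap.toSpanSingleton ℝ (velocity V c t) := by
    ext; simp [velocity]
  rw [h2] at h1
  exact h1

theorem HasVelocity.velocity_eq {c : ℝ → N} {t : ℝ} {v : V} (h : HasVelocity V c t v) :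
    velocity V c t = v := by
  rw [velocity, HasTDeriv.tmap_eq h]
  exact one_smul ℝ v

/-- The derivative of a map of two variables along a pair of maps is the sum of the partial
derivatives. -/
theorem HasTDeriv.comp₂ {F : N' × N₁ → N₂} {f : N → N'} {g : N → N₁} {x : N}
    {L₁ : V →L[ℝ] W} {L₂ : V →L[ℝ] V'} {D₁ : W →L[ℝ] W'} {D₂ : V' →L[ℝ] W'}
    (hF : MDifferentiableAt (𝓘(ℝ, W).prod 𝓘(ℝ, V')) 𝓘(ℝ, W') F (f x, g x))
    (h₁ : HasTDeriv (fun y => F (y, g x)) (f x) D₁)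
    (h₂ : HasTDeriv (fun y => F (f x, y)) (g x) D₂)
    (hf : HasTDeriv f x L₁) (hg : HasTDeriv g x L₂) :
    HasTDeriv (fun z => F (f z, g z)) x (D₁.comp L₁ + D₂.comp L₂) := by
  have hp : HasMFDerivAt 𝓘(ℝ, V) (𝓘(ℝ, W).prod 𝓘(ℝ, V')) (fun z => (f z, g z)) x
      (ContinuousLinearMap.prod L₁ L₂) := HasMFDerivAt.prodMk hf hg
  have h := HasMFDerivAt.comp x hF.hasMFDerivAt hp
  have e : (mfderiv (𝓘(ℝ, W).prod 𝓘(ℝ, V')) 𝓘(ℝ, W') F (f x, g x) : W × V' →L[ℝ] W') =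
      D₁.comp (ContinuousLinearMap.fst ℝ W V') + D₂.comp (ContinuousLinearMap.snd ℝ W V') := by
    have := mfderiv_prod_eq_add_comp hF
    refine this.trans ?_
    rw [h₁.mfderiv, h₂.mfderiv]
    rfl
  have h' : HasTDeriv (fun z => F (f z, g z)) x
    ((D₁.comp (ContinuousLinearMap.fst ℝ W V') + D₂.comp (ContinuousLinearMap.snd ℝ W V')).comp
      (ContinuousLinearMap.prod L₁ L₂)) := by
    rw [← e]; exact h
  convert h' using 1
  ext v; simp

theorem contMDiff_prodMk_left {n : WithTop ℕ∞} (y : N') :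
    ContMDiff 𝓘(ℝ, V) (𝓘(ℝ, V).prod 𝓘(ℝ, W)) n (fun x : N => (x, y)) :=
  contMDiff_id.prodMk contMDiff_const

end TDeriv

/-! ### Logarithmic derivatives in a Lie group -/

section LogDeriv

variable {VG : Type*} [NormedAddCommGroup VG] [NormedSpace ℝ VG]
  {G : Type*} [TopologicalSpace G] [ChartedSpace VG G] [Group G]
  {VE : Type*} [NormedAddCommGroup VE] [NormedSpace ℝ VE]
  {E : Type*} [TopologicalSpace E] [ChartedSpace VE E] [Group E]
  {U : Type*} [NormedAddCommGroup U] [NormedSpace ℝ U]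
  {U' : Type*} [NormedAddCommGroup U'] [NormedSpace ℝ U']

/-- `α` is the logarithmic derivative `k⁻¹ dk` at `x` of the map `k` to a Lie group. -/
def HasLogDeriv (k : U → G) (x : U) (α : U →L[ℝ] VG) : Prop :=
  HasTDeriv (fun z => (k x)⁻¹ * k z) x α

/-- The logarithmic derivative `k⁻¹ dk`. -/
def logDeriv (VG : Type*) [NormedAddCommGroup VG] [NormedSpace ℝ VG] [ChartedSpace VG G]
    (k : U → G) (x : U) : U →L[ℝ] VG :=
  tmap U VG (fun z => (k x)⁻¹ * k z) x

theorem HasLogDeriv.logDeriv_eq {k : U → G} {x : U} {α : U →L[ℝ] VG} (h : HasLogDeriv k x α) :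
    logDeriv VG k x = α := h.tmap_eq

theorem HasLogDeriv.unique {k : U → G} {x : U} {α β : U →L[ℝ] VG} (h : HasLogDeriv k x α)
    (h' : HasLogDeriv k x β) : α = β := HasTDeriv.unique h h'

theorem HasLogDeriv.comp {k : U → G} {f : U' → U} {x : U'} {α : U →L[ℝ] VG} {L : U' →L[ℝ] U}
    (h : HasLogDeriv k (f x) α) (hf : HasFDerivAt f L x) :
    HasLogDeriv (fun z => k (f z)) x (α.comp L) :=
  HasTDeriv.comp (g := fun z => (k (f x))⁻¹ * k z) h (hasTDeriv_iff_hasFDerivAt.2 hf) rfl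

theorem HasLogDeriv.congr {k l : U → G} {x : U} {α : U →L[ℝ] VG} (h : HasLogDeriv k x α)
    (hl : l =ᶠ[𝓝 x] k) : HasLogDeriv l x α := by
  refine HasTDeriv.congr h ?_
  filter_upwards [hl] with z hz
  rw [hz, hl.eq_of_nhds]

theorem HasLogDeriv.const_mul {k : U → G} {x : U} {α : U →L[ℝ] VG} (g : G)
    (h : HasLogDeriv k x α) : HasLogDeriv (fun z => g * k z) x α := by
  have e : (fun z => (g * k x)⁻¹ * (g * k z)) = fun z => (k x)⁻¹ * k z := by
    funext z; group
  unfold HasLogDeriv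
  rw [e]
  exact h

theorem hasLogDeriv_const (g : G) (x : U) : HasLogDeriv (fun _ : U => g) x (0 : U →L[ℝ] VG) :=
  hasTDeriv_const _ _

/-- A smooth homomorphism maps logarithmic derivatives by its derivative at `1`. -/
theorem HasLogDeriv.map {k : U → G} {x : U} {α : U →L[ℝ] VG} (φ : G →* E)
    (hφ : TDiff VG VE φ 1) (h : HasLogDeriv k x α) :
    HasLogDeriv (fun z => φ (k z)) x ((tmap VG VE φ 1).comp α) := by
  have e : (fun z => (φ (k x))⁻¹ * φ (k z)) = fun z => φ ((k x)⁻¹ * k z) := by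
    funext z; simp
  unfold HasLogDeriv
  rw [e]
  exact hφ.hasTDeriv.comp h (by simp)

theorem adj_one : adj VG G 1 = ContinuousLinearMap.id ℝ VG := by
  have e : (fun z : G => 1 * z * 1⁻¹) = fun z => z := by funext z; group
  unfold adj
  rw [e]
  exact (hasTDeriv_id (V := VG) (1 : G)).tmap_eq

variable [LieGroup 𝓘(ℝ, VG) ∞ G]

theorem contMDiff_mul_const {n : WithTop ℕ∞} (hn : n ≤ ∞) (g : G) :
    ContMDiff 𝓘(ℝ, VG) 𝓘(ℝ, VG) n (fun h : G => h * g) :=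
  (contMDiff_mul_right (I := 𝓘(ℝ, VG)) (n := ∞) (a := g)).of_le hn

theorem contMDiff_const_mul {n : WithTop ℕ∞} (hn : n ≤ ∞) (g : G) :
    ContMDiff 𝓘(ℝ, VG) 𝓘(ℝ, VG) n (fun h : G => g * h) :=
  (contMDiff_mul_left (I := 𝓘(ℝ, VG)) (n := ∞) (a := g)).of_le hn

theorem tDiff_const_mul (g h : G) : TDiff VG VG (fun x : G => g * x) h :=
  tDiff_of_contMDiffAt (contMDiff_const_mul (n := ∞) le_rfl g).contMDiffAt (by simp)

/-- Logarithmic derivatives in terms of derivatives: `dk = k α`. -/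
theorem hasLogDeriv_iff {k : U → G} {x : U} {α : U →L[ℝ] VG} :
    HasLogDeriv k x α ↔ HasTDeriv k x ((tmap VG VG (fun h : G => k x * h) 1).comp α) := by
  constructor
  · intro h
    have := (tDiff_const_mul (VG := VG) (k x) 1).hasTDeriv.comp h (by simp)
    simpa using this
  · intro h
    have h1 := (tDiff_const_mul (VG := VG) (k x)⁻¹ (k x)).hasTDeriv.comp h rfl
    have h2 := (tDiff_const_mul (VG := VG) (k x)⁻¹ (k x)).hasTDeriv.comp
      (tDiff_const_mul (VG := VG) (k x) 1).hasTDeriv (mul_one _)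
    have h3 : HasTDeriv (fun z : G => (k x)⁻¹ * (k x * z)) 1 (ContinuousLinearMap.id ℝ VG) := by
      simpa using hasTDeriv_id (V := VG) (1 : G)
    have h4 := h2.unique h3
    unfold HasLogDeriv
    convert h1 using 1
    rw [← ContinuousLinearMap.comp_assoc, h4, ContinuousLinearMap.id_comp]

theorem HasLogDeriv.continuousAt {k : U → G} {x : U} {α : U →L[ℝ] VG} (h : HasLogDeriv k x α) :
    ContinuousAt k x := (hasLogDeriv_iff.1 h).continuousAt

theorem HasLogDeriv.tDiff {k : U → G} {x : U} {α : U →L[ℝ] VG} (h : HasLogDeriv k x α) :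
    TDiff U VG k x := (hasLogDeriv_iff.1 h).tDiff

theorem TDiff.hasLogDeriv {k : U → G} {x : U} (h : TDiff U VG k x) :
    HasLogDeriv k x (logDeriv VG k x) :=
  ((tDiff_const_mul (VG := VG) (k x)⁻¹ (k x)).hasTDeriv.comp h.hasTDeriv rfl).tDiff.hasTDeriv

theorem hasVelocity_iff_hasLogDeriv {c : ℝ → G} {t : ℝ} {v : VG} :
    HasVelocity VG c t (tmap VG VG (fun h : G => c t * h) 1 v) ↔
      HasLogDeriv c t (ContinuousLinearMap.toSpanSingleton ℝ v) := by
  rw [hasLogDeriv_iff, hasVelocity_iff]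
  have : (ContinuousLinearMap.toSpanSingleton ℝ (tmap VG VG (fun h : G => c t * h) 1 v)) =
      (tmap VG VG (fun h : G => c t * h) 1).comp (ContinuousLinearMap.toSpanSingleton ℝ v) := by
    ext; simp
  rw [this]

/-- At the unit element, the derivative of the multiplication is the addition. -/
theorem hasTDeriv_mul_one {f g : U → G} {x : U} {α β : U →L[ℝ] VG} (hf : HasTDeriv f x α)
    (hg : HasTDeriv g x β) (hf1 : f x = 1) (hg1 : g x = 1) :
    HasTDeriv (fun z => f z * g z) x (α + β) := by
  have hF : MDifferentiableAt (𝓘(ℝ, VG).prod 𝓘(ℝ, VG)) 𝓘(ℝ, VG) (fun p : G × G => p.1 * p.2)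
    (f x, g x) := (contMDiff_mul 𝓘(ℝ, VG) ∞).mdifferentiable (by simp) _
  have h1 : HasTDeriv (fun y : G => y * g x) (f x) (ContinuousLinearMap.id ℝ VG) := by
    rw [hg1]; simpa using hasTDeriv_id (V := VG) (f x)
  have h2 : HasTDeriv (fun y : G => f x * y) (g x) (ContinuousLinearMap.id ℝ VG) := by
    rw [hf1]; simpa using hasTDeriv_id (V := VG) (g x)
  have := HasTDeriv.comp₂ hF h1 h2 hf hg
  simpa using this

theorem contMDiff_conj (g : G) : ContMDiff 𝓘(ℝ, VG) 𝓘(ℝ, VG) ∞ (fun h : G => g * h * g⁻¹) :=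
  (contMDiff_mul_const le_rfl g⁻¹).comp (contMDiff_const_mul le_rfl g)

theorem tDiff_conj (g h : G) : TDiff VG VG (fun h : G => g * h * g⁻¹) h :=
  tDiff_of_contMDiffAt (contMDiff_conj g).contMDiffAt (by simp)

/-- The product rule for logarithmic derivatives. -/
theorem HasLogDeriv.mul {k l : U → G} {x : U} {α β : U →L[ℝ] VG} (hk : HasLogDeriv k x α)
    (hl : HasLogDeriv l x β) :
    HasLogDeriv (fun z => k z * l z) x ((adj VG G (l x)⁻¹).comp α + β) := by
  have h1 := (tDiff_conj (VG := VG) (l x)⁻¹ (1 : G)).hasTDeriv.comp hk (by simp)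
  have h2 := hasTDeriv_mul_one h1 hl (by simp) (by simp)
  have e : (fun z => (k x * l x)⁻¹ * (k z * l z)) =
      fun z => (l x)⁻¹ * ((k x)⁻¹ * k z) * (l x)⁻¹⁻¹ * ((l x)⁻¹ * l z) := by
    funext z; group
  unfold HasLogDeriv
  rw [e]
  exact h2

theorem adj_mul (g h : G) : adj VG G (g * h) = (adj VG G g).comp (adj VG G h) := by
  have h1 := (tDiff_conj (VG := VG) g (1 : G)).hasTDeriv.comp
    (tDiff_conj (VG := VG) h (1 : G)).hasTDeriv (by simp)
  have e : (fun z => g * (h * z * h⁻¹) * g⁻¹) = fun z => g * h * z * (g * h)⁻¹ := by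
    funext z; group
  rw [e] at h1
  exact h1.tmap_eq

theorem adj_inv_apply (g : G) (X : VG) : adj VG G g⁻¹ (adj VG G g X) = X := by
  have := adj_mul (VG := VG) g⁻¹ g
  rw [inv_mul_cancel, adj_one] at this
  exact (congrArg (fun L : VG →L[ℝ] VG => L X) this).symm

theorem HasLogDeriv.inv {k : U → G} {x : U} {α : U →L[ℝ] VG} (hk : HasLogDeriv k x α) :
    HasLogDeriv (fun z => (k z)⁻¹) x (-(adj VG G (k x)).comp α) := by
  have hi : TDiff VG VG (fun g : G => g⁻¹) (k x) :=
    tDiff_of_contMDiffAt (contMDiff_inv 𝓘(ℝ, VG) ∞).contMDiffAt (by simp)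
  have h1 : TDiff U VG (fun z => (k z)⁻¹) x := (hi.hasTDeriv.comp hk.tDiff.hasTDeriv rfl).tDiff
  have h2 := h1.hasLogDeriv
  have h3 := hk.mul h2
  have e : (fun z => k z * (k z)⁻¹) = fun _ => 1 := by funext z; group
  rw [e, inv_inv] at h3
  have h4 := h3.unique (hasLogDeriv_const 1 x)
  rw [← eq_neg_of_add_eq_zero_right h4]
  exact h2

theorem HasLogDeriv.mul_const {k : U → G} {x : U} {α : U →L[ℝ] VG} (hk : HasLogDeriv k x α)
    (g : G) : HasLogDeriv (fun z => k z * g) x ((adj VG G g⁻¹).comp α) := by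
  simpa using hk.mul (hasLogDeriv_const (VG := VG) g x)

/-- `k l⁻¹` has logarithmic derivative zero if `k` and `l` have the same one. -/
theorem HasLogDeriv.div {k l : U → G} {x : U} {α β : U →L[ℝ] VG} (hk : HasLogDeriv k x α)
    (hl : HasLogDeriv l x β) :
    HasLogDeriv (fun z => k z * (l z)⁻¹) x ((adj VG G (l x)).comp (α - β)) := by
  have := hk.mul hl.inv
  rw [inv_inv] at this
  convert this using 1
  ext v; simp [sub_eq_add_neg]

end LogDeriv

/-! ### Derivatives in charts -/

section Charts

variable {V : Type*} [NormedAddCommGroup V] [NormedSpace ℝ V]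
  {W : Type*} [NormedAddCommGroup W] [NormedSpace ℝ W]
  {V' : Type*} [NormedAddCommGroup V'] [NormedSpace ℝ V']
  {N : Type*} [TopologicalSpace N] [ChartedSpace V N]
  {N' : Type*} [TopologicalSpace N'] [ChartedSpace W N']
  {N₁ : Type*} [TopologicalSpace N₁] [ChartedSpace V' N₁]
  {U : Type*} [NormedAddCommGroup U] [NormedSpace ℝ U]

theorem contMDiffAt_chartAt [IsManifold 𝓘(ℝ, V) ∞ N] {p x : N} (h : x ∈ (chartAt V p).source) :
    ContMDiffAt 𝓘(ℝ, V) 𝓘(ℝ, V) ∞ (chartAt V p) x :=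
  contMDiffOn_chart.contMDiffAt ((chartAt V p).open_source.mem_nhds h)

theorem contMDiffAt_chartAt_symm [IsManifold 𝓘(ℝ, V) ∞ N] {p : N} {y : V}
    (h : y ∈ (chartAt V p).target) :
    ContMDiffAt 𝓘(ℝ, V) 𝓘(ℝ, V) ∞ (chartAt V p).symm y :=
  contMDiffOn_chart_symm.contMDiffAt ((chartAt V p).open_target.mem_nhds h)

theorem tDiff_chartAt [IsManifold 𝓘(ℝ, V) ∞ N] {p x : N} (h : x ∈ (chartAt V p).source) :
    TDiff V V (chartAt V p) x := tDiff_of_contMDiffAt (contMDiffAt_chartAt h) (by simp)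

theorem tDiff_chartAt_symm [IsManifold 𝓘(ℝ, V) ∞ N] {p : N} {y : V}
    (h : y ∈ (chartAt V p).target) :
    TDiff V V (chartAt V p).symm y := tDiff_of_contMDiffAt (contMDiffAt_chartAt_symm h) (by simp)

theorem tmap_chartAt_self [IsManifold 𝓘(ℝ, V) ∞ N] (p : N) :
    tmap V V (chartAt V p) p = ContinuousLinearMap.id ℝ V := by
  have : IsManifold 𝓘(ℝ, V) 1 N := IsManifold.of_le (n := ∞) (by simp)
  ext v
  unfold tmap
  rw [mfderiv_chartAt_eq_tangentCoordChange (mem_chart_source V p)]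
  exact tangentCoordChange_self (by simp)

theorem tmap_symm_comp_tmap_chartAt [IsManifold 𝓘(ℝ, V) ∞ N] {p x : N}
    (h : x ∈ (chartAt V p).source) :
    (tmap V V (chartAt V p).symm (chartAt V p x)).comp (tmap V V (chartAt V p) x) =
      ContinuousLinearMap.id ℝ V := by
  have h1 := (tDiff_chartAt_symm ((chartAt V p).map_source h)).hasTDeriv.comp
    (tDiff_chartAt h).hasTDeriv rfl
  refine h1.unique ((hasTDeriv_id (V := V) x).congr ?_)
  filter_upwards [(chartAt V p).open_source.mem_nhds h] with z hz
  exact (chartAt V p).left_inv hz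

/-- A map whose derivative vanishes on a connected open set is constant there. -/
theorem eq_of_hasTDeriv_zero [IsManifold 𝓘(ℝ, V) ∞ N] {c : U → N} {s : Set U} (hs : IsOpen s)
    (hc : IsPreconnected s) (h : ∀ x ∈ s, HasTDeriv c x (0 : U →L[ℝ] V)) {x y : U} (hx : x ∈ s)
    (hy : y ∈ s) : c x = c y := by
  refine hc.induction₂ (fun x y => c x = c y) ?_ (fun _ _ _ _ _ _ h1 h2 => h1.trans h2)
    (fun _ _ _ _ h => h.symm) hx hy
  intro x hx
  refine nhdsWithin_le_nhds ?_
  have h1 : ∀ᶠ y in 𝓝 x, y ∈ s ∧ c y ∈ (chartAt V (c x)).source :=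
    Filter.Eventually.and (hs.mem_nhds hx) ((h x hx).continuousAt.preimage_mem_nhds
      ((chartAt V (c x)).open_source.mem_nhds (mem_chart_source V (c x))))
  obtain ⟨ε, hε, hb⟩ := Metric.eventually_nhds_iff_ball.1 h1
  filter_upwards [Metric.ball_mem_nhds x hε] with y hy
  have hd : ∀ z ∈ Metric.ball x ε,
      HasFDerivAt (fun z => chartAt V (c x) (c z)) (0 : U →L[ℝ] V) z := by
    intro z hz
    have := (tDiff_chartAt (hb z hz).2).hasTDeriv.comp (h z (hb z hz).1) rfl
    rw [ContinuousLinearMap.comp_zero] at this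
    exact hasTDeriv_iff_hasFDerivAt.1 this
  have := Metric.isOpen_ball.is_const_of_fderiv_eq_zero (𝕜 := ℝ)
    (convex_ball x ε).isPreconnected (fun z hz => (hd z hz).differentiableAt.differentiableWithinAt)
    (fun z hz => (hd z hz).fderiv) (Metric.mem_ball_self hε) hy
  exact (chartAt V (c x)).injOn (mem_chart_source V (c x)) (hb y hy).2 this

/-- Smoothness of the derivative of a family of maps in the parameter, for base points that are
read in constant charts. -/
theorem contMDiffAt_tmap [IsManifold 𝓘(ℝ, V) ∞ N] [IsManifold 𝓘(ℝ, W) ∞ N']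
    [IsManifold 𝓘(ℝ, V') ∞ N₁] {f : N → N' → N₁}
    {p : N → N'} {x₀ : N}
    (hf : ContMDiffAt (𝓘(ℝ, V).prod 𝓘(ℝ, W)) 𝓘(ℝ, V') ∞ (Function.uncurry f) (x₀, p x₀))
    (hpc : ContMDiffAt 𝓘(ℝ, V) 𝓘(ℝ, W) ∞ p x₀)
    (hp : ∀ x, chartAt W (p x) = chartAt W (p x₀))
    (hq : ∀ x, chartAt V' (f x (p x)) = chartAt V' (f x₀ (p x₀))) :
    ContMDiffAt 𝓘(ℝ, V) 𝓘(ℝ, W →L[ℝ] V') ∞ (fun x => tmap W V' (f x) (p x)) x₀ := by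
  have : IsManifold 𝓘(ℝ, V) 1 N := IsManifold.of_le (n := ∞) (by simp)
  have : IsManifold 𝓘(ℝ, W) 1 N' := IsManifold.of_le (n := ∞) (by simp)
  have : IsManifold 𝓘(ℝ, V') 1 N₁ := IsManifold.of_le (n := ∞) (by simp)
  have h := ContMDiffAt.mfderiv f p hf hpc (m := ∞) (by simp)
  refine h.congr_of_eventuallyEq (Eventually.of_forall fun x => ?_)
  have e := inTangentCoordinates_eq (I := 𝓘(ℝ, W)) (I' := 𝓘(ℝ, V')) p (fun x => f x (p x))
    (fun x => tmap W V' (f x) (p x)) (x₀ := x₀) (x := x)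
    (by rw [← hp x]; exact mem_chart_source W (p x))
    (by rw [← hq x]; exact mem_chart_source V' _)
  refine Eq.trans ?_ e.symm
  have e1 : achart W (p x₀) = achart W (p x) := Subtype.ext (hp x).symm
  have e2 : achart V' (f x₀ (p x₀)) = achart V' (f x (p x)) := Subtype.ext (hq x).symm
  rw [e1, e2]
  ext v
  simp only [ContinuousLinearMap.comp_apply]
  rw [(tangentBundleCore 𝓘(ℝ, W) N').coordChange_self _ _ (by simp),
    (tangentBundleCore 𝓘(ℝ, V') N₁).coordChange_self _ _ (by simp)]

end Charts

/-! ### Left invariant vector fields in the chart at the identity -/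

section Smoothness

variable {VG : Type*} [NormedAddCommGroup VG] [NormedSpace ℝ VG]
  {G : Type*} [TopologicalSpace G] [ChartedSpace VG G] [Group G]
  {VE : Type*} [NormedAddCommGroup VE] [NormedSpace ℝ VE]
  {E : Type*} [TopologicalSpace E] [ChartedSpace VE E] [Group E]
  {U : Type*} [NormedAddCommGroup U] [NormedSpace ℝ U]

theorem LieCrossedModule.contMDiff_actLie [IsManifold 𝓘(ℝ, VG) ∞ G] [IsManifold 𝓘(ℝ, VE) ∞ E]
    (𝒢 : LieCrossedModule VG G VE E) :
    ContMDiff 𝓘(ℝ, VG) 𝓘(ℝ, VE →L[ℝ] VE) ∞ 𝒢.actLie := by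
  intro g
  exact contMDiffAt_tmap (f := fun (g : G) (e : E) => 𝒢.act g e) (p := fun _ => 1)
    𝒢.act_smooth.contMDiffAt contMDiffAt_const (fun _ => rfl) (fun _ => by simp)

variable [LieGroup 𝓘(ℝ, VG) ∞ G]

theorem contMDiff_adj : ContMDiff 𝓘(ℝ, VG) 𝓘(ℝ, VG →L[ℝ] VG) ∞ (adj VG G) := by
  intro g
  refine contMDiffAt_tmap (f := fun g h : G => g * h * g⁻¹) (p := fun _ => 1) ?_ contMDiffAt_const
    (fun _ => rfl) (fun _ => by simp)
  have h : ContMDiff (𝓘(ℝ, VG).prod 𝓘(ℝ, VG)) 𝓘(ℝ, VG) ∞ (fun p : G × G => p.1 * p.2 * p.1⁻¹) :=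
    (contMDiff_fst.mul contMDiff_snd).mul contMDiff_fst.inv
  exact h.contMDiffAt

theorem contDiff_logDeriv {k : U → G} (hk : ContMDiff 𝓘(ℝ, U) 𝓘(ℝ, VG) ∞ k) :
    ContDiff ℝ ∞ (logDeriv VG k) := by
  rw [← contMDiff_iff_contDiff]
  intro x
  refine contMDiffAt_tmap (f := fun z w => (k z)⁻¹ * k w) (p := fun z => z) ?_ contMDiffAt_id
    (fun _ => rfl) (fun _ => by simp)
  have h : ContMDiff (𝓘(ℝ, U).prod 𝓘(ℝ, U)) 𝓘(ℝ, VG) ∞ (fun p : U × U => (k p.1)⁻¹ * k p.2) :=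
    (hk.comp contMDiff_fst).inv.mul (hk.comp contMDiff_snd)
  exact h.contMDiffAt

variable (VG G) in
/-- The left invariant vector fields of `G` in the chart at `1`: `leftField y X` is the value at
`y` of the field that is `X` at `1`. -/
def leftField (y : VG) : VG →L[ℝ] VG :=
  tmap VG VG (fun h : G => chartAt VG (1 : G) ((chartAt VG (1 : G)).symm y * h)) 1

theorem contMDiffAt_leftField_aux {y : VG} (hy : y ∈ (chartAt VG (1 : G)).target) :
    ContMDiffAt (𝓘(ℝ, VG).prod 𝓘(ℝ, VG)) 𝓘(ℝ, VG) ∞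
      (fun p : VG × G => chartAt VG (1 : G) ((chartAt VG (1 : G)).symm p.1 * p.2)) (y, 1) := by
  have h1 : ContMDiffAt (𝓘(ℝ, VG).prod 𝓘(ℝ, VG)) 𝓘(ℝ, VG) ∞
      (fun p : VG × G => (chartAt VG (1 : G)).symm p.1 * p.2) (y, 1) :=
    ((contMDiffAt_chartAt_symm hy).comp (x := (y, (1 : G))) contMDiffAt_fst).mul contMDiffAt_snd
  refine ContMDiffAt.comp (x := (y, (1 : G)))
    (g := chartAt VG (1 : G)) (contMDiffAt_chartAt ?_) h1
  simpa using (chartAt VG (1 : G)).map_target hy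

theorem contDiffAt_leftField {y : VG} (hy : y ∈ (chartAt VG (1 : G)).target) :
    ContDiffAt ℝ ∞ (leftField VG G) y := by
  rw [← contMDiffAt_iff_contDiffAt]
  exact contMDiffAt_tmap (p := fun _ => (1 : G))
    (f := fun y h => chartAt VG (1 : G) ((chartAt VG (1 : G)).symm y * h))
    (contMDiffAt_leftField_aux hy) contMDiffAt_const (fun _ => rfl) (fun _ => rfl)

theorem hasTDeriv_leftField {y : VG} (hy : y ∈ (chartAt VG (1 : G)).target) :
    HasTDeriv (fun h : G => chartAt VG (1 : G) ((chartAt VG (1 : G)).symm y * h)) 1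
      (leftField VG G y) := by
  refine TDiff.hasTDeriv ?_
  refine tDiff_of_contMDiffAt (n := ∞) ?_ (by simp)
  exact (contMDiffAt_leftField_aux hy).comp (1 : G)
    (contMDiffAt_const.prodMk contMDiffAt_id)

theorem leftField_one : leftField VG G (chartAt VG (1 : G) 1) = ContinuousLinearMap.id ℝ VG := by
  have h := hasTDeriv_leftField (G := G) (mem_chart_target VG (1 : G))
  have e : (fun h : G => chartAt VG (1 : G) ((chartAt VG (1 : G)).symm (chartAt VG (1 : G) 1) * h))
      = chartAt VG (1 : G) := by
    funext h; simp
  rw [e] at h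
  exact h.tmap_eq.symm.trans (tmap_chartAt_self (1 : G))

theorem leftField_injective {y : VG} (hy : y ∈ (chartAt VG (1 : G)).target) :
    Function.Injective (leftField VG G y) := by
  set g := (chartAt VG (1 : G)).symm y with hg
  have hgs : g ∈ (chartAt VG (1 : G)).source := (chartAt VG (1 : G)).map_target hy
  have h1 : HasTDeriv (fun z : VG => g⁻¹ * (chartAt VG (1 : G)).symm z) y _ :=
    (tDiff_const_mul g⁻¹ g).hasTDeriv.comp (tDiff_chartAt_symm hy).hasTDeriv hg.symm
  have h2 := h1.comp (hasTDeriv_leftField hy) (by simp [(chartAt VG (1 : G)).right_inv hy])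
  have h3 := h2.unique ((hasTDeriv_id (V := VG) (1 : G)).congr ?_)
  · intro a b hab
    have := congrArg (fun L : VG →L[ℝ] VG => L a - L b) h3
    simp only [ContinuousLinearMap.comp_apply, hab, sub_self, ContinuousLinearMap.id_apply] at this
    exact (sub_eq_zero.1 this.symm)
  · have hc : ContinuousAt (fun h : G => g * h) 1 :=
      (tDiff_const_mul (VG := VG) g 1).hasTDeriv.continuousAt
    filter_upwards [hc.preimage_mem_nhds
      ((chartAt VG (1 : G)).open_source.mem_nhds (by simpa using hgs))] with h hh
    rw [(chartAt VG (1 : G)).left_inv hh]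
    group

/-- In the chart at `1`, logarithmic derivatives are transformed into derivatives by
`leftField`. -/
theorem HasLogDeriv.hasFDerivAt_chart {k : U → G} {x : U} {α : U →L[ℝ] VG}
    (h : HasLogDeriv k x α) (hx : k x ∈ (chartAt VG (1 : G)).source) :
    HasFDerivAt (fun z => chartAt VG (1 : G) (k z))
      ((leftField VG G (chartAt VG (1 : G) (k x))).comp α) x := by
  rw [← hasTDeriv_iff_hasFDerivAt]
  have h1 := (hasTDeriv_leftField ((chartAt VG (1 : G)).map_source hx)).comp h (by simp)
  rw [(chartAt VG (1 : G)).left_inv hx] at h1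
  simpa using h1

/-- Conversely, a solution `y` of `dy = leftField y α` is the expression in the chart of a map with
the logarithmic derivative `α`. -/
theorem hasLogDeriv_of_chart {y : U → VG} {x : U} {α : U →L[ℝ] VG}
    (h : HasFDerivAt y ((leftField VG G (y x)).comp α) x)
    (hx : y x ∈ (chartAt VG (1 : G)).target) :
    HasLogDeriv (fun z => (chartAt VG (1 : G)).symm (y z)) x α := by
  have h1 : TDiff U VG (fun z => (chartAt VG (1 : G)).symm (y z)) x :=
    ((tDiff_chartAt_symm hx).hasTDeriv.comp (hasTDeriv_iff_hasFDerivAt.2 h) rfl).tDiff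
  have h2 := h1.hasLogDeriv
  have h3 := h2.hasFDerivAt_chart ((chartAt VG (1 : G)).map_target hx)
  rw [(chartAt VG (1 : G)).right_inv hx] at h3
  have h4 : HasFDerivAt y _ x := h3.congr_of_eventuallyEq (by
    filter_upwards [h.continuousAt.preimage_mem_nhds ((chartAt VG (1 : G)).open_target.mem_nhds hx)]
      with z hz
    exact ((chartAt VG (1 : G)).right_inv hz).symm)
  have h5 := h4.unique h
  have : logDeriv VG (fun z => (chartAt VG (1 : G)).symm (y z)) x = α := by
    ext v
    exact leftField_injective hx (congrArg (fun L : U →L[ℝ] VG => L v) h5)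
  rwa [this] at h2

/-- A map whose logarithmic derivative is `C^n` is `C^(n+1)`. -/
theorem contMDiff_succ_of_hasLogDeriv {n : ℕ} {k : U → G} {α : U → U →L[ℝ] VG}
    (h : ∀ x, HasLogDeriv k x (α x)) (hα : ContDiff ℝ n α)
    (hk : ContMDiff 𝓘(ℝ, U) 𝓘(ℝ, VG) n k) : ContMDiff 𝓘(ℝ, U) 𝓘(ℝ, VG) (n + 1 : ℕ) k := by
  intro x
  set l : U → G := fun z => (k x)⁻¹ * k z with hl
  have hlx : l x = 1 := by simp [l]
  have hlc : ContMDiff 𝓘(ℝ, U) 𝓘(ℝ, VG) n l :=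
    (contMDiff_const_mul (by exact_mod_cast le_top) _).comp hk
  have hld : ∀ z, HasLogDeriv l z (α z) := fun z => (h z).const_mul _
  have hs : ∀ᶠ z in 𝓝 x, l z ∈ (chartAt VG (1 : G)).source :=
    (hld x).continuousAt.preimage_mem_nhds ((chartAt VG (1 : G)).open_source.mem_nhds
      (by rw [hlx]; exact mem_chart_source VG 1))
  have h1 : ContDiffAt ℝ ((n : ℕ∞ω) + 1) (fun z => chartAt VG (1 : G) (l z)) x := by
    rw [contDiffAt_succ_iff_hasFDerivAt]
    refine ⟨fun z => (leftField VG G (chartAt VG (1 : G) (l z))).comp (α z),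
      ⟨_, hs, fun z hz => (hld z).hasFDerivAt_chart hz⟩, ?_⟩
    have h2 : ContDiffAt ℝ n (fun z => chartAt VG (1 : G) (l z)) x := by
      rw [← contMDiffAt_iff_contDiffAt]
      exact ((contMDiffAt_chartAt (hs.self_of_nhds)).of_le (by exact_mod_cast le_top)).comp x
        hlc.contMDiffAt
    refine ContDiffAt.clm_comp ?_ hα.contDiffAt
    have h3 : ContDiffAt ℝ n (leftField VG G) (chartAt VG (1 : G) (l x)) :=
      (contDiffAt_leftField ((chartAt VG (1 : G)).map_source hs.self_of_nhds)).of_le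
        (by exact_mod_cast le_top)
    exact h3.comp x h2
  have h2 : ContMDiffAt 𝓘(ℝ, U) 𝓘(ℝ, VG) (n + 1 : ℕ)
      (fun z => k x * (chartAt VG (1 : G)).symm (chartAt VG (1 : G) (l z))) x := by
    refine ((contMDiff_const_mul (n := (n + 1 : ℕ)) (by exact_mod_cast le_top)
      (k x)).contMDiffAt).comp x ?_
    refine ContMDiffAt.comp x ((contMDiffAt_chartAt_symm ?_).of_le (by exact_mod_cast le_top))
      (contMDiffAt_iff_contDiffAt.2 (by exact_mod_cast h1))
    exact (chartAt VG (1 : G)).map_source hs.self_of_nhds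
  refine h2.congr_of_eventuallyEq ?_
  filter_upwards [hs] with z hz
  rw [(chartAt VG (1 : G)).left_inv hz]
  simp [l]

end Smoothness

/-! ### Existence and uniqueness of ordered exponentials -/

section OrderedExp

variable {VG : Type*} [NormedAddCommGroup VG] [NormedSpace ℝ VG]
  {G : Type*} [TopologicalSpace G] [ChartedSpace VG G] [Group G]
  {U : Type*} [NormedAddCommGroup U] [NormedSpace ℝ U]

/-- The curve `c` has the logarithmic derivative `v` at time `t`. -/
abbrev HasLogVelocity (c : ℝ → G) (t : ℝ) (v : VG) : Prop :=
  HasLogDeriv c t (ContinuousLinearMap.toSpanSingleton ℝ v)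

theorem HasLogVelocity.comp {c : ℝ → G} {f : ℝ → ℝ} {t f' : ℝ} {v : VG}
    (h : HasLogVelocity c (f t) v) (hf : HasDerivAt f f' t) :
    HasLogVelocity (fun z => c (f z)) t (f' • v) := by
  have := HasLogDeriv.comp h hf.hasFDerivAt
  unfold HasLogVelocity
  convert this using 1
  ext; simp

theorem HasLogDeriv.hasLogVelocity {k : U → G} {f : ℝ → U} {t : ℝ} {α : U →L[ℝ] VG} {v : U}
    (h : HasLogDeriv k (f t) α) (hf : HasDerivAt f v t) :
    HasLogVelocity (fun z => k (f z)) t (α v) := by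
  have := HasLogDeriv.comp h hf.hasFDerivAt
  unfold HasLogVelocity
  convert this using 1
  ext; simp

variable [LieGroup 𝓘(ℝ, VG) ∞ G]

theorem isOrderedExp_iff {A : ℝ → VG} {c : ℝ → G} :
    IsOrderedExp A c ↔ c 0 = 1 ∧ ∀ t, HasLogVelocity c t (A t) := by
  simp only [IsOrderedExp, hasVelocity_iff_hasLogDeriv]

theorem HasLogVelocity.mul_const {c : ℝ → G} {t : ℝ} {v : VG} (hc : HasLogVelocity c t v) (g : G) :
    HasLogVelocity (fun z => c z * g) t (adj VG G g⁻¹ v) := by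
  have := HasLogDeriv.mul_const hc g
  unfold HasLogVelocity
  convert this using 1
  ext; simp

theorem HasLogVelocity.inv {c : ℝ → G} {t : ℝ} {v : VG} (hc : HasLogVelocity c t v) :
    HasLogVelocity (fun z => (c z)⁻¹) t (-adj VG G (c t) v) := by
  have := HasLogDeriv.inv hc
  unfold HasLogVelocity
  convert this using 1
  ext; simp

/-- Two curves with the same logarithmic derivative differ by a left translation. -/
theorem eq_mul_of_hasLogVelocity {c d : ℝ → G} {A : ℝ → VG} {s : Set ℝ} (hs : IsOpen s)
    (hp : IsPreconnected s) (hc : ∀ t ∈ s, HasLogVelocity c t (A t))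
    (hd : ∀ t ∈ s, HasLogVelocity d t (A t)) {p t : ℝ} (hps : p ∈ s) (hts : t ∈ s) :
    c t = c p * (d p)⁻¹ * d t := by
  have h : ∀ t ∈ s, HasTDeriv (fun z => c z * (d z)⁻¹) t (0 : ℝ →L[ℝ] VG) := by
    intro t ht
    have := (hc t ht).div (hd t ht)
    rw [sub_self, ContinuousLinearMap.comp_zero, hasLogDeriv_iff,
      ContinuousLinearMap.comp_zero] at this
    exact this
  have := eq_of_hasTDeriv_zero hs hp h hts hps
  rw [← this]; group

theorem IsOrderedExp.unique {c d : ℝ → G} {A : ℝ → VG} (hc : IsOrderedExp A c)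
    (hd : IsOrderedExp A d) : c = d := by
  rw [isOrderedExp_iff] at hc hd
  funext t
  have := eq_mul_of_hasLogVelocity (p := 0) (t := t) isOpen_univ isPreconnected_univ
    (fun t _ => hc.2 t) (fun t _ => hd.2 t) trivial trivial
  simpa [hc.1, hd.1] using this

theorem IsOrderedExp.eq_orderedExp {A : ℝ → VG} {c : ℝ → G} (h : IsOrderedExp A c) :
    orderedExp G A = c := by
  have hex : ∃ c : ℝ → G, IsOrderedExp A c := ⟨c, h⟩
  unfold orderedExp
  rw [dif_pos hex]
  exact hex.choose_spec.unique h

/-- Solutions of `c' = c A` on overlapping intervals can be glued. -/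
theorem exists_solution_glue {A : ℝ → VG} {a b a' b' : ℝ} (h₁ : a ≤ a') (h₂ : a' < b) (h₃ : b ≤ b')
    {c₁ c₂ : ℝ → G} (hc₁ : ∀ t ∈ Ioo a b, HasLogVelocity c₁ t (A t))
    (hc₂ : ∀ t ∈ Ioo a' b', HasLogVelocity c₂ t (A t)) :
    ∃ c : ℝ → G, ∀ t ∈ Ioo a b', HasLogVelocity c t (A t) := by
  set p := (a' + b) / 2 with hp
  have hpm : p ∈ Ioo a' b := ⟨by linarith, by linarith⟩
  have he : ∀ t ∈ Ioo a' b, c₁ t = c₁ p * (c₂ p)⁻¹ * c₂ t := fun t ht =>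
    eq_mul_of_hasLogVelocity isOpen_Ioo isPreconnected_Ioo
      (fun t ht => hc₁ t ⟨by linarith [ht.1], ht.2⟩)
      (fun t ht => hc₂ t ⟨ht.1, by linarith [ht.2]⟩) hpm ht
  refine ⟨fun t => if t < p then c₁ t else c₁ p * (c₂ p)⁻¹ * c₂ t, fun t ht => ?_⟩
  rcases lt_or_ge t p with htp | htp
  · refine HasLogDeriv.congr (hc₁ t ⟨ht.1, by linarith [hpm.2]⟩) ?_
    filter_upwards [Iio_mem_nhds htp] with z hz
    exact if_pos hz
  · refine HasLogDeriv.congr ((hc₂ t ⟨by linarith [hpm.1], ht.2⟩).const_mul (c₁ p * (c₂ p)⁻¹)) ?_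
    filter_upwards [Ioi_mem_nhds (show a' < t by linarith [hpm.1])] with z hz
    split_ifs with hzp
    · exact he z ⟨hz, by linarith [hpm.2]⟩
    · rfl

variable [FiniteDimensional ℝ VG]

variable (G) in
/-- Solutions of `c' = c δ` near `1` exist as long as they cannot leave the chart, and are there
given by the integral of `δ` up to a quadratic error. -/
theorem exists_chart_solution : ∃ r > 0, ∃ C : ℝ, ∀ (T ε : ℝ) (δ : ℝ → VG), 0 < T → 0 ≤ ε →
    Continuous δ → (∀ t ∈ Icc (-T) T, ‖δ t‖ ≤ ε) → 2 * ε * T ≤ r → ∃ c : ℝ → G, c 0 = 1 ∧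
      ∀ t ∈ Ioo (-T) T, HasLogVelocity c t (δ t) ∧ c t ∈ (chartAt VG (1 : G)).source ∧
        ‖chartAt VG (1 : G) (c t) - chartAt VG (1 : G) 1 - ∫ τ in (0 : ℝ)..t, δ τ‖
          ≤ C * (ε * T) ^ 2 := by
  have : CompleteSpace VG := FiniteDimensional.complete ℝ VG
  set y₀ := chartAt VG (1 : G) 1 with hy₀
  obtain ⟨K, s, hs, hK⟩ := ((contDiffAt_leftField (mem_chart_target VG (1 : G))).of_le
    (m := 1) (by simp)).exists_lipschitzOnWith
  obtain ⟨r₀, hr₀, hrs⟩ := Metric.nhds_basis_closedBall.mem_iff.1 (inter_mem hs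
    ((chartAt VG (1 : G)).open_target.mem_nhds (mem_chart_target VG (1 : G))))
  set r := min r₀ (1 / (K + 1)) with hr
  have hr1 : 0 < r := lt_min hr₀ (by positivity)
  have hball : Metric.closedBall y₀ r ⊆ Metric.closedBall y₀ r₀ :=
    Metric.closedBall_subset_closedBall (min_le_left _ _)
  have hKr : K * r ≤ 1 := by
    calc (K : ℝ) * r ≤ K * (1 / (K + 1)) := by gcongr; exact min_le_right _ _
      _ ≤ 1 := by rw [mul_one_div, div_le_one (by positivity)]; linarith
  have hlip : ∀ y ∈ Metric.closedBall y₀ r,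
      ‖leftField VG G y - ContinuousLinearMap.id ℝ VG‖ ≤ K * ‖y - y₀‖ := by
    intro y hy
    rw [← leftField_one (G := G), ← dist_eq_norm, ← dist_eq_norm]
    exact hK.dist_le_mul y (hrs (hball hy)).1 y₀ (hrs (Metric.mem_closedBall_self hr₀.le)).1
  have hbd : ∀ y ∈ Metric.closedBall y₀ r, ‖leftField VG G y‖ ≤ 2 := by
    intro y hy
    have h1 := hlip y hy
    have h2 : ‖y - y₀‖ ≤ r := by rwa [← dist_eq_norm]
    have h3 : ‖ContinuousLinearMap.id ℝ VG‖ ≤ 1 := ContinuousLinearMap.norm_id_le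
    have h4 : leftField VG G y =
      (leftField VG G y - ContinuousLinearMap.id ℝ VG) + ContinuousLinearMap.id ℝ VG := by abel
    rw [h4]
    refine (norm_add_le _ _).trans ?_
    have : (K : ℝ) * ‖y - y₀‖ ≤ K * r := by gcongr
    linarith
  -- On the ball of radius `r` the field `leftField` is `K`-Lipschitz and bounded by `2`, so that a
  -- solution moves by at most `2 ε T ≤ r`. There `leftField y` differs from the identity by at most
  -- `K (2 ε T)`, and the error is at most `K (2 ε T) ε T`.
  refine ⟨r, hr1, 2 * K, fun T ε δ hT hε hδ hδε hεT => ?_⟩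
  lift ε to NNReal using hε
  obtain ⟨rn, hrn⟩ : ∃ rn : NNReal, (rn : ℝ) = r := ⟨⟨r, hr1.le⟩, rfl⟩
  let f : ℝ → VG → VG := fun t y => leftField VG G y (δ t)
  have h0 : (0 : ℝ) ∈ Icc (-T) T := ⟨by linarith, hT.le⟩
  have hf : IsPicardLindelof f (⟨0, h0⟩ : Icc (-T) T) y₀ rn 0 (2 * ε) (K * ε) := by
    constructor <;> rw [hrn]
    · intro t ht
      refine LipschitzOnWith.of_dist_le_mul fun y hy z hz => ?_
      have h1 := hK.dist_le_mul y (hrs (hball hy)).1 z (hrs (hball hz)).1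
      rw [dist_eq_norm] at h1 ⊢
      calc ‖leftField VG G y (δ t) - leftField VG G z (δ t)‖
          = ‖(leftField VG G y - leftField VG G z) (δ t)‖ := by simp
        _ ≤ ‖leftField VG G y - leftField VG G z‖ * ‖δ t‖ := ContinuousLinearMap.le_opNorm _ _
        _ ≤ (K * dist y z) * ε := by gcongr; exact hδε t ht
        _ = _ := by rw [NNReal.coe_mul]; ring
    · intro y _
      exact ((leftField VG G y).continuous.comp hδ).continuousOn
    · intro t ht y hy
      calc ‖leftField VG G y (δ t)‖ ≤ ‖leftField VG G y‖ * ‖δ t‖ :=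
            ContinuousLinearMap.le_opNorm _ _
        _ ≤ 2 * ε := by gcongr; exacts [hbd y hy, hδε t ht]
        _ = _ := by simp
    · simpa using hεT
  have hx : y₀ ∈ Metric.closedBall y₀ ((0 : NNReal) : ℝ) := by simp
  obtain ⟨α, hα⟩ := ODE.FunSpace.exists_isFixedPt_next hf hx
  have hmem : ∀ t, α.compProj t ∈ Metric.closedBall y₀ r :=
    fun t => hrn ▸ α.compProj_mem_closedBall hf.mul_max_le
  set y := α.compProj with hy
  have hy0 : y 0 = y₀ := by
    have := ODE.FunSpace.compProj_val (α := α) (t := ⟨0, h0⟩)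
    rw [hy, this, ← hα, ODE.FunSpace.next_apply₀]
  have hyd : ∀ t ∈ Ioo (-T) T, HasDerivAt y (leftField VG G (y t) (δ t)) t := by
    intro t ht
    have h1 := ODE.hasDerivWithinAt_picard_Icc h0 hf.continuousOn_uncurry
      α.continuous_compProj.continuousOn (fun t _ => by rw [hrn]; exact hmem t) y₀
      (Ioo_subset_Icc_self ht)
    refine (h1.congr_of_mem ?_ (Ioo_subset_Icc_self ht)).hasDerivAt (Icc_mem_nhds ht.1 ht.2)
    intro t' ht'
    nth_rw 1 [hy, ← hα]
    rw [ODE.FunSpace.compProj_of_mem ht', ODE.FunSpace.next_apply]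
  have hmv : ∀ t ∈ Ioo (-T) T, ‖y t - y₀‖ ≤ 2 * ε * T := by
    intro t ht
    have := (convex_Ioo (-T) T).norm_image_sub_le_of_norm_hasDerivWithin_le (C := 2 * ε)
      (fun t ht => (hyd t ht).hasDerivWithinAt)
      (fun t ht => by
        simpa using hf.norm_le t (Ioo_subset_Icc_self ht) _ (by rw [hrn]; exact hmem t))
      (⟨by linarith, hT⟩ : (0 : ℝ) ∈ Ioo (-T) T) ht
    rw [hy0, sub_zero] at this
    refine this.trans ?_
    gcongr
    exact (abs_lt.2 ht).le
  refine ⟨fun t => (chartAt VG (1 : G)).symm (y t), ?_, fun t ht => ⟨?_, ?_, ?_⟩⟩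
  · simp [hy0, hy₀]
  · refine hasLogDeriv_of_chart (y := y) ?_ (hrs (hball (hmem t))).2
    have e : (leftField VG G (y t)).comp (ContinuousLinearMap.toSpanSingleton ℝ (δ t)) =
        ContinuousLinearMap.toSpanSingleton ℝ (leftField VG G (y t) (δ t)) := by
      ext; simp
    rw [e]
    exact (hyd t ht).hasFDerivAt
  · exact (chartAt VG (1 : G)).map_target (hrs (hball (hmem t))).2
  · simp only
    rw [(chartAt VG (1 : G)).right_inv (hrs (hball (hmem t))).2]
    have hd : ∀ t ∈ Ioo (-T) T, HasDerivAt (fun t => y t - ∫ τ in (0 : ℝ)..t, δ τ)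
        (leftField VG G (y t) (δ t) - δ t) t := fun t ht =>
      (hyd t ht).sub (hδ.integral_hasStrictDerivAt 0 t).hasDerivAt
    have := (convex_Ioo (-T) T).norm_image_sub_le_of_norm_hasDerivWithin_le
      (C := K * (2 * ε * T) * ε)
      (fun t ht => (hd t ht).hasDerivWithinAt) ?_
      (⟨by linarith, hT⟩ : (0 : ℝ) ∈ Ioo (-T) T) ht
    · rw [hy0, sub_zero, intervalIntegral.integral_same, sub_zero] at this
      rw [sub_right_comm]
      refine this.trans ?_
      calc K * (2 * ε * T) * ε * ‖t‖ ≤ K * (2 * ε * T) * ε * T := by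
            gcongr; exact (abs_lt.2 ht).le
        _ = _ := by ring
    · intro t ht
      have h1 : leftField VG G (y t) (δ t) - δ t =
        (leftField VG G (y t) - ContinuousLinearMap.id ℝ VG) (δ t) := by simp
      rw [h1]
      refine (ContinuousLinearMap.le_opNorm _ _).trans ?_
      gcongr
      · exact (hlip _ (hmem t)).trans (by gcongr; exact hmv t ht)
      · exact hδε t (Ioo_subset_Icc_self ht)

/-- A solution on a bounded interval is composed of solutions on short intervals. -/
theorem exists_solution_Ioo {A : ℝ → VG} (hA : Continuous A) (T : ℝ) :
    ∃ c : ℝ → G, ∀ t ∈ Ioo (-T) T, HasLogVelocity c t (A t) := by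
  obtain ⟨r, hr, C, hC⟩ := exists_chart_solution (VG := VG) G
  obtain ⟨ε, hε⟩ := (isCompact_Icc (a := -T - 1) (b := T + 1)).exists_bound_of_continuousOn
    hA.continuousOn
  set ε' := max ε 0 with hε'
  -- the length of intervals on which solutions in the chart exist, wherever they start
  set d := min 1 (r / (2 * ε' + 1)) with hd
  have hε0 : 0 ≤ ε' := le_max_right _ _
  have hd0 : 0 < d := lt_min one_pos (by positivity)
  have hdr : 2 * ε' * d ≤ r := by
    calc 2 * ε' * d ≤ 2 * ε' * (r / (2 * ε' + 1)) := by gcongr; exact min_le_right _ _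
      _ = r * (2 * ε' / (2 * ε' + 1)) := by ring
      _ ≤ r * 1 := by gcongr; rw [div_le_one (by positivity)]; linarith
      _ = r := mul_one r
  have hloc : ∀ s ∈ Icc (-T) T, ∃ c : ℝ → G, ∀ t ∈ Ioo (s - d) (s + d),
      HasLogVelocity c t (A t) := by
    intro s hs
    obtain ⟨c, -, hc⟩ := hC d ε' (fun t => A (t + s)) hd0 hε0 (by fun_prop) (fun t ht =>
      (hε _ ⟨by linarith [ht.1, hs.1, min_le_left 1 (r / (2 * ε' + 1))],
        by linarith [ht.2, hs.2, min_le_left 1 (r / (2 * ε' + 1))]⟩).trans (le_max_left _ _)) hdr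
    refine ⟨fun t => c (t - s), fun t ht => ?_⟩
    have h1 := (hc (t - s) ⟨by linarith [ht.1], by linarith [ht.2]⟩).1
    have := HasLogVelocity.comp (f := fun z => z - s) h1 ((hasDerivAt_id t).sub_const s)
    simpa using this
  have hind : ∀ n : ℕ, -T + n * (d / 2) ≤ T → ∃ c : ℝ → G,
      ∀ t ∈ Ioo (-T - d) (-T + n * (d / 2) + d), HasLogVelocity c t (A t) := by
    intro n
    induction n with
    | zero =>
      intro h
      obtain ⟨c, hc⟩ := hloc (-T) ⟨le_rfl, by simpa using h⟩
      exact ⟨c, fun t ht => hc t (by simpa using ht)⟩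
    | succ n ih =>
      intro h
      push_cast at h ⊢
      obtain ⟨c₁, h₁⟩ := ih (by linarith)
      obtain ⟨c₂, h₂⟩ := hloc (-T + (n + 1) * (d / 2)) ⟨by
        have : (0 : ℝ) ≤ (n + 1) * (d / 2) := by positivity
        linarith, h⟩
      exact exists_solution_glue (by
        have : (0 : ℝ) ≤ (n + 1) * (d / 2) := by positivity
        linarith) (by linarith) (by linarith) h₁ h₂
  rcases le_or_gt T 0 with hT | hT
  · exact ⟨1, fun t ht => absurd (ht.1.trans ht.2) (by linarith)⟩
  · set n := ⌊2 * T / (d / 2)⌋₊ with hn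
    have h1 : (n : ℝ) * (d / 2) ≤ 2 * T := by
      rw [← le_div_iff₀ (by positivity)]
      exact Nat.floor_le (by positivity)
    have h2 : 2 * T < (n + 1) * (d / 2) := by
      rw [← div_lt_iff₀ (by positivity)]
      exact Nat.lt_floor_add_one _
    obtain ⟨c, hc⟩ := hind n (by linarith)
    exact ⟨c, fun t ht => hc t ⟨by linarith [ht.1], by linarith [ht.2]⟩⟩

/-- Global existence of ordered exponentials. -/
theorem exists_isOrderedExp {A : ℝ → VG} (hA : Continuous A) : ∃ c : ℝ → G, IsOrderedExp A c := by
  choose c hc using fun n : ℕ => exists_solution_Ioo (G := G) hA (n + 1)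
  have hmem : ∀ n : ℕ, (0 : ℝ) ∈ Ioo (-((n : ℝ) + 1)) (n + 1) := fun n =>
    ⟨by have : (0 : ℝ) ≤ n := n.cast_nonneg
        linarith, by positivity⟩
  let d : ℕ → ℝ → G := fun n t => (c n 0)⁻¹ * c n t
  have hd : ∀ n : ℕ, ∀ t ∈ Ioo (-((n : ℝ) + 1)) (n + 1), HasLogVelocity (d n) t (A t) :=
    fun n t ht => (hc n t ht).const_mul _
  have hd0 : ∀ n, d n 0 = 1 := fun n => by simp [d]
  have heq : ∀ m n : ℕ, m ≤ n → ∀ t ∈ Ioo (-((m : ℝ) + 1)) (m + 1), d m t = d n t := by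
    intro m n hmn t ht
    have hmn' : (m : ℝ) ≤ n := by exact_mod_cast hmn
    have := eq_mul_of_hasLogVelocity isOpen_Ioo isPreconnected_Ioo (hd m)
      (fun t ht => hd n t ⟨by linarith [ht.1], by linarith [ht.2]⟩) (hmem m) ht
    rw [this, hd0, hd0]
    group
  refine ⟨fun t => d ⌊|t|⌋₊ t, isOrderedExp_iff.2 ⟨by simp [d], fun t => ?_⟩⟩
  set n := ⌊|t|⌋₊ + 1 with hn
  have hlt : ∀ z : ℝ, z ∈ Ioo (-((⌊|z|⌋₊ : ℝ) + 1)) (⌊|z|⌋₊ + 1) := fun z =>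
    abs_lt.1 (Nat.lt_floor_add_one |z|)
  have ht : t ∈ Ioo (-(n : ℝ)) n := by simpa [hn] using hlt t
  refine HasLogDeriv.congr (hd n t ⟨by linarith [ht.1], by linarith [ht.2]⟩) ?_
  filter_upwards [Ioo_mem_nhds ht.1 ht.2] with z hz
  refine heq _ _ ?_ z (hlt z)
  have : |z| < n := abs_lt.2 hz
  exact ((Nat.floor_lt (abs_nonneg z)).2 this).le

theorem isOrderedExp_orderedExp {A : ℝ → VG} (hA : Continuous A) :
    IsOrderedExp A (orderedExp G A) := by
  unfold orderedExp
  rw [dif_pos (exists_isOrderedExp hA)]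
  exact (exists_isOrderedExp hA).choose_spec

end OrderedExp

/-! ### Integrals that depend on parameters -/

section ParametricIntegral

variable {W : Type*} [NormedAddCommGroup W] [NormedSpace ℝ W]

/-- Rescaling to the unit interval, which turns the dependence on the upper limit into a dependence
on parameters. -/
theorem integral_eq_smul_unit {Z : Type*} (F : ℝ × Z → W) (p : ℝ × Z) :
    ∫ τ in (0 : ℝ)..p.1, F (τ, p.2) = p.1 • ∫ σ in (0 : ℝ)..1, F (p.1 * σ, p.2) := by
  rw [intervalIntegral.smul_integral_comp_mul_left (fun τ => F (τ, p.2))]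
  simp

variable {Z : Type*} [NormedAddCommGroup Z] [NormedSpace ℝ Z]

theorem hasFDerivAt_partial_snd {F : ℝ × Z → W} {p : ℝ × Z} (hF : DifferentiableAt ℝ F p) :
    HasFDerivAt (fun z => F (p.1, z)) ((fderiv ℝ F p).comp (ContinuousLinearMap.inr ℝ ℝ Z)) p.2 :=
  HasFDerivAt.comp (f := fun z => (p.1, z)) p.2 hF.hasFDerivAt (hasFDerivAt_prodMk_right p.1 p.2)

variable [FiniteDimensional ℝ Z]

/-- Differentiation under the integral sign for a `C¹` integrand. -/
theorem hasFDerivAt_integral_unit {F : ℝ × Z → W} (hF : ContDiff ℝ 1 F) (z : Z) :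
    HasFDerivAt (fun z => ∫ σ in (0 : ℝ)..1, F (σ, z))
      (∫ σ in (0 : ℝ)..1, (fderiv ℝ F (σ, z)).comp (ContinuousLinearMap.inr ℝ ℝ Z)) z := by
  have hc : Continuous fun p : ℝ × Z => (fderiv ℝ F p).comp (ContinuousLinearMap.inr ℝ ℝ Z) :=
    (hF.continuous_fderiv one_ne_zero).clm_comp continuous_const
  have : ProperSpace Z := FiniteDimensional.proper ℝ Z
  have hK : IsCompact (Icc (0 : ℝ) 1 ×ˢ Metric.closedBall z 1) :=
    isCompact_Icc.prod (isCompact_closedBall z 1)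
  obtain ⟨C, hC⟩ := hK.exists_bound_of_continuousOn hc.continuousOn
  refine intervalIntegral.hasFDerivAt_integral_of_dominated_of_fderiv_le (𝕜 := ℝ)
    (F := fun z σ => F (σ, z)) (bound := fun _ => C)
    (F' := fun z σ => (fderiv ℝ F (σ, z)).comp (ContinuousLinearMap.inr ℝ ℝ Z))
    (Metric.closedBall_mem_nhds z one_pos) ?_ ?_ ?_ ?_ ?_ ?_
  · exact Eventually.of_forall fun x =>
      (hF.continuous.comp (by fun_prop : Continuous fun σ : ℝ => (σ, x))).aestronglyMeasurable
  · exact (hF.continuous.comp (by fun_prop : Continuous fun σ : ℝ => (σ, z))).intervalIntegrable _ _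
  · exact (hc.comp (by fun_prop : Continuous fun σ : ℝ => (σ, z))).aestronglyMeasurable
  · refine Eventually.of_forall fun σ hσ x hx => ?_
    rw [uIoc_of_le zero_le_one] at hσ
    exact hC (σ, x) ⟨Ioc_subset_Icc_self hσ, hx⟩
  · exact intervalIntegrable_const
  · exact Eventually.of_forall fun σ _ x _ =>
      hasFDerivAt_partial_snd (p := (σ, x)) (hF.differentiable one_ne_zero _)

theorem contDiff_integral_unit {n : ℕ} {F : ℝ × Z → W} (hF : ContDiff ℝ n F) :
    ContDiff ℝ n fun z => ∫ σ in (0 : ℝ)..1, F (σ, z) := by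
  induction n generalizing F with
  | zero =>
    rw [Nat.cast_zero, contDiff_zero] at *
    exact intervalIntegral.continuous_parametric_intervalIntegral_of_continuous'
      (f := fun z σ => F (σ, z)) (hF.comp continuous_swap) 0 1
  | succ n ih =>
    push_cast at hF ⊢
    have hd := fun z => hasFDerivAt_integral_unit (hF.of_le (by simp)) z
    have hF' : ContDiff ℝ n (fderiv ℝ F) := hF.fderiv_right (m := n) le_rfl
    rw [contDiff_succ_iff_fderiv_apply]
    refine ⟨fun z => (hd z).differentiableAt, by simp, fun y => ?_⟩
    have e : (fun z => fderiv ℝ (fun z => ∫ σ in (0 : ℝ)..1, F (σ, z)) z y) =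
        fun z => ∫ σ in (0 : ℝ)..1, fderiv ℝ F (σ, z) (0, y) := by
      funext z
      rw [(hd z).fderiv, ContinuousLinearMap.intervalIntegral_apply]
      · simp
      · exact Continuous.intervalIntegrable ((hF'.continuous.comp
          (by fun_prop : Continuous fun σ : ℝ => (σ, z))).clm_comp continuous_const) _ _
    rw [e]
    exact ih (hF'.clm_apply contDiff_const)

theorem contDiff_integral_nat {n : ℕ} {F : ℝ × Z → W} (hF : ContDiff ℝ n F) :
    ContDiff ℝ n fun p : ℝ × Z => ∫ τ in (0 : ℝ)..p.1, F (τ, p.2) := by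
  simp_rw [integral_eq_smul_unit]
  refine contDiff_fst.smul ?_
  exact contDiff_integral_unit (F := fun q : ℝ × ℝ × Z => F (q.2.1 * q.1, q.2.2))
    (hF.comp (by fun_prop))

/-- An integral with variable upper limit depends smoothly on the limit and on parameters. -/
theorem contDiff_integral {F : ℝ × Z → W} (hF : ContDiff ℝ ∞ F) :
    ContDiff ℝ ∞ fun p : ℝ × Z => ∫ τ in (0 : ℝ)..p.1, F (τ, p.2) :=
  contDiff_infty.2 fun n => contDiff_integral_nat (contDiff_infty.1 hF n)

theorem fderiv_integral_fst [CompleteSpace W] {F : ℝ × Z → W} (hF : ContDiff ℝ 1 F) (p : ℝ × Z) :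
    fderiv ℝ (fun p : ℝ × Z => ∫ τ in (0 : ℝ)..p.1, F (τ, p.2)) p (1, 0) = F p := by
  have h1 := ((contDiff_integral_nat (n := 1) (by exact_mod_cast hF)).differentiable
    (by simp) p).hasFDerivAt
  have hc : Continuous fun τ : ℝ => F (τ, p.2) := hF.continuous.comp (by fun_prop)
  have h2 : HasDerivAt (fun t : ℝ => ((t, p.2) : ℝ × Z)) (1, 0) p.1 :=
    (hasDerivAt_id p.1).prodMk (hasDerivAt_const _ _)
  have h3 := HasFDerivAt.comp_hasDerivAt (f := fun t : ℝ => ((t, p.2) : ℝ × Z)) p.1 h1 h2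
  exact h3.unique (hc.integral_hasStrictDerivAt 0 p.1).hasDerivAt

theorem fderiv_integral_snd {F : ℝ × Z → W} (hF : ContDiff ℝ 1 F) (p : ℝ × Z) (ζ : Z) :
    fderiv ℝ (fun p : ℝ × Z => ∫ τ in (0 : ℝ)..p.1, F (τ, p.2)) p (0, ζ) =
      ∫ τ in (0 : ℝ)..p.1, fderiv ℝ F (τ, p.2) (0, ζ) := by
  have h1 := hasFDerivAt_partial_snd (p := p)
    ((contDiff_integral_nat (n := 1) (by exact_mod_cast hF)).differentiable (by simp) p)
  have hF' : ContDiff ℝ 1 (fun q : ℝ × Z => F (p.1 * q.1, q.2)) := hF.comp (by fun_prop)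
  have h2 := (hasFDerivAt_integral_unit hF' p.2).const_smul p.1
  have h3 : (fun z => ∫ τ in (0 : ℝ)..p.1, F (τ, z)) =
      fun z => p.1 • ∫ σ in (0 : ℝ)..1, F (p.1 * σ, z) := by
    funext z; exact integral_eq_smul_unit F (p.1, z)
  have h4 := (congrArg (fun L : Z →L[ℝ] W => L ζ) ((h3 ▸ h1).unique h2))
  simp only [ContinuousLinearMap.comp_apply, ContinuousLinearMap.inr_apply,
    smul_apply] at h4
  rw [h4, ContinuousLinearMap.intervalIntegral_apply]
  · have h5 := integral_eq_smul_unit (fun q : ℝ × Z => fderiv ℝ F q (0, ζ)) p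
    rw [h5]
    congr 1
    refine intervalIntegral.integral_congr fun σ _ => ?_
    have h6 : HasFDerivAt (fun q : ℝ × Z => (p.1 * q.1, q.2))
        (((p.1 • ContinuousLinearMap.fst ℝ ℝ Z)).prod (ContinuousLinearMap.snd ℝ ℝ Z)) (σ, p.2) :=
      (hasFDerivAt_fst.const_mul p.1).prodMk hasFDerivAt_snd
    have h7 := (HasFDerivAt.comp (f := fun q : ℝ × Z => (p.1 * q.1, q.2)) (σ, p.2)
      (hF.differentiable one_ne_zero (p.1 * σ, p.2)).hasFDerivAt h6).fderiv
    simp only [ContinuousLinearMap.comp_apply, ContinuousLinearMap.inr_apply]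
    erw [h7]
    simp
  · refine Continuous.intervalIntegrable ?_ _ _
    exact ((hF'.continuous_fderiv one_ne_zero).comp
      (by fun_prop : Continuous fun σ : ℝ => (σ, p.2))).clm_comp
      continuous_const

end ParametricIntegral

/-! ### Smooth dependence of ordered exponentials on parameters -/

section SmoothDependence

variable {VG : Type*} [NormedAddCommGroup VG] [NormedSpace ℝ VG]
  {G : Type*} [TopologicalSpace G] [ChartedSpace VG G] [Group G]
  {U : Type*} [NormedAddCommGroup U] [NormedSpace ℝ U]
  {X : Type*} [NormedAddCommGroup X] [NormedSpace ℝ X]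
  [LieGroup 𝓘(ℝ, VG) ∞ G]

/-- Bootstrapping: if the logarithmic derivative of `k` is as smooth as `k` is, then `k` is smooth.
-/
theorem contMDiff_of_hasLogDeriv {k : U → G} {α : U → U →L[ℝ] VG}
    (h : ∀ x, HasLogDeriv k x (α x))
    (hα : ∀ n : ℕ, ContMDiff 𝓘(ℝ, U) 𝓘(ℝ, VG) n k → ContDiff ℝ n α) :
    ContMDiff 𝓘(ℝ, U) 𝓘(ℝ, VG) ∞ k := by
  rw [contMDiff_infty]
  intro n
  induction n with
  | zero =>
    exact contMDiff_zero_iff.2 (continuous_iff_continuousAt.2 fun x => (h x).continuousAt)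
  | succ n ih => exact contMDiff_succ_of_hasLogDeriv h (hα n ih) ih

theorem contMDiff_of_hasLogVelocity {c : ℝ → G} {A : ℝ → VG} (hA : ContDiff ℝ ∞ A)
    (h : ∀ t, HasLogVelocity c t (A t)) : ContMDiff 𝓘(ℝ, ℝ) 𝓘(ℝ, VG) ∞ c := by
  refine contMDiff_of_hasLogDeriv h fun n _ => ?_
  exact ((ContinuousLinearMap.toSpanSingletonCLE (𝕜 := ℝ) (E := VG)).contDiff.comp
    (hA.of_le (by exact_mod_cast le_top)))

theorem contDiff_adj_comp {n : ℕ∞} {k : U → G} (hk : ContMDiff 𝓘(ℝ, U) 𝓘(ℝ, VG) n k) :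
    ContDiff ℝ n fun z => adj VG G (k z) :=
  contMDiff_iff_contDiff.1 ((contMDiff_adj.of_le (by exact_mod_cast le_top)).comp hk)

/-- The integrand of the variation of a family of solutions around the one with parameter `x₀`. -/
def variationIntegrand (l : ℝ × X → G) (a : ℝ × X → VG) (x₀ : X) (p : ℝ × X) : VG :=
  adj VG G (l (p.1, x₀)) (a p - a (p.1, x₀))

theorem contDiff_variationIntegrand {a : ℝ × X → VG} (ha : ContDiff ℝ ∞ a) {l : ℝ × X → G}
    (hl : ∀ t x, HasLogVelocity (fun τ => l (τ, x)) t (a (t, x))) (x₀ : X) :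
    ContDiff ℝ ∞ (variationIntegrand l a x₀) := by
  have hs : ContMDiff 𝓘(ℝ, ℝ) 𝓘(ℝ, VG) ∞ fun τ => l (τ, x₀) :=
    contMDiff_of_hasLogVelocity (ha.comp (by fun_prop : ContDiff ℝ ∞ fun t : ℝ => (t, x₀)))
      (fun t => hl t x₀)
  exact ((contDiff_adj_comp (n := ⊤) hs).comp contDiff_fst).clm_apply
    (ha.sub (ha.comp (by fun_prop : ContDiff ℝ ∞ fun p : ℝ × X => (p.1, x₀))))

variable [FiniteDimensional ℝ VG] [FiniteDimensional ℝ X]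

/-- A family of solutions is differentiable in the parameter. In the chart at `1` the quotient
`l(t,x) l(t,x₀)⁻¹` is, up to a quadratic error, the integral of `variationIntegrand`. -/
theorem hasLogDeriv_solution {a : ℝ × X → VG} (ha : ContDiff ℝ ∞ a) {l : ℝ × X → G}
    (h0 : ∀ x, l (0, x) = 1)
    (hl : ∀ t x, HasLogVelocity (fun τ => l (τ, x)) t (a (t, x))) (p : ℝ × X) :
    HasLogDeriv l p ((adj VG G (l p)⁻¹).comp (fderiv ℝ (fun q : ℝ × X =>
      ∫ τ in (0 : ℝ)..q.1, variationIntegrand l a p.2 (τ, q.2)) p) +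
      (ContinuousLinearMap.toSpanSingleton ℝ (a p)).comp (ContinuousLinearMap.fst ℝ ℝ X)) := by
  obtain ⟨t₀, x₀⟩ := p
  have : ProperSpace X := FiniteDimensional.proper ℝ X
  set F := variationIntegrand l a x₀ with hF
  have hFs : ContDiff ℝ ∞ F := contDiff_variationIntegrand ha hl x₀
  have hF0 : ∀ t, F (t, x₀) = 0 := fun t => by simp [F, variationIntegrand]
  set I : ℝ × X → VG := fun q => ∫ τ in (0 : ℝ)..q.1, F (τ, q.2) with hI
  have hI0 : ∀ t, I (t, x₀) = 0 := fun t => by simp [I, hF0]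
  -- `m` solves `m' = m F` with a coefficient `F` that vanishes for `x = x₀`; so for `x` near `x₀`
  -- it stays in the chart at `1` during all of `[-T,T]`, and the estimate in the chart applies
  let m : ℝ × X → G := fun q => l q * (l (q.1, x₀))⁻¹
  have hm : ∀ t x, HasLogVelocity (fun τ => m (τ, x)) t (F (t, x)) := by
    intro t x
    have := (hl t x).div (hl t x₀)
    unfold HasLogVelocity
    convert this using 1
    ext; simp [F, variationIntegrand]
  set T := |t₀| + 1 with hT
  have hT0 : 0 < T := by positivity
  obtain ⟨C, hC⟩ := (isCompact_Icc.prod (isCompact_closedBall x₀ 1) :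
    IsCompact (Icc (-T) T ×ˢ Metric.closedBall x₀ 1)).exists_bound_of_continuousOn
      (f := fun p => (fderiv ℝ F p).comp (ContinuousLinearMap.inr ℝ ℝ X))
      ((hFs.continuous_fderiv (by simp)).clm_comp continuous_const).continuousOn
  have hC0 : 0 ≤ C := (norm_nonneg _).trans (hC (0, x₀)
    ⟨⟨by linarith, hT0.le⟩, Metric.mem_closedBall_self zero_le_one⟩)
  have hFC : ∀ t ∈ Icc (-T) T, ∀ x ∈ Metric.closedBall x₀ 1, ‖F (t, x)‖ ≤ C * ‖x - x₀‖ := by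
    intro t ht x hx
    have := (convex_closedBall x₀ 1).norm_image_sub_le_of_norm_hasFDerivWithin_le (𝕜 := ℝ)
      (f := fun x => F (t, x))
      (fun x _ => (hasFDerivAt_partial_snd (p := (t, x))
        (hFs.differentiable (by simp) _)).hasFDerivWithinAt)
      (fun x hx => hC (t, x) ⟨ht, hx⟩) (Metric.mem_closedBall_self zero_le_one) hx
    rwa [hF0, sub_zero] at this
  obtain ⟨r, hr, D, hD⟩ := exists_chart_solution (VG := VG) G
  have key : ∀ᶠ q in 𝓝 (t₀, x₀), m q ∈ (chartAt VG (1 : G)).source ∧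
      ‖chartAt VG (1 : G) (m q) - chartAt VG (1 : G) 1 - I q‖
        ≤ (D * (C * T) ^ 2) * ‖q.2 - x₀‖ ^ 2 := by
    have e1 : ∀ᶠ q : ℝ × X in 𝓝 (t₀, x₀), q.1 ∈ Ioo (-T) T :=
      continuousAt_fst.preimage_mem_nhds (Ioo_mem_nhds
        (by linarith [neg_abs_le t₀]) (by linarith [le_abs_self t₀]))
    have e2 : ∀ᶠ q : ℝ × X in 𝓝 (t₀, x₀), ‖q.2 - x₀‖ < min 1 (r / (2 * C * T + 1)) := by
      have hc : ContinuousAt (fun q : ℝ × X => ‖q.2 - x₀‖) (t₀, x₀) := by fun_prop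
      refine hc.preimage_mem_nhds (Iio_mem_nhds ?_)
      simp only [sub_self, norm_zero]
      positivity
    filter_upwards [e1, e2] with q hq1 hq2
    obtain ⟨t, x⟩ := q
    have hx1 : x ∈ Metric.closedBall x₀ 1 := by
      rw [Metric.mem_closedBall, dist_eq_norm]; exact hq2.le.trans (min_le_left _ _)
    have hx2 : 2 * (C * ‖x - x₀‖) * T ≤ r := by
      have h1 : ‖x - x₀‖ ≤ r / (2 * C * T + 1) := hq2.le.trans (min_le_right _ _)
      calc 2 * (C * ‖x - x₀‖) * T = 2 * C * T * ‖x - x₀‖ := by ring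
        _ ≤ (2 * C * T + 1) * (r / (2 * C * T + 1)) := by gcongr; linarith
        _ = r := by field_simp
    obtain ⟨c, hc0, hc⟩ := hD T (C * ‖x - x₀‖) (fun τ => F (τ, x)) hT0 (by positivity)
      (hFs.continuous.comp (by fun_prop)) (fun τ hτ => hFC τ hτ x hx1) hx2
    have hmem : (0 : ℝ) ∈ Ioo (-T) T := ⟨by linarith, hT0⟩
    have hcm := eq_mul_of_hasLogVelocity isOpen_Ioo isPreconnected_Ioo
      (fun τ hτ => (hc τ hτ).1) (fun τ _ => hm τ x) hmem hq1
    have hm0 : m (0, x) = 1 := by simp [m, h0]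
    rw [hc0, hm0] at hcm
    have hcm' : c t = m (t, x) := by simpa using hcm
    rw [← hcm']
    refine ⟨(hc t hq1).2.1, (hc t hq1).2.2.trans_eq ?_⟩
    ring
  have hm1 : m (t₀, x₀) = 1 := by simp [m]
  have hR : HasFDerivAt (fun q => chartAt VG (1 : G) (m q) - chartAt VG (1 : G) 1 - I q)
      (0 : ℝ × X →L[ℝ] VG) (t₀, x₀) := by
    refine Asymptotics.IsBigO.hasFDerivAt (n := 2) ?_ (by norm_num)
    refine Asymptotics.IsBigO.of_bound (|D * (C * T) ^ 2|) ?_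
    filter_upwards [key] with q hq
    refine hq.2.trans ?_
    rw [norm_pow, norm_norm]
    have h1 : ‖q.2 - x₀‖ ≤ ‖q - (t₀, x₀)‖ := norm_snd_le (q - (t₀, x₀))
    calc D * (C * T) ^ 2 * ‖q.2 - x₀‖ ^ 2 ≤ |D * (C * T) ^ 2| * ‖q.2 - x₀‖ ^ 2 := by
          gcongr; exact le_abs_self _
      _ ≤ _ := by gcongr
  have hId : HasFDerivAt I (fderiv ℝ I (t₀, x₀)) (t₀, x₀) :=
    ((contDiff_integral hFs).differentiable (by simp) _).hasFDerivAt
  have hψ : HasFDerivAt (fun q => chartAt VG (1 : G) (m q)) (fderiv ℝ I (t₀, x₀)) (t₀, x₀) := by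
    have := (hR.add hId).add_const (chartAt VG (1 : G) 1)
    rw [zero_add] at this
    refine this.congr_of_eventuallyEq (Eventually.of_forall fun q => ?_)
    simp
  have hmd : HasLogDeriv m (t₀, x₀) (fderiv ℝ I (t₀, x₀)) := by
    have := hasLogDeriv_of_chart (G := G) (y := fun q => chartAt VG (1 : G) (m q))
      (α := fderiv ℝ I (t₀, x₀)) (x := (t₀, x₀))
      (by simp only [hm1]; rw [leftField_one, ContinuousLinearMap.id_comp]; exact hψ)
      (by simp only [hm1]; exact mem_chart_target VG (1 : G))
    refine this.congr ?_
    filter_upwards [key] with q hq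
    exact ((chartAt VG (1 : G)).left_inv hq.1).symm
  have h2 : HasLogDeriv (fun q : ℝ × X => l (q.1, x₀)) (t₀, x₀) _ :=
    HasLogDeriv.comp (k := fun τ => l (τ, x₀)) (f := fun q : ℝ × X => q.1) (x := (t₀, x₀))
      (hl t₀ x₀) hasFDerivAt_fst
  refine (hmd.mul h2).congr (Eventually.of_forall fun q => ?_)
  simp [m]

/-- Solutions of `l' = l a` depend smoothly on parameters. The parameter derivative is
`Ad_{l⁻¹} ∫ Ad_l ∂ₓa`, so it is as smooth as `l` is. -/
theorem contMDiff_solution {a : ℝ × X → VG} (ha : ContDiff ℝ ∞ a) {l : ℝ × X → G}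
    (h0 : ∀ x, l (0, x) = 1)
    (hl : ∀ t x, HasLogVelocity (fun τ => l (τ, x)) t (a (t, x))) :
    ContMDiff 𝓘(ℝ, ℝ × X) 𝓘(ℝ, VG) ∞ l := by
  have : CompleteSpace VG := FiniteDimensional.complete ℝ VG
  refine contMDiff_of_hasLogDeriv (hasLogDeriv_solution ha h0 hl) fun n hn => ?_
  rw [contDiff_clm_apply_iff]
  rintro ⟨τ, ξ⟩
  have hn' : ContMDiff 𝓘(ℝ, ℝ × X) 𝓘(ℝ, VG) n fun p => (l p)⁻¹ :=
    ((contMDiff_inv 𝓘(ℝ, VG) ∞).of_le (by exact_mod_cast le_top)).comp hn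
  have han : ContDiff ℝ n a := ha.of_le (by exact_mod_cast le_top)
  have hdan : ContDiff ℝ n (fderiv ℝ a) :=
    (ha.fderiv_right (m := ∞) (by simp)).of_le (by exact_mod_cast le_top)
  -- the derivative in a form that shows its smoothness; the base point of `variationIntegrand` is
  -- `p.2` and thus varies with `p`
  have e : (fun p : ℝ × X => ((adj VG G (l p)⁻¹).comp (fderiv ℝ (fun q : ℝ × X =>
      ∫ τ in (0 : ℝ)..q.1, variationIntegrand l a p.2 (τ, q.2)) p) +
      (ContinuousLinearMap.toSpanSingleton ℝ (a p)).comp (ContinuousLinearMap.fst ℝ ℝ X)) (τ, ξ)) =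
      fun p => adj VG G (l p)⁻¹ (∫ σ in (0 : ℝ)..p.1,
        adj VG G (l (σ, p.2)) (fderiv ℝ a (σ, p.2) (0, ξ))) + τ • a p := by
    funext p
    have hFs := contDiff_variationIntegrand ha hl p.2
    have e1 : ((τ, ξ) : ℝ × X) = τ • (1, 0) + (0, ξ) := by simp
    simp only [add_apply, ContinuousLinearMap.comp_apply,
      ContinuousLinearMap.coe_fst', ContinuousLinearMap.toSpanSingleton_apply]
    rw [e1, map_add, map_smul, fderiv_integral_fst (hFs.of_le (by simp)),
      fderiv_integral_snd (hFs.of_le (by simp))]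
    have e2 : variationIntegrand l a p.2 p = 0 := by simp [variationIntegrand]
    rw [e2, smul_zero, zero_add]
    congr 2
    refine intervalIntegral.integral_congr fun σ _ => ?_
    have h1 : HasFDerivAt (fun z => variationIntegrand l a p.2 (σ, z))
        ((adj VG G (l (σ, p.2))).comp
          ((fderiv ℝ a (σ, p.2)).comp (ContinuousLinearMap.inr ℝ ℝ X))) p.2 :=
      (adj VG G (l (σ, p.2))).hasFDerivAt.comp p.2
        ((hasFDerivAt_partial_snd (p := (σ, p.2)) (ha.differentiable (by simp) _)).sub_const
          (a (σ, p.2)))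
    have h2 := hasFDerivAt_partial_snd (p := (σ, p.2)) (hFs.differentiable (by simp) (σ, p.2))
    have := congrArg (fun L : X →L[ℝ] VG => L ξ) (h2.unique h1)
    simpa using this
  rw [e]
  refine ContDiff.add ((contDiff_adj_comp (n := n) hn').clm_apply ?_) (contDiff_const.smul han)
  exact contDiff_integral_nat (F := fun q : ℝ × X => adj VG G (l q) (fderiv ℝ a q (0, ξ)))
    ((contDiff_adj_comp (n := n) hn).clm_apply (hdan.clm_apply contDiff_const))

end SmoothDependence

/-! ### The bracket and the Maurer–Cartan equation -/

section Bracket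

variable {VG : Type*} [NormedAddCommGroup VG] [NormedSpace ℝ VG]
  {G : Type*} [TopologicalSpace G] [ChartedSpace VG G] [Group G]
  {U : Type*} [NormedAddCommGroup U] [NormedSpace ℝ U]
  [LieGroup 𝓘(ℝ, VG) ∞ G]

/-- The pullback of a left invariant vector field to the chart at `1`. -/
theorem mpullback_mulInvariantVectorField_chart (X : VG) {y : VG}
    (hy : y ∈ (chartAt VG (1 : G)).target) :
    (VectorField.mpullbackWithin 𝓘(ℝ, VG) 𝓘(ℝ, VG) (extChartAt 𝓘(ℝ, VG) (1 : G)).symm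
      (mulInvariantVectorField (I := 𝓘(ℝ, VG)) (G := G) X) (range 𝓘(ℝ, VG)) y : VG) =
      leftField VG G y X := by
  set ψ := chartAt VG (1 : G) with hψ
  have hs : ψ.symm y ∈ ψ.source := ψ.map_target hy
  have h1 : (tmap VG VG ψ.symm y).comp (tmap VG VG ψ (ψ.symm y)) =
      ContinuousLinearMap.id ℝ VG := by
    have := tmap_symm_comp_tmap_chartAt hs
    rwa [← hψ, ψ.right_inv hy] at this
  have h2 : (tmap VG VG ψ (ψ.symm y)).comp (tmap VG VG ψ.symm y) =
      ContinuousLinearMap.id ℝ VG := by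
    have h3 := (tDiff_chartAt hs).hasTDeriv.comp (tDiff_chartAt_symm hy).hasTDeriv rfl
    refine h3.unique ((hasTDeriv_id (V := VG) y).congr ?_)
    filter_upwards [ψ.open_target.mem_nhds hy] with z hz
    exact ψ.right_inv hz
  have h3 : leftField VG G y = (tmap VG VG ψ (ψ.symm y)).comp
      (tmap VG VG (fun h : G => ψ.symm y * h) 1) := by
    refine (hasTDeriv_leftField hy).unique ?_
    exact (tDiff_chartAt hs).hasTDeriv.comp (tDiff_const_mul (ψ.symm y) 1).hasTDeriv (mul_one _)
  have h4 : (mfderivWithin 𝓘(ℝ, VG) 𝓘(ℝ, VG) (extChartAt 𝓘(ℝ, VG) (1 : G)).symm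
      (range 𝓘(ℝ, VG)) y : VG →L[ℝ] VG) = tmap VG VG ψ.symm y := by
    have : range 𝓘(ℝ, VG) = univ := by simp
    rw [this, mfderivWithin_univ]
    rfl
  have h5 : (tmap VG VG ψ.symm y).inverse = tmap VG VG ψ (ψ.symm y) :=
    ContinuousLinearMap.inverse_eq h1 h2
  rw [VectorField.mpullbackWithin_apply]
  refine Eq.trans (congrArg (fun L : VG →L[ℝ] VG => L.inverse
    (tmap VG VG (fun h : G => ψ.symm y * h) 1 X)) h4) ?_
  rw [h3]
  exact congrArg (fun L : VG →L[ℝ] VG => L (tmap VG VG (fun h : G => ψ.symm y * h) 1 X)) h5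

/-- The bracket of the Lie algebra in terms of the left invariant vector fields in the chart
at `1`. -/
theorem lieBr_eq (X Y : VG) : lieBr VG G X Y =
    fderiv ℝ (leftField VG G) (chartAt VG (1 : G) 1) X Y -
      fderiv ℝ (leftField VG G) (chartAt VG (1 : G) 1) Y X := by
  set ψ := chartAt VG (1 : G) with hψ
  have hd : DifferentiableAt ℝ (leftField VG G) (ψ 1) :=
    (contDiffAt_leftField (mem_chart_target VG (1 : G))).differentiableAt (by simp)
  have hf : ∀ Y : VG, (fun y => (VectorField.mpullbackWithin 𝓘(ℝ, VG) 𝓘(ℝ, VG)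
      (extChartAt 𝓘(ℝ, VG) (1 : G)).symm
      (mulInvariantVectorField (I := 𝓘(ℝ, VG)) (G := G) Y) (range 𝓘(ℝ, VG)) y : VG)) =ᶠ[𝓝 (ψ 1)]
      fun y => leftField VG G y Y := by
    intro Y
    filter_upwards [ψ.open_target.mem_nhds (mem_chart_target VG (1 : G))] with y hy
    exact mpullback_mulInvariantVectorField_chart Y hy
  have e : (extChartAt 𝓘(ℝ, VG) (1 : G)) 1 = ψ 1 := rfl
  have hid : ((mfderiv 𝓘(ℝ, VG) 𝓘(ℝ, VG) (extChartAt 𝓘(ℝ, VG) (1 : G)) 1 : VG →L[ℝ] VG)) =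
      ContinuousLinearMap.id ℝ VG := tmap_chartAt_self (1 : G)
  have hb : ∀ V W : VG → VG, V =ᶠ[𝓝 (ψ 1)] (fun y => leftField VG G y X) →
      W =ᶠ[𝓝 (ψ 1)] (fun y => leftField VG G y Y) →
      VectorField.lieBracketWithin ℝ V W ((extChartAt 𝓘(ℝ, VG) (1 : G)).symm ⁻¹' univ ∩
        range 𝓘(ℝ, VG)) (ψ 1) = fderiv ℝ (leftField VG G) (ψ 1) X Y -
      fderiv ℝ (leftField VG G) (ψ 1) Y X := by
    intro V W hV hW
    have e1 : ((extChartAt 𝓘(ℝ, VG) (1 : G)).symm ⁻¹' univ ∩ range 𝓘(ℝ, VG)) = univ := by simp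
    rw [e1, VectorField.lieBracketWithin_univ, VectorField.lieBracket_eq]
    dsimp only
    rw [hV.fderiv_eq, hW.fderiv_eq, hV.self_of_nhds, hW.self_of_nhds, fderiv_clm_apply hd
      (differentiableAt_const _), fderiv_clm_apply hd (differentiableAt_const _)]
    simp [leftField_one, hψ]
  refine Eq.trans ?_ (hb _ _ (hf X) (hf Y))
  change (VectorField.mlieBracketWithin 𝓘(ℝ, VG)
    (mulInvariantVectorField (I := 𝓘(ℝ, VG)) (G := G) X)
    (mulInvariantVectorField (I := 𝓘(ℝ, VG)) (G := G) Y) univ (1 : G) : VG) = _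
  rw [VectorField.mlieBracketWithin_apply]
  refine Eq.trans (congrArg (fun L : VG →L[ℝ] VG => L.inverse _) hid) ?_
  rw [ContinuousLinearMap.inverse_id]
  rfl

theorem lieBr_antisymm (X Y : VG) : lieBr VG G Y X = -lieBr VG G X Y := by
  rw [lieBr_eq, lieBr_eq]; abel

/-- The Maurer–Cartan equation. -/
theorem maurerCartan {k : U → G} (hk : ContMDiff 𝓘(ℝ, U) 𝓘(ℝ, VG) ∞ k) (x v w : U) :
    fderiv ℝ (fun z => logDeriv VG k z w) x v - fderiv ℝ (fun z => logDeriv VG k z v) x w =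
      -lieBr VG G (logDeriv VG k x v) (logDeriv VG k x w) := by
  set l : U → G := fun z => (k x)⁻¹ * k z with hl
  have hlx : l x = 1 := by simp [l]
  have hkd : ∀ z, HasLogDeriv k z (logDeriv VG k z) := fun z =>
    TDiff.hasLogDeriv (tDiff_of_contMDiffAt hk.contMDiffAt (by simp))
  have hld : ∀ z, HasLogDeriv l z (logDeriv VG k z) := fun z => (hkd z).const_mul _
  have hs : ∀ᶠ z in 𝓝 x, l z ∈ (chartAt VG (1 : G)).source :=
    (hld x).continuousAt.preimage_mem_nhds ((chartAt VG (1 : G)).open_source.mem_nhds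
      (by rw [hlx]; exact mem_chart_source VG 1))
  have hα : DifferentiableAt ℝ (logDeriv VG k) x :=
    (contDiff_logDeriv hk).differentiable (by simp) x
  have h1 : ∀ᶠ z in 𝓝 x, HasFDerivAt (fun z => chartAt VG (1 : G) (l z))
      ((leftField VG G (chartAt VG (1 : G) (l z))).comp (logDeriv VG k z)) z := by
    filter_upwards [hs] with z hz
    exact (hld z).hasFDerivAt_chart hz
  have h0 := h1.self_of_nhds
  have hL : DifferentiableAt ℝ (leftField VG G) (chartAt VG (1 : G) (l x)) :=
    (contDiffAt_leftField ((chartAt VG (1 : G)).map_source hs.self_of_nhds)).differentiableAt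
      (by simp)
  have h2 := (hL.hasFDerivAt.comp x h0).clm_comp hα.hasFDerivAt
  -- In the chart at `1` the derivative of `l` is `leftField ∘ k⁻¹dk`; the symmetry of its
  -- derivative is the claim, by the formula for the bracket.
  have h3 := second_derivative_symmetric_of_eventually h1 h2 v w
  have ev : ∀ v w, fderiv ℝ (fun z => logDeriv VG k z w) x v = fderiv ℝ (logDeriv VG k) x v w := by
    intro v w
    rw [fderiv_clm_apply hα (differentiableAt_const _)]
    simp
  rw [ev, ev, lieBr_eq]
  simp only [Function.comp_apply, hlx, leftField_one, ContinuousLinearMap.id_comp,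
    add_apply, ContinuousLinearMap.comp_apply,
    ContinuousLinearMap.compL_apply, ContinuousLinearMap.flip_apply] at h3
  rw [← sub_eq_zero] at h3 ⊢
  rw [← h3]
  abel

end Bracket

/-! ### Representations on vector spaces -/

section Representation

variable {VG : Type*} [NormedAddCommGroup VG] [NormedSpace ℝ VG]
  {G : Type*} [TopologicalSpace G] [ChartedSpace VG G] [Group G]
  {U : Type*} [NormedAddCommGroup U] [NormedSpace ℝ U]
  {W : Type*} [NormedAddCommGroup W] [NormedSpace ℝ W]

/-- The derivative of a representation along a map to the group. -/
theorem HasLogDeriv.hasFDerivAt_rep {ρ : G → W →L[ℝ] W} (hρ : ∀ g h, ρ (g * h) = (ρ g).comp (ρ h))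
    (hd : TDiff VG (W →L[ℝ] W) ρ 1) {k : U → G} {x : U} {α : U →L[ℝ] VG} (hk : HasLogDeriv k x α) :
    HasFDerivAt (fun z => ρ (k z)) ((ContinuousLinearMap.compL ℝ W W W (ρ (k x))).comp
      ((tmap VG (W →L[ℝ] W) ρ 1).comp α)) x := by
  have h1 := hd.hasTDeriv.comp hk (by simp)
  have h2 := (ContinuousLinearMap.compL ℝ W W W (ρ (k x))).hasFDerivAt.comp x
    (hasTDeriv_iff_hasFDerivAt.1 h1)
  refine h2.congr_of_eventuallyEq (Eventually.of_forall fun z => ?_)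
  simp only [Function.comp_apply, ContinuousLinearMap.compL_apply]
  rw [← hρ, mul_inv_cancel_left]

/-- The product rule `d(ρ(k) w) = ρ(k) (dρ(k⁻¹dk) w + dw)`. -/
theorem HasLogDeriv.fderiv_rep_apply {ρ : G → W →L[ℝ] W}
    (hρ : ∀ g h, ρ (g * h) = (ρ g).comp (ρ h))
    (hd : TDiff VG (W →L[ℝ] W) ρ 1) {k : U → G} {x : U} {α : U →L[ℝ] VG} (hk : HasLogDeriv k x α)
    {w : U → W} (hw : DifferentiableAt ℝ w x) (v : U) :
    fderiv ℝ (fun z => ρ (k z) (w z)) x v =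
      ρ (k x) (tmap VG (W →L[ℝ] W) ρ 1 (α v) (w x) + fderiv ℝ w x v) := by
  rw [((hk.hasFDerivAt_rep hρ hd).clm_apply hw.hasFDerivAt).fderiv]
  simp [add_comm]

variable [LieGroup 𝓘(ℝ, VG) ∞ G]

/-- `ρ(g) dρ(X) = dρ(Ad_g X) ρ(g)`. -/
theorem rep_deriv_adj {ρ : G → W →L[ℝ] W} (hρ : ∀ g h, ρ (g * h) = (ρ g).comp (ρ h))
    (hd : TDiff VG (W →L[ℝ] W) ρ 1) (g : G) (X : VG) (w : W) :
    ρ g (tmap VG (W →L[ℝ] W) ρ 1 X w) = tmap VG (W →L[ℝ] W) ρ 1 (adj VG G g X) (ρ g w) := by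
  have h1 : HasTDeriv (fun h => ρ (g * h * g⁻¹)) (1 : G)
      ((tmap VG (W →L[ℝ] W) ρ 1).comp (adj VG G g)) :=
    hd.hasTDeriv.comp (tDiff_conj g (1 : G)).hasTDeriv (by simp)
  have h2 : HasTDeriv (fun A : W →L[ℝ] W => ((ρ g).comp A).comp (ρ g⁻¹)) (ρ 1) _ :=
    hasTDeriv_iff_hasFDerivAt.2 (((ContinuousLinearMap.compL ℝ W W W).flip (ρ g⁻¹)).comp
      (ContinuousLinearMap.compL ℝ W W W (ρ g))).hasFDerivAt
  have h3 := h2.comp hd.hasTDeriv rfl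
  have e : (fun h => ρ (g * h * g⁻¹)) = fun h => ((ρ g).comp (ρ h)).comp (ρ g⁻¹) := by
    funext h; rw [hρ, hρ]
  rw [e] at h1
  have h4 := congrArg (fun L : VG →L[ℝ] W →L[ℝ] W => L X (ρ g w)) (h1.unique h3)
  have h5 : ρ g⁻¹ (ρ g w) = ρ 1 w := by
    rw [← ContinuousLinearMap.comp_apply, ← hρ, inv_mul_cancel]
  have h6 : tmap VG (W →L[ℝ] W) ρ 1 X (ρ 1 w) = tmap VG (W →L[ℝ] W) ρ 1 X w := by
    have h7 : HasTDeriv (fun A : W →L[ℝ] W => A.comp (ρ 1)) (ρ 1) _ :=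
      hasTDeriv_iff_hasFDerivAt.2
        ((ContinuousLinearMap.compL ℝ W W W).flip (ρ 1)).hasFDerivAt
    have h8 := h7.comp hd.hasTDeriv rfl
    have e : (fun h => (ρ h).comp (ρ 1)) = ρ := by
      funext h; rw [← hρ, mul_one]
    rw [e] at h8
    have := congrArg (fun L : VG →L[ℝ] W →L[ℝ] W => L X w) (h8.unique hd.hasTDeriv)
    simpa using this
  simp only [ContinuousLinearMap.comp_apply, ContinuousLinearMap.flip_apply,
    ContinuousLinearMap.compL_apply] at h4
  rw [h5, h6] at h4
  exact h4.symm

theorem tDiff_adj : TDiff VG (VG →L[ℝ] VG) (adj VG G) 1 :=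
  tDiff_of_contMDiffAt contMDiff_adj.contMDiffAt (by simp)

variable (VG G) in
/-- The adjoint representation of the Lie algebra of `G`, as a bilinear map of the model space. -/
def adInf : VG →L[ℝ] VG →L[ℝ] VG := tmap VG (VG →L[ℝ] VG) (adj VG G) 1

variable [FiniteDimensional ℝ VG]

/-- The derivative of the adjoint representation is the bracket. -/
theorem adInf_eq_lieBr (X Y : VG) : adInf VG G X Y = lieBr VG G X Y := by
  unfold adInf
  -- apply the Maurer–Cartan equation to `k(x,y) = exp(xY) exp(yX)`, whose logarithmic derivative
  -- has the coefficients `Ad_{exp(-yX)} Y` and `X`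
  obtain ⟨c, hc⟩ := exists_isOrderedExp (G := G) (A := fun _ => Y) continuous_const
  obtain ⟨d, hd⟩ := exists_isOrderedExp (G := G) (A := fun _ => X) continuous_const
  rw [isOrderedExp_iff] at hc hd
  have hcs := contMDiff_of_hasLogVelocity contDiff_const hc.2
  have hds := contMDiff_of_hasLogVelocity contDiff_const hd.2
  set k : ℝ × ℝ → G := fun p => c p.1 * d p.2 with hk
  have hks : ContMDiff 𝓘(ℝ, ℝ × ℝ) 𝓘(ℝ, VG) ∞ k :=
    (hcs.comp (contDiff_fst (𝕜 := ℝ) (E := ℝ) (F := ℝ)).contMDiff).mul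
      (hds.comp (contDiff_snd (𝕜 := ℝ) (E := ℝ) (F := ℝ)).contMDiff)
  have hkd : ∀ p : ℝ × ℝ, HasLogDeriv k p _ := fun p =>
    (HasLogDeriv.comp (k := c) (f := fun p : ℝ × ℝ => p.1) (hc.2 p.1) hasFDerivAt_fst).mul
      (HasLogDeriv.comp (k := d) (f := fun p : ℝ × ℝ => p.2) (hd.2 p.2) hasFDerivAt_snd)
  have e1 : (fun p => logDeriv VG k p (1, 0)) = fun p => adj VG G (d p.2)⁻¹ Y := by
    funext p; rw [(hkd p).logDeriv_eq]; simp
  have e2 : (fun p => logDeriv VG k p (0, 1)) = fun p => X := by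
    funext p; rw [(hkd p).logDeriv_eq]; simp
  have h1 := maurerCartan hks (0, 0) (1, 0) (0, 1)
  rw [congrFun e1 (0, 0), congrFun e2 (0, 0), e1, e2] at h1
  have h2 := (HasLogDeriv.comp (k := d) (f := fun p : ℝ × ℝ => p.2) (x := (0, 0)) (hd.2 0)
    hasFDerivAt_snd).inv.fderiv_rep_apply (ρ := adj VG G) adj_mul tDiff_adj
    (w := fun _ => Y) (differentiableAt_const _) (0, 1)
  rw [h2] at h1
  have h0 : HasFDerivAt (fun _ : ℝ × ℝ => X) (0 : ℝ × ℝ →L[ℝ] VG) (0, 0) := hasFDerivAt_const _ _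
  rw [h0.fderiv] at h1
  simp [hd.1, adj_one] at h1
  rw [h1, lieBr_antisymm, neg_neg]

theorem adInf_antisymm (X Y : VG) : adInf VG G Y X = -adInf VG G X Y := by
  rw [adInf_eq_lieBr, adInf_eq_lieBr, lieBr_antisymm]

theorem fderiv_logDeriv_comm {k : U → G} (hk : ContMDiff 𝓘(ℝ, U) 𝓘(ℝ, VG) ∞ k) (x v w : U) :
    fderiv ℝ (fun z => logDeriv VG k z w) x v = fderiv ℝ (fun z => logDeriv VG k z v) x w -
      adInf VG G (logDeriv VG k x v) (logDeriv VG k x w) := by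
  rw [adInf_eq_lieBr, sub_eq_add_neg, ← maurerCartan hk]
  abel

/-- The covariant derivative of a connection along a map to the group: the variation of
`Ad_k(b_w - (k⁻¹dk)_w)` in direction `v` is a curvature. -/
theorem fderiv_adj_sub_logDeriv {k : U → G} (hk : ContMDiff 𝓘(ℝ, U) 𝓘(ℝ, VG) ∞ k) {b : U → VG}
    {x : U} (hb : DifferentiableAt ℝ b x) (v w : U) :
    fderiv ℝ (fun z => adj VG G (k z) (b z - logDeriv VG k z w)) x v =
      adj VG G (k x) (adInf VG G (logDeriv VG k x v) (b x) + fderiv ℝ b x v -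
        fderiv ℝ (fun z => logDeriv VG k z v) x w) := by
  have hld : HasLogDeriv k x (logDeriv VG k x) :=
    TDiff.hasLogDeriv (tDiff_of_contMDiffAt hk.contMDiffAt (by simp))
  have hlw : DifferentiableAt ℝ (fun z => logDeriv VG k z w) x :=
    ((contDiff_logDeriv hk).clm_apply contDiff_const).differentiable (by simp) x
  have h0 : DifferentiableAt ℝ (fun z => b z - logDeriv VG k z w) x := hb.sub hlw
  rw [hld.fderiv_rep_apply (ρ := adj VG G) adj_mul tDiff_adj h0, fderiv_fun_sub hb hlw]
  change adj VG G (k x) (adInf VG G (logDeriv VG k x v) (b x - logDeriv VG k x w) + _) = _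
  rw [sub_apply, fderiv_logDeriv_comm hk x v w, map_sub]
  congr 1
  abel

end Representation

/-! ### Infinitesimal crossed modules -/

section Infinitesimal

variable {VG : Type*} [NormedAddCommGroup VG] [NormedSpace ℝ VG]
  {G : Type*} [TopologicalSpace G] [ChartedSpace VG G] [Group G]
  {VE : Type*} [NormedAddCommGroup VE] [NormedSpace ℝ VE]
  {E : Type*} [TopologicalSpace E] [ChartedSpace VE E] [Group E]

namespace LieCrossedModule

variable (𝒢 : LieCrossedModule VG G VE E)

theorem tDiff_bd (e : E) : TDiff VE VG 𝒢.bd e :=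
  tDiff_of_contMDiffAt 𝒢.bd_smooth.contMDiffAt (by simp)

theorem contMDiff_act (g : G) : ContMDiff 𝓘(ℝ, VE) 𝓘(ℝ, VE) ∞ (fun e : E => 𝒢.act g e) :=
  𝒢.act_smooth.comp (contMDiff_const.prodMk contMDiff_id)

theorem tDiff_act (g : G) (e : E) : TDiff VE VE (fun e : E => 𝒢.act g e) e :=
  tDiff_of_contMDiffAt (𝒢.contMDiff_act g).contMDiffAt (by simp)

theorem actLie_one : 𝒢.actLie 1 = ContinuousLinearMap.id ℝ VE := by
  have e : (fun z => 𝒢.act 1 z) = fun z => z := by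
    funext z; simp
  unfold actLie
  rw [e]
  exact (hasTDeriv_id (V := VE) (1 : E)).tmap_eq

/-- The infinitesimal action of the Lie algebra of `G` on that of `E`. -/
def actInf (X : VG) : VE →L[ℝ] VE := tmap VG (VE →L[ℝ] VE) 𝒢.actLie 1 X

theorem actInf_add (X Y : VG) : 𝒢.actInf (X + Y) = 𝒢.actInf X + 𝒢.actInf Y := map_add _ _ _
theorem actInf_sub (X Y : VG) : 𝒢.actInf (X - Y) = 𝒢.actInf X - 𝒢.actInf Y := map_sub _ _ _
theorem actInf_smul (r : ℝ) (X : VG) : 𝒢.actInf (r • X) = r • 𝒢.actInf X := map_smul _ _ _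

theorem actLie_bd (e : E) : 𝒢.actLie (𝒢.bd e) = adj VE E e := by
  have h : (fun f => 𝒢.act (𝒢.bd e) f) = fun f => e * f * e⁻¹ := funext (𝒢.peiffer e)
  unfold actLie adj
  rw [h]

variable [LieGroup 𝓘(ℝ, VG) ∞ G] [LieGroup 𝓘(ℝ, VE) ∞ E]

theorem tDiff_actLie : TDiff VG (VE →L[ℝ] VE) 𝒢.actLie 1 :=
  tDiff_of_contMDiffAt 𝒢.contMDiff_actLie.contMDiffAt (by simp)

theorem actLie_mul (g h : G) : 𝒢.actLie (g * h) = (𝒢.actLie g).comp (𝒢.actLie h) := by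
  have h1 := (𝒢.tDiff_act g 1).hasTDeriv.comp (𝒢.tDiff_act h 1).hasTDeriv (by simp)
  have e : (fun z => 𝒢.act g (𝒢.act h z)) = fun z => 𝒢.act (g * h) z := by
    funext z; rw [map_mul]; rfl
  rw [e] at h1
  exact h1.tmap_eq

theorem actLie_actInf (g : G) (X : VG) (v : VE) :
    𝒢.actLie g (𝒢.actInf X v) = 𝒢.actInf (adj VG G g X) (𝒢.actLie g v) :=
  rep_deriv_adj 𝒢.actLie_mul 𝒢.tDiff_actLie g X v

theorem bdLie_actLie (g : G) (v : VE) : 𝒢.bdLie (𝒢.actLie g v) = adj VG G g (𝒢.bdLie v) := by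
  have h1 := (𝒢.tDiff_bd 1).hasTDeriv.comp (𝒢.tDiff_act g 1).hasTDeriv (by simp)
  have h2 := (tDiff_conj g (1 : G)).hasTDeriv.comp (𝒢.tDiff_bd 1).hasTDeriv (by simp)
  have e : (fun f => 𝒢.bd (𝒢.act g f)) = fun f => g * 𝒢.bd f * g⁻¹ := funext (𝒢.bd_act g)
  rw [e] at h1
  exact congrArg (fun L : VE →L[ℝ] VG => L v) (h1.unique h2)

/-- The infinitesimal Peiffer identity. -/
theorem actInf_bdLie (η v : VE) :
    𝒢.actInf (𝒢.bdLie η) v = adInf VE E η v := by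
  have h1 : HasTDeriv (fun e : E => 𝒢.actLie (𝒢.bd e)) 1 _ :=
    𝒢.tDiff_actLie.hasTDeriv.comp (𝒢.tDiff_bd 1).hasTDeriv (by simp)
  rw [funext 𝒢.actLie_bd] at h1
  exact congrArg (fun L : VE →L[ℝ] VE →L[ℝ] VE => L η v) (h1.tmap_eq.symm)

end LieCrossedModule

end Infinitesimal

/-! ### Pullbacks of differential forms -/

section Pullback

variable {V : Type*} [NormedAddCommGroup V] [NormedSpace ℝ V]
  {W : Type*} [NormedAddCommGroup W] [NormedSpace ℝ W]
  {N : Type*} [TopologicalSpace N] [ChartedSpace V N]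
  {U : Type*} [NormedAddCommGroup U] [NormedSpace ℝ U] {n : ℕ}

theorem ContDiffAt.continuousAlternatingMap_apply {n : ℕ} {m : WithTop ℕ∞} {z₀ : U}
    {g : U → V [⋀^Fin n]→L[ℝ] W} (hg : ContDiffAt ℝ m g z₀) {h : Fin n → U → V}
    (hh : ∀ i, ContDiffAt ℝ m (h i) z₀) : ContDiffAt ℝ m (fun z => g z fun i => h i z) z₀ := by
  induction n with
  | zero =>
    have h1 :=
      (ContinuousAlternatingMap.constOfIsEmptyLIE ℝ V W (Fin 0)).symm.contDiff.contDiffAt.comp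
      z₀ hg
    refine h1.congr_of_eventuallyEq (Eventually.of_forall fun z => ?_)
    exact congrArg (g z) (Subsingleton.elim _ _)
  | succ n ih =>
    have hL : IsBoundedLinearMap ℝ (fun f : V [⋀^Fin (n + 1)]→L[ℝ] W => f.curryLeft) :=
      ⟨⟨fun _ _ => rfl, fun _ _ => rfl⟩, 1, one_pos, fun f => by rw [f.norm_curryLeft, one_mul]⟩
    have h1 : ContDiffAt ℝ m (fun z => (g z).curryLeft) z₀ :=
      ContDiffAt.comp (g := fun f : V [⋀^Fin (n + 1)]→L[ℝ] W => f.curryLeft) z₀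
        hL.contDiff.contDiffAt hg
    have h2 := ih (h1.clm_apply (hh 0)) (h := fun i => h i.succ) (fun i => hh i.succ)
    refine h2.congr_of_eventuallyEq (Eventually.of_forall fun z => ?_)
    dsimp only
    rw [ContinuousAlternatingMap.curryLeft_apply_apply]
    congr 1
    funext i
    refine Fin.cases rfl (fun i => rfl) i

/-- The pullback of a form along a map from a vector space. -/
def DiffForm.pullback (α : DiffForm V W N n) (f : U → N) (z : U) : U [⋀^Fin n]→L[ℝ] W :=
  (α (f z)).compContinuousLinearMap (tmap U V f z)

theorem DiffForm.pullback_apply (α : DiffForm V W N n) (f : U → N) (z : U) (v : Fin n → U) :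
    α.pullback f z v = α (f z) fun i => tmap U V f z (v i) := rfl

theorem DiffForm.pullback_one (α : DiffForm V W N 1) (f : U → N) (z v : U) :
    α.pullback f z ![v] = α (f z) ![tmap U V f z v] := by
  rw [pullback_apply]
  congr 1
  funext i; fin_cases i; rfl

theorem DiffForm.pullback_two (α : DiffForm V W N 2) (f : U → N) (z v w : U) :
    α.pullback f z ![v, w] = α (f z) ![tmap U V f z v, tmap U V f z w] := by
  rw [pullback_apply]
  congr 1
  funext i; fin_cases i <;> rfl

variable [IsManifold 𝓘(ℝ, V) ∞ N]

/-- Near `z₀`, the pullback of a form along `f` is the pullback of its expression in the chart at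
`f z₀`. -/
theorem DiffForm.pullback_eventuallyEq (α : DiffForm V W N n) {f : U → N}
    (hf : ContMDiff 𝓘(ℝ, U) 𝓘(ℝ, V) ∞ f) (z₀ : U) :
    α.pullback f =ᶠ[𝓝 z₀] fun z =>
      (α.inChart (f z₀) (chartAt V (f z₀) (f z))).compContinuousLinearMap
        (fderiv ℝ (fun z => chartAt V (f z₀) (f z)) z) := by
  have hs : ∀ᶠ z in 𝓝 z₀, f z ∈ (chartAt V (f z₀)).source :=
    hf.continuous.continuousAt.preimage_mem_nhds
      ((chartAt V (f z₀)).open_source.mem_nhds (mem_chart_source V (f z₀)))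
  filter_upwards [hs] with z hz
  have h1 : TDiff U V f z := tDiff_of_contMDiffAt hf.contMDiffAt (by simp)
  have h2 := (tDiff_chartAt hz).hasTDeriv.comp h1.hasTDeriv rfl
  have h3 := (tDiff_chartAt_symm ((chartAt V (f z₀)).map_source hz)).hasTDeriv.comp h2 rfl
  have h4 : tmap U V f z = _ := (h3.congr (g := f) (by
    filter_upwards [hf.continuous.continuousAt.preimage_mem_nhds
      ((chartAt V (f z₀)).open_source.mem_nhds hz)] with y hy
    exact ((chartAt V (f z₀)).left_inv hy).symm)).tmap_eq
  unfold DiffForm.pullback DiffForm.inChart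
  rw [h4, (chartAt V (f z₀)).left_inv hz, (hasTDeriv_iff_hasFDerivAt.1 h2).fderiv]
  rfl

theorem contDiffAt_chart_comp {f : U → N} (hf : ContMDiff 𝓘(ℝ, U) 𝓘(ℝ, V) ∞ f) (z₀ : U) :
    ContDiffAt ℝ ∞ (fun z => chartAt V (f z₀) (f z)) z₀ := by
  rw [← contMDiffAt_iff_contDiffAt]
  exact (contMDiffAt_chartAt (mem_chart_source V (f z₀))).comp z₀ hf.contMDiffAt

theorem DiffForm.Smooth.contDiffAt_inChart {α : DiffForm V W N n} (hα : α.Smooth) (p : N) :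
    ContDiffAt ℝ ∞ (α.inChart p) (chartAt V p p) :=
  (hα p).contDiffAt ((chartAt V p).open_target.mem_nhds (mem_chart_target V p))

theorem DiffForm.Smooth.contDiff_pullback_apply {α : DiffForm V W N n} (hα : α.Smooth) {f : U → N}
    (hf : ContMDiff 𝓘(ℝ, U) 𝓘(ℝ, V) ∞ f) (v : Fin n → U) :
    ContDiff ℝ ∞ fun z => α.pullback f z v := by
  rw [contDiff_iff_contDiffAt]
  intro z₀
  have hc := contDiffAt_chart_comp hf z₀
  have h1 : ContDiffAt ℝ ∞ (fun z => α.inChart (f z₀) (chartAt V (f z₀) (f z))) z₀ :=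
    ContDiffAt.comp (g := α.inChart (f z₀)) z₀ (hα.contDiffAt_inChart (f z₀)) hc
  have h2 : ContDiffAt ℝ ∞ (fderiv ℝ (fun z => chartAt V (f z₀) (f z))) z₀ :=
    hc.fderiv_right (m := ∞) (by simp)
  refine (ContDiffAt.continuousAlternatingMap_apply h1
    (h := fun i z => fderiv ℝ (fun z => chartAt V (f z₀) (f z)) z (v i))
    (fun i => h2.clm_apply contDiffAt_const)).congr_of_eventuallyEq ?_
  filter_upwards [α.pullback_eventuallyEq hf z₀] with z hz
  rw [hz]
  rfl

theorem DiffForm.Smooth.differentiableAt_pullback {α : DiffForm V W N n} (hα : α.Smooth)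
    {f : U → N} (hf : ContMDiff 𝓘(ℝ, U) 𝓘(ℝ, V) ∞ f) (z₀ : U) :
    DifferentiableAt ℝ (α.pullback f) z₀ := by
  have hc := contDiffAt_chart_comp hf z₀
  have h1 : ContDiffAt ℝ ∞ (fun z => α.inChart (f z₀) (chartAt V (f z₀) (f z))) z₀ :=
    ContDiffAt.comp (g := α.inChart (f z₀)) z₀ (hα.contDiffAt_inChart (f z₀)) hc
  have h2 : ContDiffAt ℝ ∞ (fderiv ℝ (fun z => chartAt V (f z₀) (f z))) z₀ :=
    hc.fderiv_right (m := ∞) (by simp)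
  exact ((h1.differentiableAt (by simp)).continuousAlternatingMapCompContinuousLinearMap
    (h2.differentiableAt (by simp))).congr_of_eventuallyEq (α.pullback_eventuallyEq hf z₀)

/-- Naturality of the exterior derivative. -/
theorem DiffForm.Smooth.extDeriv_pullback {α : DiffForm V W N n} (hα : α.Smooth)
    {f : U → N} (hf : ContMDiff 𝓘(ℝ, U) 𝓘(ℝ, V) ∞ f) (z₀ : U) :
    extDeriv (α.pullback f) z₀ = (α.d (f z₀)).compContinuousLinearMap (tmap U V f z₀) := by
  have hc := contDiffAt_chart_comp hf z₀
  have h1 : TDiff U V f z₀ := tDiff_of_contMDiffAt hf.contMDiffAt (by simp)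
  have h2 := (tDiff_chartAt (mem_chart_source V (f z₀))).hasTDeriv.comp h1.hasTDeriv rfl
  rw [(α.pullback_eventuallyEq hf z₀).extDeriv_eq, _root_.extDeriv_pullback (r := ∞)
    (f := fun z => chartAt V (f z₀) (f z))
    (DifferentiableAt.congr_of_eventuallyEq
      ((hα.contDiffAt_inChart (f z₀)).differentiableAt (by simp)) EventuallyEq.rfl) hc
      (by rw [minSmoothness_of_isRCLikeNormedField]; exact WithTop.coe_le_coe.2 le_top),
    (hasTDeriv_iff_hasFDerivAt.1 h2).fderiv]
  rfl

/-- The exterior derivative of a 1-form on the images of the constant vector fields `v`, `w`. -/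
theorem DiffForm.Smooth.d_apply_two {α : DiffForm V W N 1} (hα : α.Smooth)
    {f : U → N} (hf : ContMDiff 𝓘(ℝ, U) 𝓘(ℝ, V) ∞ f) (z v w : U) :
    α.d (f z) ![tmap U V f z v, tmap U V f z w] =
      fderiv ℝ (fun z => α (f z) ![tmap U V f z w]) z v -
        fderiv ℝ (fun z => α (f z) ![tmap U V f z v]) z w := by
  have h1 := congrArg (fun β : U [⋀^Fin 2]→L[ℝ] W => β ![v, w]) (hα.extDeriv_pullback hf z)
  rw [extDeriv_apply (hα.differentiableAt_pullback hf z)] at h1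
  have e0 : (0 : Fin 2).removeNth ![v, w] = ![w] := by
    funext i; fin_cases i; rfl
  have e1 : (1 : Fin 2).removeNth ![v, w] = ![v] := by
    funext i; fin_cases i; rfl
  rw [Fin.sum_univ_two, e0, e1] at h1
  simp only [pullback_one] at h1
  have e2 : (α.d (f z)).compContinuousLinearMap (tmap U V f z) ![v, w] =
      α.d (f z) ![tmap U V f z v, tmap U V f z w] := DiffForm.pullback_two α.d f z v w
  rw [← e2, ← h1]
  simp [sub_eq_add_neg]

/-- The exterior derivative of a 2-form on the images of the constant vector fields `u`, `v`, `w`.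
-/
theorem DiffForm.Smooth.d_apply_three {β : DiffForm V W N 2} (hβ : β.Smooth)
    {f : U → N} (hf : ContMDiff 𝓘(ℝ, U) 𝓘(ℝ, V) ∞ f) (z u v w : U) :
    β.d (f z) ![tmap U V f z u, tmap U V f z v, tmap U V f z w] =
      fderiv ℝ (fun z => β (f z) ![tmap U V f z v, tmap U V f z w]) z u -
        fderiv ℝ (fun z => β (f z) ![tmap U V f z u, tmap U V f z w]) z v +
        fderiv ℝ (fun z => β (f z) ![tmap U V f z u, tmap U V f z v]) z w := by
  have h1 := congrArg (fun γ : U [⋀^Fin 3]→L[ℝ] W => γ ![u, v, w]) (hβ.extDeriv_pullback hf z)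
  rw [extDeriv_apply (hβ.differentiableAt_pullback hf z)] at h1
  have e0 : (0 : Fin 3).removeNth ![u, v, w] = ![v, w] := by
    funext i; fin_cases i <;> rfl
  have e1 : (1 : Fin 3).removeNth ![u, v, w] = ![u, w] := by
    funext i; fin_cases i <;> rfl
  have e2 : (2 : Fin 3).removeNth ![u, v, w] = ![u, v] := by
    funext i; fin_cases i <;> rfl
  rw [Fin.sum_univ_three, e0, e1, e2] at h1
  simp only [pullback_two] at h1
  have e2 : (β.d (f z)).compContinuousLinearMap (tmap U V f z) ![u, v, w] =
      β.d (f z) ![tmap U V f z u, tmap U V f z v, tmap U V f z w] := by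
    rw [ContinuousAlternatingMap.compContinuousLinearMap_apply]
    congr 1
    funext i; fin_cases i <;> rfl
  rw [← e2, ← h1]
  simp [sub_eq_add_neg]

end Pullback

/-! ### Operations on ordered exponentials -/

section OrderedExpOps

variable {VG : Type*} [NormedAddCommGroup VG] [NormedSpace ℝ VG] [FiniteDimensional ℝ VG]
  {G : Type*} [TopologicalSpace G] [ChartedSpace VG G] [Group G] [LieGroup 𝓘(ℝ, VG) ∞ G]
  {VE : Type*} [NormedAddCommGroup VE] [NormedSpace ℝ VE] [FiniteDimensional ℝ VE]
  {E : Type*} [TopologicalSpace E] [ChartedSpace VE E] [Group E] [LieGroup 𝓘(ℝ, VE) ∞ E]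
  {U : Type*} [NormedAddCommGroup U] [NormedSpace ℝ U]
  {X : Type*} [NormedAddCommGroup X] [NormedSpace ℝ X]

theorem orderedExp_zero_right {A : ℝ → VG} (hA : Continuous A) : orderedExp G A 0 = 1 :=
  (isOrderedExp_orderedExp hA).1

theorem hasLogVelocity_orderedExp {A : ℝ → VG} (hA : Continuous A) (t : ℝ) :
    HasLogVelocity (orderedExp G A) t (A t) :=
  (isOrderedExp_iff.1 (isOrderedExp_orderedExp hA)).2 t

theorem continuous_orderedExp {A : ℝ → VG} (hA : Continuous A) : Continuous (orderedExp G A) :=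
  continuous_iff_continuousAt.2 fun t => (hasLogVelocity_orderedExp hA t).continuousAt

theorem orderedExp_eq {A : ℝ → VG} {c : ℝ → G} (h0 : c 0 = 1)
    (h : ∀ t, HasLogVelocity c t (A t)) : orderedExp G A = c :=
  (isOrderedExp_iff.2 ⟨h0, h⟩).eq_orderedExp

theorem orderedExp_zero : orderedExp G (fun _ => (0 : VG)) = fun _ => 1 := by
  refine orderedExp_eq rfl fun t => ?_
  unfold HasLogVelocity
  rw [ContinuousLinearMap.toSpanSingleton_zero]
  exact hasLogDeriv_const 1 t

/-- Curves with the same logarithmic derivative and the same value at `0` are equal. -/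
theorem HasLogVelocity.eq_mul {c d : ℝ → G} {A : ℝ → VG} (hc : ∀ t, HasLogVelocity c t (A t))
    (hd : ∀ t, HasLogVelocity d t (A t)) (h : c 0 = d 0) : c = d := by
  funext t
  rw [eq_mul_of_hasLogVelocity isOpen_univ isPreconnected_univ (fun t _ => hc t) (fun t _ => hd t)
    (mem_univ 0) (mem_univ t), h, mul_inv_cancel, one_mul]

/-- The ordered exponential of a reversed curve. -/
theorem orderedExp_rev {A A' : ℝ → VG} (hA : Continuous A) (h : ∀ t, A' t = -A (1 - t)) (t : ℝ) :
    orderedExp G A' t = (orderedExp G A 1)⁻¹ * orderedExp G A (1 - t) := by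
  refine congrFun (orderedExp_eq (c := fun t => (orderedExp G A 1)⁻¹ * orderedExp G A (1 - t))
    (by simp) fun t => ?_) t
  have h1 := HasLogVelocity.comp (f := fun z => 1 - z)
    (hasLogVelocity_orderedExp (G := G) hA (1 - t))
    ((hasDerivAt_id t).const_sub 1)
  rw [neg_smul, one_smul, ← h] at h1
  exact h1.const_mul _

theorem orderedExp_map {A : ℝ → VG} (hA : Continuous A) (φ : G →* E) (hφ : TDiff VG VE φ 1)
    (t : ℝ) : orderedExp E (fun t => tmap VG VE φ 1 (A t)) t = φ (orderedExp G A t) := by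
  refine congrFun (orderedExp_eq (c := fun t => φ (orderedExp G A t))
    (by simp [orderedExp_zero_right hA]) fun t => ?_) t
  have := (hasLogVelocity_orderedExp (G := G) hA t).map φ hφ
  unfold HasLogVelocity
  convert this using 1
  ext; simp

theorem orderedExp_act (𝒢 : LieCrossedModule VG G VE E) {A : ℝ → VE} (hA : Continuous A) (g : G)
    (t : ℝ) : orderedExp E (fun t => 𝒢.actLie g (A t)) t = 𝒢.act g (orderedExp E A t) :=
  orderedExp_map hA (𝒢.act g : E ≃* E).toMonoidHom (𝒢.tDiff_act g 1) t

variable [T2Space G]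

/-- On the first half, the ordered exponential of a concatenation is that of the first curve. The
value of `A''` at `1 / 2` is not prescribed, so that this time is reached by continuity. -/
theorem orderedExp_concat_left {A A'' : ℝ → VG} (hA : Continuous A)
    (hA'' : Continuous A'') (h : ∀ t < 1 / 2, A'' t = (2 : ℝ) • A (2 * t)) {t : ℝ}
    (ht : t ≤ 1 / 2) : orderedExp G A'' t = orderedExp G A (2 * t) := by
  have key : EqOn (orderedExp G A'') (fun t => orderedExp G A (2 * t)) (Iio (1 / 2)) := by
    intro t ht
    have := eq_mul_of_hasLogVelocity (G := G) (A := A'') (c := orderedExp G A'')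
      (d := fun t => orderedExp G A (2 * t)) isOpen_Iio isPreconnected_Iio
      (fun t _ => hasLogVelocity_orderedExp hA'' t) (fun t ht => by
        rw [h t ht]
        exact HasLogVelocity.comp (f := fun z => 2 * z) (hasLogVelocity_orderedExp hA (2 * t))
          (by simpa using (hasDerivAt_id t).const_mul (2 : ℝ)))
      (show (0 : ℝ) ∈ Iio (1 / 2) by norm_num) ht
    rw [this, orderedExp_zero_right hA'', mul_zero, orderedExp_zero_right hA]
    simp
  have := key.closure (continuous_orderedExp hA'') ((continuous_orderedExp hA).comp (by fun_prop))
  rw [closure_Iio] at this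
  exact this ht

/-- The ordered exponential of a concatenation. -/
theorem orderedExp_concat_right {A A' A'' : ℝ → VG} (hA : Continuous A) (hA' : Continuous A')
    (hA'' : Continuous A'') (h : ∀ t < 1 / 2, A'' t = (2 : ℝ) • A (2 * t))
    (h' : ∀ t > 1 / 2, A'' t = (2 : ℝ) • A' (2 * t - 1)) {t : ℝ} (ht : 1 / 2 ≤ t) :
    orderedExp G A'' t = orderedExp G A 1 * orderedExp G A' (2 * t - 1) := by
  set d : ℝ → G := fun t => orderedExp G A' (2 * t - 1) with hd
  have hdc : Continuous d := (continuous_orderedExp hA').comp (by fun_prop)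
  have hdl : ∀ t ∈ Ioi (1 / 2 : ℝ), HasLogVelocity d t (A'' t) := fun t ht => by
    rw [h' t ht]
    exact HasLogVelocity.comp (f := fun z => 2 * z - 1) (hasLogVelocity_orderedExp hA' (2 * t - 1))
      (by simpa using ((hasDerivAt_id t).const_mul (2 : ℝ)).sub_const 1)
  have key : ∀ p > (1 / 2 : ℝ), EqOn (orderedExp G A'')
      (fun t => orderedExp G A'' p * (d p)⁻¹ * d t) (Ioi (1 / 2)) := fun p hp t ht =>
    eq_mul_of_hasLogVelocity isOpen_Ioi isPreconnected_Ioi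
      (fun t _ => hasLogVelocity_orderedExp hA'' t) hdl hp ht
  have hcm : ∀ g : G, Continuous fun h : G => g * h := fun g =>
    (contMDiff_const_mul (VG := VG) (n := ∞) le_rfl g).continuous
  have key' : ∀ p > (1 / 2 : ℝ), EqOn (orderedExp G A'')
      (fun t => orderedExp G A'' p * (d p)⁻¹ * d t) (Ici (1 / 2)) := fun p hp => by
    have := (key p hp).closure (continuous_orderedExp hA'') ((hcm _).comp hdc)
    rwa [closure_Ioi] at this
  have h1 := key' 1 (by norm_num) (mem_Ici.2 le_rfl)
  have hd0 : d (1 / 2) = 1 := by simp [d, orderedExp_zero_right hA']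
  have h2 := orderedExp_concat_left (G := G) hA hA'' h le_rfl
  have h3 := key' 1 (by norm_num) (mem_Ici.2 ht)
  dsimp only at h1 h3
  rw [h3]
  rw [hd0, mul_one, h2] at h1
  rw [← h1]
  norm_num [d]

end OrderedExpOps

/-! ### Ordered exponentials of families -/

section Families

variable {VG : Type*} [NormedAddCommGroup VG] [NormedSpace ℝ VG] [FiniteDimensional ℝ VG]
  {G : Type*} [TopologicalSpace G] [ChartedSpace VG G] [Group G] [LieGroup 𝓘(ℝ, VG) ∞ G]
  {U : Type*} [NormedAddCommGroup U] [NormedSpace ℝ U]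
  {X : Type*} [NormedAddCommGroup X] [NormedSpace ℝ X] [FiniteDimensional ℝ X]
  {W : Type*} [NormedAddCommGroup W] [NormedSpace ℝ W]

theorem eq_of_fderiv_eq_zero_dir {F : U → W} (hF : Differentiable ℝ F) {v : U}
    (h : ∀ z, fderiv ℝ F z v = 0) (p : U) (r : ℝ) : F (p + r • v) = F p := by
  have hd : ∀ r : ℝ, HasDerivAt (fun r : ℝ => F (p + r • v)) 0 r := by
    intro r
    have h1 : HasDerivAt (fun r : ℝ => p + r • v) v r := by
      simpa using ((hasDerivAt_id r).smul_const v).const_add p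
    have h2 := (hF (p + r • v)).hasFDerivAt.comp_hasDerivAt r h1
    rwa [h] at h2
  have := is_const_of_deriv_eq_zero (fun r => (hd r).differentiableAt) (fun r => (hd r).deriv) r 0
  simpa using this

theorem eq_zero_of_fderiv_fst {F : ℝ × X → W} (hF : Differentiable ℝ F)
    (h : ∀ z, fderiv ℝ F z (1, 0) = 0) (h0 : ∀ x, F (0, x) = 0) (p : ℝ × X) : F p = 0 := by
  have := eq_of_fderiv_eq_zero_dir hF h (0, p.2) p.1
  rw [h0] at this
  simpa using this

theorem fderiv_fderiv_comm {F : U → W} (hF : ContDiff ℝ ∞ F) (z v w : U) :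
    fderiv ℝ (fun z => fderiv ℝ F z w) z v = fderiv ℝ (fun z => fderiv ℝ F z v) z w := by
  have hd : DifferentiableAt ℝ (fderiv ℝ F) z :=
    (hF.fderiv_right (m := ∞) (by simp)).differentiable (by simp) z
  have h : ∀ v w, fderiv ℝ (fun z => fderiv ℝ F z w) z v = fderiv ℝ (fderiv ℝ F) z v w := by
    intro v w
    rw [fderiv_clm_apply hd (differentiableAt_const _)]
    simp
  rw [h, h]
  exact (hF.contDiffAt.isSymmSndFDerivAt (by
    rw [minSmoothness_of_isRCLikeNormedField]; exact WithTop.coe_le_coe.2 le_top)).eq v w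

theorem fderiv_comp_prodMk {F : ℝ × X → W} (hF : Differentiable ℝ F) (t : ℝ) (x v : X) :
    fderiv ℝ (fun y => F (t, y)) x v = fderiv ℝ F (t, x) (0, v) := by
  rw [(hasFDerivAt_partial_snd (p := (t, x)) (hF _)).fderiv]
  rfl

theorem logDeriv_apply_of_hasLogVelocity {K : U → G} (hK : ContMDiff 𝓘(ℝ, U) 𝓘(ℝ, VG) ∞ K)
    {f : ℝ → U} {t : ℝ} {v : U} {y : VG} (hf : HasDerivAt f v t)
    (h : HasLogVelocity (fun τ => K (f τ)) t y) : logDeriv VG K (f t) v = y := by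
  have h1 : HasLogDeriv K (f t) (logDeriv VG K (f t)) :=
    TDiff.hasLogDeriv (tDiff_of_contMDiffAt hK.contMDiffAt (by simp))
  have := HasLogDeriv.unique (h1.hasLogVelocity hf) h
  simpa using congrArg (fun L : ℝ →L[ℝ] VG => L 1) this

theorem hasLogVelocity_of_contMDiff {K : U → G} (hK : ContMDiff 𝓘(ℝ, U) 𝓘(ℝ, VG) ∞ K)
    {f : ℝ → U} {t : ℝ} {v : U} (hf : HasDerivAt f v t) :
    HasLogVelocity (fun τ => K (f τ)) t (logDeriv VG K (f t) v) :=
  (TDiff.hasLogDeriv (tDiff_of_contMDiffAt hK.contMDiffAt (by simp))).hasLogVelocity hf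

/-- The solutions of `∂K/∂t = K a` with initial values `K₀`, for `a` and `K₀` that depend on
parameters. -/
def solution (K₀ : X → G) (a : ℝ × X → VG) (p : ℝ × X) : G :=
  K₀ p.2 * orderedExp G (fun τ => a (τ, p.2)) p.1

theorem solution_zero (K₀ : X → G) {a : ℝ × X → VG} (ha : ContDiff ℝ ∞ a) (x : X) :
    solution K₀ a (0, x) = K₀ x := by
  unfold solution
  rw [orderedExp_zero_right (A := fun τ => a (τ, x)) (ha.continuous.comp (by fun_prop)), mul_one]

theorem hasLogVelocity_solution (K₀ : X → G) {a : ℝ × X → VG} (ha : ContDiff ℝ ∞ a) (t : ℝ)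
    (x : X) : HasLogVelocity (fun τ => solution K₀ a (τ, x)) t (a (t, x)) :=
  (hasLogVelocity_orderedExp (A := fun τ => a (τ, x)) (ha.continuous.comp (by fun_prop))
    t).const_mul (K₀ x)

theorem contMDiff_comp_contDiff {k : U → G} (hk : ContMDiff 𝓘(ℝ, U) 𝓘(ℝ, VG) ∞ k) {f : X → U}
    (hf : ContDiff ℝ ∞ f) : ContMDiff 𝓘(ℝ, X) 𝓘(ℝ, VG) ∞ fun x => k (f x) :=
  hk.comp hf.contMDiff

theorem contMDiff_family {K₀ : X → G} (hK₀ : ContMDiff 𝓘(ℝ, X) 𝓘(ℝ, VG) ∞ K₀) {a : ℝ × X → VG}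
    (ha : ContDiff ℝ ∞ a) : ContMDiff 𝓘(ℝ, ℝ × X) 𝓘(ℝ, VG) ∞ (solution K₀ a) := by
  refine (contMDiff_comp_contDiff hK₀ contDiff_snd).mul ?_
  exact contMDiff_solution ha
    (fun x => orderedExp_zero_right (A := fun τ => a (τ, x)) (ha.continuous.comp (by fun_prop)))
    (fun t x => hasLogVelocity_orderedExp (A := fun τ => a (τ, x))
      (ha.continuous.comp (by fun_prop)) t)

theorem logDeriv_solution_fst {K₀ : X → G} (hK₀ : ContMDiff 𝓘(ℝ, X) 𝓘(ℝ, VG) ∞ K₀)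
    {a : ℝ × X → VG} (ha : ContDiff ℝ ∞ a) (p : ℝ × X) :
    logDeriv VG (solution K₀ a) p (1, 0) = a p :=
  logDeriv_apply_of_hasLogVelocity (contMDiff_family hK₀ ha) (f := fun τ => (τ, p.2)) (t := p.1)
    ((hasDerivAt_id p.1).prodMk (hasDerivAt_const _ _)) (hasLogVelocity_solution K₀ ha p.1 p.2)

theorem logDeriv_comp_prodMk {K : ℝ × X → G} (hK : ContMDiff 𝓘(ℝ, ℝ × X) 𝓘(ℝ, VG) ∞ K) (t : ℝ)
    (x v : X) : logDeriv VG (fun x => K (t, x)) x v = logDeriv VG K (t, x) (0, v) := by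
  have h1 : HasLogDeriv K (t, x) (logDeriv VG K (t, x)) :=
    TDiff.hasLogDeriv (tDiff_of_contMDiffAt hK.contMDiffAt (by simp))
  rw [(h1.comp (f := fun x => (t, x)) (hasFDerivAt_prodMk_right t x)).logDeriv_eq]
  rfl

theorem logDeriv_const (g : G) (x : U) : logDeriv VG (fun _ : U => g) x = 0 :=
  (hasLogDeriv_const g x).logDeriv_eq

theorem adj_injective (g : G) : Function.Injective (adj VG G g) := fun X Y h => by
  rw [← adj_inv_apply g X, h, adj_inv_apply]

end Families

/-! ### Surface ordered exponentials in coordinates -/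

section Core

variable {VG : Type*} [NormedAddCommGroup VG] [NormedSpace ℝ VG] [FiniteDimensional ℝ VG]
  {G : Type*} [TopologicalSpace G] [ChartedSpace VG G] [Group G] [LieGroup 𝓘(ℝ, VG) ∞ G]
  {VE : Type*} [NormedAddCommGroup VE] [NormedSpace ℝ VE] [FiniteDimensional ℝ VE]
  {E : Type*} [TopologicalSpace E] [ChartedSpace VE E] [Group E] [LieGroup 𝓘(ℝ, VE) ∞ E]
  {U : Type*} [NormedAddCommGroup U] [NormedSpace ℝ U]
  {X : Type*} [NormedAddCommGroup X] [NormedSpace ℝ X] [FiniteDimensional ℝ X]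
  (𝒢 : LieCrossedModule VG G VE E)

theorem contDiff_defect {K : U → G} (hK : ContMDiff 𝓘(ℝ, U) 𝓘(ℝ, VG) ∞ K) {a : U → VG}
    (ha : ContDiff ℝ ∞ a) (w : U) :
    ContDiff ℝ ∞ fun z => adj VG G (K z) (a z - logDeriv VG K z w) :=
  (contDiff_adj_comp (n := ⊤) hK).clm_apply
    (ha.sub ((contDiff_logDeriv hK).clm_apply contDiff_const))

theorem LieCrossedModule.contDiff_actLie_apply {K : U → G} (hK : ContMDiff 𝓘(ℝ, U) 𝓘(ℝ, VG) ∞ K)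
    {b : U → VE} (hb : ContDiff ℝ ∞ b) : ContDiff ℝ ∞ fun z => 𝒢.actLie (K z) (b z) :=
  (contMDiff_iff_contDiff.1 (𝒢.contMDiff_actLie.comp hK)).clm_apply hb

theorem LieCrossedModule.fderiv_actLie_apply {K : U → G} (hK : ContMDiff 𝓘(ℝ, U) 𝓘(ℝ, VG) ∞ K)
    {b : U → VE} (hb : ContDiff ℝ ∞ b) (z v : U) :
    fderiv ℝ (fun z => 𝒢.actLie (K z) (b z)) z v =
      𝒢.actLie (K z) (𝒢.actInf (logDeriv VG K z v) (b z) + fderiv ℝ b z v) :=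
  HasLogDeriv.fderiv_rep_apply 𝒢.actLie_mul 𝒢.tDiff_actLie
    (TDiff.hasLogDeriv (tDiff_of_contMDiffAt hK.contMDiffAt (by simp)))
    (hb.differentiable (by simp) z) v

/-- If `K` is parallel in direction `v`, then the derivative in this direction of its covariant
derivative in direction `w` is the curvature, transported by `K`. -/
theorem fderiv_defect {K : U → G} (hK : ContMDiff 𝓘(ℝ, U) 𝓘(ℝ, VG) ∞ K) {a a' : U → VG}
    {z v w : U} (ha' : DifferentiableAt ℝ a' z) (h : ∀ z, logDeriv VG K z v = a z) {β : VE}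
    (fake : fderiv ℝ a' z v - fderiv ℝ a z w + adInf VG G (a z) (a' z) = 𝒢.bdLie β) :
    fderiv ℝ (fun z => adj VG G (K z) (a' z - logDeriv VG K z w)) z v =
      𝒢.bdLie (𝒢.actLie (K z) β) := by
  rw [fderiv_adj_sub_logDeriv hK ha', 𝒢.bdLie_actLie, ← fake, funext h, h z]
  congr 1
  abel

/-- Integrated form of `fderiv_defect`, for `K` that is parallel along the first axis, and also in
the direction of `w` on the hyperplane where the first coordinate vanishes. -/
theorem defect_eq_integral {K : ℝ × X → G} (hK : ContMDiff 𝓘(ℝ, ℝ × X) 𝓘(ℝ, VG) ∞ K)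
    {a a' : ℝ × X → VG} {b : ℝ × X → VE} (ha' : ContDiff ℝ ∞ a') (hb : ContDiff ℝ ∞ b)
    (h : ∀ z, logDeriv VG K z (1, 0) = a z) {w : ℝ × X}
    (fake : ∀ z, fderiv ℝ a' z (1, 0) - fderiv ℝ a z w + adInf VG G (a z) (a' z) = 𝒢.bdLie (b z))
    (h0 : ∀ x, logDeriv VG K (0, x) w = a' (0, x)) (p : ℝ × X) :
    adj VG G (K p) (a' p - logDeriv VG K p w) =
      𝒢.bdLie (∫ τ in (0 : ℝ)..p.1, 𝒢.actLie (K (τ, p.2)) (b (τ, p.2))) := by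
  have hF := 𝒢.contDiff_actLie_apply hK hb
  have hI := contDiff_integral hF
  have hD := contDiff_defect hK ha' w
  have hB : ContDiff ℝ ∞ fun p : ℝ × X =>
      𝒢.bdLie (∫ τ in (0 : ℝ)..p.1, 𝒢.actLie (K (τ, p.2)) (b (τ, p.2))) :=
    𝒢.bdLie.contDiff.comp hI
  refine sub_eq_zero.1 (eq_zero_of_fderiv_fst (F := fun p => adj VG G (K p)
    (a' p - logDeriv VG K p w) - 𝒢.bdLie (∫ τ in (0 : ℝ)..p.1, 𝒢.actLie (K (τ, p.2))
      (b (τ, p.2)))) ((hD.sub hB).differentiable (by simp)) (fun z => ?_) (fun x => ?_) p)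
  · rw [fderiv_fun_sub (hD.differentiable (by simp) z) (hB.differentiable (by simp) z),
      sub_apply, fderiv_defect 𝒢 hK (ha'.differentiable (by simp) z) h (fake z)]
    have := (𝒢.bdLie.hasFDerivAt.comp z (hI.differentiable (by simp) z).hasFDerivAt).fderiv
    have e := congrArg (fun L : ℝ × X →L[ℝ] VG => L (1, 0)) this
    simp only [ContinuousLinearMap.comp_apply] at e
    rw [fderiv_integral_fst (hF.of_le (by simp))] at e
    rw [sub_eq_zero]
    exact e.symm
  · simp [h0]

/-- The functions `a₁`, `a₂` and `b` are the coefficients of a connection pair on the plane. -/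
structure PlanePair (a₁ a₂ : ℝ × ℝ → VG) (b : ℝ × ℝ → VE) : Prop where
  smooth₁ : ContDiff ℝ ∞ a₁
  smooth₂ : ContDiff ℝ ∞ a₂
  smooth : ContDiff ℝ ∞ b
  fake : ∀ z, fderiv ℝ a₂ z (1, 0) - fderiv ℝ a₁ z (0, 1) + adInf VG G (a₁ z) (a₂ z) =
    𝒢.bdLie (b z)

variable (G) in
/-- Parallel transport from the origin to `(t,s)`, first along the second axis and then in the
direction of the first one. -/
def frame (a₁ a₂ : ℝ × ℝ → VG) : ℝ × ℝ → G :=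
  solution (orderedExp G fun σ => a₂ (0, σ)) a₁

/-- The surface ordered exponential of the rectangle between the origin and `(t,s)`. -/
def planeExp (a₁ a₂ : ℝ × ℝ → VG) (b : ℝ × ℝ → VE) (t s : ℝ) : E :=
  orderedExp E (fun σ => ∫ τ in (0 : ℝ)..t, 𝒢.actLie (frame G a₁ a₂ (τ, σ)) (b (τ, σ))) s

variable {𝒢} {a₁ a₂ : ℝ × ℝ → VG} {b : ℝ × ℝ → VE}

theorem contMDiff_orderedExp {a : ℝ → VG} (ha : ContDiff ℝ ∞ a) :
    ContMDiff 𝓘(ℝ, ℝ) 𝓘(ℝ, VG) ∞ (orderedExp G a) :=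
  contMDiff_of_hasLogVelocity ha (hasLogVelocity_orderedExp ha.continuous)

/-- The coefficients after the interchange of coordinates. -/
theorem PlanePair.swap (h : PlanePair 𝒢 a₁ a₂ b) :
    PlanePair 𝒢 (fun p => a₂ p.swap) (fun p => a₁ p.swap) (fun p => -b p.swap) := by
  have hs : ContDiff ℝ ∞ (Prod.swap : ℝ × ℝ → ℝ × ℝ) := contDiff_snd.prodMk contDiff_fst
  refine ⟨h.smooth₂.comp hs, h.smooth₁.comp hs, (h.smooth.comp hs).neg, fun z => ?_⟩
  have e : ∀ {f : ℝ × ℝ → VG}, ContDiff ℝ ∞ f → ∀ v : ℝ × ℝ,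
      fderiv ℝ (fun p : ℝ × ℝ => f p.swap) z v = fderiv ℝ f z.swap v.swap := by
    intro f hf v
    have h1 : HasFDerivAt (Prod.swap : ℝ × ℝ → ℝ × ℝ)
      ((ContinuousLinearMap.snd ℝ ℝ ℝ).prod (ContinuousLinearMap.fst ℝ ℝ ℝ)) z :=
      hasFDerivAt_snd.prodMk hasFDerivAt_fst
    have h2 := ((hf.differentiable (by simp) z.swap).hasFDerivAt.comp z h1).fderiv
    exact congrArg (fun L : ℝ × ℝ →L[ℝ] VG => L v) h2
  rw [e h.smooth₁, e h.smooth₂, map_neg, ← h.fake, adInf_antisymm]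
  simp only [Prod.swap_prod_mk]
  abel

namespace PlanePair

theorem contDiff_left (h : PlanePair 𝒢 a₁ a₂ b) : ContDiff ℝ ∞ fun σ : ℝ => a₂ (0, σ) :=
  h.smooth₂.comp (by fun_prop)

theorem contMDiff_left (h : PlanePair 𝒢 a₁ a₂ b) :
    ContMDiff 𝓘(ℝ, ℝ) 𝓘(ℝ, VG) ∞ (orderedExp G fun σ => a₂ (0, σ)) :=
  contMDiff_orderedExp h.contDiff_left

theorem contMDiff_frame (h : PlanePair 𝒢 a₁ a₂ b) :
    ContMDiff 𝓘(ℝ, ℝ × ℝ) 𝓘(ℝ, VG) ∞ (frame G a₁ a₂) :=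
  contMDiff_family h.contMDiff_left h.smooth₁

theorem logDeriv_frame (h : PlanePair 𝒢 a₁ a₂ b) (z : ℝ × ℝ) :
    logDeriv VG (frame G a₁ a₂) z (1, 0) = a₁ z :=
  logDeriv_solution_fst h.contMDiff_left h.smooth₁ z

theorem frame_zero (h : PlanePair 𝒢 a₁ a₂ b) (s : ℝ) :
    frame G a₁ a₂ (0, s) = orderedExp G (fun σ => a₂ (0, σ)) s :=
  solution_zero _ h.smooth₁ s

theorem logDeriv_frame_left (h : PlanePair 𝒢 a₁ a₂ b) (s : ℝ) :
    logDeriv VG (frame G a₁ a₂) (0, s) (0, 1) = a₂ (0, s) := by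
  refine logDeriv_apply_of_hasLogVelocity h.contMDiff_frame (f := fun s => ((0 : ℝ), s)) (t := s)
    ((hasDerivAt_const _ _).prodMk (hasDerivAt_id s)) ?_
  simp_rw [h.frame_zero]
  exact hasLogVelocity_orderedExp h.contDiff_left.continuous s

theorem contDiff_transported (h : PlanePair 𝒢 a₁ a₂ b) :
    ContDiff ℝ ∞ fun z => 𝒢.actLie (frame G a₁ a₂ z) (b z) :=
  𝒢.contDiff_actLie_apply h.contMDiff_frame h.smooth

theorem contDiff_flux (h : PlanePair 𝒢 a₁ a₂ b) : ContDiff ℝ ∞ fun p : ℝ × ℝ =>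
    ∫ τ in (0 : ℝ)..p.1, 𝒢.actLie (frame G a₁ a₂ (τ, p.2)) (b (τ, p.2)) :=
  contDiff_integral h.contDiff_transported

theorem contDiff_flux_swap (h : PlanePair 𝒢 a₁ a₂ b) : ContDiff ℝ ∞ fun p : ℝ × ℝ =>
    ∫ τ in (0 : ℝ)..p.2, 𝒢.actLie (frame G a₁ a₂ (τ, p.1)) (b (τ, p.1)) :=
  h.contDiff_flux.comp (contDiff_snd.prodMk contDiff_fst)

theorem continuous_flux (h : PlanePair 𝒢 a₁ a₂ b) (t : ℝ) : Continuous fun σ : ℝ =>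
    ∫ τ in (0 : ℝ)..t, 𝒢.actLie (frame G a₁ a₂ (τ, σ)) (b (τ, σ)) :=
  h.contDiff_flux.continuous.comp (by fun_prop : Continuous fun σ : ℝ => (t, σ))

/-- The transport along the second axis fails to be parallel in the direction of `s` by the flux
`∫₀ᵗ K ▷ b`. -/
theorem defect_eq (h : PlanePair 𝒢 a₁ a₂ b) (p : ℝ × ℝ) :
    adj VG G (frame G a₁ a₂ p) (a₂ p - logDeriv VG (frame G a₁ a₂) p (0, 1)) =
      𝒢.bdLie (∫ τ in (0 : ℝ)..p.1, 𝒢.actLie (frame G a₁ a₂ (τ, p.2)) (b (τ, p.2))) :=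
  defect_eq_integral 𝒢 h.contMDiff_frame h.smooth₂ h.smooth h.logDeriv_frame h.fake
    h.logDeriv_frame_left p

/-- The surface ordered exponential intertwines the transports along the two pairs of sides of a
rectangle. -/
theorem bd_planeExp_mul_frame (h : PlanePair 𝒢 a₁ a₂ b) (t s : ℝ) :
    𝒢.bd (planeExp 𝒢 a₁ a₂ b t s) * frame G a₁ a₂ (t, s) =
      frame G (fun p => a₂ p.swap) (fun p => a₁ p.swap) (s, t) := by
  have hc := h.continuous_flux t
  refine congrFun (HasLogVelocity.eq_mul (A := fun s => a₂ (t, s))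
    (c := fun s => 𝒢.bd (planeExp 𝒢 a₁ a₂ b t s) * frame G a₁ a₂ (t, s))
    (d := fun s => frame G (fun p => a₂ p.swap) (fun p => a₁ p.swap) (s, t))
    (fun s => ?_) (fun s => ?_) ?_) s
  · have h1 := ((hasLogVelocity_orderedExp (G := E) hc s).map 𝒢.bd (𝒢.tDiff_bd 1)).mul
      (hasLogVelocity_of_contMDiff h.contMDiff_frame (f := fun s => (t, s)) (t := s)
        ((hasDerivAt_const _ _).prodMk (hasDerivAt_id s)))
    have h2 := h.defect_eq (t, s)
    have h3 := congrArg (adj VG G (frame G a₁ a₂ (t, s))⁻¹) h2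
    rw [adj_inv_apply, sub_eq_iff_eq_add] at h3
    have e : ContinuousLinearMap.toSpanSingleton ℝ (a₂ (t, s)) =
        (adj VG G (frame G a₁ a₂ (t, s))⁻¹).comp ((tmap VE VG 𝒢.bd 1).comp
          (ContinuousLinearMap.toSpanSingleton ℝ
            (∫ τ in (0 : ℝ)..t, 𝒢.actLie (frame G a₁ a₂ (τ, s)) (b (τ, s))))) +
        ContinuousLinearMap.toSpanSingleton ℝ (logDeriv VG (frame G a₁ a₂) (t, s) (0, 1)) := by
      ext
      simpa [LieCrossedModule.bdLie] using h3
    unfold HasLogVelocity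
    rw [e]
    exact h1
  · exact hasLogVelocity_solution _ h.swap.smooth₁ s t
  · refine Eq.trans ?_ (h.swap.frame_zero t).symm
    have e : planeExp 𝒢 a₁ a₂ b t 0 = 1 := orderedExp_zero_right hc
    rw [e, map_one, one_mul]
    unfold frame solution
    rw [orderedExp_zero_right h.contDiff_left.continuous]
    simp

theorem planeExp_zero_right (h : PlanePair 𝒢 a₁ a₂ b) (t : ℝ) : planeExp 𝒢 a₁ a₂ b t 0 = 1 :=
  orderedExp_zero_right (h.continuous_flux t)

theorem planeExp_zero_left (s : ℝ) : planeExp 𝒢 a₁ a₂ b 0 s = 1 := by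
  unfold planeExp
  simp only [intervalIntegral.integral_same]
  rw [orderedExp_zero]

/-- The surface ordered exponential is inverted by the interchange of coordinates. -/
theorem planeExp_swap (h : PlanePair 𝒢 a₁ a₂ b) (t s : ℝ) :
    planeExp 𝒢 (fun p => a₂ p.swap) (fun p => a₁ p.swap) (fun p => -b p.swap) s t =
      (planeExp 𝒢 a₁ a₂ b t s)⁻¹ := by
  -- `e(s,t)` as a solution in `s`, with the parameter `t`
  set η : ℝ × ℝ → VE := fun p =>
    ∫ τ in (0 : ℝ)..p.2, 𝒢.actLie (frame G a₁ a₂ (τ, p.1)) (b (τ, p.1)) with hη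
  have hηs : ContDiff ℝ ∞ η := h.contDiff_flux_swap
  set e : ℝ × ℝ → E := solution (fun _ => 1) η with he
  have hes : ContMDiff 𝓘(ℝ, ℝ × ℝ) 𝓘(ℝ, VE) ∞ e := contMDiff_family contMDiff_const hηs
  have hee : ∀ t s, e (s, t) = planeExp 𝒢 a₁ a₂ b t s := fun t s => one_mul _
  have hed : ∀ z, logDeriv VE e z (1, 0) = η z := logDeriv_solution_fst contMDiff_const hηs
  set K' : ℝ × ℝ → G := frame G (fun p => a₂ p.swap) (fun p => a₁ p.swap) with hK'
  have hT := h.swap.contDiff_transported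
  have hI : ContDiff ℝ ∞ fun p : ℝ × ℝ =>
      ∫ τ in (0 : ℝ)..p.1, 𝒢.actLie (K' (τ, p.2)) (-b (p.2, τ)) := h.swap.contDiff_flux
  have hD : ContDiff ℝ ∞ fun z => adj VE E (e z) (0 - logDeriv VE e z (0, 1)) :=
    contDiff_defect hes contDiff_const _
  have hηt : ∀ z : ℝ × ℝ, fderiv ℝ η z (0, 1) =
      𝒢.actLie (frame G a₁ a₂ z.swap) (b z.swap) := by
    intro z
    have h1 : HasFDerivAt (Prod.swap : ℝ × ℝ → ℝ × ℝ)
      ((ContinuousLinearMap.snd ℝ ℝ ℝ).prod (ContinuousLinearMap.fst ℝ ℝ ℝ)) z :=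
      hasFDerivAt_snd.prodMk hasFDerivAt_fst
    have h2 := ((h.contDiff_flux.differentiable (by simp) z.swap).hasFDerivAt.comp z h1).fderiv
    have h3 := congrArg (fun L : ℝ × ℝ →L[ℝ] VE => L (0, 1)) h2
    refine h3.trans ?_
    exact fderiv_integral_fst (h.contDiff_transported.of_le (by simp)) z.swap
  -- the logarithmic derivative of `e` in the direction of `t`, by integration of its derivative in
  -- the direction of `s`; the Peiffer identity and `∂(e) K = K'` turn `Ad_e (K ▷ b)` into `K' ▷ b`
  have key : ∀ p : ℝ × ℝ, adj VE E (e p) (0 - logDeriv VE e p (0, 1)) =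
      ∫ τ in (0 : ℝ)..p.1, 𝒢.actLie (K' (τ, p.2)) (-b (p.2, τ)) := by
    intro p
    refine sub_eq_zero.1 (eq_zero_of_fderiv_fst (F := fun p : ℝ × ℝ => adj VE E (e p)
      (0 - logDeriv VE e p (0, 1)) -
      ∫ τ in (0 : ℝ)..p.1, 𝒢.actLie (K' (τ, p.2)) (-b (p.2, τ)))
      ((hD.sub hI).differentiable (by simp)) (fun z => ?_) (fun x => ?_) p)
    · have h1 := fderiv_integral_fst (hT.of_le (by simp)) z
      have h2 := fderiv_adj_sub_logDeriv hes (b := fun _ => 0) (x := z)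
        (differentiableAt_const _) (1, 0) (0, 1)
      rw [fderiv_fun_sub (hD.differentiable (by simp) z) (hI.differentiable (by simp) z),
        sub_apply, sub_eq_zero]
      refine h2.trans (Eq.trans ?_ h1.symm)
      have h3 : fderiv ℝ (fun _ : ℝ × ℝ => (0 : VE)) z = 0 := by simp
      rw [funext hed, hηt, h3, ← h.bd_planeExp_mul_frame, 𝒢.actLie_mul, 𝒢.actLie_bd, ← hee]
      simp [Prod.swap]
    · have : (fun t => e (0, t)) = fun _ => 1 := funext fun t => by
        rw [hee, h.planeExp_zero_right]
      rw [← logDeriv_comp_prodMk hes, this, logDeriv_const]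
      simp
  refine congrFun (orderedExp_eq (c := fun t => (planeExp 𝒢 a₁ a₂ b t s)⁻¹) ?_ fun t => ?_) t
  · simp [planeExp_zero_left]
  · have h1 := (hasLogVelocity_of_contMDiff hes (f := fun t => (s, t)) (t := t)
      ((hasDerivAt_const _ _).prodMk (hasDerivAt_id t))).inv
    simp_rw [hee] at h1
    convert h1 using 1
    have h2 := key (s, t)
    simp only [zero_sub, map_neg, hee] at h2
    rw [h2]
    simp [Prod.swap, hK']

end PlanePair

end Core

/-! ### Homotopy invariance in coordinates -/

section Space

variable {VG : Type*} [NormedAddCommGroup VG] [NormedSpace ℝ VG] [FiniteDimensional ℝ VG]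
  {G : Type*} [TopologicalSpace G] [ChartedSpace VG G] [Group G] [LieGroup 𝓘(ℝ, VG) ∞ G]
  {VE : Type*} [NormedAddCommGroup VE] [NormedSpace ℝ VE] [FiniteDimensional ℝ VE]
  {E : Type*} [TopologicalSpace E] [ChartedSpace VE E] [Group E] [LieGroup 𝓘(ℝ, VE) ∞ E]
  (𝒢 : LieCrossedModule VG G VE E)

/-- The coefficients `aᵢ` and `bᵢⱼ` of a connection pair on `ℝ³` with vanishing curvature
3-form, such that `b₂₃` vanishes on the faces `t = 0, 1` of the cube, `b₁₃` vanishes on the faces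
`s = 0, 1`, and `a₃` vanishes on the edge `t = s = 0`. -/
structure SpacePair (a₁ a₂ a₃ : ℝ × ℝ × ℝ → VG) (b₁₂ b₁₃ b₂₃ : ℝ × ℝ × ℝ → VE) : Prop where
  smooth₁ : ContDiff ℝ ∞ a₁
  smooth₂ : ContDiff ℝ ∞ a₂
  smooth₃ : ContDiff ℝ ∞ a₃
  smooth₁₂ : ContDiff ℝ ∞ b₁₂
  smooth₁₃ : ContDiff ℝ ∞ b₁₃
  smooth₂₃ : ContDiff ℝ ∞ b₂₃
  fake₁₂ : ∀ z, fderiv ℝ a₂ z (1, 0, 0) - fderiv ℝ a₁ z (0, 1, 0) + adInf VG G (a₁ z) (a₂ z) =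
    𝒢.bdLie (b₁₂ z)
  fake₁₃ : ∀ z, fderiv ℝ a₃ z (1, 0, 0) - fderiv ℝ a₁ z (0, 0, 1) + adInf VG G (a₁ z) (a₃ z) =
    𝒢.bdLie (b₁₃ z)
  fake₂₃ : ∀ z, fderiv ℝ a₃ z (0, 1, 0) - fderiv ℝ a₂ z (0, 0, 1) + adInf VG G (a₂ z) (a₃ z) =
    𝒢.bdLie (b₂₃ z)
  flat : ∀ z, fderiv ℝ b₂₃ z (1, 0, 0) - fderiv ℝ b₁₃ z (0, 1, 0) + fderiv ℝ b₁₂ z (0, 0, 1) +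
    (𝒢.actInf (a₁ z) (b₂₃ z) - 𝒢.actInf (a₂ z) (b₁₃ z) + 𝒢.actInf (a₃ z) (b₁₂ z)) = 0
  edge : ∀ x, a₃ (0, 0, x) = 0
  left : ∀ s x, b₂₃ (0, s, x) = 0
  right : ∀ s x, b₂₃ (1, s, x) = 0
  down : ∀ t x, b₁₃ (t, 0, x) = 0
  up : ∀ t x, b₁₃ (t, 1, x) = 0

variable {𝒢} {a₁ a₂ a₃ : ℝ × ℝ × ℝ → VG} {b₁₂ b₁₃ b₂₃ : ℝ × ℝ × ℝ → VE}

/-- The transport on the face `t = 0`. -/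
def leftFrame (G : Type*) [TopologicalSpace G] [ChartedSpace VG G] [Group G]
    (a₂ : ℝ × ℝ × ℝ → VG) : ℝ × ℝ → G :=
  solution (fun _ => 1) fun q => a₂ (0, q)

/-- The transport from the edge `t = s = 0` to `(t,s,x)`, first in the direction of `s`, then in
that of `t`. -/
def spaceFrame (G : Type*) [TopologicalSpace G] [ChartedSpace VG G] [Group G]
    (a₁ a₂ : ℝ × ℝ × ℝ → VG) : ℝ × ℝ × ℝ → G :=
  solution (leftFrame G a₂) a₁

namespace SpacePair

theorem contMDiff_leftFrame (h : SpacePair 𝒢 a₁ a₂ a₃ b₁₂ b₁₃ b₂₃) :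
    ContMDiff 𝓘(ℝ, ℝ × ℝ) 𝓘(ℝ, VG) ∞ (leftFrame G a₂) :=
  contMDiff_family contMDiff_const (h.smooth₂.comp (by fun_prop))

theorem contMDiff_spaceFrame (h : SpacePair 𝒢 a₁ a₂ a₃ b₁₂ b₁₃ b₂₃) :
    ContMDiff 𝓘(ℝ, ℝ × ℝ × ℝ) 𝓘(ℝ, VG) ∞ (spaceFrame G a₁ a₂) :=
  contMDiff_family h.contMDiff_leftFrame h.smooth₁

theorem logDeriv_spaceFrame (h : SpacePair 𝒢 a₁ a₂ a₃ b₁₂ b₁₃ b₂₃) (z : ℝ × ℝ × ℝ) :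
    logDeriv VG (spaceFrame G a₁ a₂) z (1, 0) = a₁ z :=
  logDeriv_solution_fst h.contMDiff_leftFrame h.smooth₁ z

theorem logDeriv_spaceFrame_left (h : SpacePair 𝒢 a₁ a₂ a₃ b₁₂ b₁₃ b₂₃) (q v : ℝ × ℝ) :
    logDeriv VG (spaceFrame G a₁ a₂) (0, q) (0, v) = logDeriv VG (leftFrame G a₂) q v := by
  rw [← logDeriv_comp_prodMk h.contMDiff_spaceFrame]
  have : (fun q => spaceFrame G a₁ a₂ (0, q)) = leftFrame G a₂ :=
    funext fun q => solution_zero _ h.smooth₁ q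
  rw [this]

theorem logDeriv_leftFrame (h : SpacePair 𝒢 a₁ a₂ a₃ b₁₂ b₁₃ b₂₃) (q : ℝ × ℝ) :
    logDeriv VG (leftFrame G a₂) q (1, 0) = a₂ (0, q) :=
  logDeriv_solution_fst contMDiff_const (h.smooth₂.comp (by fun_prop)) q

/-- The transport on the face `t = 0` is parallel in direction of `x`, since this face is flat. -/
theorem logDeriv_leftFrame_snd (h : SpacePair 𝒢 a₁ a₂ a₃ b₁₂ b₁₃ b₂₃) (q : ℝ × ℝ) :
    logDeriv VG (leftFrame G a₂) q (0, 1) = a₃ (0, q) := by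
  have h3 : ContDiff ℝ ∞ fun q : ℝ × ℝ => a₃ (0, q) := h.smooth₃.comp (by fun_prop)
  have key := defect_eq_integral 𝒢 h.contMDiff_leftFrame (a' := fun q => a₃ (0, q))
    (b := fun _ => 0) h3 contDiff_const h.logDeriv_leftFrame (w := (0, 1)) (fun z => by
      rw [fderiv_comp_prodMk (h.smooth₃.differentiable (by simp)),
        fderiv_comp_prodMk (h.smooth₂.differentiable (by simp)), ← h.left z.1 z.2]
      exact h.fake₂₃ (0, z)) (fun x => by
      have : (fun x => leftFrame G a₂ (0, x)) = fun _ => 1 :=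
        funext fun x => solution_zero _ (h.smooth₂.comp (by fun_prop)) x
      rw [← logDeriv_comp_prodMk h.contMDiff_leftFrame, this, logDeriv_const, h.edge]
      rfl) q
  simp only [map_zero, intervalIntegral.integral_zero] at key
  have := adj_injective (VG := VG) (leftFrame G a₂ q) (key.trans (map_zero _).symm)
  exact (sub_eq_zero.1 this).symm

/-- The integrals `∫₀ᵗ K ▷ bᵢ`. -/
def flux (𝒢 : LieCrossedModule VG G VE E) (a₁ a₂ : ℝ × ℝ × ℝ → VG) (b : ℝ × ℝ × ℝ → VE)
    (p : ℝ × ℝ × ℝ) : VE :=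
  ∫ τ in (0 : ℝ)..p.1, 𝒢.actLie (spaceFrame G a₁ a₂ (τ, p.2)) (b (τ, p.2))

theorem contDiff_flux (h : SpacePair 𝒢 a₁ a₂ a₃ b₁₂ b₁₃ b₂₃) {b : ℝ × ℝ × ℝ → VE}
    (hb : ContDiff ℝ ∞ b) : ContDiff ℝ ∞ (flux 𝒢 a₁ a₂ b) :=
  contDiff_integral (𝒢.contDiff_actLie_apply h.contMDiff_spaceFrame hb)

theorem fderiv_flux (h : SpacePair 𝒢 a₁ a₂ a₃ b₁₂ b₁₃ b₂₃) {b : ℝ × ℝ × ℝ → VE}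
    (hb : ContDiff ℝ ∞ b) (z : ℝ × ℝ × ℝ) :
    fderiv ℝ (flux 𝒢 a₁ a₂ b) z (1, 0) = 𝒢.actLie (spaceFrame G a₁ a₂ z) (b z) :=
  fderiv_integral_fst ((𝒢.contDiff_actLie_apply h.contMDiff_spaceFrame hb).of_le (by simp)) z

theorem defect₂ (h : SpacePair 𝒢 a₁ a₂ a₃ b₁₂ b₁₃ b₂₃) (p : ℝ × ℝ × ℝ) :
    adj VG G (spaceFrame G a₁ a₂ p) (a₂ p - logDeriv VG (spaceFrame G a₁ a₂) p (0, 1, 0)) =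
      𝒢.bdLie (flux 𝒢 a₁ a₂ b₁₂ p) :=
  defect_eq_integral 𝒢 h.contMDiff_spaceFrame h.smooth₂ h.smooth₁₂ h.logDeriv_spaceFrame h.fake₁₂
    (fun q => (h.logDeriv_spaceFrame_left q (1, 0)).trans (h.logDeriv_leftFrame q)) p

theorem defect₃ (h : SpacePair 𝒢 a₁ a₂ a₃ b₁₂ b₁₃ b₂₃) (p : ℝ × ℝ × ℝ) :
    adj VG G (spaceFrame G a₁ a₂ p) (a₃ p - logDeriv VG (spaceFrame G a₁ a₂) p (0, 0, 1)) =
      𝒢.bdLie (flux 𝒢 a₁ a₂ b₁₃ p) :=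
  defect_eq_integral 𝒢 h.contMDiff_spaceFrame h.smooth₃ h.smooth₁₃ h.logDeriv_spaceFrame h.fake₁₃
    (fun q => (h.logDeriv_spaceFrame_left q (0, 1)).trans (h.logDeriv_leftFrame_snd q)) p

/-- By the infinitesimal Peiffer identity, the fluxes act on `E` as `∂(η)` does, hence by the
failure of `K` to be parallel. -/
theorem adInf_flux {a : ℝ × ℝ × ℝ → VG}
    {b : ℝ × ℝ × ℝ → VE} {w p : ℝ × ℝ × ℝ}
    (hd : adj VG G (spaceFrame G a₁ a₂ p) (a p - logDeriv VG (spaceFrame G a₁ a₂) p w) =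
      𝒢.bdLie (flux 𝒢 a₁ a₂ b p)) (v : VE) :
    adInf VE E (flux 𝒢 a₁ a₂ b p) (𝒢.actLie (spaceFrame G a₁ a₂ p) v) =
      𝒢.actLie (spaceFrame G a₁ a₂ p) (𝒢.actInf (a p) v -
        𝒢.actInf (logDeriv VG (spaceFrame G a₁ a₂) p w) v) := by
  rw [← 𝒢.actInf_bdLie, ← hd, ← 𝒢.actLie_actInf, 𝒢.actInf_sub]
  rfl

/-- The fluxes `η₂`, `η₃` are the coefficients of a connection with curvature `K ▷ b₂₃`. -/
theorem curvature_flux (h : SpacePair 𝒢 a₁ a₂ a₃ b₁₂ b₁₃ b₂₃) (p : ℝ × ℝ × ℝ) :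
    fderiv ℝ (flux 𝒢 a₁ a₂ b₁₃) p (0, 1, 0) - fderiv ℝ (flux 𝒢 a₁ a₂ b₁₂) p (0, 0, 1) +
      adInf VE E (flux 𝒢 a₁ a₂ b₁₂ p) (flux 𝒢 a₁ a₂ b₁₃ p) =
      𝒢.actLie (spaceFrame G a₁ a₂ p) (b₂₃ p) := by
  set K := spaceFrame G a₁ a₂ with hKdef
  set η₂ := flux 𝒢 a₁ a₂ b₁₂ with hη₂
  set η₃ := flux 𝒢 a₁ a₂ b₁₃ with hη₃
  have hK : ContMDiff 𝓘(ℝ, ℝ × ℝ × ℝ) 𝓘(ℝ, VG) ∞ K := h.contMDiff_spaceFrame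
  have s₂ : ContDiff ℝ ∞ η₂ := h.contDiff_flux h.smooth₁₂
  have s₃ : ContDiff ℝ ∞ η₃ := h.contDiff_flux h.smooth₁₃
  have d₂ : ∀ z, fderiv ℝ η₂ z (1, 0) = 𝒢.actLie (K z) (b₁₂ z) := h.fderiv_flux h.smooth₁₂
  have d₃ : ∀ z, fderiv ℝ η₃ z (1, 0) = 𝒢.actLie (K z) (b₁₃ z) := h.fderiv_flux h.smooth₁₃
  have t₂ : ContDiff ℝ ∞ fun z => fderiv ℝ η₂ z (0, 0, 1) :=
    (s₂.fderiv_right (m := ∞) (by simp)).clm_apply contDiff_const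
  have t₃ : ContDiff ℝ ∞ fun z => fderiv ℝ η₃ z (0, 1, 0) :=
    (s₃.fderiv_right (m := ∞) (by simp)).clm_apply contDiff_const
  have t₁ : ContDiff ℝ ∞ fun z => adInf VE E (η₂ z) (η₃ z) :=
    ((adInf VE E).contDiff.comp s₂).clm_apply s₃
  have t₄ : ContDiff ℝ ∞ fun z => 𝒢.actLie (K z) (b₂₃ z) := 𝒢.contDiff_actLie_apply hK h.smooth₂₃
  have dt₁ : ∀ z v, fderiv ℝ (fun z => adInf VE E (η₂ z) (η₃ z)) z v =
      adInf VE E (fderiv ℝ η₂ z v) (η₃ z) + adInf VE E (η₂ z) (fderiv ℝ η₃ z v) := by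
    intro z v
    have e1 : HasFDerivAt (fun z => adInf VE E (η₂ z)) ((adInf VE E).comp (fderiv ℝ η₂ z)) z :=
      (adInf VE E).hasFDerivAt.comp z (s₂.differentiable (by simp) z).hasFDerivAt
    rw [(e1.clm_apply (s₃.differentiable (by simp) z).hasFDerivAt).fderiv]
    simp [add_comm]
  have ht : ContDiff ℝ ∞ fun z => fderiv ℝ η₃ z (0, 1, 0) - fderiv ℝ η₂ z (0, 0, 1) +
      adInf VE E (η₂ z) (η₃ z) - 𝒢.actLie (K z) (b₂₃ z) := ((t₃.sub t₂).add t₁).sub t₄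
  -- Both sides vanish for `t = 0`, and by `h.flat` they have the same derivative in the direction
  -- of `t`.
  refine sub_eq_zero.1 (eq_zero_of_fderiv_fst (F := fun z => fderiv ℝ η₃ z (0, 1, 0) -
    fderiv ℝ η₂ z (0, 0, 1) + adInf VE E (η₂ z) (η₃ z) - 𝒢.actLie (K z) (b₂₃ z))
    (ht.differentiable (by simp)) (fun z => ?_) (fun q => ?_) p)
  · rw [fderiv_fun_sub (((t₃.sub t₂).add t₁).differentiable (by simp) z)
        (t₄.differentiable (by simp) z), sub_apply,
      fderiv_fun_add ((t₃.sub t₂).differentiable (by simp) z) (t₁.differentiable (by simp) z),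
      add_apply, fderiv_fun_sub (t₃.differentiable (by simp) z)
        (t₂.differentiable (by simp) z), sub_apply,
      fderiv_fderiv_comm s₃, fderiv_fderiv_comm s₂, funext d₂, funext d₃, dt₁, d₂, d₃,
      𝒢.fderiv_actLie_apply hK h.smooth₁₂, 𝒢.fderiv_actLie_apply hK h.smooth₁₃,
      𝒢.fderiv_actLie_apply hK h.smooth₂₃, h.logDeriv_spaceFrame,
      adInf_antisymm (η₃ z), adInf_flux (h.defect₂ z), adInf_flux (h.defect₃ z),
      ← map_sub, ← map_neg, ← map_add, ← map_add, ← map_sub]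
    have := h.flat z
    refine Eq.trans (congrArg (𝒢.actLie (K z)) ?_) (map_zero (𝒢.actLie (K z)))
    rw [← neg_eq_zero] at this
    rw [← this]
    change _ = -(fderiv ℝ b₂₃ z (1, 0) - _ + _ + _)
    abel
  · have e₂ : ∀ q : ℝ × ℝ, η₂ (0, q) = 0 := fun q => intervalIntegral.integral_same
    have e₃ : ∀ q : ℝ × ℝ, η₃ (0, q) = 0 := fun q => intervalIntegral.integral_same
    have f₂ := fderiv_comp_prodMk (s₂.differentiable (by simp)) 0 q (0, 1)
    have f₃ := fderiv_comp_prodMk (s₃.differentiable (by simp)) 0 q (1, 0)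
    rw [funext e₂] at f₂
    rw [funext e₃] at f₃
    rw [← f₂, ← f₃, e₂, e₃, h.left q.1 q.2]
    simp

/-- The surface ordered exponential of the square `x = const` does not depend on `x`. -/
theorem planeExp_eq (h : SpacePair 𝒢 a₁ a₂ a₃ b₁₂ b₁₃ b₂₃) (x y : ℝ) :
    planeExp 𝒢 (fun p => a₁ (p.1, p.2, x)) (fun p => a₂ (p.1, p.2, x))
      (fun p => b₁₂ (p.1, p.2, x)) 1 1 =
    planeExp 𝒢 (fun p => a₁ (p.1, p.2, y)) (fun p => a₂ (p.1, p.2, y))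
      (fun p => b₁₂ (p.1, p.2, y)) 1 1 := by
  set η₂ : ℝ × ℝ → VE := fun q => flux 𝒢 a₁ a₂ b₁₂ (1, q) with hη₂
  set η₃ : ℝ × ℝ → VE := fun q => flux 𝒢 a₁ a₂ b₁₃ (1, q) with hη₃
  have s₂ : ContDiff ℝ ∞ η₂ := (h.contDiff_flux h.smooth₁₂).comp (by fun_prop)
  have s₃ : ContDiff ℝ ∞ η₃ := (h.contDiff_flux h.smooth₁₃).comp (by fun_prop)
  set e : ℝ × ℝ → E := solution (fun _ => 1) η₂ with he
  have hes : ContMDiff 𝓘(ℝ, ℝ × ℝ) 𝓘(ℝ, VE) ∞ e := contMDiff_family contMDiff_const s₂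
  have hed : ∀ z, logDeriv VE e z (1, 0) = η₂ z := logDeriv_solution_fst contMDiff_const s₂
  have hee : ∀ x, e (1, x) = planeExp 𝒢 (fun p => a₁ (p.1, p.2, x)) (fun p => a₂ (p.1, p.2, x))
      (fun p => b₁₂ (p.1, p.2, x)) 1 1 := by
    intro x
    change 1 * orderedExp E (fun s => flux 𝒢 a₁ a₂ b₁₂ (1, s, x)) 1 = _
    rw [one_mul]
    unfold planeExp
    congr 1
    funext s
    refine intervalIntegral.integral_congr fun τ _ => ?_
    dsimp only
    congr 2
    change (1 * _) * _ = _
    rw [one_mul]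
    rfl
  -- on the face `t = 1` the connection `(η₂, η₃)` is flat
  have hflat : ∀ q, fderiv ℝ η₃ q (1, 0) - fderiv ℝ η₂ q (0, 1) +
      adInf VE E (η₂ q) (η₃ q) = 0 := by
    intro q
    rw [fderiv_comp_prodMk ((h.contDiff_flux h.smooth₁₂).differentiable (by simp)),
      fderiv_comp_prodMk ((h.contDiff_flux h.smooth₁₃).differentiable (by simp))]
    rw [h.curvature_flux (1, q), h.right q.1 q.2, map_zero]
  have hD : ContDiff ℝ ∞ fun z => adj VE E (e z) (η₃ z - logDeriv VE e z (0, 1)) :=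
    contDiff_defect hes s₃ _
  -- hence `e`, which is parallel in the direction of `s`, is parallel in that of `x`: this holds
  -- for `s = 0`, and propagates by flatness
  have hz : ∀ q, logDeriv VE e q (0, 1) = η₃ q := by
    intro q
    have key := eq_zero_of_fderiv_fst
      (F := fun z => adj VE E (e z) (η₃ z - logDeriv VE e z (0, 1)))
      (hD.differentiable (by simp)) (fun z => by
        rw [fderiv_adj_sub_logDeriv hes (s₃.differentiable (by simp) z), hed, funext hed]
        rw [add_comm, add_sub_right_comm, hflat, map_zero]) (fun x => by
        have e0 : (fun x => e (0, x)) = fun _ => 1 := funext fun x => solution_zero _ s₂ x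
        have e1 : η₃ (0, x) = 0 := by
          change ∫ τ in (0 : ℝ)..1, 𝒢.actLie _ (b₁₃ (τ, 0, x)) = 0
          simp [h.down]
        rw [← logDeriv_comp_prodMk hes, e0, logDeriv_const, e1]
        simp) q
    have := adj_injective (VG := VE) (e q) (key.trans (map_zero _).symm)
    exact (sub_eq_zero.1 this).symm
  -- for `s = 1` the coefficient vanishes, and `e` is constant
  have hu : ∀ x, η₃ (1, x) = 0 := by
    intro x
    change ∫ τ in (0 : ℝ)..1, 𝒢.actLie _ (b₁₃ (τ, 1, x)) = 0
    simp [h.up]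
  have hv : ∀ x : ℝ, HasLogVelocity (fun x => e (1, x)) x (0 : VE) := by
    intro x
    have := hasLogVelocity_of_contMDiff hes (f := fun x => ((1 : ℝ), x)) (t := x)
      ((hasDerivAt_const _ _).prodMk (hasDerivAt_id x))
    rwa [hz, hu] at this
  rw [← hee, ← hee]
  refine congrFun (HasLogVelocity.eq_mul (c := fun x => e (1, x)) (d := fun _ => e (1, 0))
    (A := fun _ => (0 : VE)) hv (fun t => ?_) rfl) x |>.trans
    (congrFun (HasLogVelocity.eq_mul (c := fun x => e (1, x)) (d := fun _ => e (1, 0))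
    (A := fun _ => (0 : VE)) hv (fun t => ?_) rfl) y).symm <;>
  · unfold HasLogVelocity
    rw [ContinuousLinearMap.toSpanSingleton_zero]
    exact hasLogDeriv_const _ t

end SpacePair

end Space

/-! ### Local connection pairs along smooth maps -/

section PairAlong

variable {V : Type*} [NormedAddCommGroup V] [NormedSpace ℝ V]
  {N : Type*} [TopologicalSpace N] [ChartedSpace V N]
  {U : Type*} [NormedAddCommGroup U] [NormedSpace ℝ U]
  {U' : Type*} [NormedAddCommGroup U'] [NormedSpace ℝ U']

theorem tmap_comp {f : U → N} (hf : ContMDiff 𝓘(ℝ, U) 𝓘(ℝ, V) ∞ f) {φ : U' → U} {x : U'}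
    {L : U' →L[ℝ] U} (hφ : HasFDerivAt φ L x) {g : U' → N} (h : g =ᶠ[𝓝 x] fun x => f (φ x)) :
    tmap U' V g x = (tmap U V f (φ x)).comp L :=
  (((TDiff.hasTDeriv (tDiff_of_contMDiffAt hf.contMDiffAt (by simp))).comp
    (hasTDeriv_iff_hasFDerivAt.2 hφ) rfl).congr h).tmap_eq

theorem tmap_comp_apply {f : U → N} (hf : ContMDiff 𝓘(ℝ, U) 𝓘(ℝ, V) ∞ f) {φ : U' → U} {x : U'}
    {L : U' →L[ℝ] U} (hφ : HasFDerivAt φ L x) {g : U' → N} (h : g =ᶠ[𝓝 x] fun x => f (φ x))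
    (v : U') : tmap U' V g x v = tmap U V f (φ x) (L v) := by
  rw [tmap_comp hf hφ h]; rfl

variable {VG : Type*} [NormedAddCommGroup VG] [NormedSpace ℝ VG]
  {G : Type*} [TopologicalSpace G] [ChartedSpace VG G] [Group G]
  {VE : Type*} [NormedAddCommGroup VE] [NormedSpace ℝ VE]
  {E : Type*} [TopologicalSpace E] [ChartedSpace VE E] [Group E]
  {𝒢 : LieCrossedModule VG G VE E}

namespace LocalConnectionPair

/-- The value on the constant vector field `v` of the pullback of `A` under `f`. -/
def coeff₁ (c : LocalConnectionPair 𝒢 V N) (f : U → N) (v z : U) : VG :=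
  c.A (f z) ![tmap U V f z v]

/-- The value on the constant vector fields `v`, `w` of the pullback of `B` under `f`. -/
def coeff₂ (c : LocalConnectionPair 𝒢 V N) (f : U → N) (v w z : U) : VE :=
  c.B (f z) ![tmap U V f z v, tmap U V f z w]

variable (c : LocalConnectionPair 𝒢 V N)

theorem pathExp_eq (γ : OnePath V N) : c.pathExp γ = orderedExp G (c.coeff₁ γ.toFun 1) := rfl

theorem coeff₁_comp {f : U → N} (hf : ContMDiff 𝓘(ℝ, U) 𝓘(ℝ, V) ∞ f) {φ : U' → U} {x : U'}
    {L : U' →L[ℝ] U} (hφ : HasFDerivAt φ L x) {g : U' → N} (h : g =ᶠ[𝓝 x] fun x => f (φ x))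
    (v : U') : c.coeff₁ g v x = c.coeff₁ f (L v) (φ x) := by
  unfold coeff₁
  rw [tmap_comp_apply hf hφ h, h.eq_of_nhds]

theorem coeff₂_comp {f : U → N} (hf : ContMDiff 𝓘(ℝ, U) 𝓘(ℝ, V) ∞ f) {φ : U' → U} {x : U'}
    {L : U' →L[ℝ] U} (hφ : HasFDerivAt φ L x) {g : U' → N} (h : g =ᶠ[𝓝 x] fun x => f (φ x))
    (v w : U') : c.coeff₂ g v w x = c.coeff₂ f (L v) (L w) (φ x) := by
  unfold coeff₂
  rw [tmap_comp_apply hf hφ h, tmap_comp_apply hf hφ h, h.eq_of_nhds]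

theorem B_swap (x : N) (X Y : V) : c.B x ![X, Y] = -c.B x ![Y, X] := by
  have h := (c.B x).toAlternatingMap.map_swap ![Y, X] (i := 0) (j := 1) (by simp)
  have e : ![Y, X] ∘ Equiv.swap (0 : Fin 2) 1 = ![X, Y] := by
    funext i; fin_cases i <;> simp
  rw [e] at h
  exact h

theorem B_self (x : N) (X : V) : c.B x ![X, X] = 0 :=
  (c.B x).map_eq_zero_of_eq ![X, X] (i := 0) (j := 1) rfl (by simp)

theorem B_add_left (x : N) (X X' Y : V) :
    c.B x ![X + X', Y] = c.B x ![X, Y] + c.B x ![X', Y] := by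
  have := (c.B x).map_update_add ![X, Y] 0 X X'
  convert this using 2 <;> try congr 1
  all_goals (ext i; fin_cases i <;> simp)

theorem B_smul_left (x : N) (r : ℝ) (X Y : V) : c.B x ![r • X, Y] = r • c.B x ![X, Y] := by
  have := (c.B x).map_update_smul ![X, Y] 0 r X
  convert this using 2 <;> try congr 1
  all_goals (ext i; fin_cases i <;> simp)

theorem B_smul_right (x : N) (r : ℝ) (X Y : V) : c.B x ![X, r • Y] = r • c.B x ![X, Y] := by
  rw [c.B_swap, c.B_smul_left, ← smul_neg, ← c.B_swap]

theorem B_zero_left (x : N) (Y : V) : c.B x ![0, Y] = 0 := by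
  have := c.B_smul_left x 0 0 Y
  rwa [zero_smul, zero_smul] at this

theorem A_zero (x : N) : c.A x ![0] = 0 := by
  have := (c.A x).map_coord_zero (m := ![0]) 0 rfl
  exact this

theorem A_add (x : N) (X Y : V) : c.A x ![X + Y] = c.A x ![X] + c.A x ![Y] := by
  have := (c.A x).map_update_add ![X] 0 X Y
  convert this using 2 <;> try congr 1
  all_goals (ext i; fin_cases i; simp)

theorem A_smul (x : N) (r : ℝ) (X : V) : c.A x ![r • X] = r • c.A x ![X] := by
  have := (c.A x).map_update_smul ![X] 0 r X
  convert this using 2 <;> try congr 1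
  all_goals (ext i; fin_cases i; simp)

theorem coeff₁_smul (f : U → N) (r : ℝ) (v z : U) :
    c.coeff₁ f (r • v) z = r • c.coeff₁ f v z := by
  unfold coeff₁
  rw [map_smul, A_smul]

theorem coeff₂_swap (f : U → N) (v w z : U) : c.coeff₂ f v w z = -c.coeff₂ f w v z :=
  c.B_swap _ _ _

section Smooth

variable [IsManifold 𝓘(ℝ, V) ∞ N]

theorem contDiff_coeff₁ {f : U → N} (hf : ContMDiff 𝓘(ℝ, U) 𝓘(ℝ, V) ∞ f) (v : U) :
    ContDiff ℝ ∞ (c.coeff₁ f v) := by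
  have := c.A_smooth.contDiff_pullback_apply hf ![v]
  simp only [DiffForm.pullback_one] at this
  exact this

theorem contDiff_coeff₂ {f : U → N} (hf : ContMDiff 𝓘(ℝ, U) 𝓘(ℝ, V) ∞ f) (v w : U) :
    ContDiff ℝ ∞ (c.coeff₂ f v w) := by
  have := c.B_smooth.contDiff_pullback_apply hf ![v, w]
  simp only [DiffForm.pullback_two] at this
  exact this

variable [FiniteDimensional ℝ VG] [LieGroup 𝓘(ℝ, VG) ∞ G]

/-- The vanishing of the fake curvature, for the coefficients of the pulled back forms. -/
theorem fake_coeff {f : U → N} (hf : ContMDiff 𝓘(ℝ, U) 𝓘(ℝ, V) ∞ f) (v w z : U) :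
    fderiv ℝ (c.coeff₁ f w) z v - fderiv ℝ (c.coeff₁ f v) z w +
      adInf VG G (c.coeff₁ f v z) (c.coeff₁ f w z) = 𝒢.bdLie (c.coeff₂ f v w z) := by
  have h := c.fake (f z) (tmap U V f z v) (tmap U V f z w)
  unfold curvature at h
  rw [c.A_smooth.d_apply_two hf] at h
  rw [adInf_eq_lieBr]
  exact h.symm

end Smooth

end LocalConnectionPair

theorem TwoPath.velocity_hslice (Γ : TwoPath V N) (t s : ℝ) :
    velocity V (Γ.hslice s) t = Γ.dt t s := by
  have := tmap_comp_apply Γ.smooth (φ := fun t : ℝ => (t, s)) (x := t)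
    (hasFDerivAt_prodMk_left t s) (g := (Γ.hslice s).toFun) EventuallyEq.rfl 1
  exact this

theorem TwoPath.velocity_vslice (Γ : TwoPath V N) (t s : ℝ) :
    velocity V (Γ.vslice t) s = Γ.ds t s := by
  have := tmap_comp_apply Γ.smooth (φ := fun s : ℝ => (t, s)) (x := s)
    (hasFDerivAt_prodMk_right t s) (g := (Γ.vslice t).toFun) EventuallyEq.rfl 1
  exact this

namespace LocalConnectionPair

variable (c : LocalConnectionPair 𝒢 V N)

theorem pathExp_hslice (Γ : TwoPath V N) (s : ℝ) :
    c.pathExp (Γ.hslice s) = orderedExp G fun t => c.coeff₁ Γ.toFun (1, 0) (t, s) := by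
  unfold pathExp
  simp only [Γ.velocity_hslice]
  rfl

theorem pathExp_vslice (Γ : TwoPath V N) (t : ℝ) :
    c.pathExp (Γ.vslice t) = orderedExp G fun s => c.coeff₁ Γ.toFun (0, 1) (t, s) := by
  unfold pathExp
  simp only [Γ.velocity_vslice]
  rfl

theorem pathExp_mul_pathExp (Γ : TwoPath V N) (t s : ℝ) :
    c.pathExp Γ.left s * c.pathExp (Γ.hslice s) t =
      frame G (c.coeff₁ Γ.toFun (1, 0)) (c.coeff₁ Γ.toFun (0, 1)) (t, s) := by
  unfold TwoPath.left
  rw [pathExp_hslice, pathExp_vslice]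
  rfl

theorem surfaceExpAt_eq (Γ : TwoPath V N) (t s : ℝ) :
    c.surfaceExpAt Γ t s = planeExp 𝒢 (c.coeff₁ Γ.toFun (1, 0)) (c.coeff₁ Γ.toFun (0, 1))
      (c.coeff₂ Γ.toFun (1, 0) (0, 1)) t s := by
  unfold surfaceExpAt
  simp only [pathExp_mul_pathExp]
  rfl

end LocalConnectionPair

end PairAlong

/-! ### Path and surface ordered exponentials -/

section Consequences

variable {V : Type*} [NormedAddCommGroup V] [NormedSpace ℝ V]
  {N : Type*} [TopologicalSpace N] [ChartedSpace V N] [IsManifold 𝓘(ℝ, V) ∞ N]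
  {U : Type*} [NormedAddCommGroup U] [NormedSpace ℝ U]
  {VG : Type*} [NormedAddCommGroup VG] [NormedSpace ℝ VG] [FiniteDimensional ℝ VG]
  {G : Type*} [TopologicalSpace G] [ChartedSpace VG G] [Group G]
  [LieGroup 𝓘(ℝ, VG) ∞ G]
  {VE : Type*} [NormedAddCommGroup VE] [NormedSpace ℝ VE] [FiniteDimensional ℝ VE]
  {E : Type*} [TopologicalSpace E] [ChartedSpace VE E] [Group E]
  [LieGroup 𝓘(ℝ, VE) ∞ E]
  {𝒢 : LieCrossedModule VG G VE E}

namespace LocalConnectionPair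

variable (c : LocalConnectionPair 𝒢 V N)

theorem continuous_coeff_path (γ : OnePath V N) : Continuous (c.coeff₁ γ.toFun 1) :=
  (c.contDiff_coeff₁ γ.smooth 1).continuous

theorem planePair (Γ : TwoPath V N) : PlanePair 𝒢 (c.coeff₁ Γ.toFun (1, 0))
    (c.coeff₁ Γ.toFun (0, 1)) (c.coeff₂ Γ.toFun (1, 0) (0, 1)) :=
  ⟨c.contDiff_coeff₁ Γ.smooth _, c.contDiff_coeff₁ Γ.smooth _, c.contDiff_coeff₂ Γ.smooth _ _,
    fun z => c.fake_coeff Γ.smooth _ _ z⟩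

theorem coeff₁_transp (Γ : TwoPath V N) (v : ℝ × ℝ) :
    c.coeff₁ Γ.transp.toFun v = fun p => c.coeff₁ Γ.toFun v.swap p.swap := by
  funext p
  exact c.coeff₁_comp Γ.smooth (φ := Prod.swap)
    (hasFDerivAt_snd.prodMk hasFDerivAt_fst) EventuallyEq.rfl v

theorem coeff₂_transp (Γ : TwoPath V N) (v w : ℝ × ℝ) :
    c.coeff₂ Γ.transp.toFun v w = fun p => c.coeff₂ Γ.toFun v.swap w.swap p.swap := by
  funext p
  exact c.coeff₂_comp Γ.smooth (φ := Prod.swap)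
    (hasFDerivAt_snd.prodMk hasFDerivAt_fst) EventuallyEq.rfl v w

theorem surfaceExp_transp (Γ : TwoPath V N) : c.surfaceExp Γ.transp = (c.surfaceExp Γ)⁻¹ := by
  unfold surfaceExp
  rw [surfaceExpAt_eq, surfaceExpAt_eq, ← (c.planePair Γ).planeExp_swap, coeff₁_transp,
    coeff₁_transp, coeff₂_transp]
  congr 1
  funext p
  exact c.coeff₂_swap _ _ _ _

/-- The boundary condition of the square of a 2-path. -/
theorem surfaceExp_comm (Γ : TwoPath V N) :
    (𝒢.bd (c.surfaceExp Γ))⁻¹ * c.pathExp Γ.down 1 * c.pathExp Γ.right 1 =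
      c.pathExp Γ.left 1 * c.pathExp Γ.up 1 := by
  have h := (c.planePair Γ).bd_planeExp_mul_frame 1 1
  have h1 := c.pathExp_mul_pathExp Γ 1 1
  have h2 := c.pathExp_mul_pathExp Γ.transp 1 1
  rw [coeff₁_transp, coeff₁_transp] at h2
  rw [← surfaceExpAt_eq] at h
  rw [mul_assoc, inv_mul_eq_iff_eq_mul]
  refine Eq.trans ?_ (congrArg (fun g => 𝒢.bd (c.surfaceExp Γ) * g) h1.symm)
  exact h2.trans h.symm

theorem pathExp_const (x : N) (t : ℝ) : c.pathExp (OnePath.const x) t = 1 := by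
  have : (c.coeff₁ (OnePath.const (V := V) x).toFun 1 : ℝ → VG) = fun _ => 0 := by
    funext t
    have : tmap ℝ V (fun _ : ℝ => x) t = 0 := (hasTDeriv_const x t).tmap_eq
    change c.A x ![tmap ℝ V (fun _ : ℝ => x) t 1] = 0
    rw [this]
    exact c.A_zero x
  rw [pathExp_eq, this, orderedExp_zero]

theorem pathExp_rev (γ γ' : OnePath V N) (h : ∀ t, γ' t = γ (1 - t)) (t : ℝ) :
    c.pathExp γ' t = (c.pathExp γ 1)⁻¹ * c.pathExp γ (1 - t) := by
  refine orderedExp_rev (c.continuous_coeff_path γ) (fun t => ?_) t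
  refine (c.coeff₁_comp γ.smooth (φ := fun t : ℝ => 1 - t)
    (((hasDerivAt_id t).const_sub 1).hasFDerivAt) (g := γ'.toFun)
    (Eventually.of_forall h) (1 : ℝ)).trans ?_
  simp only [ContinuousLinearMap.toSpanSingleton_apply]
  rw [coeff₁_smul, one_smul]
  rw [← neg_one_smul ℝ (1 : ℝ), coeff₁_smul, neg_one_smul]

theorem coeff₁_concat_left (γ φ : OnePath V N) (h : γ 1 = φ 0) {t : ℝ} (ht : t < 1 / 2) :
    c.coeff₁ (γ.concat φ h).toFun 1 t = (2 : ℝ) • c.coeff₁ γ.toFun 1 (2 * t) := by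
  rw [← coeff₁_smul]
  refine (c.coeff₁_comp γ.smooth (φ := fun t : ℝ => 2 * t)
    (L := (2 : ℝ) • ContinuousLinearMap.id ℝ ℝ)
    ((hasFDerivAt_id t).const_mul 2) ?_ (1 : ℝ)).trans (by simp)
  filter_upwards [Iio_mem_nhds ht] with x hx
  exact if_pos (le_of_lt hx)

theorem coeff₁_concat_right (γ φ : OnePath V N) (h : γ 1 = φ 0) {t : ℝ} (ht : 1 / 2 < t) :
    c.coeff₁ (γ.concat φ h).toFun 1 t = (2 : ℝ) • c.coeff₁ φ.toFun 1 (2 * t - 1) := by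
  rw [← coeff₁_smul]
  refine (c.coeff₁_comp φ.smooth (φ := fun t : ℝ => 2 * t - 1)
    (L := (2 : ℝ) • ContinuousLinearMap.id ℝ ℝ)
    (((hasFDerivAt_id t).const_mul 2).sub_const 1) ?_ (1 : ℝ)).trans (by simp)
  filter_upwards [Ioi_mem_nhds ht] with x hx
  exact if_neg (not_le.2 hx)

theorem pathExp_concat_left [T2Space G] (γ φ : OnePath V N) (h : γ 1 = φ 0) {t : ℝ}
    (ht : t ≤ 1 / 2) : c.pathExp (γ.concat φ h) t = c.pathExp γ (2 * t) :=
  orderedExp_concat_left (c.continuous_coeff_path γ) (c.continuous_coeff_path _)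
    (fun _ => c.coeff₁_concat_left γ φ h) ht

theorem pathExp_concat_right [T2Space G] (γ φ : OnePath V N) (h : γ 1 = φ 0) {t : ℝ}
    (ht : 1 / 2 ≤ t) : c.pathExp (γ.concat φ h) t = c.pathExp γ 1 * c.pathExp φ (2 * t - 1) :=
  orderedExp_concat_right (c.continuous_coeff_path γ) (c.continuous_coeff_path φ)
    (c.continuous_coeff_path _) (fun _ => c.coeff₁_concat_left γ φ h)
    (fun _ => c.coeff₁_concat_right γ φ h) ht

theorem pathExp_concat [T2Space G] (γ φ : OnePath V N) (h : γ 1 = φ 0) :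
    c.pathExp (γ.concat φ h) 1 = c.pathExp γ 1 * c.pathExp φ 1 := by
  rw [c.pathExp_concat_right γ φ h (by norm_num)]
  norm_num

/-- The integrand of the surface ordered exponential: the transported flux of `B` through the
path `γ_s`. -/
def flux (Γ : TwoPath V N) (s : ℝ) : VE :=
  ∫ t in (0 : ℝ)..1, 𝒢.actLie (c.pathExp Γ.left s * c.pathExp (Γ.hslice s) t)
    (c.coeff₂ Γ.toFun (1, 0) (0, 1) (t, s))

theorem surfaceExp_eq (Γ : TwoPath V N) : c.surfaceExp Γ = orderedExp E (c.flux Γ) 1 := rfl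

theorem continuous_flux (Γ : TwoPath V N) : Continuous (c.flux Γ) := by
  unfold flux
  simp only [pathExp_mul_pathExp]
  exact (c.planePair Γ).continuous_flux 1

theorem surfaceExp_eq_one (Γ : TwoPath V N) (h : ∀ p, c.coeff₂ Γ.toFun (1, 0) (0, 1) p = 0) :
    c.surfaceExp Γ = 1 := by
  have : c.flux Γ = fun _ => 0 := by
    funext s
    unfold flux
    simp only [h, map_zero, intervalIntegral.integral_zero]
  rw [surfaceExp_eq, this, orderedExp_zero]

variable {c} in
/-- The surface ordered exponential of a piece of `Γ''` that is obtained from `Γ` by a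
change of the second coordinate. -/
theorem flux_eq_smul {Γ Γ'' : TwoPath V N} {s r s' : ℝ} {g : G}
    {φ : ℝ → ℝ} (hφ : HasDerivAt φ r s) (hs : φ s = s')
    (h : ∀ᶠ σ in 𝓝 s, ∀ t, Γ'' (t, σ) = Γ (t, φ σ))
    (hg : c.pathExp Γ''.left s = g * c.pathExp Γ.left s') :
    c.flux Γ'' s = r • 𝒢.actLie g (c.flux Γ s') := by
  subst hs
  have hslice : Γ''.hslice s = Γ.hslice (φ s) := by
    ext t; exact h.self_of_nhds t
  unfold flux
  rw [← ContinuousLinearMap.intervalIntegral_comp_comm, ← intervalIntegral.integral_smul]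
  · congr 1
    funext t
    have hd : HasFDerivAt (fun p : ℝ × ℝ => (p.1, φ p.2)) ((ContinuousLinearMap.fst ℝ ℝ ℝ).prod
        ((ContinuousLinearMap.toSpanSingleton ℝ r).comp (ContinuousLinearMap.snd ℝ ℝ ℝ))) (t, s) :=
      hasFDerivAt_fst.prodMk
        (HasFDerivAt.comp (g := φ) (t, s) hφ.hasFDerivAt hasFDerivAt_snd)
    have hev : Γ''.toFun =ᶠ[𝓝 (t, s)] fun p => Γ.toFun (p.1, φ p.2) := by
      filter_upwards [continuous_snd.continuousAt.eventually h] with p hp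
      exact hp p.1
    rw [c.coeff₂_comp Γ.smooth hd hev, hslice, hg, mul_assoc, 𝒢.actLie_mul]
    have e1 : ((ContinuousLinearMap.fst ℝ ℝ ℝ).prod
        ((ContinuousLinearMap.toSpanSingleton ℝ r).comp (ContinuousLinearMap.snd ℝ ℝ ℝ)))
        ((1, 0) : ℝ × ℝ) = (1, 0) := by simp
    have e2 : ((ContinuousLinearMap.fst ℝ ℝ ℝ).prod
        ((ContinuousLinearMap.toSpanSingleton ℝ r).comp (ContinuousLinearMap.snd ℝ ℝ ℝ)))
        ((0, 1) : ℝ × ℝ) = r • ((0, 1) : ℝ × ℝ) := by simp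
    rw [e1, e2]
    have e3 : c.coeff₂ Γ.toFun (1, 0) (r • (0, 1)) (t, φ s) =
        r • c.coeff₂ Γ.toFun (1, 0) (0, 1) (t, φ s) := by
      unfold coeff₂
      rw [map_smul]
      exact c.B_smul_right _ _ _ _
    rw [e3, map_smul]
    rfl
  · have : Continuous fun t : ℝ => 𝒢.actLie (c.pathExp Γ.left (φ s) * c.pathExp (Γ.hslice (φ s)) t)
        (c.coeff₂ Γ.toFun (1, 0) (0, 1) (t, φ s)) := by
      simp only [pathExp_mul_pathExp]
      exact (c.planePair Γ).contDiff_transported.continuous.comp (by fun_prop)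
    exact this.intervalIntegrable _ _

theorem surfaceExp_vconcat [T2Space G] [T2Space E] (Γ Γ' : TwoPath V N) (h : Γ.up = Γ'.down) :
    c.surfaceExp (Γ.vconcat Γ' h) =
      c.surfaceExp Γ * 𝒢.act (c.pathExp Γ.left 1) (c.surfaceExp Γ') := by
  have hl : Γ.left 1 = Γ'.left 0 := congrArg (fun γ : OnePath V N => γ 0) h
  have hleft : (Γ.vconcat Γ' h).left = Γ.left.concat Γ'.left hl := rfl
  rw [surfaceExp_eq, surfaceExp_eq, surfaceExp_eq, ← orderedExp_act 𝒢 (c.continuous_flux Γ'),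
    orderedExp_concat_right (A := c.flux Γ)
      (A' := fun s => 𝒢.actLie (c.pathExp Γ.left 1) (c.flux Γ' s)) (c.continuous_flux Γ)
      ((𝒢.actLie _).continuous.comp (c.continuous_flux Γ')) (c.continuous_flux _) _ _
      (by norm_num : (1 / 2 : ℝ) ≤ 1)]
  · norm_num
  · intro s hs
    have := flux_eq_smul (c := c) (Γ := Γ) (Γ'' := Γ.vconcat Γ' h) (s := s) (r := 2) (g := 1)
      (φ := fun s => 2 * s) (by simpa using (hasDerivAt_id s).const_mul (2 : ℝ)) rfl
      (by filter_upwards [Iio_mem_nhds hs] with σ hσ t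
          exact if_pos (le_of_lt hσ))
      (by rw [hleft, one_mul]; exact c.pathExp_concat_left _ _ hl hs.le)
    rw [this, 𝒢.actLie_one]
    rfl
  · intro s hs
    exact flux_eq_smul (c := c) (Γ := Γ') (Γ'' := Γ.vconcat Γ' h) (s := s) (r := 2)
      (φ := fun s => 2 * s - 1)
      (by simpa using ((hasDerivAt_id s).const_mul (2 : ℝ)).sub_const 1) rfl
      (by filter_upwards [Ioi_mem_nhds hs] with σ hσ t
          exact if_neg (not_le.2 hσ))
      (by rw [hleft]; exact c.pathExp_concat_right _ _ hl hs.le)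

theorem surfaceExp_hconcat [T2Space G] [T2Space E] (Γ Γ' : TwoPath V N) (h : Γ.right = Γ'.left) :
    c.surfaceExp (Γ.hconcat Γ' h) =
      𝒢.act (c.pathExp Γ.down 1) (c.surfaceExp Γ') * c.surfaceExp Γ := by
  have h' : Γ.transp.up = Γ'.transp.down := h
  have h1 : Γ.hconcat Γ' h = (Γ.transp.vconcat Γ'.transp h').transp := rfl
  rw [h1, surfaceExp_transp, surfaceExp_vconcat, surfaceExp_transp, surfaceExp_transp]
  have h2 : Γ.transp.left = Γ.down := rfl
  rw [h2, mul_inv_rev, inv_inv, map_inv (𝒢.act _), inv_inv]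

theorem surfaceExp_vrev (Γ : TwoPath V N) :
    c.surfaceExp Γ.vrev = 𝒢.act (c.pathExp Γ.left 1)⁻¹ (c.surfaceExp Γ)⁻¹ := by
  have hl := c.pathExp_rev Γ.left Γ.vrev.left (fun _ => rfl)
  have hf : c.flux Γ.vrev =
      fun s => 𝒢.actLie (c.pathExp Γ.left 1)⁻¹ ((-1 : ℝ) • c.flux Γ (1 - s)) := by
    funext s
    rw [map_smul]
    exact flux_eq_smul (c := c) (Γ := Γ) (Γ'' := Γ.vrev) (s := s) (r := -1)
      (φ := fun s => 1 - s) ((hasDerivAt_id s).const_sub 1) rfl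
      (Eventually.of_forall fun σ t => rfl) (hl s)
  have hc := c.continuous_flux Γ
  rw [surfaceExp_eq, hf, orderedExp_act 𝒢 (A := fun s => (-1 : ℝ) • c.flux Γ (1 - s))
    (by fun_prop), orderedExp_rev hc (fun s => neg_one_smul ℝ _), sub_self,
    orderedExp_zero_right hc, mul_one, surfaceExp_eq]

/-- A thin 2-path with constant left and right faces does not change the path ordered
exponential. -/
theorem pathExp_eq_of_coeff₂ (Γ : TwoPath V N)
    (h : ∀ p, c.coeff₂ Γ.toFun (1, 0) (0, 1) p = 0)
    (hl : ∀ s, Γ.left s = Γ.left 0) (hr : ∀ s, Γ.right s = Γ.right 0) :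
    c.pathExp Γ.down 1 = c.pathExp Γ.up 1 := by
  have h1 := c.surfaceExp_comm Γ
  have h2 : Γ.left = OnePath.const (Γ.left 0) := by ext s; exact hl s
  have h3 : Γ.right = OnePath.const (Γ.right 0) := by ext s; exact hr s
  rw [c.surfaceExp_eq_one Γ h, h2, h3, pathExp_const, pathExp_const] at h1
  simpa using h1

end LocalConnectionPair

end Consequences

/-! ### Invariance of surface ordered exponentials under homotopy -/

section Rank

variable {V : Type*} [NormedAddCommGroup V] [NormedSpace ℝ V]
  {N : Type*} [TopologicalSpace N] [ChartedSpace V N]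
  {U : Type*} [NormedAddCommGroup U] [NormedSpace ℝ U] [FiniteDimensional ℝ U]

theorem RankLE.exists_tmap_eq_zero {k : ℕ} {f : U → N} (hf : RankLE (V := V) k f)
    (hk : k < Module.finrank ℝ U) (z : U) : ∃ v ≠ 0, tmap U V f z v = 0 := by
  by_contra! h
  have hi : LinearMap.ker (tmap U V f z : U →ₗ[ℝ] V) = ⊥ :=
    LinearMap.ker_eq_bot'.2 fun v hv => by_contra fun hv0 => h v hv0 hv
  have h1 := LinearMap.finrank_range_add_finrank_ker (tmap U V f z : U →ₗ[ℝ] V)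
  rw [hi, finrank_bot] at h1
  have := hf z
  omega

end Rank

section Homotopy

variable {V : Type*} [NormedAddCommGroup V] [NormedSpace ℝ V]
  {N : Type*} [TopologicalSpace N] [ChartedSpace V N]
  {U : Type*} [NormedAddCommGroup U] [NormedSpace ℝ U]
  {VG : Type*} [NormedAddCommGroup VG] [NormedSpace ℝ VG] [FiniteDimensional ℝ VG]
  {G : Type*} [TopologicalSpace G] [ChartedSpace VG G] [Group G]
  [LieGroup 𝓘(ℝ, VG) ∞ G]
  {VE : Type*} [NormedAddCommGroup VE] [NormedSpace ℝ VE] [FiniteDimensional ℝ VE]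
  {E : Type*} [TopologicalSpace E] [ChartedSpace VE E] [Group E]
  [LieGroup 𝓘(ℝ, VE) ∞ E]
  {𝒢 : LieCrossedModule VG G VE E}

namespace LocalConnectionPair

variable (c : LocalConnectionPair 𝒢 V N)

/-- A 2-form vanishes on the image of a plane if it is annihilated by the image of a nonzero vector.
-/
theorem coeff₂_eq_zero {f : ℝ × ℝ → N} {z v : ℝ × ℝ} (hv : v ≠ 0)
    (h : ∀ Y, c.B (f z) ![tmap (ℝ × ℝ) V f z v, Y] = 0) :
    c.coeff₂ f (1, 0) (0, 1) z = 0 := by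
  unfold coeff₂
  set X := tmap (ℝ × ℝ) V f z (1, 0) with hX
  set Y := tmap (ℝ × ℝ) V f z (0, 1) with hY
  have e : tmap (ℝ × ℝ) V f z v = v.1 • X + v.2 • Y := by
    rw [hX, hY, ← map_smul, ← map_smul, ← map_add]
    congr 1
    ext <;> simp
  have h' : ∀ Z, v.1 • c.B (f z) ![X, Z] + v.2 • c.B (f z) ![Y, Z] = 0 := fun Z => by
    rw [← c.B_smul_left, ← c.B_smul_left, ← c.B_add_left, ← e, h]
  by_cases h1 : v.1 = 0
  · have h2 : v.2 ≠ 0 := fun h2 => hv (Prod.ext h1 h2)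
    have h3 := h' X
    rw [c.B_self, smul_zero, zero_add] at h3
    rw [c.B_swap, (smul_eq_zero.1 h3).resolve_left h2, neg_zero]
  · have h3 := h' Y
    rw [c.B_self, smul_zero, add_zero] at h3
    exact (smul_eq_zero.1 h3).resolve_left h1

theorem coeff₂_eq_zero_of_rank {f : ℝ × ℝ → N} (hf : RankLE (V := V) 1 f) (z : ℝ × ℝ) :
    c.coeff₂ f (1, 0) (0, 1) z = 0 := by
  obtain ⟨v, hv, h⟩ := hf.exists_tmap_eq_zero (by simp) z
  refine c.coeff₂_eq_zero hv fun Y => ?_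
  rw [h, c.B_zero_left]

/-- The curvature 3-form `dB + A ∧^▷ B` of a local connection pair. -/
def curv₃ (x : N) (X Y Z : V) : VE :=
  c.B.d x ![X, Y, Z] + (𝒢.actInf (c.A x ![X]) (c.B x ![Y, Z]) -
    𝒢.actInf (c.A x ![Y]) (c.B x ![X, Z]) + 𝒢.actInf (c.A x ![Z]) (c.B x ![X, Y]))

theorem curv₃_add_left (x : N) (X X' Y Z : V) :
    c.curv₃ x (X + X') Y Z = c.curv₃ x X Y Z + c.curv₃ x X' Y Z := by
  have h := (c.B.d x).toAlternatingMap.map_update_add ![X, Y, Z] 0 X X'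
  have e : ∀ W : V, Function.update ![X, Y, Z] 0 W = ![W, Y, Z] := fun W => by
    funext i; fin_cases i <;> simp
  rw [e, e, e] at h
  have h' : c.B.d x ![X + X', Y, Z] = c.B.d x ![X, Y, Z] + c.B.d x ![X', Y, Z] := h
  unfold curv₃
  rw [h', c.A_add, c.B_add_left, c.B_add_left, 𝒢.actInf_add, map_add, map_add]
  simp only [add_apply]
  abel

theorem curv₃_smul_left (x : N) (r : ℝ) (X Y Z : V) :
    c.curv₃ x (r • X) Y Z = r • c.curv₃ x X Y Z := by
  have h := (c.B.d x).toAlternatingMap.map_update_smul ![X, Y, Z] 0 r X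
  have e : ∀ W : V, Function.update ![X, Y, Z] 0 W = ![W, Y, Z] := fun W => by
    funext i; fin_cases i <;> simp
  rw [e, e] at h
  have h' : c.B.d x ![r • X, Y, Z] = r • c.B.d x ![X, Y, Z] := h
  unfold curv₃
  rw [h', c.A_smul, c.B_smul_left, c.B_smul_left, 𝒢.actInf_smul, map_smul, map_smul, smul_add,
    smul_add, smul_sub]
  rfl

theorem curv₃_zero_left (x : N) (Y Z : V) : c.curv₃ x 0 Y Z = 0 := by
  have := c.curv₃_smul_left x 0 0 Y Z
  rwa [zero_smul, zero_smul] at this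

theorem curv₃_swap_left (x : N) (X Y Z : V) : c.curv₃ x Y X Z = -c.curv₃ x X Y Z := by
  have h := (c.B.d x).toAlternatingMap.map_swap ![X, Y, Z] (i := 0) (j := 1) (by simp)
  have e : ![X, Y, Z] ∘ Equiv.swap (0 : Fin 3) 1 = ![Y, X, Z] := by
    funext i; fin_cases i <;> rfl
  rw [e] at h
  have h' : c.B.d x ![Y, X, Z] = -c.B.d x ![X, Y, Z] := h
  unfold curv₃
  rw [h', c.B_swap x Y X, map_neg]
  abel

theorem curv₃_swap_right (x : N) (X Y Z : V) : c.curv₃ x X Z Y = -c.curv₃ x X Y Z := by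
  have h := (c.B.d x).toAlternatingMap.map_swap ![X, Y, Z] (i := 1) (j := 2) (by simp)
  have e : ![X, Y, Z] ∘ Equiv.swap (1 : Fin 3) 2 = ![X, Z, Y] := by
    funext i; fin_cases i <;> rfl
  rw [e] at h
  have h' : c.B.d x ![X, Z, Y] = -c.B.d x ![X, Y, Z] := h
  unfold curv₃
  rw [h', c.B_swap x Z Y, map_neg]
  abel

theorem curv₃_self_left (x : N) (X Z : V) : c.curv₃ x X X Z = 0 := by
  have h : c.curv₃ x X X Z + c.curv₃ x X X Z = 0 := by
    nth_rewrite 1 [c.curv₃_swap_left x X X Z]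
    exact neg_add_cancel _
  rw [← two_smul ℝ] at h
  exact (smul_eq_zero.1 h).resolve_left two_ne_zero

theorem curv₃_self_right (x : N) (X Y : V) : c.curv₃ x X Y X = 0 := by
  rw [c.curv₃_swap_right, c.curv₃_self_left, neg_zero]

/-- The curvature 3-form vanishes on a triple of vectors if it is annihilated by a nontrivial
combination of them. -/
theorem curv₃_eq_zero {x : N} {X₁ X₂ X₃ : V} {r₁ r₂ r₃ : ℝ} (hr : (r₁, r₂, r₃) ≠ 0)
    (h₁ : c.curv₃ x (r₁ • X₁ + r₂ • X₂ + r₃ • X₃) X₂ X₃ = 0)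
    (h₂ : c.curv₃ x (r₁ • X₁ + r₂ • X₂ + r₃ • X₃) X₁ X₃ = 0)
    (h₃ : c.curv₃ x (r₁ • X₁ + r₂ • X₂ + r₃ • X₃) X₁ X₂ = 0) : c.curv₃ x X₁ X₂ X₃ = 0 := by
  simp only [curv₃_add_left, curv₃_smul_left, curv₃_self_left, curv₃_self_right, smul_zero,
    add_zero, zero_add] at h₁ h₂ h₃
  rw [c.curv₃_swap_left, smul_neg, neg_eq_zero] at h₂
  rw [c.curv₃_swap_left _ X₁ X₃, c.curv₃_swap_right, neg_neg] at h₃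
  by_contra h
  have e₁ := (smul_eq_zero.1 h₁).resolve_right h
  have e₂ := (smul_eq_zero.1 h₂).resolve_right h
  have e₃ := (smul_eq_zero.1 h₃).resolve_right h
  exact hr (by rw [e₁, e₂, e₃]; rfl)

variable [IsManifold 𝓘(ℝ, V) ∞ N]

/-- The curvature 3-form in terms of the coefficients of the pulled back forms. -/
theorem curv₃_tmap {f : U → N} (hf : ContMDiff 𝓘(ℝ, U) 𝓘(ℝ, V) ∞ f) (z u v w : U) :
    c.curv₃ (f z) (tmap U V f z u) (tmap U V f z v) (tmap U V f z w) =
      fderiv ℝ (c.coeff₂ f v w) z u - fderiv ℝ (c.coeff₂ f u w) z v +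
        fderiv ℝ (c.coeff₂ f u v) z w +
      (𝒢.actInf (c.coeff₁ f u z) (c.coeff₂ f v w z) -
        𝒢.actInf (c.coeff₁ f v z) (c.coeff₂ f u w z) +
        𝒢.actInf (c.coeff₁ f w z) (c.coeff₂ f u v z)) := by
  unfold curv₃
  rw [c.B_smooth.d_apply_three hf]
  rfl

/-- Surface ordered exponentials are invariant under homotopies along which the curvature 3-form
vanishes, if `B` vanishes on the side faces and `A` on the edge over the origin. -/
theorem surfaceExp_eq_of_homotopy {J : ℝ × ℝ × ℝ → N}
    (hJ : ContMDiff 𝓘(ℝ, ℝ × ℝ × ℝ) 𝓘(ℝ, V) ∞ J) {Γ Γ' : TwoPath V N}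
    (start : ∀ t s, J (t, s, 0) = Γ (t, s)) (finish : ∀ t s, J (t, s, 1) = Γ' (t, s))
    (flat : ∀ z, ∃ v ≠ 0, ∀ w w', c.curv₃ (J z) (tmap (ℝ × ℝ × ℝ) V J z v)
      (tmap (ℝ × ℝ × ℝ) V J z w) (tmap (ℝ × ℝ × ℝ) V J z w') = 0)
    (edge : ∀ x, c.coeff₁ (fun x => J (0, 0, x)) 1 x = 0)
    (left : ∀ p, c.coeff₂ (fun q : ℝ × ℝ => J (0, q)) (1, 0) (0, 1) p = 0)
    (right : ∀ p, c.coeff₂ (fun q : ℝ × ℝ => J (1, q)) (1, 0) (0, 1) p = 0)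
    (down : ∀ p, c.coeff₂ (fun q : ℝ × ℝ => J (q.1, 0, q.2)) (1, 0) (0, 1) p = 0)
    (up : ∀ p, c.coeff₂ (fun q : ℝ × ℝ => J (q.1, 1, q.2)) (1, 0) (0, 1) p = 0) :
    c.surfaceExp Γ = c.surfaceExp Γ' := by
  have face₁ : ∀ (r : ℝ) (p : ℝ × ℝ), c.coeff₂ J (0, 1, 0) (0, 0, 1) (r, p) =
      c.coeff₂ (fun q : ℝ × ℝ => J (r, q)) (1, 0) (0, 1) p := fun r p =>
    (c.coeff₂_comp hJ (φ := fun q : ℝ × ℝ => (r, q)) (hasFDerivAt_prodMk_right r p)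
      EventuallyEq.rfl (1, 0) (0, 1)).symm
  have face₂ : ∀ (r : ℝ) (p : ℝ × ℝ), c.coeff₂ J (1, 0, 0) (0, 0, 1) (p.1, r, p.2) =
      c.coeff₂ (fun q : ℝ × ℝ => J (q.1, r, q.2)) (1, 0) (0, 1) p := fun r p =>
    (c.coeff₂_comp hJ (φ := fun q : ℝ × ℝ => (q.1, r, q.2))
      (x := p) (L := (ContinuousLinearMap.fst ℝ ℝ ℝ).prod
        ((0 : ℝ × ℝ →L[ℝ] ℝ).prod (ContinuousLinearMap.snd ℝ ℝ ℝ)))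
      (hasFDerivAt_fst.prodMk ((hasFDerivAt_const r p).prodMk hasFDerivAt_snd))
      EventuallyEq.rfl (1, 0) (0, 1)).symm
  have sp : SpacePair 𝒢 (c.coeff₁ J (1, 0, 0)) (c.coeff₁ J (0, 1, 0)) (c.coeff₁ J (0, 0, 1))
      (c.coeff₂ J (1, 0, 0) (0, 1, 0)) (c.coeff₂ J (1, 0, 0) (0, 0, 1))
      (c.coeff₂ J (0, 1, 0) (0, 0, 1)) :=
    { smooth₁ := c.contDiff_coeff₁ hJ _
      smooth₂ := c.contDiff_coeff₁ hJ _
      smooth₃ := c.contDiff_coeff₁ hJ _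
      smooth₁₂ := c.contDiff_coeff₂ hJ _ _
      smooth₁₃ := c.contDiff_coeff₂ hJ _ _
      smooth₂₃ := c.contDiff_coeff₂ hJ _ _
      fake₁₂ := c.fake_coeff hJ _ _
      fake₁₃ := c.fake_coeff hJ _ _
      fake₂₃ := c.fake_coeff hJ _ _
      flat := fun z => by
        rw [← c.curv₃_tmap hJ]
        obtain ⟨v, hv, h⟩ := flat z
        have e : tmap (ℝ × ℝ × ℝ) V J z v = v.1 • tmap (ℝ × ℝ × ℝ) V J z (1, 0, 0) +
            v.2.1 • tmap (ℝ × ℝ × ℝ) V J z (0, 1, 0) +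
            v.2.2 • tmap (ℝ × ℝ × ℝ) V J z (0, 0, 1) := by
          rw [← map_smul, ← map_smul, ← map_smul, ← map_add, ← map_add]
          congr 1
          ext <;> simp
        rw [e] at h
        exact c.curv₃_eq_zero (r₁ := v.1) (r₂ := v.2.1) (r₃ := v.2.2) hv (h _ _) (h _ _) (h _ _)
      edge := fun x => (c.coeff₁_comp hJ (φ := fun x : ℝ => ((0 : ℝ), (0 : ℝ), x))
        ((hasFDerivAt_const _ _).prodMk ((hasFDerivAt_const _ _).prodMk (hasFDerivAt_id x)))
        EventuallyEq.rfl (1 : ℝ)).symm.trans (edge x)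
      left := fun s x => (face₁ 0 (s, x)).trans (left _)
      right := fun s x => (face₁ 1 (s, x)).trans (right _)
      down := fun t x => (face₂ 0 (t, x)).trans (down _)
      up := fun t x => (face₂ 1 (t, x)).trans (up _) }
  have slice : ∀ (x : ℝ) (Δ : TwoPath V N), (∀ t s, J (t, s, x) = Δ (t, s)) →
      c.surfaceExp Δ = planeExp 𝒢 (fun p => c.coeff₁ J (1, 0, 0) (p.1, p.2, x))
        (fun p => c.coeff₁ J (0, 1, 0) (p.1, p.2, x))
        (fun p => c.coeff₂ J (1, 0, 0) (0, 1, 0) (p.1, p.2, x)) 1 1 := by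
    intro x Δ hΔ
    have hd : ∀ p : ℝ × ℝ, HasFDerivAt (fun p : ℝ × ℝ => (p.1, p.2, x))
        ((ContinuousLinearMap.fst ℝ ℝ ℝ).prod ((ContinuousLinearMap.snd ℝ ℝ ℝ).prod 0)) p :=
      fun p => hasFDerivAt_fst.prodMk (hasFDerivAt_snd.prodMk (hasFDerivAt_const _ _))
    have hev : ∀ p : ℝ × ℝ, Δ.toFun =ᶠ[𝓝 p] fun p => J (p.1, p.2, x) := fun p =>
      Eventually.of_forall fun q => (hΔ q.1 q.2).symm
    have e1 : c.coeff₁ Δ.toFun (1, 0) = fun p => c.coeff₁ J (1, 0, 0) (p.1, p.2, x) :=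
      funext fun p => c.coeff₁_comp hJ (hd p) (hev p) (1, 0)
    have e2 : c.coeff₁ Δ.toFun (0, 1) = fun p => c.coeff₁ J (0, 1, 0) (p.1, p.2, x) :=
      funext fun p => c.coeff₁_comp hJ (hd p) (hev p) (0, 1)
    have e3 : c.coeff₂ Δ.toFun (1, 0) (0, 1) =
        fun p => c.coeff₂ J (1, 0, 0) (0, 1, 0) (p.1, p.2, x) :=
      funext fun p => c.coeff₂_comp hJ (hd p) (hev p) (1, 0) (0, 1)
    unfold surfaceExp
    rw [surfaceExpAt_eq, e1, e2, e3]
  rw [slice 0 Γ start, slice 1 Γ' finish]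
  exact sp.planeExp_eq 0 1

theorem coeff₁_const (f : U → N) (hf : ∀ z z', f z = f z') (v z : U) : c.coeff₁ f v z = 0 := by
  have e : f = fun _ => f z := funext fun z' => hf z' z
  unfold coeff₁
  have e' : tmap U V (fun _ : U => f z) z = 0 := (hasTDeriv_const (f z) z).tmap_eq
  rw [e, e']
  exact c.A_zero _

theorem surfaceExp_eq_of_rankTwoHomotopic {Γ Γ' : TwoPath V N} (h : RankTwoHomotopic Γ Γ') :
    c.surfaceExp Γ = c.surfaceExp Γ' := by
  obtain ⟨J, h⟩ := h
  refine c.surfaceExp_eq_of_homotopy h.smooth h.start h.finish (fun z => ?_) ?_ ?_ ?_ ?_ ?_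
  · obtain ⟨v, hv, h0⟩ := h.rank.exists_tmap_eq_zero (by simp) z
    exact ⟨v, hv, fun Y Z => by rw [h0, c.curv₃_zero_left]⟩
  · obtain ⟨K, hK, hr⟩ := h.left
    refine c.coeff₁_const _ (fun x y => ?_) (1 : ℝ)
    have hd := hr.left_const
    rw [← hK, ← hK]
    exact (hd x).trans (hd y).symm
  · obtain ⟨K, hK, hr⟩ := h.left
    rw [show (fun q : ℝ × ℝ => J (0, q)) = K.toFun from funext fun q => (hK q.1 q.2).symm]
    exact c.coeff₂_eq_zero_of_rank hr.rank
  · obtain ⟨K, hK, hr⟩ := h.right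
    rw [show (fun q : ℝ × ℝ => J (1, q)) = K.toFun from funext fun q => (hK q.1 q.2).symm]
    exact c.coeff₂_eq_zero_of_rank hr.rank
  · obtain ⟨K, hK, hr⟩ := h.down
    rw [show (fun q : ℝ × ℝ => J (q.1, 0, q.2)) = K.toFun from
      funext fun q => (hK q.1 q.2).symm]
    exact c.coeff₂_eq_zero_of_rank hr.rank
  · obtain ⟨K, hK, hr⟩ := h.up
    rw [show (fun q : ℝ × ℝ => J (q.1, 1, q.2)) = K.toFun from
      funext fun q => (hK q.1 q.2).symm]
    exact c.coeff₂_eq_zero_of_rank hr.rank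

theorem pathExp_eq_of_rankOneHomotopic {φ γ : OnePath V N} (h : RankOneHomotopic φ γ) :
    c.pathExp φ 1 = c.pathExp γ 1 := by
  obtain ⟨K, h⟩ := h
  rw [← h.down_eq, ← h.up_eq]
  exact c.pathExp_eq_of_coeff₂ K (c.coeff₂_eq_zero_of_rank h.rank) h.left_const h.right_const

theorem surfaceExp_eq_one_of_rank {Γ : TwoPath V N} (h : RankLE (V := V) 1 Γ.toFun) :
    c.surfaceExp Γ = 1 :=
  c.surfaceExp_eq_one Γ (c.coeff₂_eq_zero_of_rank h)

end LocalConnectionPair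

end Homotopy

/-! ### The morphism defined by a local connection pair -/

section Tracks

variable {V : Type*} [NormedAddCommGroup V] [NormedSpace ℝ V]
  {N : Type*} [TopologicalSpace N] [ChartedSpace V N] {Γ Γ' : TwoPath V N}

theorem RankTwoHomotopic.left (h : RankTwoHomotopic Γ Γ') :
    RankOneHomotopic Γ.left Γ'.left :=
  let ⟨_, h⟩ := h
  ⟨_, h.left.choose_spec.2⟩

theorem RankTwoHomotopic.right (h : RankTwoHomotopic Γ Γ') :
    RankOneHomotopic Γ.right Γ'.right :=
  let ⟨_, h⟩ := h
  ⟨_, h.right.choose_spec.2⟩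

theorem RankTwoHomotopic.down (h : RankTwoHomotopic Γ Γ') :
    RankOneHomotopic Γ.down Γ'.down :=
  let ⟨_, h⟩ := h
  ⟨_, h.down.choose_spec.2⟩

theorem RankTwoHomotopic.up (h : RankTwoHomotopic Γ Γ') :
    RankOneHomotopic Γ.up Γ'.up :=
  let ⟨_, h⟩ := h
  ⟨_, h.up.choose_spec.2⟩

end Tracks

section Degenerate

variable {V : Type*} [NormedAddCommGroup V] [NormedSpace ℝ V] [FiniteDimensional ℝ V]
  {N : Type*} [TopologicalSpace N] [ChartedSpace V N]

theorem rankLE_deg₁ (γ : OnePath V N) : RankLE (V := V) 1 γ.deg₁.toFun := by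
  have h : RankLE (V := V) 1 γ.toFun := fun t =>
    (LinearMap.finrank_range_le _).trans (by simp)
  exact h.comp γ.smooth contDiff_snd

end Degenerate

section Equivariance

/-- A map that commutes with the two reflections and the interchange commutes with the action of
the dihedral group. -/
theorem map_d4Fun {α β : Type*} {h v t : α → α} {h' v' t' : β → β} {f : α → β}
    (hh : ∀ x, f (h x) = h' (f x)) (hv : ∀ x, f (v x) = v' (f x)) (ht : ∀ x, f (t x) = t' (f x))
    (g : DihedralGroup 4) (x : α) : f (d4Fun h v t g x) = d4Fun h' v' t' g (f x) := by
  rcases g with ((i : Fin 4) | (i : Fin 4)) <;> fin_cases i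
  · rfl
  · exact (hh _).trans (congrArg h' (ht _))
  · exact (hh _).trans (congrArg h' (hv _))
  · exact (ht _).trans (congrArg t' (hh _))
  · exact ht _
  · exact hv _
  · exact (ht _).trans (congrArg t' ((hh _).trans (congrArg h' (hv _))))
  · exact hh _

end Equivariance

section LocalMorphism

variable {V : Type*} [NormedAddCommGroup V] [NormedSpace ℝ V] [FiniteDimensional ℝ V]
  {N : Type*} [TopologicalSpace N] [ChartedSpace V N] [IsManifold 𝓘(ℝ, V) ∞ N]
  {VG : Type*} [NormedAddCommGroup VG] [NormedSpace ℝ VG] [FiniteDimensional ℝ VG]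
  {G : Type*} [TopologicalSpace G] [T2Space G] [ChartedSpace VG G] [Group G]
  [LieGroup 𝓘(ℝ, VG) ∞ G]
  {VE : Type*} [NormedAddCommGroup VE] [NormedSpace ℝ VE] [FiniteDimensional ℝ VE]
  {E : Type*} [TopologicalSpace E] [T2Space E] [ChartedSpace VE E] [Group E]
  [LieGroup 𝓘(ℝ, VE) ∞ E]
  {𝒢 : LieCrossedModule VG G VE E}

namespace LocalConnectionPair

variable (c : LocalConnectionPair 𝒢 V N)

/-- The square of the ordered exponentials of a 2-path. -/
def square (Γ : TwoPath V N) : 𝒢.Square :=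
  ⟨c.pathExp Γ.down 1, c.pathExp Γ.right 1, c.pathExp Γ.left 1, c.pathExp Γ.up 1,
    c.surfaceExp Γ, c.surfaceExp_comm Γ⟩

theorem square_eq_of_rankTwoHomotopic {Γ Γ' : TwoPath V N} (h : RankTwoHomotopic Γ Γ') :
    c.square Γ = c.square Γ' :=
  LieCrossedModule.Square.ext (c.pathExp_eq_of_rankOneHomotopic h.down)
    (c.pathExp_eq_of_rankOneHomotopic h.right) (c.pathExp_eq_of_rankOneHomotopic h.left)
    (c.pathExp_eq_of_rankOneHomotopic h.up) (c.surfaceExp_eq_of_rankTwoHomotopic h)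

theorem square_transp (Γ : TwoPath V N) : c.square Γ.transp = (c.square Γ).transp :=
  LieCrossedModule.Square.ext rfl rfl rfl rfl (c.surfaceExp_transp Γ)

theorem pathExp_rev_one (γ γ' : OnePath V N) (h : ∀ t, γ' t = γ (1 - t)) :
    c.pathExp γ' 1 = (c.pathExp γ 1)⁻¹ := by
  rw [c.pathExp_rev γ γ' h, sub_self]
  have : c.pathExp γ 0 = 1 := orderedExp_zero_right (c.continuous_coeff_path γ)
  rw [this, mul_one]

theorem square_vrev (Γ : TwoPath V N) : c.square Γ.vrev = (c.square Γ).vrev := by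
  refine LieCrossedModule.Square.ext ?_ ?_ ?_ ?_ (c.surfaceExp_vrev Γ)
  · refine congrArg (fun γ => c.pathExp γ 1) (?_ : Γ.vrev.down = Γ.up)
    ext t; exact congrArg (fun s => Γ (t, s)) (sub_zero 1)
  · exact c.pathExp_rev_one _ _ fun _ => rfl
  · exact c.pathExp_rev_one _ _ fun _ => rfl
  · refine congrArg (fun γ => c.pathExp γ 1) (?_ : Γ.vrev.up = Γ.down)
    ext t; exact congrArg (fun s => Γ (t, s)) (sub_self 1)

theorem square_hrev (Γ : TwoPath V N) : c.square Γ.hrev = (c.square Γ).hrev := by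
  have h : Γ.hrev = Γ.transp.vrev.transp := rfl
  rw [h, square_transp, square_vrev, square_transp]
  ext <;> simp [LieCrossedModule.Square.hrev, LieCrossedModule.Square.vrev,
    LieCrossedModule.Square.transp]

theorem square_hconcat (Γ Γ' : TwoPath V N) (h : Γ.right = Γ'.left) :
    c.square (Γ.hconcat Γ' h) =
      (c.square Γ).hcomp (c.square Γ') (congrArg (fun γ => c.pathExp γ 1) h) := by
  have h0 : Γ.down 1 = Γ'.down 0 := congrArg (fun γ : OnePath V N => γ 0) h
  have h1 : Γ.up 1 = Γ'.up 0 := congrArg (fun γ : OnePath V N => γ 1) h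
  refine LieCrossedModule.Square.ext (c.pathExp_concat Γ.down Γ'.down h0) ?_ ?_
    (c.pathExp_concat Γ.up Γ'.up h1) (c.surfaceExp_hconcat Γ Γ' h)
  · refine congrArg (fun γ => c.pathExp γ 1) (?_ : (Γ.hconcat Γ' h).right = Γ'.right)
    ext s
    refine (if_neg (by norm_num)).trans (congrArg (fun t => Γ' (t, s)) ?_)
    norm_num
  · refine congrArg (fun γ => c.pathExp γ 1) (?_ : (Γ.hconcat Γ' h).left = Γ.left)
    ext s
    refine (if_pos (by norm_num)).trans (congrArg (fun t => Γ (t, s)) ?_)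
    norm_num

theorem square_vconcat (Γ Γ' : TwoPath V N) (h : Γ.up = Γ'.down) :
    c.square (Γ.vconcat Γ' h) =
      (c.square Γ).vcomp (c.square Γ') (congrArg (fun γ => c.pathExp γ 1) h) := by
  have h0 : Γ.left 1 = Γ'.left 0 := congrArg (fun γ : OnePath V N => γ 0) h
  have h1 : Γ.right 1 = Γ'.right 0 := congrArg (fun γ : OnePath V N => γ 1) h
  refine LieCrossedModule.Square.ext ?_ (c.pathExp_concat Γ.right Γ'.right h1)
    (c.pathExp_concat Γ.left Γ'.left h0) ?_ (c.surfaceExp_vconcat Γ Γ' h)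
  · refine congrArg (fun γ => c.pathExp γ 1) (?_ : (Γ.vconcat Γ' h).down = Γ.down)
    ext s
    refine (if_pos (by norm_num)).trans (congrArg (fun t => Γ (s, t)) ?_)
    norm_num
  · refine congrArg (fun γ => c.pathExp γ 1) (?_ : (Γ.vconcat Γ' h).up = Γ'.up)
    ext s
    refine (if_neg (by norm_num)).trans (congrArg (fun t => Γ' (s, t)) ?_)
    norm_num

theorem square_of_isRankOneHomotopy {J : TwoPath V N} {φ γ : OnePath V N}
    (h : IsRankOneHomotopy J φ γ) :
    c.square J = ⟨c.pathExp φ 1, 1, 1, c.pathExp φ 1, 1, by simp⟩ := by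
  have hl : J.left = OnePath.const (J.left 0) := by ext s; exact h.left_const s
  have hr : J.right = OnePath.const (J.right 0) := by ext s; exact h.right_const s
  refine LieCrossedModule.Square.ext (congrArg (fun γ => c.pathExp γ 1) h.down_eq) ?_ ?_ ?_
    (c.surfaceExp_eq_one_of_rank h.rank)
  · change c.pathExp J.right 1 = 1
    rw [hr, pathExp_const]
  · change c.pathExp J.left 1 = 1
    rw [hl, pathExp_const]
  · change c.pathExp J.up 1 = _
    rw [h.up_eq]
    exact (c.pathExp_eq_of_rankOneHomotopic ⟨J, h⟩).symm

/-- The morphism of double groupoids with thin structure given by the ordered exponentials. -/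
def morphism : (thinDoubleGroupoid V N).Hom 𝒢.doubleGroupoid where
  obj _ := ()
  edge := Quot.lift (fun γ => c.pathExp γ 1) fun _ _ => c.pathExp_eq_of_rankOneHomotopic
  sq := Quot.lift c.square fun _ _ => c.square_eq_of_rankTwoHomotopic
  map_src _ := rfl
  map_tgt _ := rfl
  map_one x := c.pathExp_const x 1
  map_comp := by
    rintro _ _ _ ⟨γ, φ, h, rfl, rfl, rfl⟩
    exact (c.pathExp_concat γ φ h).symm
  map_left k := by induction k using Quot.ind; rfl
  map_right k := by induction k using Quot.ind; rfl
  map_down k := by induction k using Quot.ind; rfl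
  map_up k := by induction k using Quot.ind; rfl
  map_deg₁ a := by
    induction a using Quot.ind with
    | mk γ =>
      refine LieCrossedModule.Square.ext (c.pathExp_const (γ 0) 1) rfl rfl
        (c.pathExp_const (γ 1) 1) ?_
      exact c.surfaceExp_eq_one_of_rank (rankLE_deg₁ γ)
  map_deg₂ a := by
    induction a using Quot.ind with
    | mk γ =>
      refine LieCrossedModule.Square.ext rfl (c.pathExp_const (γ 1) 1)
        (c.pathExp_const (γ 0) 1) rfl ?_
      refine (c.surfaceExp_transp γ.deg₁).trans ?_
      rw [c.surfaceExp_eq_one_of_rank (rankLE_deg₁ γ), inv_one]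
      rfl
  map_hcomp := by
    rintro _ _ _ ⟨Γ, J, Γ', h, h', hJ, rfl, rfl, rfl⟩
    have hY : c.pathExp Γ.right 1 = c.pathExp Γ'.left 1 := c.pathExp_eq_of_rankOneHomotopic ⟨J, hJ⟩
    refine ⟨hY, ?_⟩
    change (c.square Γ).hcomp (c.square Γ') _ = c.square ((Γ.hconcat J.transp h).hconcat Γ' h')
    have hq := c.square_of_isRankOneHomotopy hJ
    ext <;> simp [square_hconcat, square_transp, hq, LieCrossedModule.Square.hcomp,
      LieCrossedModule.Square.transp]
  map_vcomp := by
    rintro _ _ _ ⟨Γ, J, Γ', h, h', hJ, rfl, rfl, rfl⟩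
    have hY : c.pathExp Γ.up 1 = c.pathExp Γ'.down 1 := c.pathExp_eq_of_rankOneHomotopic ⟨J, hJ⟩
    refine ⟨hY, ?_⟩
    change (c.square Γ).vcomp (c.square Γ') _ = c.square ((Γ.vconcat J h).vconcat Γ' h')
    have hq := c.square_of_isRankOneHomotopy hJ
    ext <;> simp [square_vconcat, hq, LieCrossedModule.Square.vcomp]
  map_thin := by
    rintro _ ⟨Γ, h, rfl⟩
    exact c.surfaceExp_eq_one_of_rank h
  map_d4 g k := by
    refine map_d4Fun (fun k => ?_) (fun k => ?_) (fun k => ?_) g k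
    · induction k using Quot.ind with
      | mk Γ => exact c.square_hrev Γ
    · induction k using Quot.ind with
      | mk Γ => exact c.square_vrev Γ
    · induction k using Quot.ind with
      | mk Γ => exact c.square_transp Γ

end LocalConnectionPair

end LocalMorphism

/-! ### Connections on principal bundles -/

section Bundle

variable {VM : Type*} [NormedAddCommGroup VM] [NormedSpace ℝ VM]
  {M : Type*} [TopologicalSpace M] [ChartedSpace VM M]
  {VG : Type*} [NormedAddCommGroup VG] [NormedSpace ℝ VG]
  {G : Type*} [TopologicalSpace G] [ChartedSpace VG G] [Group G]
  {VP : Type*} [NormedAddCommGroup VP] [NormedSpace ℝ VP]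
  {P : Type*} [TopologicalSpace P] [ChartedSpace VP P]
  {V : Type*} [NormedAddCommGroup V] [NormedSpace ℝ V]
  {N : Type*} [TopologicalSpace N] [ChartedSpace V N]

namespace PrincipalBundle

variable (B : PrincipalBundle VM M VG G VP P)

theorem contMDiff_act_const (g : G) : ContMDiff 𝓘(ℝ, VP) 𝓘(ℝ, VP) ∞ fun q => B.act q g :=
  B.act_smooth.comp (contMDiff_id.prodMk contMDiff_const)

theorem contMDiff_const_act (p : P) : ContMDiff 𝓘(ℝ, VG) 𝓘(ℝ, VP) ∞ fun g => B.act p g :=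
  B.act_smooth.comp (contMDiff_const.prodMk contMDiff_id)

theorem tDiff_proj (p : P) : TDiff VP VM B.proj p :=
  tDiff_of_contMDiffAt B.proj_smooth.contMDiffAt (by simp)

/-- The derivative `A ↦ A^#` of the orbit map. -/
def vertL (p : P) : VG →L[ℝ] VP := tmap VG VP (fun g : G => B.act p g) 1

theorem vertL_apply (p : P) (A : VG) : B.vertL p A = B.vert p A := rfl

theorem hasTDeriv_orbit (p : P) : HasTDeriv (fun g : G => B.act p g) 1 (B.vertL p) :=
  TDiff.hasTDeriv (tDiff_of_contMDiffAt (B.contMDiff_const_act p).contMDiffAt (by simp))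

theorem hasTDeriv_act_const (p : P) (g : G) :
    HasTDeriv (fun q => B.act q g) p (tmap VP VP (fun q => B.act q g) p) :=
  TDiff.hasTDeriv (tDiff_of_contMDiffAt (B.contMDiff_act_const g).contMDiffAt (by simp))

/-- The product rule for the action. -/
theorem hasTDeriv_act {f : N → P} {k : N → G} {x : N} {L : V →L[ℝ] VP} {α : V →L[ℝ] VG}
    (hf : HasTDeriv f x L) (hk : HasTDeriv (fun z => (k x)⁻¹ * k z) x α) :
    HasTDeriv (fun z => B.act (f z) (k z)) x
      ((tmap VP VP (fun q => B.act q (k x)) (f x)).comp L +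
        (B.vertL (B.act (f x) (k x))).comp α) := by
  have h0 : (k x)⁻¹ * k x = 1 := inv_mul_cancel _
  have hs : ContMDiff (𝓘(ℝ, VP).prod 𝓘(ℝ, VG)) 𝓘(ℝ, VP) ∞
      fun y : P × G => B.act (B.act y.1 (k x)) y.2 :=
    B.act_smooth.comp (((B.contMDiff_act_const (k x)).comp contMDiff_fst).prodMk contMDiff_snd)
  have h := HasTDeriv.comp₂ (F := fun y : P × G => B.act (B.act y.1 (k x)) y.2) (f := f)
    (g := fun z => (k x)⁻¹ * k z) (x := x) (D₁ := tmap VP VP (fun q => B.act q (k x)) (f x))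
    (D₂ := B.vertL (B.act (f x) (k x)))
    (hs.mdifferentiableAt (by simp)) (by
      have := B.hasTDeriv_act_const (f x) (k x)
      simp only [h0, B.act_one]
      exact this) (by
      simp only [h0]
      exact B.hasTDeriv_orbit _) hf hk
  refine h.congr (Eventually.of_forall fun z => ?_)
  change B.act (f z) (k z) = B.act (B.act (f z) (k x)) ((k x)⁻¹ * k z)
  rw [← B.act_mul, mul_inv_cancel_left]

theorem tmap_proj_vert (p : P) (A : VG) : tmap VP VM B.proj p (B.vert p A) = 0 := by
  have h1 := (B.tDiff_proj p).hasTDeriv.comp (B.hasTDeriv_orbit p) (B.act_one p)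
  have h2 : HasTDeriv (fun g : G => B.proj (B.act p g)) 1 (0 : VG →L[ℝ] VM) :=
    (hasTDeriv_const (B.proj p) (1 : G)).congr (Eventually.of_forall fun g => B.proj_act p g)
  exact congrArg (fun L : VG →L[ℝ] VM => L A) (h1.unique h2)

theorem tmap_proj_act (p : P) (g : G) (X : VP) :
    tmap VP VM B.proj (B.act p g) (tmap VP VP (fun q => B.act q g) p X) =
      tmap VP VM B.proj p X := by
  have h1 := (B.tDiff_proj (B.act p g)).hasTDeriv.comp (B.hasTDeriv_act_const p g) rfl
  have h2 := (B.tDiff_proj p).hasTDeriv.congr (g := fun q => B.proj (B.act q g))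
    (Eventually.of_forall fun q => B.proj_act q g)
  exact congrArg (fun L : VP →L[ℝ] VM => L X) (h1.unique h2)

theorem tmap_proj_comp {f : N → P} {γ : N → M} {x : N} {L : V →L[ℝ] VP} (hf : HasTDeriv f x L)
    (h : ∀ᶠ z in 𝓝 x, B.proj (f z) = γ z) (v : V) :
    tmap VP VM B.proj (f x) (L v) = tmap V VM γ x v := by
  have h1 := ((B.tDiff_proj (f x)).hasTDeriv.comp hf rfl).congr (g := γ)
    (h.mono fun z hz => hz.symm)
  rw [h1.tmap_eq]
  rfl

variable [LieGroup 𝓘(ℝ, VG) ∞ G]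

/-- A tangent vector that projects to zero is vertical. -/
theorem exists_eq_vert {p : P} {X : VP} (hX : tmap VP VM B.proj p X = 0) :
    ∃ A, X = B.vert p A := by
  obtain ⟨U, Φ, hU, hx, hs, ht, hΦ, hΨ, heq⟩ := B.locTriv (B.proj p)
  have hp : p ∈ Φ.source := by rw [hs]; exact hx
  set S : M → P := fun x => Φ.symm (x, (Φ p).2) with hS
  have hmt : (B.proj p, (Φ p).2) ∈ Φ.target := by rw [ht]; exact ⟨hx, trivial⟩
  have hSp : S (B.proj p) = p := by
    rw [hS, ← (heq p hp).1]
    exact Φ.left_inv hp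
  have hSd : TDiff VM VP S (B.proj p) := by
    refine tDiff_of_contMDiffAt (n := ∞) ?_ (by simp)
    exact ContMDiffAt.comp (B.proj p)
      (hΨ.contMDiffAt (Φ.open_target.mem_nhds hmt))
      (contMDiff_prodMk_left (Φ p).2).contMDiffAt
  have hh : ContMDiffAt 𝓘(ℝ, VP) 𝓘(ℝ, VG) ∞ (fun y => (Φ p).2⁻¹ * (Φ y).2) p := by
    refine contMDiffAt_const.mul ?_
    exact contMDiffAt_snd.comp p (hΦ.contMDiffAt (Φ.open_source.mem_nhds hp))
  have h1 := hSd.hasTDeriv.comp (B.tDiff_proj p).hasTDeriv rfl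
  have h2 := B.hasTDeriv_act (k := fun y => (Φ p).2⁻¹ * (Φ y).2) h1
    (α := tmap VP VG (fun y => (Φ p).2⁻¹ * (Φ y).2) p) (by
      simp only [inv_mul_cancel, inv_one, one_mul]
      exact TDiff.hasTDeriv (tDiff_of_contMDiffAt hh (by simp)))
  have h3 : ∀ᶠ y in 𝓝 p, y = B.act (S (B.proj y)) ((Φ p).2⁻¹ * (Φ y).2) := by
    filter_upwards [Φ.open_source.mem_nhds hp] with y hy
    have hyt : (B.proj y, (Φ p).2) ∈ Φ.target := by
      rw [ht]; rw [hs] at hy; exact ⟨hy, trivial⟩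
    have hSy : S (B.proj y) ∈ Φ.source := Φ.map_target hyt
    refine Φ.injOn hy ?_ ?_
    · rw [hs, mem_preimage, B.proj_act]
      rwa [hs] at hSy
    · rw [(heq _ hSy).2]
      have : Φ (S (B.proj y)) = (B.proj y, (Φ p).2) := Φ.right_inv hyt
      rw [this, mul_inv_cancel_left, ← (heq y hy).1]
  have h4 := (h2.congr h3).unique (hasTDeriv_id p)
  have h5 := congrArg (fun L : VP →L[ℝ] VP => L X) h4
  simp only [inv_mul_cancel, hSp, B.act_one] at h5
  refine ⟨tmap VP VG (fun y => (Φ p).2⁻¹ * (Φ y).2) p X, ?_⟩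
  refine h5.symm.trans ?_
  rw [add_apply, ContinuousLinearMap.comp_apply, ContinuousLinearMap.comp_apply]
  erw [hX]
  rw [map_zero, map_zero, zero_add]
  rfl

/-- Locally, the element of `G` that takes one point of a fibre to another one depends smoothly on
the two points. -/
theorem exists_smooth_difference {p p' : P} (h : B.proj p = B.proj p') :
    ∃ D : P × P → G, ContMDiffAt (𝓘(ℝ, VP).prod 𝓘(ℝ, VP)) 𝓘(ℝ, VG) ∞ D (p, p') ∧
      ∀ᶠ x in 𝓝 (p, p'), B.proj x.1 = B.proj x.2 → B.act x.1 (D x) = x.2 := by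
  obtain ⟨U, Φ, hU, hx, hs, ht, hΦ, hΨ, heq⟩ := B.locTriv (B.proj p)
  have hp : p ∈ Φ.source := by rw [hs]; exact hx
  have hp' : p' ∈ Φ.source := by rw [hs, mem_preimage, ← h]; exact hx
  refine ⟨fun x => (Φ x.1).2⁻¹ * (Φ x.2).2, ?_, ?_⟩
  · have h1 : ContMDiffAt 𝓘(ℝ, VP) 𝓘(ℝ, VG) ∞ (fun y => (Φ y).2) p :=
      contMDiffAt_snd.comp p (hΦ.contMDiffAt (Φ.open_source.mem_nhds hp))
    have h2 : ContMDiffAt 𝓘(ℝ, VP) 𝓘(ℝ, VG) ∞ (fun y => (Φ y).2) p' :=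
      contMDiffAt_snd.comp p' (hΦ.contMDiffAt (Φ.open_source.mem_nhds hp'))
    exact ContMDiffAt.mul (ContMDiffAt.inv (h1.comp (p, p') (f := Prod.fst) contMDiffAt_fst))
      (h2.comp (p, p') (f := Prod.snd) contMDiffAt_snd)
  · filter_upwards [(Φ.open_source.prod Φ.open_source).mem_nhds ⟨hp, hp'⟩] with x hx h12
    refine Φ.injOn ?_ hx.2 ?_
    · rw [hs, mem_preimage, B.proj_act]
      have := hx.1
      rwa [hs] at this
    · rw [(heq _ hx.1).2, mul_inv_cancel_left, (heq _ hx.1).1, h12, ← (heq _ hx.2).1]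

theorem act_left_cancel {p : P} {g h : G} (hgh : B.act p g = B.act p h) : g = h := by
  have : B.act p (g * h⁻¹) = p := by rw [B.act_mul, hgh, ← B.act_mul, mul_inv_cancel, B.act_one]
  exact mul_inv_eq_one.1 (B.act_free this)

theorem contMDiffAt_difference {f f' : N → P} {k : N → G} {x : N}
    (hf : ContMDiffAt 𝓘(ℝ, V) 𝓘(ℝ, VP) ∞ f x) (hf' : ContMDiffAt 𝓘(ℝ, V) 𝓘(ℝ, VP) ∞ f' x)
    (hk : ∀ᶠ z in 𝓝 x, B.act (f z) (k z) = f' z) : ContMDiffAt 𝓘(ℝ, V) 𝓘(ℝ, VG) ∞ k x := by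
  have hx : B.proj (f x) = B.proj (f' x) := by rw [← hk.self_of_nhds, B.proj_act]
  obtain ⟨D, hD, hD'⟩ := B.exists_smooth_difference hx
  have h1 : ContMDiffAt 𝓘(ℝ, V) 𝓘(ℝ, VG) ∞ (fun z => D (f z, f' z)) x :=
    ContMDiffAt.comp x hD (hf.prodMk hf')
  refine h1.congr_of_eventuallyEq ?_
  filter_upwards [hk, (hf.prodMk hf').continuousAt.eventually hD'] with z hz hz'
  refine B.act_left_cancel (hz.trans (hz' ?_).symm)
  rw [← hz, B.proj_act]

theorem tDiff_difference {f f' : N → P} {k : N → G} {x : N} (hf : TDiff V VP f x)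
    (hf' : TDiff V VP f' x) (hk : ∀ᶠ z in 𝓝 x, B.act (f z) (k z) = f' z) : TDiff V VG k x := by
  have hx : B.proj (f x) = B.proj (f' x) := by rw [← hk.self_of_nhds, B.proj_act]
  obtain ⟨D, hD, hD'⟩ := B.exists_smooth_difference hx
  have hc : MDifferentiableAt 𝓘(ℝ, V) (𝓘(ℝ, VP).prod 𝓘(ℝ, VP)) (fun z => (f z, f' z)) x :=
    MDifferentiableAt.prodMk hf hf'
  have h1 : TDiff V VG (fun z => D (f z, f' z)) x :=
    MDifferentiableAt.comp x (hD.mdifferentiableAt (by simp)) hc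
  refine (h1.hasTDeriv.congr ?_).tDiff
  filter_upwards [hk, hc.continuousAt.eventually hD'] with z hz hz'
  refine B.act_left_cancel (hz.trans (hz' ?_).symm)
  rw [← hz, B.proj_act]

end PrincipalBundle

end Bundle

/-! ### Categorical connections -/

section Connection

variable {VM : Type*} [NormedAddCommGroup VM] [NormedSpace ℝ VM]
  {M : Type*} [TopologicalSpace M] [ChartedSpace VM M]
  {VG : Type*} [NormedAddCommGroup VG] [NormedSpace ℝ VG] [FiniteDimensional ℝ VG]
  {G : Type*} [TopologicalSpace G] [ChartedSpace VG G] [Group G] [LieGroup 𝓘(ℝ, VG) ∞ G]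
  {VE : Type*} [NormedAddCommGroup VE] [NormedSpace ℝ VE] [FiniteDimensional ℝ VE]
  {E : Type*} [TopologicalSpace E] [ChartedSpace VE E] [Group E] [LieGroup 𝓘(ℝ, VE) ∞ E]
  {VP : Type*} [NormedAddCommGroup VP] [NormedSpace ℝ VP]
  {P : Type*} [TopologicalSpace P] [ChartedSpace VP P]
  {V : Type*} [NormedAddCommGroup V] [NormedSpace ℝ V]
  {N : Type*} [TopologicalSpace N] [ChartedSpace V N]

namespace CategoricalConnection

variable {𝒢 : LieCrossedModule VG G VE E} {B : PrincipalBundle VM M VG G VP P}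
  (c : CategoricalConnection 𝒢 B)

/-- A categorical connection is, in particular, a local connection pair on the total space. -/
def pair : LocalConnectionPair 𝒢 VP P :=
  ⟨c.conn, c.m, c.conn_smooth, c.m_smooth, c.fake⟩

theorem conn_add (p : P) (X Y : VP) : c.conn p ![X + Y] = c.conn p ![X] + c.conn p ![Y] :=
  c.pair.A_add p X Y

theorem conn_neg (p : P) (X : VP) : c.conn p ![-X] = -c.conn p ![X] := by
  have := c.pair.A_smul p (-1) X
  rwa [neg_one_smul, neg_one_smul] at this

theorem conn_sub (p : P) (X Y : VP) : c.conn p ![X - Y] = c.conn p ![X] - c.conn p ![Y] := by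
  rw [sub_eq_add_neg, conn_add, conn_neg, sub_eq_add_neg]

theorem eq_vert_conn {p : P} {X : VP} (hX : tmap VP VM B.proj p X = 0) :
    X = B.vert p (c.conn p ![X]) := by
  obtain ⟨A, rfl⟩ := B.exists_eq_vert hX
  rw [c.conn_vert]

theorem eq_of_tmap_proj_eq {p : P} {X Y : VP}
    (h : tmap VP VM B.proj p X = tmap VP VM B.proj p Y) (h' : c.conn p ![X] = c.conn p ![Y]) :
    X = Y := by
  have h1 := c.eq_vert_conn (p := p) (X := X - Y) (by rw [map_sub, h, sub_self])
  rw [conn_sub, h', sub_self, ← B.vertL_apply, map_zero] at h1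
  exact sub_eq_zero.1 h1

/-- The horizontal lift is the horizontal part of any lift. -/
theorem horLift_tmap_proj (p : P) (X : VP) :
    c.horLift p (tmap VP VM B.proj p X) = X - B.vert p (c.conn p ![X]) := by
  have hex : ∃ Y : VP, tmap VP VM B.proj p Y = tmap VP VM B.proj p X ∧ c.conn p ![Y] = 0 := by
    refine ⟨X - B.vert p (c.conn p ![X]), ?_, ?_⟩
    · rw [map_sub, B.tmap_proj_vert, sub_zero]
    · rw [conn_sub, c.conn_vert, sub_self]
  unfold horLift
  rw [dif_pos hex]
  refine c.eq_of_tmap_proj_eq (p := p) ?_ ?_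
  · rw [hex.choose_spec.1, map_sub, B.tmap_proj_vert, sub_zero]
  · rw [hex.choose_spec.2, conn_sub, c.conn_vert, sub_self]

theorem m_vert_left (p : P) (A : VG) (Y : VP) : c.m p ![B.vert p A, Y] = 0 := by
  rw [c.m_horizontal, c.conn_vert, sub_self]
  exact c.pair.B_zero_left p _

theorem m_horLift (p : P) (X Y : VP) :
    c.m p ![c.horLift p (tmap VP VM B.proj p X), c.horLift p (tmap VP VM B.proj p Y)] =
      c.m p ![X, Y] := by
  rw [horLift_tmap_proj, horLift_tmap_proj, ← c.m_horizontal]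

end CategoricalConnection

end Connection

/-! ### Horizontal curves and lifts of 2-paths -/

section Horizontal

variable {VM : Type*} [NormedAddCommGroup VM] [NormedSpace ℝ VM]
  {M : Type*} [TopologicalSpace M] [ChartedSpace VM M]
  {VG : Type*} [NormedAddCommGroup VG] [NormedSpace ℝ VG] [FiniteDimensional ℝ VG]
  {G : Type*} [TopologicalSpace G] [ChartedSpace VG G] [Group G] [LieGroup 𝓘(ℝ, VG) ∞ G]
  {VE : Type*} [NormedAddCommGroup VE] [NormedSpace ℝ VE] [FiniteDimensional ℝ VE]
  {E : Type*} [TopologicalSpace E] [ChartedSpace VE E] [Group E] [LieGroup 𝓘(ℝ, VE) ∞ E]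
  {VP : Type*} [NormedAddCommGroup VP] [NormedSpace ℝ VP]
  {P : Type*} [TopologicalSpace P] [ChartedSpace VP P]
  {U : Type*} [NormedAddCommGroup U] [NormedSpace ℝ U]

namespace CategoricalConnection

variable {𝒢 : LieCrossedModule VG G VE E} {B : PrincipalBundle VM M VG G VP P}
  (c : CategoricalConnection 𝒢 B)

/-- The curve `q` is differentiable at `t`, with horizontal velocity. -/
def IsHorizontalAt (q : ℝ → P) (t : ℝ) : Prop :=
  ∃ v, HasVelocity VP q t v ∧ c.conn (q t) ![v] = 0

variable {c} in
theorem IsHorizontalAt.congr {q q' : ℝ → P} {t : ℝ} (h : c.IsHorizontalAt q t)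
    (hq : q' =ᶠ[𝓝 t] q) : c.IsHorizontalAt q' t := by
  obtain ⟨v, hv, h⟩ := h
  exact ⟨v, HasTDeriv.congr hv hq, by rwa [hq.self_of_nhds]⟩

theorem conn_horLift (p : P) (v : VM) : c.conn p ![c.horLift p v] = 0 := by
  unfold horLift
  split_ifs with h
  · exact h.choose_spec.2
  · exact c.pair.A_zero p

theorem tmap_proj_velocity {q : ℝ → P} {γ : ℝ → M} {t : ℝ} {v : VP} (hq : HasVelocity VP q t v)
    (h : ∀ᶠ s in 𝓝 t, B.proj (q s) = γ s) : tmap VP VM B.proj (q t) v = velocity VM γ t := by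
  have := B.tmap_proj_comp hq h 1
  exact (congrArg (tmap VP VM B.proj (q t)) (one_smul ℝ v).symm).trans this

/-- Transport along `γ` is given by the lifts of `γ` with horizontal velocity, without reference to
`horLift`. -/
theorem isTransport_iff {γ : OnePath VM M} {u : P} {q : ℝ → P} :
    c.IsTransport γ u q ↔ q 0 = u ∧ ∀ t, B.proj (q t) = γ t ∧ c.IsHorizontalAt q t := by
  refine and_congr_right fun _ => ⟨fun h t => ⟨(h t).1, _, (h t).2, c.conn_horLift _ _⟩,
    fun h t => ⟨(h t).1, ?_⟩⟩
  obtain ⟨v, hv, hc⟩ := (h t).2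
  rw [← tmap_proj_velocity hv (Eventually.of_forall fun s => (h s).1), horLift_tmap_proj, hc,
    ← B.vertL_apply, map_zero, sub_zero]
  exact hv

/-- The velocity of a curve that is moved along the fibres. -/
theorem exists_velocity_act {q : ℝ → P} {k : ℝ → G} {t : ℝ} {v : VP} {α : VG}
    (hq : HasVelocity VP q t v) (hk : HasLogVelocity k t α) :
    ∃ w, HasVelocity VP (fun s => B.act (q s) (k s)) t w ∧
      c.conn (B.act (q t) (k t)) ![w] = adj VG G (k t)⁻¹ (c.conn (q t) ![v]) + α := by
  refine ⟨tmap VP VP (fun p => B.act p (k t)) (q t) v + B.vert (B.act (q t) (k t)) α, ?_, ?_⟩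
  · have h := B.hasTDeriv_act hq hk
    rw [hasVelocity_iff]
    convert h using 1
    refine ContinuousLinearMap.ext_ring ?_
    change (1 : ℝ) • (tmap VP VP (fun p => B.act p (k t)) (q t) v +
      B.vertL (B.act (q t) (k t)) α) = tmap VP VP (fun p => B.act p (k t)) (q t) ((1 : ℝ) • v) +
        B.vertL (B.act (q t) (k t)) ((1 : ℝ) • α)
    rw [one_smul, one_smul, one_smul]
  · rw [conn_add, c.conn_equivariant, c.conn_vert]

theorem isHorizontalAt_act {q : ℝ → P} {k : ℝ → G} {t : ℝ} {v : VP} {α : VG}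
    (hq : HasVelocity VP q t v) (hk : HasLogVelocity k t α)
    (h : adj VG G (k t)⁻¹ (c.conn (q t) ![v]) + α = 0) :
    c.IsHorizontalAt (fun s => B.act (q s) (k s)) t := by
  obtain ⟨w, hw, hc⟩ := c.exists_velocity_act hq hk
  exact ⟨w, hw, hc.trans h⟩

open Classical in
/-- Horizontal lifts of a curve are determined by their value at one time. -/
theorem eq_of_isHorizontalAt [T2Space G] {s : Set ℝ} (hs : IsOpen s) (hs' : IsPreconnected s)
    {q q' : ℝ → P}
    (hp : ∀ t ∈ s, B.proj (q t) = B.proj (q' t)) (hq : ∀ t ∈ s, c.IsHorizontalAt q t)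
    (hq' : ∀ t ∈ s, c.IsHorizontalAt q' t) {t₀ t : ℝ} (h₀ : t₀ ∈ s) (ht : t ∈ s)
    (h : q t₀ = q' t₀) : q t = q' t := by
  -- the element of `G` that takes `q t` to `q' t`; its logarithmic derivative vanishes
  set k : ℝ → G := fun t => if h : ∃ g, B.act (q t) g = q' t then h.choose else 1 with hk
  have hkq : ∀ t ∈ s, B.act (q t) (k t) = q' t := fun t ht => by
    have hex := B.exists_act_eq (hp t ht)
    rw [hk]
    dsimp only
    rw [dif_pos hex]
    exact hex.choose_spec
  have hkv : ∀ t ∈ s, HasLogVelocity k t (0 : VG) := fun t ht => by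
    obtain ⟨v, hv, hc⟩ := hq t ht
    obtain ⟨v', hv', hc'⟩ := hq' t ht
    have hev : ∀ᶠ r in 𝓝 t, B.act (q r) (k r) = q' r :=
      eventually_of_mem (hs.mem_nhds ht) hkq
    have hd : TDiff ℝ VG k t :=
      B.tDiff_difference (HasTDeriv.tDiff hv) (HasTDeriv.tDiff hv') hev
    have hl := (TDiff.hasLogDeriv hd).hasLogVelocity (f := fun r => r) (hasDerivAt_id t)
    obtain ⟨w, hw, hcw⟩ := c.exists_velocity_act hv hl
    have hw' : HasVelocity VP q' t w := HasTDeriv.congr hw (hev.mono fun _ h => h.symm)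
    have e : w = v' := hw'.velocity_eq.symm.trans hv'.velocity_eq
    subst e
    rw [hkq t ht, hc', hc, map_zero, zero_add] at hcw
    rw [← hcw] at hl
    exact hl
  have hone : ∀ t ∈ s, HasLogVelocity (fun _ : ℝ => (1 : G)) t (0 : VG) := fun t _ => by
    unfold HasLogVelocity
    rw [ContinuousLinearMap.toSpanSingleton_zero]
    exact hasLogDeriv_const 1 t
  have h1 := eq_mul_of_hasLogVelocity hs hs' hkv hone h₀ ht
  have h2 : k t₀ = 1 := B.act_left_cancel (p := q t₀) (by rw [hkq t₀ h₀, B.act_one, h])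
  rw [h2, inv_one, mul_one, mul_one] at h1
  rw [← hkq t ht, h1, B.act_one]

section Transport

variable [IsManifold 𝓘(ℝ, VP) ∞ P]

/-- A lift of `γ` becomes horizontal after correction by the path ordered exponential. -/
theorem isTransport_of_lift {γ : OnePath VM M} {σ : OnePath VP P} (h : ∀ t, B.proj (σ t) = γ t)
    (g : G) : c.IsTransport γ (B.act (σ 0) g) fun t =>
      B.act (σ t) ((c.pair.pathExp σ t)⁻¹ * g) := by
  have hA := c.pair.continuous_coeff_path σ
  refine c.isTransport_iff.2 ⟨?_, fun t => ⟨(B.proj_act _ _).trans (h t), ?_⟩⟩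
  · have : c.pair.pathExp σ 0 = 1 := orderedExp_zero_right hA
    rw [this, inv_one, one_mul]
  · have hv : HasVelocity VP σ.toFun t (velocity VP σ t) :=
      TDiff.hasVelocity (tDiff_of_contMDiffAt σ.smooth.contMDiffAt (by simp))
    have hk := ((hasLogVelocity_orderedExp (G := G) hA t).inv).mul_const g
    refine c.isHorizontalAt_act hv hk ?_
    have e : ((c.pair.pathExp σ t)⁻¹ * g)⁻¹ = g⁻¹ * c.pair.pathExp σ t := by group
    rw [e, adj_mul, map_neg]
    exact add_neg_cancel _

/-- Parallel transport along `γ` in terms of an arbitrary lift of `γ`. -/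
theorem transport_eq [T2Space G] {γ : OnePath VM M} {σ : OnePath VP P} (h : ∀ t, B.proj (σ t) = γ t)
    (g : G) (t : ℝ) :
    c.transport γ (B.act (σ 0) g) t = B.act (σ t) ((c.pair.pathExp σ t)⁻¹ * g) := by
  have h1 := c.isTransport_of_lift h g
  have hex : ∃ q, c.IsTransport γ (B.act (σ 0) g) q := ⟨_, h1⟩
  have h2 := c.isTransport_iff.1 hex.choose_spec
  have h3 := c.isTransport_iff.1 h1
  unfold transport
  rw [dif_pos hex]
  exact c.eq_of_isHorizontalAt isOpen_univ isPreconnected_univ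
    (fun t _ => (h2.2 t).1.trans (h3.2 t).1.symm) (fun t _ => (h2.2 t).2) (fun t _ => (h3.2 t).2)
    (mem_univ 0) (mem_univ t) (h2.1.trans h3.1.symm)

/-- The curvature 3-form of a categorical connection is horizontal: this is the infinitesimal form
of the equivariance of `m`. -/
theorem curv₃_vert [FiniteDimensional ℝ U] {σ : U → P} (hσ : ContMDiff 𝓘(ℝ, U) 𝓘(ℝ, VP) ∞ σ)
    (z w w' : U) (A : VG) :
    c.pair.curv₃ (σ z) (B.vert (σ z) A) (tmap U VP σ z w) (tmap U VP σ z w') = 0 := by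
  have hEv : ∀ r, HasLogVelocity (orderedExp G fun _ => A) r A :=
    hasLogVelocity_orderedExp continuous_const
  have hE0 : orderedExp G (fun _ => A) 0 = 1 := orderedExp_zero_right continuous_const
  have hEs : ContMDiff 𝓘(ℝ, ℝ) 𝓘(ℝ, VG) ∞ (orderedExp G fun _ => A) :=
    contMDiff_orderedExp contDiff_const
  set e : ℝ → G := orderedExp G fun _ => A with he
  -- move the map along the one-parameter group generated by `A`
  set F : ℝ × U → P := fun x => B.act (σ x.2) (e x.1) with hF
  have hFs : ContMDiff 𝓘(ℝ, ℝ × U) 𝓘(ℝ, VP) ∞ F :=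
    B.act_smooth.comp ((hσ.comp contDiff_snd.contMDiff).prodMk (hEs.comp contDiff_fst.contMDiff))
  have hFd : ∀ (x : ℝ × U) (v : ℝ × U), tmap (ℝ × U) VP F x v =
      tmap VP VP (fun q => B.act q (e x.1)) (σ x.2) (tmap U VP σ x.2 v.2) +
        B.vert (F x) (v.1 • A) := by
    intro x v
    have h1 : HasTDeriv (fun x : ℝ × U => σ x.2) x _ :=
      (TDiff.hasTDeriv (tDiff_of_contMDiffAt (hσ.contMDiffAt (x := x.2)) (by simp))).comp
        (hasTDeriv_iff_hasFDerivAt.2 hasFDerivAt_snd) rfl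
    have h2 : HasTDeriv (fun y : ℝ × U => (e x.1)⁻¹ * e y.1) x _ :=
      HasTDeriv.comp (g := fun r => (e x.1)⁻¹ * e r) (f := Prod.fst) (hEv x.1)
        (hasTDeriv_iff_hasFDerivAt.2 hasFDerivAt_fst) rfl
    have h3 := (B.hasTDeriv_act (k := fun x : ℝ × U => e x.1) h1 h2).tmap_eq
    exact congrArg (fun L : ℝ × U →L[ℝ] VP => L v) h3
  have hv0 : ∀ p, B.vert p (0 : VG) = 0 := fun p => (B.vertL p).map_zero
  have hF1 : ∀ x, tmap (ℝ × U) VP F x (1, 0) = B.vert (F x) A := fun x => by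
    rw [hFd, map_zero, map_zero, zero_add, one_smul]
  have hF2 : ∀ x w, tmap (ℝ × U) VP F x (0, w) =
      tmap VP VP (fun q => B.act q (e x.1)) (σ x.2) (tmap U VP σ x.2 w) := fun x w => by
    rw [hFd, zero_smul, hv0, add_zero]
  have c1 : ∀ x, c.pair.coeff₁ F (1, 0) x = A := fun x => by
    unfold LocalConnectionPair.coeff₁
    rw [hF1]
    exact c.conn_vert _ _
  have c2 : ∀ w, c.pair.coeff₂ F (1, 0) (0, w) = fun _ => 0 := fun w => by
    funext x
    unfold LocalConnectionPair.coeff₂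
    rw [hF1]
    exact c.m_vert_left _ _ _
  set β := c.pair.coeff₂ σ w w' with hβ
  have hβs : ContDiff ℝ ∞ β := c.pair.contDiff_coeff₂ hσ _ _
  have c3 : c.pair.coeff₂ F (0, w) (0, w') = fun x => 𝒢.actLie (e x.1)⁻¹ (β x.2) := by
    funext x
    unfold LocalConnectionPair.coeff₂
    rw [hF2, hF2]
    exact c.m_equivariant _ _ _ _
  have hKs : ContMDiff 𝓘(ℝ, ℝ × U) 𝓘(ℝ, VG) ∞ fun x : ℝ × U => (e x.1)⁻¹ :=
    (hEs.comp contDiff_fst.contMDiff).inv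
  have hKd : logDeriv VG (fun x : ℝ × U => (e x.1)⁻¹) (0, z) (1, 0) = -A := by
    refine logDeriv_apply_of_hasLogVelocity hKs (f := fun r => (r, z)) (t := 0)
      ((hasDerivAt_id _).prodMk (hasDerivAt_const _ _)) ?_
    have := (hEv 0).inv
    rw [hE0, adj_one] at this
    exact this
  have hF0 : F (0, z) = σ z := by
    change B.act (σ z) (e 0) = σ z
    rw [hE0, B.act_one]
  have hR : tmap VP VP (fun q => B.act q (1 : G)) (σ z) = ContinuousLinearMap.id ℝ VP := by
    simp only [B.act_one]
    exact (hasTDeriv_id (σ z)).tmap_eq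
  have key := c.pair.curv₃_tmap hFs (0, z) (1, 0) (0, w) (0, w')
  have hβd : fderiv ℝ (fun x : ℝ × U => β x.2) (0, z) (1, 0) = 0 := by
    have := ((hβs.differentiable (by simp) z).hasFDerivAt.comp (0, z)
      (hasFDerivAt_snd (𝕜 := ℝ) (E := ℝ) (F := U) (p := ((0 : ℝ), z)))).fderiv
    refine (congrArg (fun L : ℝ × U →L[ℝ] VE => L (1, 0)) this).trans ?_
    exact (fderiv ℝ β z).map_zero
  rw [hF1, hF2, hF2, c2, c2, c1, c3, 𝒢.fderiv_actLie_apply hKs (b := fun x : ℝ × U => β x.2)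
    (hβs.comp contDiff_snd), hKd, hβd] at key
  simp only [hF0, hR, hE0, inv_one, 𝒢.actLie_one, fderiv_fun_const, Pi.zero_apply] at key
  refine key.trans ?_
  have e1 : 𝒢.actInf (-A) (β z) = -𝒢.actInf A (β z) := by
    have := 𝒢.actInf_smul (-1) A
    rw [neg_one_smul, neg_one_smul] at this
    rw [this]; rfl
  rw [e1]
  simp

end Transport

section Lifts

variable [IsManifold 𝓘(ℝ, VP) ∞ P] [T2Space G]

/-- A vector in the kernel of the derivative of `f` is mapped to a vertical one by a lift of `f`. -/
theorem exists_vert_tmap {f : U → M} {σ : U → P} (hσ : ContMDiff 𝓘(ℝ, U) 𝓘(ℝ, VP) ∞ σ)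
    (h : ∀ z, B.proj (σ z) = f z) {z v : U} (hv : tmap U VM f z v = 0) :
    ∃ A, tmap U VP σ z v = B.vert (σ z) A := by
  refine B.exists_eq_vert ?_
  rw [B.tmap_proj_comp (TDiff.hasTDeriv (tDiff_of_contMDiffAt hσ.contMDiffAt (by simp)))
    (Eventually.of_forall h), hv]

theorem coeff₂_lift_eq_zero {f : ℝ × ℝ → M} {σ : ℝ × ℝ → P}
    (hσ : ContMDiff 𝓘(ℝ, ℝ × ℝ) 𝓘(ℝ, VP) ∞ σ) (h : ∀ z, B.proj (σ z) = f z)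
    (hf : RankLE (V := VM) 1 f) (z : ℝ × ℝ) : c.pair.coeff₂ σ (1, 0) (0, 1) z = 0 := by
  obtain ⟨v, hv, h0⟩ := hf.exists_tmap_eq_zero (by simp) z
  obtain ⟨A, hA⟩ := exists_vert_tmap hσ h h0
  refine c.pair.coeff₂_eq_zero hv fun Y => ?_
  rw [hA]
  exact c.m_vert_left _ _ _

/-- The categorical holonomy of a 2-path is the surface ordered exponential of a lift. -/
theorem catHol_eq {Γ : TwoPath VM M} {σ : TwoPath VP P} (h : ∀ p, B.proj (σ p) = Γ p) (g : G) :
    c.catHol Γ (B.act (σ (0, 0)) g) = 𝒢.act g⁻¹ (c.pair.surfaceExp σ) := by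
  have hf : (fun s => ∫ t' in (0 : ℝ)..1,
      (let q := c.transport (Γ.hslice s) (c.transport Γ.left (B.act (σ (0, 0)) g) s) t'
       c.m q ![c.horLift q (Γ.dt t' s), c.horLift q (Γ.ds t' s)])) =
      fun s => 𝒢.actLie g⁻¹ (c.pair.flux σ s) := by
    funext s
    have hint : IntervalIntegrable (fun t => 𝒢.actLie
        (c.pair.pathExp σ.left s * c.pair.pathExp (σ.hslice s) t)
        (c.pair.coeff₂ σ.toFun (1, 0) (0, 1) (t, s))) MeasureTheory.volume 0 1 := by
      simp only [c.pair.pathExp_mul_pathExp]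
      exact ((c.pair.planePair σ).contDiff_transported.continuous.comp
        (by fun_prop : Continuous fun t : ℝ => (t, s))).intervalIntegrable _ _
    unfold LocalConnectionPair.flux
    rw [← ContinuousLinearMap.intervalIntegral_comp_comm _ hint]
    congr 1
    funext t
    have h1 : c.transport Γ.left (B.act (σ (0, 0)) g) s =
        B.act (σ (0, s)) ((c.pair.pathExp σ.left s)⁻¹ * g) :=
      c.transport_eq (γ := Γ.left) (σ := σ.left) (fun s => h (0, s)) g s
    have h2 : c.transport (Γ.hslice s) (B.act (σ (0, s)) ((c.pair.pathExp σ.left s)⁻¹ * g)) t =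
        B.act (σ (t, s)) ((c.pair.pathExp (σ.hslice s) t)⁻¹ *
          ((c.pair.pathExp σ.left s)⁻¹ * g)) :=
      c.transport_eq (γ := Γ.hslice s) (σ := σ.hslice s) (fun t => h (t, s)) _ t
    have h3 : ∀ (v : ℝ × ℝ) (k : G), tmap (ℝ × ℝ) VM Γ.toFun (t, s) v =
        tmap VP VM B.proj (B.act (σ (t, s)) k) (tmap VP VP (fun q => B.act q k) (σ (t, s))
          (tmap (ℝ × ℝ) VP σ.toFun (t, s) v)) := fun v k => by
      rw [B.tmap_proj_act]
      exact (B.tmap_proj_comp (TDiff.hasTDeriv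
        (tDiff_of_contMDiffAt σ.smooth.contMDiffAt (by simp))) (Eventually.of_forall h) v).symm
    dsimp only
    rw [h1, h2]
    unfold TwoPath.dt TwoPath.ds
    rw [h3 _ ((c.pair.pathExp (σ.hslice s) t)⁻¹ * ((c.pair.pathExp σ.left s)⁻¹ * g)),
      h3 _ ((c.pair.pathExp (σ.hslice s) t)⁻¹ * ((c.pair.pathExp σ.left s)⁻¹ * g)),
      m_horLift, c.m_equivariant]
    have e : ((c.pair.pathExp (σ.hslice s) t)⁻¹ * ((c.pair.pathExp σ.left s)⁻¹ * g))⁻¹ =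
      g⁻¹ * (c.pair.pathExp σ.left s * c.pair.pathExp (σ.hslice s) t) := by group
    rw [e, 𝒢.actLie_mul]
    rfl
  unfold catHol catHolAt
  rw [hf, orderedExp_act 𝒢 (c.pair.continuous_flux σ), ← c.pair.surfaceExp_eq]

end Lifts

end CategoricalConnection

end Horizontal

/-! ### Existence of smooth lifts -/

section Retract

variable {X : Type*} [NormedAddCommGroup X] [NormedSpace ℝ X] [FiniteDimensional ℝ X]

/-- A smooth map that is the identity on a ball and has values in a larger ball. -/
theorem exists_smooth_retract (x₀ : X) {r R : ℝ} (hr : 0 < r) (hR : r < R) :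
    ∃ ρ : X → X, ContDiff ℝ ∞ ρ ∧ (∀ x ∈ Metric.ball x₀ r, ρ x = x) ∧
      ∀ x, ρ x ∈ Metric.ball x₀ R := by
  let f : ContDiffBump x₀ := ⟨r, R, hr, hR⟩
  refine ⟨fun x => x₀ + f x • (x - x₀), ?_, fun x hx => ?_, fun x => ?_⟩
  · exact contDiff_const.add (f.contDiff.smul (contDiff_id.sub contDiff_const))
  · dsimp only
    rw [f.one_of_mem_closedBall (Metric.ball_subset_closedBall hx), one_smul, add_sub_cancel]
  · rw [mem_ball_iff_norm, add_sub_cancel_left, norm_smul, Real.norm_of_nonneg f.nonneg]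
    by_cases hx : x ∈ Metric.ball x₀ R
    · rw [mem_ball_iff_norm] at hx
      exact (mul_le_of_le_one_left (norm_nonneg _) f.le_one).trans_lt hx
    · have : f x = 0 := by
        by_contra h
        exact hx (f.support_eq ▸ h)
      rw [this, zero_mul]
      exact hr.trans hR

/-- A smooth map of the line to `[0,1]` that is constant near the end points of `[0,1]`, and moves
points only within `t ≤ ε` and within `1 - ε ≤ t`. Maps with a product structure on these two
regions are invariant under precomposition with it, while precomposition with it gives any smooth
map a product structure close to the boundary. -/
structure IsClamp (ε : ℝ) (r : ℝ → ℝ) : Prop where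
  smooth : ContDiff ℝ ∞ r
  sitting : ∃ δ > 0, (∀ t ≤ δ, r t = 0) ∧ ∀ t ≥ 1 - δ, r t = 1
  mem : ∀ t, r t ∈ Icc (0 : ℝ) 1
  eq_or : ∀ t, r t = t ∨ (t ≤ ε ∧ r t ≤ ε) ∨ (1 - ε ≤ t ∧ 1 - ε ≤ r t)

theorem exists_isClamp {ε : ℝ} (hε : 0 < ε) : ∃ r, IsClamp ε r := by
  set η := min ε (1 / 4) with hη
  have hη0 : 0 < η := lt_min hε (by norm_num)
  have hη1 : η ≤ ε := min_le_left _ _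
  have hη2 : η ≤ 1 / 4 := min_le_right _ _
  set χ : ℝ → ℝ := fun t => Real.smoothTransition (2 / η * t - 1) with hχ
  have hχs : ContDiff ℝ ∞ χ := Real.smoothTransition.contDiff.comp (by fun_prop)
  have χ0 : ∀ t ≤ η / 2, χ t = 0 := fun t ht => by
    refine Real.smoothTransition.zero_of_nonpos ?_
    have : 2 / η * t ≤ 2 / η * (η / 2) := by gcongr
    have e : 2 / η * (η / 2) = 1 := by field_simp
    linarith
  have χ1 : ∀ t ≥ η, χ t = 1 := fun t ht => by
    refine Real.smoothTransition.one_of_one_le ?_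
    have : 2 / η * η ≤ 2 / η * t := by gcongr
    have e : 2 / η * η = 2 := by field_simp
    linarith
  have χmul : ∀ t ≤ η, χ t * t ≤ η := fun t ht => by
    rcases le_or_gt t 0 with h | h
    · rw [χ0 t (by linarith), zero_mul]; exact hη0.le
    · exact (mul_le_of_le_one_left h.le (Real.smoothTransition.le_one _)).trans ht
  refine ⟨fun t => χ t * (1 - χ (1 - t) * (1 - t)), ?_, ⟨η / 2, by positivity, fun t ht => ?_,
    fun t ht => ?_⟩, fun t => ?_, fun t => ?_⟩
  · have : ContDiff ℝ ∞ fun t => χ (1 - t) := hχs.comp (by fun_prop)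
    fun_prop
  · rw [χ0 t ht, zero_mul]
  · rw [χ1 t (by linarith), χ0 (1 - t) (by linarith)]
    ring
  · rcases le_or_gt t 0 with h | h
    · rw [χ0 t (by linarith), zero_mul]
      exact ⟨le_rfl, zero_le_one⟩
    rcases le_or_gt 1 t with h' | h'
    · rw [χ1 t (by linarith), χ0 (1 - t) (by linarith)]
      norm_num
    have h1 : 0 ≤ χ t := Real.smoothTransition.nonneg _
    have h2 : χ t ≤ 1 := Real.smoothTransition.le_one _
    have h3 : 0 ≤ χ (1 - t) * (1 - t) :=
      mul_nonneg (Real.smoothTransition.nonneg _) (by linarith)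
    have h4 : χ (1 - t) * (1 - t) ≤ 1 :=
      mul_le_one₀ (Real.smoothTransition.le_one _) (by linarith) (by linarith)
    exact ⟨mul_nonneg h1 (by linarith), mul_le_one₀ h2 (by linarith) (by linarith)⟩
  · rcases le_or_gt t η with h | h
    · refine Or.inr (Or.inl ⟨h.trans hη1, ?_⟩)
      have := χmul t h
      rw [χ1 (1 - t) (by linarith)]
      linarith
    · rcases le_or_gt (1 - t) η with h' | h'
      · refine Or.inr (Or.inr ⟨by linarith, ?_⟩)
        have := χmul (1 - t) h'
        rw [χ1 t (by linarith)]
        linarith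
      · refine Or.inl ?_
        rw [χ1 t (by linarith), χ1 (1 - t) (by linarith)]
        ring

theorem IsClamp.mono {ε ε' : ℝ} {r : ℝ → ℝ} (h : IsClamp ε r) (hε : ε ≤ ε') : IsClamp ε' r :=
  ⟨h.smooth, h.sitting, h.mem, fun t => (h.eq_or t).imp_right <| Or.imp
    (And.imp (fun h => h.trans hε) fun h => h.trans hε)
    (And.imp (fun h => by linarith) fun h => by linarith)⟩

/-- Functions that are constant on `t ≤ ε` and on `1 - ε ≤ t` are invariant under
precomposition with a clamp. -/
theorem IsClamp.comp_eq {α : Type*} {g : ℝ → α} {ε : ℝ} {r : ℝ → ℝ} (h : IsClamp ε r)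
    (h₀ : ∀ t ≤ ε, g t = g 0) (h₁ : ∀ t ≥ 1 - ε, g t = g 1) (t : ℝ) : g (r t) = g t := by
  rcases h.eq_or t with h | h | h
  · rw [h]
  · rw [h₀ _ h.1, h₀ _ h.2]
  · rw [h₁ _ h.1, h₁ _ h.2]

end Retract

section Lift

variable {VM : Type*} [NormedAddCommGroup VM] [NormedSpace ℝ VM]
  {M : Type*} [TopologicalSpace M] [ChartedSpace VM M]
  {VG : Type*} [NormedAddCommGroup VG] [NormedSpace ℝ VG] [FiniteDimensional ℝ VG]
  {G : Type*} [TopologicalSpace G] [ChartedSpace VG G] [Group G] [LieGroup 𝓘(ℝ, VG) ∞ G]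
  {VE : Type*} [NormedAddCommGroup VE] [NormedSpace ℝ VE] [FiniteDimensional ℝ VE]
  {E : Type*} [TopologicalSpace E] [ChartedSpace VE E] [Group E] [LieGroup 𝓘(ℝ, VE) ∞ E]
  {VP : Type*} [NormedAddCommGroup VP] [NormedSpace ℝ VP]
  {P : Type*} [TopologicalSpace P] [ChartedSpace VP P] [IsManifold 𝓘(ℝ, VP) ∞ P]
  {X : Type*} [NormedAddCommGroup X] [NormedSpace ℝ X] [FiniteDimensional ℝ X]

theorem PrincipalBundle.exists_local_section (B : PrincipalBundle VM M VG G VP P) (x : M) :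
    ∃ (U : Set M) (s : M → P), IsOpen U ∧ x ∈ U ∧ ContMDiffOn 𝓘(ℝ, VM) 𝓘(ℝ, VP) ∞ s U ∧
      ∀ y ∈ U, B.proj (s y) = y := by
  obtain ⟨U, Φ, hU, hx, hs, ht, hΦ, hΨ, heq⟩ := B.locTriv x
  have hm : ∀ y ∈ U, (y, (1 : G)) ∈ Φ.target := fun y hy => by rw [ht]; exact ⟨hy, trivial⟩
  refine ⟨U, fun y => Φ.symm (y, 1), hU, hx, ?_, fun y hy => ?_⟩
  · exact hΨ.comp (contMDiff_prodMk_left (1 : G)).contMDiffOn hm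
  · rw [← (heq _ (Φ.map_target (hm y hy))).1, Φ.right_inv (hm y hy)]

namespace CategoricalConnection

variable {𝒢 : LieCrossedModule VG G VE E} {B : PrincipalBundle VM M VG G VP P}
  (c : CategoricalConnection 𝒢 B)

/-- The map `σ` is smooth at `(t,x)`, lifts `F`, and is horizontal in the direction of `t`. -/
structure IsLiftAt (F : ℝ × X → M) (σ : ℝ × X → P) (t : ℝ) (x : X) : Prop where
  smooth : ContMDiffAt 𝓘(ℝ, ℝ × X) 𝓘(ℝ, VP) ∞ σ (t, x)
  proj : B.proj (σ (t, x)) = F (t, x)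
  horizontal : c.IsHorizontalAt (fun t => σ (t, x)) t

variable {c} in
theorem IsLiftAt.congr {F : ℝ × X → M} {σ σ' : ℝ × X → P} {t : ℝ} {x : X}
    (h : c.IsLiftAt F σ t x) (hσ : σ' =ᶠ[𝓝 (t, x)] σ) : c.IsLiftAt F σ' t x := by
  refine ⟨h.smooth.congr_of_eventuallyEq hσ, ?_, h.horizontal.congr ?_⟩
  · rw [hσ.self_of_nhds, h.proj]
  · exact (Continuous.prodMk_left x).continuousAt.eventually hσ

open Classical in
/-- Over an interval whose image lies in the domain of a local section, horizontal lifts exist and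
depend smoothly on parameters. -/
theorem exists_local_lift {F : ℝ × X → M} (hF : ContMDiff 𝓘(ℝ, ℝ × X) 𝓘(ℝ, VM) ∞ F) {a b : ℝ}
    (hab : a ≤ b) {x₀ : X} {U : Set M} (hU : IsOpen U) {s : M → P}
    (hs : ContMDiffOn 𝓘(ℝ, VM) 𝓘(ℝ, VP) ∞ s U) (hsp : ∀ y ∈ U, B.proj (s y) = y)
    (hFU : ∀ t ∈ Icc a b, F (t, x₀) ∈ U) {τ : X → P}
    (hτ : ∀ᶠ x in 𝓝 x₀, ContMDiffAt 𝓘(ℝ, X) 𝓘(ℝ, VP) ∞ τ x)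
    (hτp : ∀ᶠ x in 𝓝 x₀, B.proj (τ x) = F (a, x)) :
    ∃ δ > 0, ∃ W : Set X, IsOpen W ∧ x₀ ∈ W ∧ ∃ σ : ℝ × X → P,
      (∀ t ∈ Ioo (a - δ) (b + δ), ∀ x ∈ W, c.IsLiftAt F σ t x) ∧ ∀ x ∈ W, σ (a, x) = τ x := by
  have hK : IsCompact (Icc a b ×ˢ {x₀} : Set (ℝ × X)) := isCompact_Icc.prod isCompact_singleton
  obtain ⟨δ, hδ, hsub⟩ := hK.exists_thickening_subset_open (hU.preimage hF.continuous) (by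
    rintro ⟨t, x⟩ ⟨ht, hx⟩
    obtain rfl : x = x₀ := hx
    exact hFU t ht)
  have hFmem : ∀ t ∈ Metric.ball ((a + b) / 2) ((b - a) / 2 + δ), ∀ x ∈ Metric.ball x₀ δ,
      F (t, x) ∈ U := by
    intro t ht x hx
    refine hsub (Metric.mem_thickening_iff.2 ⟨(max a (min b t), x₀), ⟨⟨le_max_left _ _,
      max_le hab (min_le_left _ _)⟩, rfl⟩, ?_⟩)
    rw [Real.ball_eq_Ioo] at ht
    rw [Prod.dist_eq, max_lt_iff]
    refine ⟨?_, hx⟩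
    rw [Real.dist_eq, abs_lt]
    rcases max_cases a (min b t) with h | h <;> rcases min_cases b t with h' | h' <;>
      constructor <;> linarith [ht.1, ht.2]
  obtain ⟨ρ₁, hρ₁, hρ₁', hρ₁U⟩ := exists_smooth_retract ((a + b) / 2)
    (r := (b - a) / 2 + δ / 2) (R := (b - a) / 2 + δ) (by linarith) (by linarith)
  obtain ⟨ρ₂, hρ₂, hρ₂', hρ₂U⟩ := exists_smooth_retract x₀ (r := δ / 2) (R := δ)
    (by linarith) (by linarith)
  -- a globally defined smooth lift of a modification of `F` away from `[a,b] × {x₀}`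
  set f : ℝ × X → P := fun p => s (F (ρ₁ p.1, ρ₂ p.2)) with hf
  have hfs : ContMDiff 𝓘(ℝ, ℝ × X) 𝓘(ℝ, VP) ∞ f := by
    intro p
    have h1 : ContMDiffAt 𝓘(ℝ, ℝ × X) 𝓘(ℝ, VM) ∞ (fun p : ℝ × X => F (ρ₁ p.1, ρ₂ p.2)) p :=
      (hF.comp (((hρ₁.comp contDiff_fst).prodMk (hρ₂.comp contDiff_snd)).contMDiff)).contMDiffAt
    exact ContMDiffAt.comp p (hs.contMDiffAt (hU.mem_nhds (hFmem _ (hρ₁U _) _ (hρ₂U _)))) h1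
  have hI : ∀ t ∈ Ioo (a - δ / 2) (b + δ / 2),
      t ∈ Metric.ball ((a + b) / 2) ((b - a) / 2 + δ / 2) :=
    fun t ht => by
      rw [Real.ball_eq_Ioo]
      exact ⟨by linarith [ht.1], by linarith [ht.2]⟩
  have hfp : ∀ t ∈ Ioo (a - δ / 2) (b + δ / 2), ∀ x ∈ Metric.ball x₀ (δ / 2),
      B.proj (f (t, x)) = F (t, x) := by
    intro t ht x hx
    have h1 := hsp _ (hFmem _ (hρ₁U t) _ (hρ₂U x))
    rw [hρ₁' t (hI t ht), hρ₂' x hx] at h1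
    change B.proj (s (F (ρ₁ t, ρ₂ x))) = _
    rw [hρ₁' t (hI t ht), hρ₂' x hx, h1]
  -- `f h⁻¹` is horizontal in the direction of `t`; the factor `h(a,x) D(x)` adjusts its value at
  -- `a`
  set A := c.pair.coeff₁ f (1, 0) with hA
  have hAs : ContDiff ℝ ∞ A := c.pair.contDiff_coeff₁ hfs _
  set h : ℝ × X → G := solution (fun _ => 1) A with hh
  have hhs : ContMDiff 𝓘(ℝ, ℝ × X) 𝓘(ℝ, VG) ∞ h := contMDiff_family contMDiff_const hAs
  set D : X → G := fun x => if h : ∃ g, B.act (f (a, x)) g = τ x then h.choose else 1 with hD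
  have ha : a ∈ Ioo (a - δ / 2) (b + δ / 2) := ⟨by linarith, by linarith⟩
  have hDτ : ∀ᶠ x in 𝓝 x₀, B.act (f (a, x)) (D x) = τ x := by
    filter_upwards [hτp, Metric.ball_mem_nhds x₀ (half_pos hδ)] with x hx hx'
    have hex := B.exists_act_eq ((hfp a ha x hx').trans hx.symm)
    rw [hD]
    dsimp only
    rw [dif_pos hex]
    exact hex.choose_spec
  have hev : ∀ᶠ x in 𝓝 x₀, ContMDiffAt 𝓘(ℝ, X) 𝓘(ℝ, VG) ∞ D x ∧
      B.act (f (a, x)) (D x) = τ x ∧ x ∈ Metric.ball x₀ (δ / 2) := by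
    filter_upwards [hτ, hDτ.eventually_nhds, hDτ, Metric.ball_mem_nhds x₀ (half_pos hδ)]
      with x h1 h2 h3 h4
    exact ⟨B.contMDiffAt_difference
      (hfs.comp (by fun_prop : ContDiff ℝ ∞ fun x : X => (a, x)).contMDiff).contMDiffAt h1 h2,
      h3, h4⟩
  obtain ⟨W, hW, hWo, hx₀⟩ := eventually_nhds_iff.1 hev
  refine ⟨δ / 2, half_pos hδ, W, hWo, hx₀,
    fun p => B.act (f p) ((h p)⁻¹ * (h (a, p.2) * D p.2)), fun t ht x hx => ⟨?_, ?_, ?_⟩,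
    fun x hx => ?_⟩
  · have h1 : ContMDiffAt 𝓘(ℝ, ℝ × X) 𝓘(ℝ, VG) ∞ (fun p : ℝ × X => D p.2) (t, x) :=
      ContMDiffAt.comp (t, x) (hW x hx).1 contDiff_snd.contMDiff.contMDiffAt
    have h2 : ContMDiffAt 𝓘(ℝ, ℝ × X) 𝓘(ℝ, VG) ∞ (fun p : ℝ × X => h (a, p.2)) (t, x) :=
      (hhs.comp (by fun_prop : ContDiff ℝ ∞ fun p : ℝ × X => (a, p.2)).contMDiff).contMDiffAt
    exact ContMDiffAt.comp (t, x) B.act_smooth.contMDiffAt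
      (hfs.contMDiffAt.prodMk (hhs.contMDiffAt.inv.mul (h2.mul h1)))
  · exact (B.proj_act _ _).trans (hfp t ht x (hW x hx).2.2)
  · have hv : HasVelocity VP (fun t => f (t, x)) t (tmap (ℝ × X) VP f (t, x) (1, 0)) := by
      have h1 : HasTDeriv (fun t => f (t, x)) t _ :=
        (TDiff.hasTDeriv (tDiff_of_contMDiffAt (hfs.contMDiffAt (x := (t, x))) (by simp))).comp
          (hasTDeriv_iff_hasFDerivAt.2 (hasFDerivAt_prodMk_left t x)) rfl
      rw [hasVelocity_iff]
      convert h1 using 1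
      refine ContinuousLinearMap.ext_ring ?_
      change (1 : ℝ) • tmap (ℝ × X) VP f (t, x) (1, 0) = tmap (ℝ × X) VP f (t, x) (1, 0)
      exact one_smul ℝ _
    have hk := ((hasLogVelocity_solution (fun _ => (1 : G)) hAs t x).inv).mul_const
      (h (a, x) * D x)
    refine c.isHorizontalAt_act hv hk ?_
    have e : ((h (t, x))⁻¹ * (h (a, x) * D x))⁻¹ = (h (a, x) * D x)⁻¹ * h (t, x) := by group
    change adj VG G ((h (t, x))⁻¹ * (h (a, x) * D x))⁻¹ (A (t, x)) + _ = 0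
    rw [e, adj_mul, map_neg]
    exact add_neg_cancel _
  · change B.act (f (a, x)) ((h (a, x))⁻¹ * (h (a, x) * D x)) = τ x
    rw [inv_mul_cancel_left, (hW x hx).2.1]

/-- Near `x₀`, the map `F` has a smooth horizontal lift over `[0,a]` that starts at `u`. -/
def LiftsTo (F : ℝ × X → M) (x₀ : X) (u : P) (a : ℝ) : Prop :=
  ∃ δ > 0, ∃ W : Set X, IsOpen W ∧ x₀ ∈ W ∧ ∃ σ : ℝ × X → P,
    (∀ t ∈ Ioo (-δ) (a + δ), ∀ x ∈ W, c.IsLiftAt F σ t x) ∧ ∀ x ∈ W, σ (0, x) = u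

variable [T2Space G]

variable {c} in
/-- A lift over `[0,a]` extends over an interval `[a,b]` that `F (·, x₀)` maps into the domain of a
local section. -/
theorem LiftsTo.extend {F : ℝ × X → M} (hF : ContMDiff 𝓘(ℝ, ℝ × X) 𝓘(ℝ, VM) ∞ F) {x₀ : X} {u : P}
    {a b : ℝ} (ha : 0 ≤ a) (hab : a ≤ b) (h : c.LiftsTo F x₀ u a) {U : Set M} (hU : IsOpen U)
    {s : M → P} (hs : ContMDiffOn 𝓘(ℝ, VM) 𝓘(ℝ, VP) ∞ s U) (hsp : ∀ y ∈ U, B.proj (s y) = y)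
    (hFU : ∀ t ∈ Icc a b, F (t, x₀) ∈ U) : c.LiftsTo F x₀ u b := by
  obtain ⟨δ, hδ, W, hW, hxW, σ, hσ, hσ0⟩ := h
  have haI : a ∈ Ioo (-δ) (a + δ) := ⟨by linarith, by linarith⟩
  obtain ⟨δ', hδ', W', hW', hxW', σ', hσ', hσa⟩ := c.exists_local_lift hF hab hU hs hsp hFU
    (τ := fun x => σ (a, x))
    (eventually_of_mem (hW.mem_nhds hxW) fun x hx =>
      ContMDiffAt.comp x (hσ a haI x hx).smooth
        (by fun_prop : ContDiff ℝ ∞ fun x : X => (a, x)).contMDiff.contMDiffAt)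
    (eventually_of_mem (hW.mem_nhds hxW) fun x hx => (hσ a haI x hx).proj)
  have hmin := min_le_left δ δ'
  have hmin' := min_le_right δ δ'
  have hm0 : 0 < min δ δ' := lt_min hδ hδ'
  -- the two lifts agree where both are defined
  have hagree : ∀ x ∈ W ∩ W', ∀ t ∈ Ioo (a - min δ δ') (a + min δ δ'), -δ < t →
      σ (t, x) = σ' (t, x) := by
    intro x hx t ht htδ
    have e : ∀ r ∈ Ioo (max (-δ) (a - min δ δ')) (a + min δ δ'),
        r ∈ Ioo (-δ) (a + δ) ∧ r ∈ Ioo (a - δ') (b + δ') := fun r hr => by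
      have h1 := max_lt_iff.1 hr.1
      exact ⟨⟨h1.1, by linarith [hr.2]⟩, ⟨by linarith [h1.2], by linarith [hr.2]⟩⟩
    exact c.eq_of_isHorizontalAt (q := fun t => σ (t, x)) (q' := fun t => σ' (t, x)) isOpen_Ioo
      isPreconnected_Ioo
      (fun r hr => (hσ r (e r hr).1 x hx.1).proj.trans (hσ' r (e r hr).2 x hx.2).proj.symm)
      (fun r hr => (hσ r (e r hr).1 x hx.1).horizontal)
      (fun r hr => (hσ' r (e r hr).2 x hx.2).horizontal)
      (t₀ := a) ⟨max_lt (by linarith) (by linarith), by linarith⟩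
      ⟨max_lt htδ ht.1, ht.2⟩ (hσa x hx.2).symm
  refine ⟨min δ δ', hm0, W ∩ W', hW.inter hW', ⟨hxW, hxW'⟩,
    fun p => if p.1 < a then σ p else σ' p, fun t ht x hx => ?_, fun x hx => ?_⟩
  · rcases lt_or_ge t a with h | h
    · refine (hσ t ⟨by linarith [ht.1], by linarith⟩ x hx.1).congr ?_
      filter_upwards [continuous_fst.continuousAt.preimage_mem_nhds (Iio_mem_nhds h)] with p hp
      exact if_pos hp
    · refine (hσ' t ⟨by linarith, by linarith [ht.2]⟩ x hx.2).congr ?_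
      filter_upwards [continuous_fst.continuousAt.preimage_mem_nhds
          (Ioi_mem_nhds (show -δ < t by linarith)),
        continuous_fst.continuousAt.preimage_mem_nhds
          (Ioi_mem_nhds (show a - min δ δ' < t by linarith)),
        continuous_snd.continuousAt.preimage_mem_nhds ((hW.inter hW').mem_nhds hx)]
        with p hp hp' hpx
      split_ifs with hpa
      · exact hagree p.2 hpx p.1 ⟨hp', by linarith⟩ hp
      · rfl
  · dsimp only
    split_ifs with h0
    · exact hσ0 x hx.1
    · obtain rfl : a = 0 := le_antisymm (not_lt.1 h0) ha
      rw [hσa x hx.2, hσ0 x hx.1]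

theorem liftsTo_one {F : ℝ × X → M} (hF : ContMDiff 𝓘(ℝ, ℝ × X) 𝓘(ℝ, VM) ∞ F) (x₀ : X) {u : P}
    (hu : ∀ x, B.proj u = F (0, x)) : c.LiftsTo F x₀ u 1 := by
  choose U s hU hxU hs hsp using B.exists_local_section
  have h0 : c.LiftsTo F x₀ u 0 := by
    obtain ⟨δ, hδ, W, hW, hxW, σ, hσ, hσ0⟩ := c.exists_local_lift hF (le_refl (0 : ℝ)) (x₀ := x₀)
      (hU (F (0, x₀))) (hs _) (hsp _)
      (fun t ht => by rw [le_antisymm ht.2 ht.1]; exact hxU _) (τ := fun _ => u)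
      (Eventually.of_forall fun x => contMDiffAt_const) (Eventually.of_forall hu)
    exact ⟨δ, hδ, W, hW, hxW, σ, fun t ht => hσ t (by simpa using ht), hσ0⟩
  have hc : Continuous fun t : Icc (0 : ℝ) 1 => F (t, x₀) :=
    hF.continuous.comp (by fun_prop)
  -- cut `[0,1]` into intervals that are mapped into the domains of local sections
  obtain ⟨t, ht0, htm, ⟨m, hm⟩, hsub⟩ := exists_monotone_Icc_subset_open_cover_Icc
    (zero_le_one (α := ℝ)) (c := fun y : M => {t : Icc (0 : ℝ) 1 | F (t, x₀) ∈ U y})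
    (fun y => (hU y).preimage hc) (fun t _ => mem_iUnion.2 ⟨F (t, x₀), hxU _⟩)
  have key : ∀ n, c.LiftsTo F x₀ u (t n) := by
    intro n
    induction n with
    | zero => rw [ht0]; exact h0
    | succ n ih =>
      obtain ⟨y, hy⟩ := hsub n
      refine ih.extend hF (t n).2.1 (htm (Nat.le_succ n)) (hU y) (hs y) (hsp y) fun r hr => ?_
      exact @hy ⟨r, (t n).2.1.trans hr.1, hr.2.trans (t (n + 1)).2.2⟩ hr
  have := key m
  rwa [hm m le_rfl] at this

/-- Smooth maps from vector spaces lift to the total space: lift horizontally along the rays. -/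
theorem exists_lift (c : CategoricalConnection 𝒢 B) {f : X → M}
    (hf : ContMDiff 𝓘(ℝ, X) 𝓘(ℝ, VM) ∞ f) :
    ∃ σ : X → P, ContMDiff 𝓘(ℝ, X) 𝓘(ℝ, VP) ∞ σ ∧ ∀ x, B.proj (σ x) = f x := by
  obtain ⟨u, hu⟩ := B.proj_surjective (f 0)
  have hF : ContMDiff 𝓘(ℝ, ℝ × X) 𝓘(ℝ, VM) ∞ fun p : ℝ × X => f (p.1 • p.2) :=
    hf.comp (by fun_prop : ContDiff ℝ ∞ fun p : ℝ × X => p.1 • p.2).contMDiff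
  have hl := fun x₀ : X => c.liftsTo_one hF x₀ (u := u) fun x => by rw [hu, zero_smul]
  choose δ hδ W hW hxW σ hσ hσ0 using hl
  -- the lifts near different points agree, since both are horizontal along the ray through `x`
  have heq : ∀ x₀, ∀ x ∈ W x₀, σ x (1, x) = σ x₀ (1, x) := by
    intro x₀ x hx
    have hm0 : 0 < min (δ x) (δ x₀) := lt_min (hδ x) (hδ x₀)
    have e : ∀ r ∈ Ioo (-min (δ x) (δ x₀)) (1 + min (δ x) (δ x₀)),
        r ∈ Ioo (-δ x) (1 + δ x) ∧ r ∈ Ioo (-δ x₀) (1 + δ x₀) := fun r hr => by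
      have h1 := min_le_left (δ x) (δ x₀)
      have h2 := min_le_right (δ x) (δ x₀)
      exact ⟨⟨by linarith [hr.1], by linarith [hr.2]⟩, ⟨by linarith [hr.1], by linarith [hr.2]⟩⟩
    exact c.eq_of_isHorizontalAt (q := fun t => σ x (t, x)) (q' := fun t => σ x₀ (t, x)) isOpen_Ioo
      isPreconnected_Ioo
      (fun r hr => (hσ x r (e r hr).1 x (hxW x)).proj.trans (hσ x₀ r (e r hr).2 x hx).proj.symm)
      (fun r hr => (hσ x r (e r hr).1 x (hxW x)).horizontal)
      (fun r hr => (hσ x₀ r (e r hr).2 x hx).horizontal)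
      (t₀ := 0) ⟨by linarith, by linarith⟩ ⟨by linarith, by linarith⟩
      ((hσ0 x x (hxW x)).trans (hσ0 x₀ x hx).symm)
  have h1 : ∀ x, (1 : ℝ) ∈ Ioo (-δ x) (1 + δ x) := fun x =>
    ⟨by linarith [hδ x], by linarith [hδ x]⟩
  refine ⟨fun x => σ x (1, x), fun x₀ => ?_, fun x => ?_⟩
  · have h2 : ContMDiffAt 𝓘(ℝ, X) 𝓘(ℝ, VP) ∞ (fun x => σ x₀ (1, x)) x₀ :=
      ContMDiffAt.comp x₀ (hσ x₀ 1 (h1 x₀) x₀ (hxW x₀)).smooth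
        (by fun_prop : ContDiff ℝ ∞ fun x : X => ((1 : ℝ), x)).contMDiff.contMDiffAt
    refine h2.congr_of_eventuallyEq ?_
    filter_upwards [(hW x₀).mem_nhds (hxW x₀)] with x hx
    exact heq x₀ x hx
  · rw [(hσ x 1 (h1 x) x (hxW x)).proj, one_smul]

end CategoricalConnection

end Lift

/-! ### Lifts of paths and of homotopies -/

section Clamp

variable {V : Type*} [NormedAddCommGroup V] [NormedSpace ℝ V]
  {N : Type*} [TopologicalSpace N] [ChartedSpace V N] {ε : ℝ} {r : ℝ → ℝ}

/-- A smooth curve, reparametrised to have sitting instants. -/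
def OnePath.ofClamp (hr : IsClamp ε r) {f : ℝ → N} (hf : ContMDiff 𝓘(ℝ, ℝ) 𝓘(ℝ, V) ∞ f) :
    OnePath V N where
  toFun t := f (r t)
  smooth := hf.comp hr.smooth.contMDiff
  sitting := by
    obtain ⟨δ, hδ, h₀, h₁⟩ := hr.sitting
    exact ⟨δ, hδ, fun t ht => by rw [h₀ t ht, h₀ 0 hδ.le],
      fun t ht => by rw [h₁ t ht, h₁ 1 (by linarith)]⟩

/-- A smooth map of the plane, reparametrised to have a product structure close to the boundary of
the square. -/
def TwoPath.ofClamp (hr : IsClamp ε r) {f : ℝ × ℝ → N}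
    (hf : ContMDiff 𝓘(ℝ, ℝ × ℝ) 𝓘(ℝ, V) ∞ f) : TwoPath V N where
  toFun p := f (r p.1, r p.2)
  smooth := hf.comp
    ((hr.smooth.comp contDiff_fst).prodMk (hr.smooth.comp contDiff_snd)).contMDiff
  product := by
    obtain ⟨δ, hδ, h₀, h₁⟩ := hr.sitting
    exact ⟨δ, hδ, fun t ht s => by rw [h₀ t ht, h₀ 0 hδ.le],
      fun t ht s => by rw [h₁ t ht, h₁ 1 (by linarith)],
      fun t ht s => by rw [h₀ t ht, h₀ 0 hδ.le],
      fun t ht s => by rw [h₁ t ht, h₁ 1 (by linarith)]⟩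

theorem OnePath.exists_comp_clamp_eq (γ : OnePath V N) :
    ∃ ε > 0, ∀ r, IsClamp ε r → ∀ t, γ (r t) = γ t := by
  obtain ⟨ε, hε, h₀, h₁⟩ := γ.sitting
  exact ⟨ε, hε, fun r hr => hr.comp_eq h₀ h₁⟩

theorem TwoPath.exists_comp_clamp_eq (Γ : TwoPath V N) :
    ∃ ε > 0, ∀ r, IsClamp ε r → ∀ t s, Γ (r t, r s) = Γ (t, s) := by
  obtain ⟨ε, hε, h₀, h₁, h₂, h₃⟩ := Γ.product
  refine ⟨ε, hε, fun r hr t s => ?_⟩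
  rw [hr.comp_eq (g := fun t => Γ (t, r s)) (fun t ht => h₀ t ht _) (fun t ht => h₁ t ht _),
    hr.comp_eq (g := fun s => Γ (t, s)) (fun s hs => h₂ s hs _) (fun s hs => h₃ s hs _)]

end Clamp

section Lift

variable {VM : Type*} [NormedAddCommGroup VM] [NormedSpace ℝ VM]
  {M : Type*} [TopologicalSpace M] [ChartedSpace VM M]
  {VG : Type*} [NormedAddCommGroup VG] [NormedSpace ℝ VG] [FiniteDimensional ℝ VG]
  {G : Type*} [TopologicalSpace G] [T2Space G] [ChartedSpace VG G] [Group G]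
  [LieGroup 𝓘(ℝ, VG) ∞ G]
  {VE : Type*} [NormedAddCommGroup VE] [NormedSpace ℝ VE] [FiniteDimensional ℝ VE]
  {E : Type*} [TopologicalSpace E] [T2Space E] [ChartedSpace VE E] [Group E]
  [LieGroup 𝓘(ℝ, VE) ∞ E]
  {VP : Type*} [NormedAddCommGroup VP] [NormedSpace ℝ VP]
  {P : Type*} [TopologicalSpace P] [ChartedSpace VP P] [IsManifold 𝓘(ℝ, VP) ∞ P]
  {𝒢 : LieCrossedModule VG G VE E} {B : PrincipalBundle VM M VG G VP P}

namespace CategoricalConnection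

theorem exists_onePath_lift (c : CategoricalConnection 𝒢 B) (γ : OnePath VM M) :
    ∃ σ : OnePath VP P, ∀ t, B.proj (σ t) = γ t := by
  obtain ⟨L, hL, h⟩ := c.exists_lift γ.smooth
  obtain ⟨ε, hε, hγ⟩ := γ.exists_comp_clamp_eq
  obtain ⟨r, hr⟩ := exists_isClamp hε
  exact ⟨.ofClamp hr hL, fun t => (h _).trans (hγ r hr t)⟩

theorem exists_twoPath_lift (c : CategoricalConnection 𝒢 B) (Γ : TwoPath VM M) :
    ∃ σ : TwoPath VP P, ∀ p, B.proj (σ p) = Γ p := by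
  obtain ⟨L, hL, h⟩ := c.exists_lift Γ.smooth
  obtain ⟨ε, hε, hΓ⟩ := Γ.exists_comp_clamp_eq
  obtain ⟨r, hr⟩ := exists_isClamp hε
  exact ⟨.ofClamp hr hL, fun p => (h _).trans (hΓ r hr p.1 p.2)⟩

/-- Composable paths have composable lifts, cut out of a lift of their concatenation. -/
theorem exists_concat_lift (c : CategoricalConnection 𝒢 B) (γ φ : OnePath VM M) (h : γ 1 = φ 0) :
    ∃ σ τ : OnePath VP P, σ 1 = τ 0 ∧ (∀ t, B.proj (σ t) = γ t) ∧ ∀ t, B.proj (τ t) = φ t := by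
  obtain ⟨L, hL, hp⟩ := c.exists_lift (γ.concat φ h).smooth
  obtain ⟨ε, hε, hγ⟩ := γ.exists_comp_clamp_eq
  obtain ⟨ε', hε', hφ⟩ := φ.exists_comp_clamp_eq
  obtain ⟨r, hr⟩ := exists_isClamp (lt_min hε hε')
  have hs : ContMDiff 𝓘(ℝ, ℝ) 𝓘(ℝ, VP) ∞ fun t : ℝ => L (t / 2) :=
    hL.comp (by fun_prop : ContDiff ℝ ∞ fun t : ℝ => t / 2).contMDiff
  have hs' : ContMDiff 𝓘(ℝ, ℝ) 𝓘(ℝ, VP) ∞ fun t : ℝ => L ((t + 1) / 2) :=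
    hL.comp (by fun_prop : ContDiff ℝ ∞ fun t : ℝ => (t + 1) / 2).contMDiff
  have key : ∀ t ∈ Icc (0 : ℝ) 1, B.proj (L (t / 2)) = γ t ∧ B.proj (L ((t + 1) / 2)) = φ t := by
    intro t ht
    rw [hp, hp]
    constructor
    · refine (if_pos (by linarith [ht.2])).trans (congrArg γ (by ring))
    · rcases ht.1.eq_or_lt with rfl | ht0
      · refine (if_pos (by norm_num)).trans ((congrArg γ (by norm_num)).trans h)
      · exact (if_neg (by linarith)).trans (congrArg φ (by ring))
  refine ⟨.ofClamp hr hs, .ofClamp hr hs', ?_,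
    fun t => (key _ (hr.mem t)).1.trans (hγ r (hr.mono (min_le_left _ _)) t),
    fun t => (key _ (hr.mem t)).2.trans (hφ r (hr.mono (min_le_right _ _)) t)⟩
  obtain ⟨δ, hδ, h₀, h₁⟩ := hr.sitting
  change L (r 1 / 2) = L ((r 0 + 1) / 2)
  rw [h₁ 1 (by linarith), h₀ 0 hδ.le, zero_add]

/-- Composable 2-paths have composable lifts, cut out of a lift of their composite. -/
theorem exists_hconcat_lift (c : CategoricalConnection 𝒢 B) (Γ Γ' : TwoPath VM M)
    (h : Γ.right = Γ'.left) : ∃ σ τ : TwoPath VP P, σ.right = τ.left ∧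
      (∀ p, B.proj (σ p) = Γ p) ∧ ∀ p, B.proj (τ p) = Γ' p := by
  obtain ⟨L, hL, hp⟩ := c.exists_lift (Γ.hconcat Γ' h).smooth
  obtain ⟨ε, hε, hΓ⟩ := Γ.exists_comp_clamp_eq
  obtain ⟨ε', hε', hΓ'⟩ := Γ'.exists_comp_clamp_eq
  obtain ⟨r, hr⟩ := exists_isClamp (lt_min hε hε')
  have hs : ContMDiff 𝓘(ℝ, ℝ × ℝ) 𝓘(ℝ, VP) ∞ fun p : ℝ × ℝ => L (p.1 / 2, p.2) :=
    hL.comp (by fun_prop : ContDiff ℝ ∞ fun p : ℝ × ℝ => (p.1 / 2, p.2)).contMDiff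
  have hs' : ContMDiff 𝓘(ℝ, ℝ × ℝ) 𝓘(ℝ, VP) ∞ fun p : ℝ × ℝ => L ((p.1 + 1) / 2, p.2) :=
    hL.comp (by fun_prop : ContDiff ℝ ∞ fun p : ℝ × ℝ => ((p.1 + 1) / 2, p.2)).contMDiff
  have key : ∀ t ∈ Icc (0 : ℝ) 1, ∀ s, B.proj (L (t / 2, s)) = Γ (t, s) ∧
      B.proj (L ((t + 1) / 2, s)) = Γ' (t, s) := by
    intro t ht s
    rw [hp, hp]
    constructor
    · exact (if_pos (by dsimp only; linarith [ht.2])).trans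
        (congrArg (fun t => Γ (t, s)) (by dsimp only; ring))
    · rcases ht.1.eq_or_lt with rfl | ht0
      · exact (if_pos (by norm_num)).trans ((congrArg (fun t => Γ (t, s)) (by norm_num)).trans
          (congrArg (fun γ : OnePath VM M => γ s) h))
      · exact (if_neg (by dsimp only; linarith)).trans
          (congrArg (fun t => Γ' (t, s)) (by dsimp only; ring))
  refine ⟨.ofClamp hr hs, .ofClamp hr hs', ?_,
    fun p => (key _ (hr.mem p.1) _).1.trans (hΓ r (hr.mono (min_le_left _ _)) p.1 p.2),
    fun p => (key _ (hr.mem p.1) _).2.trans (hΓ' r (hr.mono (min_le_right _ _)) p.1 p.2)⟩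
  obtain ⟨δ, hδ, h₀, h₁⟩ := hr.sitting
  ext s
  change L (r 1 / 2, r s) = L ((r 0 + 1) / 2, r s)
  rw [h₁ 1 (by linarith), h₀ 0 hδ.le, zero_add]

/-- The holonomy of a 2-path is invariant under rank-2 homotopy: the homotopy lifts to a homotopy of
lifts along which the curvature 3-form vanishes. -/
theorem catHol_eq_of_rankTwoHomotopic (c : CategoricalConnection 𝒢 B) {Γ Γ' : TwoPath VM M}
    (h : RankTwoHomotopic Γ Γ') {u : P} (hu : B.proj u = Γ (0, 0)) :
    c.catHol Γ u = c.catHol Γ' u := by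
  obtain ⟨J, h⟩ := h
  obtain ⟨ε, hε, h1, h2, h3, h4, h5, h6⟩ := h.product
  obtain ⟨r, hr⟩ := exists_isClamp hε
  obtain ⟨L, hL, hp⟩ := c.exists_lift h.smooth
  have hJr : ∀ t s x, J (r t, r s, r x) = J (t, s, x) := fun t s x => by
    rw [hr.comp_eq (g := fun t => J (t, r s, r x)) (fun t ht => h1 t ht _ _)
        (fun t ht => h2 t ht _ _),
      hr.comp_eq (g := fun s => J (t, s, r x)) (fun t ht => h3 t ht _ _) (fun t ht => h4 t ht _ _),
      hr.comp_eq (g := fun x => J (t, s, x)) (fun t ht => h5 t ht _ _) (fun t ht => h6 t ht _ _)]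
  set σ₀ : ℝ × ℝ × ℝ → P := fun z => L (r z.1, r z.2.1, r z.2.2) with hσ₀
  have hσ₀s : ContMDiff 𝓘(ℝ, ℝ × ℝ × ℝ) 𝓘(ℝ, VP) ∞ σ₀ :=
    hL.comp ((hr.smooth.comp contDiff_fst).prodMk ((hr.smooth.comp (contDiff_fst.comp
      contDiff_snd)).prodMk (hr.smooth.comp (contDiff_snd.comp contDiff_snd)))).contMDiff
  have hσ₀p : ∀ z, B.proj (σ₀ z) = J z := fun z => (hp _).trans (hJr _ _ _)
  have hJ0 : ∀ x, J (0, 0, x) = Γ (0, 0) := fun x => by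
    obtain ⟨K, hK, hr⟩ := h.left
    have := hr.left_const x
    change K (0, x) = K (0, 0) at this
    rw [← hK, this, hK, h.start]
  -- normalise the lift so that it is constant along the edge over the origin
  choose g hg using fun x => B.exists_act_eq (((hσ₀p _).trans (hJ0 x)).trans hu.symm)
  have hgs : ContMDiff 𝓘(ℝ, ℝ) 𝓘(ℝ, VG) ∞ g := fun x => B.contMDiffAt_difference
    (hσ₀s.comp (by fun_prop : ContDiff ℝ ∞ fun x : ℝ => ((0 : ℝ), (0 : ℝ), x)).contMDiff x)
    (contMDiffAt_const (c := u)) (Eventually.of_forall hg)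
  set σ : ℝ × ℝ × ℝ → P := fun z => B.act (σ₀ z) (g z.2.2) with hσ
  have hσs : ContMDiff 𝓘(ℝ, ℝ × ℝ × ℝ) 𝓘(ℝ, VP) ∞ σ := B.act_smooth.comp
    (hσ₀s.prodMk (hgs.comp (contDiff_snd.comp contDiff_snd).contMDiff))
  have hσp : ∀ z, B.proj (σ z) = J z := fun z => (B.proj_act _ _).trans (hσ₀p z)
  have slice : ∀ x, ∃ Δ : TwoPath VP P, ∀ t s, σ (t, s, x) = Δ (t, s) := fun x =>
    ⟨.ofClamp hr ((B.contMDiff_act_const (g x)).comp (hL.comp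
      (by fun_prop : ContDiff ℝ ∞ fun p : ℝ × ℝ => (p.1, p.2, r x)).contMDiff)), fun _ _ => rfl⟩
  obtain ⟨Δ, hΔ⟩ := slice 0
  obtain ⟨Δ', hΔ'⟩ := slice 1
  have e := c.catHol_eq (Γ := Γ) (σ := Δ) (fun p => by rw [← hΔ, hσp, h.start]) 1
  have e' := c.catHol_eq (Γ := Γ') (σ := Δ') (fun p => by rw [← hΔ', hσp, h.finish]) 1
  rw [B.act_one, ← hΔ, show σ (0, 0, 0) = u from hg 0] at e
  rw [B.act_one, ← hΔ', show σ (0, 0, 1) = u from hg 1] at e'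
  rw [e, e']
  congr 1
  refine c.pair.surfaceExp_eq_of_homotopy hσs hΔ hΔ' (fun z => ?_) (fun x => ?_) (fun p => ?_)
    (fun p => ?_) (fun p => ?_) (fun p => ?_)
  · obtain ⟨v, hv, h0⟩ := h.rank.exists_tmap_eq_zero (by simp) z
    obtain ⟨A, hA⟩ := exists_vert_tmap hσs hσp h0
    exact ⟨v, hv, fun w w' => by rw [hA]; exact c.curv₃_vert hσs z w w' A⟩
  · exact c.pair.coeff₁_const _ (fun x y => (hg x).trans (hg y).symm) (1 : ℝ) x
  · obtain ⟨K, hK, hr⟩ := h.left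
    exact c.coeff₂_lift_eq_zero (hσs.comp
      (by fun_prop : ContDiff ℝ ∞ fun q : ℝ × ℝ => ((0 : ℝ), q)).contMDiff)
      (fun q => (hσp _).trans (hK q.1 q.2).symm) hr.rank p
  · obtain ⟨K, hK, hr⟩ := h.right
    exact c.coeff₂_lift_eq_zero (hσs.comp
      (by fun_prop : ContDiff ℝ ∞ fun q : ℝ × ℝ => ((1 : ℝ), q)).contMDiff)
      (fun q => (hσp _).trans (hK q.1 q.2).symm) hr.rank p
  · obtain ⟨K, hK, hr⟩ := h.down
    exact c.coeff₂_lift_eq_zero (hσs.comp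
      (by fun_prop : ContDiff ℝ ∞ fun q : ℝ × ℝ => (q.1, (0 : ℝ), q.2)).contMDiff)
      (fun q => (hσp _).trans (hK q.1 q.2).symm) hr.rank p
  · obtain ⟨K, hK, hr⟩ := h.up
    exact c.coeff₂_lift_eq_zero (hσs.comp
      (by fun_prop : ContDiff ℝ ∞ fun q : ℝ × ℝ => (q.1, (1 : ℝ), q.2)).contMDiff)
      (fun q => (hσp _).trans (hK q.1 q.2).symm) hr.rank p

end CategoricalConnection

end Lift

/-! ### Functoriality of the categorical holonomy -/

section Functoriality

variable {VM : Type*} [NormedAddCommGroup VM] [NormedSpace ℝ VM]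
  {M : Type*} [TopologicalSpace M] [ChartedSpace VM M]
  {VG : Type*} [NormedAddCommGroup VG] [NormedSpace ℝ VG] [FiniteDimensional ℝ VG]
  {G : Type*} [TopologicalSpace G] [T2Space G] [ChartedSpace VG G] [Group G]
  [LieGroup 𝓘(ℝ, VG) ∞ G]
  {VE : Type*} [NormedAddCommGroup VE] [NormedSpace ℝ VE] [FiniteDimensional ℝ VE]
  {E : Type*} [TopologicalSpace E] [T2Space E] [ChartedSpace VE E] [Group E]
  [LieGroup 𝓘(ℝ, VE) ∞ E]
  {VP : Type*} [NormedAddCommGroup VP] [NormedSpace ℝ VP] [FiniteDimensional ℝ VP]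
  {P : Type*} [TopologicalSpace P] [ChartedSpace VP P] [IsManifold 𝓘(ℝ, VP) ∞ P]
  {𝒢 : LieCrossedModule VG G VE E} {B : PrincipalBundle VM M VG G VP P}

namespace CategoricalConnection

variable (c : CategoricalConnection 𝒢 B)

theorem proj_transport (γ : OnePath VM M) {u : P} (hu : B.proj u = γ 0) (t : ℝ) :
    B.proj (c.transport γ u t) = γ t := by
  obtain ⟨σ, h⟩ := c.exists_onePath_lift γ
  obtain ⟨g, rfl⟩ := B.exists_act_eq ((h 0).trans hu.symm)
  rw [c.transport_eq h, B.proj_act, h]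

theorem transport_act (γ : OnePath VM M) {u : P} (hu : B.proj u = γ 0) (k : G) (t : ℝ) :
    c.transport γ (B.act u k) t = B.act (c.transport γ u t) k := by
  obtain ⟨σ, h⟩ := c.exists_onePath_lift γ
  obtain ⟨g, rfl⟩ := B.exists_act_eq ((h 0).trans hu.symm)
  rw [← B.act_mul, c.transport_eq h, c.transport_eq h, ← B.act_mul, mul_assoc]

theorem transport_const (u : P) (t : ℝ) : c.transport (OnePath.const (B.proj u)) u t = u := by
  have h := c.transport_eq (γ := OnePath.const (B.proj u)) (σ := OnePath.const u)
    (fun _ => rfl) 1 t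
  rw [LocalConnectionPair.pathExp_const, inv_one, mul_one, B.act_one] at h
  exact h.trans (B.act_one u)

theorem transport_of_const {γ : OnePath VM M} (hγ : ∀ t, γ t = γ 0) {u : P}
    (hu : B.proj u = γ 0) (t : ℝ) : c.transport γ u t = u := by
  have : γ = OnePath.const (B.proj u) := by
    ext t
    exact (hγ t).trans hu.symm
  rw [this, c.transport_const]

theorem transport_concat (γ φ : OnePath VM M) (h : γ 1 = φ 0) {u : P} (hu : B.proj u = γ 0) :
    c.transport (γ.concat φ h) u 1 = c.transport φ (c.transport γ u 1) 1 := by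
  obtain ⟨σ, τ, hστ, hσ, hτ⟩ := c.exists_concat_lift γ φ h
  obtain ⟨g, rfl⟩ := B.exists_act_eq ((hσ 0).trans hu.symm)
  have h0 : (σ.concat τ hστ) 0 = σ 0 :=
    (if_pos (by norm_num)).trans (congrArg σ (mul_zero 2))
  have h1 : (σ.concat τ hστ) 1 = τ 1 :=
    (if_neg (by norm_num)).trans (congrArg τ (by norm_num))
  have hc : ∀ t, B.proj ((σ.concat τ hστ) t) = (γ.concat φ h) t := fun t => by
    change B.proj (if t ≤ 1 / 2 then _ else _) = if t ≤ 1 / 2 then _ else _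
    split_ifs
    · exact hσ _
    · exact hτ _
  have e := c.transport_eq hc g 1
  rw [h0, h1, LocalConnectionPair.pathExp_concat] at e
  rw [e, c.transport_eq hσ, hστ, c.transport_eq hτ, mul_inv_rev, mul_assoc]

theorem transport_rev (γ γ' : OnePath VM M) (hr : ∀ t, γ' t = γ (1 - t)) {u : P}
    (hu : B.proj u = γ 0) : c.transport γ' (c.transport γ u 1) 1 = u := by
  obtain ⟨σ, h⟩ := c.exists_onePath_lift γ
  obtain ⟨g, rfl⟩ := B.exists_act_eq ((h 0).trans hu.symm)
  -- the reversal of the lift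
  set σ' : OnePath VP P := σ.deg₁.vrev.left
  have hσ' : ∀ t, σ' t = σ (1 - t) := fun _ => rfl
  have e := c.transport_eq (γ := γ') (σ := σ') (fun t => by rw [hσ', h, hr])
    ((c.pair.pathExp σ 1)⁻¹ * g) 1
  rw [hσ', hσ', sub_zero, sub_self, c.pair.pathExp_rev_one σ σ' hσ', inv_inv,
    mul_inv_cancel_left] at e
  rw [c.transport_eq h, e]

theorem catHol_act (Γ : TwoPath VM M) {u : P} (hu : B.proj u = Γ (0, 0)) (k : G) :
    c.catHol Γ (B.act u k) = 𝒢.act k⁻¹ (c.catHol Γ u) := by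
  obtain ⟨σ, h⟩ := c.exists_twoPath_lift Γ
  obtain ⟨g, rfl⟩ := B.exists_act_eq ((h (0, 0)).trans hu.symm)
  rw [← B.act_mul, c.catHol_eq h, c.catHol_eq h, mul_inv_rev, map_mul]
  rfl

/-- The boundary condition of the square of a 2-path. -/
theorem transport_act_bd_catHol (Γ : TwoPath VM M) {u : P} (hu : B.proj u = Γ (0, 0)) :
    B.act (c.transport Γ.right (c.transport Γ.down u 1) 1) (𝒢.bd (c.catHol Γ u)) =
      c.transport Γ.up (c.transport Γ.left u 1) 1 := by
  obtain ⟨σ, h⟩ := c.exists_twoPath_lift Γ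
  obtain ⟨g, rfl⟩ := B.exists_act_eq ((h (0, 0)).trans hu.symm)
  have e1 : c.transport Γ.down (B.act (σ (0, 0)) g) 1 =
      B.act (σ (1, 0)) ((c.pair.pathExp σ.down 1)⁻¹ * g) :=
    c.transport_eq (γ := Γ.down) (σ := σ.down) (fun _ => h _) g 1
  have e2 : ∀ k, c.transport Γ.right (B.act (σ (1, 0)) k) 1 =
      B.act (σ (1, 1)) ((c.pair.pathExp σ.right 1)⁻¹ * k) := fun k =>
    c.transport_eq (γ := Γ.right) (σ := σ.right) (fun _ => h _) k 1
  have e3 : c.transport Γ.left (B.act (σ (0, 0)) g) 1 =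
      B.act (σ (0, 1)) ((c.pair.pathExp σ.left 1)⁻¹ * g) :=
    c.transport_eq (γ := Γ.left) (σ := σ.left) (fun _ => h _) g 1
  have e4 : ∀ k, c.transport Γ.up (B.act (σ (0, 1)) k) 1 =
      B.act (σ (1, 1)) ((c.pair.pathExp σ.up 1)⁻¹ * k) := fun k =>
    c.transport_eq (γ := Γ.up) (σ := σ.up) (fun _ => h _) k 1
  rw [e1, e2, e3, e4, c.catHol_eq h, ← B.act_mul, 𝒢.bd_act]
  congr 1
  have hc := congrArg (·⁻¹) (c.pair.surfaceExp_comm σ)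
  simp only [mul_inv_rev, inv_inv] at hc
  rw [← mul_assoc _ (c.pair.pathExp σ.left 1)⁻¹ g, ← hc]
  group

theorem catHol_eq_one_of_rank {Γ : TwoPath VM M} (hΓ : RankLE (V := VM) 1 Γ.toFun) {u : P}
    (hu : B.proj u = Γ (0, 0)) : c.catHol Γ u = 1 := by
  obtain ⟨σ, h⟩ := c.exists_twoPath_lift Γ
  obtain ⟨g, rfl⟩ := B.exists_act_eq ((h (0, 0)).trans hu.symm)
  rw [c.catHol_eq h, c.pair.surfaceExp_eq_one σ (c.coeff₂_lift_eq_zero σ.smooth h hΓ), map_one]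

/-- The boundary condition of a rank-1 homotopy, whose holonomy is trivial. -/
theorem transport_eq_of_rankOneHomotopic {φ γ : OnePath VM M} (h : RankOneHomotopic φ γ) {u : P}
    (hu : B.proj u = φ 0) : c.transport φ u 1 = c.transport γ u 1 := by
  obtain ⟨K, h⟩ := h
  have hu' : B.proj u = K.down 0 := by rw [h.down_eq, hu]
  have e := c.transport_act_bd_catHol K (u := u) hu'
  rwa [c.catHol_eq_one_of_rank h.rank hu', map_one, B.act_one, h.down_eq, h.up_eq,
    c.transport_of_const h.left_const hu', c.transport_of_const h.right_const] at e
  rw [c.proj_transport φ hu, ← h.down_eq]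
  rfl

theorem catHol_transp (Γ : TwoPath VM M) {u : P} (hu : B.proj u = Γ (0, 0)) :
    c.catHol Γ.transp u = (c.catHol Γ u)⁻¹ := by
  obtain ⟨σ, h⟩ := c.exists_twoPath_lift Γ
  obtain ⟨g, rfl⟩ := B.exists_act_eq ((h (0, 0)).trans hu.symm)
  have e : c.catHol Γ.transp (B.act (σ (0, 0)) g) = 𝒢.act g⁻¹ (c.pair.surfaceExp σ.transp) :=
    c.catHol_eq (Γ := Γ.transp) (σ := σ.transp) (fun p => h p.swap) g
  rw [e, c.catHol_eq h, c.pair.surfaceExp_transp, map_inv (𝒢.act g⁻¹)]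

theorem catHol_vrev (Γ : TwoPath VM M) {u : P} (hu : B.proj u = Γ (0, 0)) :
    c.catHol Γ.vrev (c.transport Γ.left u 1) = (c.catHol Γ u)⁻¹ := by
  obtain ⟨σ, h⟩ := c.exists_twoPath_lift Γ
  obtain ⟨g, rfl⟩ := B.exists_act_eq ((h (0, 0)).trans hu.symm)
  have e1 : c.transport Γ.left (B.act (σ (0, 0)) g) 1 =
      B.act (σ (0, 1)) ((c.pair.pathExp σ.left 1)⁻¹ * g) :=
    c.transport_eq (γ := Γ.left) (σ := σ.left) (fun _ => h _) g 1
  have e2 := c.catHol_eq (Γ := Γ.vrev) (σ := σ.vrev) (fun p => h _)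
    ((c.pair.pathExp σ.left 1)⁻¹ * g)
  have e3 : σ.vrev (0, 0) = σ (0, 1) := congrArg (fun s => σ (0, s)) (sub_zero 1)
  rw [e3] at e2
  rw [e1, e2, c.catHol_eq h, c.pair.surfaceExp_vrev, mul_inv_rev, map_mul, MulAut.mul_apply,
    ← map_inv (𝒢.act g⁻¹), inv_inv]
  congr 1
  rw [← MulAut.mul_apply, ← map_mul, mul_inv_cancel, map_one]
  rfl

theorem catHol_hconcat (Γ Γ' : TwoPath VM M) (h : Γ.right = Γ'.left) {u : P}
    (hu : B.proj u = Γ (0, 0)) : c.catHol (Γ.hconcat Γ' h) u =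
      c.catHol Γ' (c.transport Γ.down u 1) * c.catHol Γ u := by
  obtain ⟨σ, τ, hστ, hσ, hτ⟩ := c.exists_hconcat_lift Γ Γ' h
  obtain ⟨g, rfl⟩ := B.exists_act_eq ((hσ (0, 0)).trans hu.symm)
  have h0 : (σ.hconcat τ hστ) (0, 0) = σ (0, 0) :=
    (if_pos (by norm_num)).trans (congrArg (fun t => σ (t, 0)) (mul_zero 2))
  have hc : ∀ p, B.proj ((σ.hconcat τ hστ) p) = (Γ.hconcat Γ' h) p := fun p => by
    change B.proj (if p.1 ≤ 1 / 2 then _ else _) = if p.1 ≤ 1 / 2 then _ else _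
    split_ifs
    · exact hσ _
    · exact hτ _
  have e1 : c.transport Γ.down (B.act (σ (0, 0)) g) 1 =
      B.act (σ (1, 0)) ((c.pair.pathExp σ.down 1)⁻¹ * g) :=
    c.transport_eq (γ := Γ.down) (σ := σ.down) (fun _ => hσ _) g 1
  have e2 : σ (1, 0) = τ (0, 0) := congrArg (fun γ : OnePath VP P => γ 0) hστ
  have e := c.catHol_eq hc g
  rw [h0] at e
  rw [e, e1, e2, c.catHol_eq hτ, c.catHol_eq hσ, c.pair.surfaceExp_hconcat, map_mul,
    mul_inv_rev, inv_inv, map_mul 𝒢.act, MulAut.mul_apply]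

end CategoricalConnection

end Functoriality

/-! ### Criteria for squares in the double groupoid of a bundle -/

section Squares

variable {VM : Type*} [NormedAddCommGroup VM] [NormedSpace ℝ VM]
  {M : Type*} [TopologicalSpace M] [ChartedSpace VM M]
  {VG : Type*} [NormedAddCommGroup VG] [NormedSpace ℝ VG]
  {G : Type*} [TopologicalSpace G] [ChartedSpace VG G] [Group G]
  {VE : Type*} [NormedAddCommGroup VE] [NormedSpace ℝ VE]
  {E : Type*} [TopologicalSpace E] [ChartedSpace VE E] [Group E]
  {VP : Type*} [NormedAddCommGroup VP] [NormedSpace ℝ VP]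
  {P : Type*} [TopologicalSpace P] [ChartedSpace VP P]
  {𝒢 : LieCrossedModule VG G VE E} {B : PrincipalBundle VM M VG G VP P}

namespace PrincipalBundle

/-- Edges are equal if they have the same end points and the same underlying map of points of the
total space. -/
theorem Edge.ext_of_val {e e' : B.Edge} (hs : e.src = e'.src) (ht : e.tgt = e'.tgt)
    (h : ∀ (u : B.Fibre e.src) (u' : B.Fibre e'.src), u.1 = u'.1 → (e.map u).1 = (e'.map u').1) :
    e = e' := by
  obtain ⟨x, y, a⟩ := e
  obtain ⟨x', y', a'⟩ := e'
  obtain rfl : x = x' := hs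
  obtain rfl : y = y' := ht
  congr 1
  exact FibreMap.ext (funext fun u => Subtype.ext (h u u rfl))

theorem Edge.Comp.of_val {e e' e'' : B.Edge} (h : e.tgt = e'.src) (hs : e''.src = e.src)
    (ht : e''.tgt = e'.tgt)
    (hm : ∀ (u'' : B.Fibre e''.src) (u : B.Fibre e.src) (u' : B.Fibre e'.src), u''.1 = u.1 →
      u'.1 = (e.map u).1 → (e''.map u'').1 = (e'.map u').1) : Edge.Comp e e' e'' := by
  obtain ⟨x, y, a⟩ := e
  obtain ⟨y', z, b⟩ := e'
  obtain ⟨x', z', d⟩ := e''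
  obtain rfl : y = y' := h
  obtain rfl : x' = x := hs
  obtain rfl : z' = z := ht
  obtain rfl : d = a.comp b :=
    FibreMap.ext (funext fun u => Subtype.ext (hm u u (a u) rfl rfl))
  exact .mk a b

/-- Squares are equal if they have the same faces and the same underlying function of points of
the total space. -/
theorem Square.ext_of_val {k k' : Square B 𝒢}
    (hd : (⟨k.x, k.y, k.a⟩ : B.Edge) = ⟨k'.x, k'.y, k'.a⟩)
    (hr : (⟨k.y, k.w, k.b⟩ : B.Edge) = ⟨k'.y, k'.w, k'.b⟩)
    (hl : (⟨k.x, k.z, k.c⟩ : B.Edge) = ⟨k'.x, k'.z, k'.c⟩)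
    (hu : (⟨k.z, k.w, k.d⟩ : B.Edge) = ⟨k'.z, k'.w, k'.d⟩)
    (hf : ∀ (u : B.Fibre k.x) (u' : B.Fibre k'.x), u.1 = u'.1 →
      k.filler.f u = k'.filler.f u') : k = k' := by
  obtain @⟨x, y, z, w, a, b, c, d, F⟩ := k
  obtain @⟨x', y', z', w', a', b', c', d', F'⟩ := k'
  simp only [Edge.mk.injEq] at hd hr hl hu
  obtain ⟨rfl, rfl, ha⟩ := hd
  obtain ⟨-, rfl, hb⟩ := hr
  obtain ⟨-, rfl, hc⟩ := hl
  obtain ⟨-, -, hd⟩ := hu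
  exact mk_congr F F' (eq_of_heq ha) (eq_of_heq hb) (eq_of_heq hc) (eq_of_heq hd)
    fun u => hf u u rfl

theorem Square.HComp.of_val {k k' k'' : Square B 𝒢}
    (h : (⟨k.y, k.w, k.b⟩ : B.Edge) = ⟨k'.x, k'.z, k'.c⟩)
    (hd : Edge.Comp (B := B) ⟨k.x, k.y, k.a⟩ ⟨k'.x, k'.y, k'.a⟩ ⟨k''.x, k''.y, k''.a⟩)
    (hr : (⟨k''.y, k''.w, k''.b⟩ : B.Edge) = ⟨k'.y, k'.w, k'.b⟩)
    (hl : (⟨k''.x, k''.z, k''.c⟩ : B.Edge) = ⟨k.x, k.z, k.c⟩)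
    (hu : Edge.Comp (B := B) ⟨k.z, k.w, k.d⟩ ⟨k'.z, k'.w, k'.d⟩ ⟨k''.z, k''.w, k''.d⟩)
    (hf : ∀ (u'' : B.Fibre k''.x) (u : B.Fibre k.x) (u' : B.Fibre k'.x), u''.1 = u.1 →
      u'.1 = (k.a u).1 → k''.filler.f u'' = k'.filler.f u' * k.filler.f u) :
    HComp k k' k'' := by
  obtain @⟨x, y, z, w, a, b, c, d, F⟩ := k
  obtain @⟨x', y', z', w', a', b', c', d', F'⟩ := k'
  obtain @⟨x'', y'', z'', w'', a'', b'', c'', d'', F''⟩ := k''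
  simp only [Edge.mk.injEq] at h hr hl
  obtain ⟨rfl, rfl, h⟩ := h
  obtain ⟨rfl, rfl, hr⟩ := hr
  obtain ⟨rfl, rfl, hl⟩ := hl
  obtain rfl := eq_of_heq h
  obtain rfl := eq_of_heq hr
  obtain rfl := eq_of_heq hl
  cases hd
  cases hu
  have e : (⟨F''⟩ : Square B 𝒢) = ⟨F.hcomp F'⟩ :=
    mk_congr F'' (F.hcomp F') rfl rfl rfl rfl fun u => hf u u (a u) rfl rfl
  rw [e]
  exact .mk F F'

theorem Square.HComp.transp {k k' k'' : Square B 𝒢} (h : HComp k k' k'') :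
    VComp (⟨k.filler.transp⟩ : Square B 𝒢) ⟨k'.filler.transp⟩ ⟨k''.filler.transp⟩ := by
  obtain ⟨F, F'⟩ := h
  have e : (⟨(F.hcomp F').transp⟩ : Square B 𝒢) = ⟨F.transp.vcomp F'.transp⟩ :=
    mk_congr _ _ rfl rfl rfl rfl fun u => mul_inv_rev _ _
  rw [e]
  exact .mk F.transp F'.transp

end PrincipalBundle

end Squares

/-! ### The morphism defined by a categorical connection -/

section BundleMorphism

variable {VM : Type*} [NormedAddCommGroup VM] [NormedSpace ℝ VM] [FiniteDimensional ℝ VM]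
  {M : Type*} [TopologicalSpace M] [ChartedSpace VM M]
  {VG : Type*} [NormedAddCommGroup VG] [NormedSpace ℝ VG] [FiniteDimensional ℝ VG]
  {G : Type*} [TopologicalSpace G] [T2Space G] [ChartedSpace VG G] [Group G]
  [LieGroup 𝓘(ℝ, VG) ∞ G]
  {VE : Type*} [NormedAddCommGroup VE] [NormedSpace ℝ VE] [FiniteDimensional ℝ VE]
  {E : Type*} [TopologicalSpace E] [T2Space E] [ChartedSpace VE E] [Group E]
  [LieGroup 𝓘(ℝ, VE) ∞ E]
  {VP : Type*} [NormedAddCommGroup VP] [NormedSpace ℝ VP] [FiniteDimensional ℝ VP]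
  {P : Type*} [TopologicalSpace P] [ChartedSpace VP P] [IsManifold 𝓘(ℝ, VP) ∞ P]
  {𝒢 : LieCrossedModule VG G VE E} {B : PrincipalBundle VM M VG G VP P}

namespace CategoricalConnection

open PrincipalBundle

variable (c : CategoricalConnection 𝒢 B)

/-- Parallel transport as an equivariant map of fibres. -/
def transportMap (γ : OnePath VM M) : B.FibreMap (γ 0) (γ 1) where
  toFun u := ⟨c.transport γ u.1 1, c.proj_transport γ u.2 1⟩
  map_act u g := Subtype.ext (c.transport_act γ u.2 g 1)

/-- Parallel transport as an edge of the double groupoid of the bundle. -/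
def edge (γ : OnePath VM M) : B.Edge := ⟨γ 0, γ 1, c.transportMap γ⟩

/-- The square of a 2-path. -/
def square (Γ : TwoPath VM M) : Square B 𝒢 where
  x := Γ (0, 0)
  y := Γ (1, 0)
  z := Γ (0, 1)
  w := Γ (1, 1)
  a := c.transportMap Γ.down
  b := c.transportMap Γ.right
  c := c.transportMap Γ.left
  d := c.transportMap Γ.up
  filler :=
    { f := fun u => c.catHol Γ u.1
      map_act := fun u g => c.catHol_act Γ u.2 g
      comm := fun u => Subtype.ext (c.transport_act_bd_catHol Γ u.2) }

theorem edge_eq_of_rankOneHomotopic {φ γ : OnePath VM M} (h : RankOneHomotopic φ γ) :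
    c.edge φ = c.edge γ := by
  refine Edge.ext_of_val ?_ ?_ fun u u' hu => ?_
  · obtain ⟨K, h⟩ := h
    change φ 0 = γ 0
    rw [← h.down_eq, ← h.up_eq]
    exact (h.left_const 1).symm
  · obtain ⟨K, h⟩ := h
    change φ 1 = γ 1
    rw [← h.down_eq, ← h.up_eq]
    exact (h.right_const 1).symm
  · change c.transport φ u.1 1 = c.transport γ u'.1 1
    rw [← hu, c.transport_eq_of_rankOneHomotopic h u.2]

theorem edge_of_const {γ : OnePath VM M} (hγ : ∀ t, γ t = γ 0) :
    c.edge γ = ⟨γ 0, γ 0, FibreMap.id _⟩ :=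
  Edge.ext_of_val rfl (hγ 1) fun u _ hu => (c.transport_of_const hγ u.2 1).trans hu

theorem edge_concat (γ φ : OnePath VM M) (h : γ 1 = φ 0) :
    Edge.Comp (c.edge γ) (c.edge φ) (c.edge (γ.concat φ h)) := by
  refine .of_val h ((if_pos (by norm_num)).trans (congrArg γ (mul_zero 2)))
    ((if_neg (by norm_num)).trans (congrArg φ (by norm_num))) fun u'' u u' h1 h2 => ?_
  change c.transport _ u''.1 1 = c.transport φ u'.1 1
  rw [h1, h2, c.transport_concat γ φ h u.2]
  rfl

theorem edge_concat_of_const (γ φ : OnePath VM M) (h : γ 1 = φ 0) (hφ : ∀ t, φ t = φ 0) :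
    c.edge (γ.concat φ h) = c.edge γ := by
  refine Edge.ext_of_val ((if_pos (by norm_num)).trans (congrArg γ (mul_zero 2)))
    ((if_neg (by norm_num)).trans ((hφ _).trans h.symm)) fun u u' hu => ?_
  change c.transport _ u.1 1 = c.transport γ u'.1 1
  rw [hu, c.transport_concat γ φ h u'.2,
    c.transport_of_const hφ ((c.proj_transport γ u'.2 1).trans h)]

theorem edge_rev (γ γ' : OnePath VM M) (h : ∀ t, γ' t = γ (1 - t)) :
    c.edge γ' = ⟨γ 1, γ 0, (c.transportMap γ).inv⟩ := by
  refine Edge.ext_of_val ((h 0).trans (congrArg γ (sub_zero 1)))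
    ((h 1).trans (congrArg γ (sub_self 1))) fun u u' hu => ?_
  set v := (c.transportMap γ).inv u' with hv
  have hv' : c.transport γ v.1 1 = u'.1 :=
    congrArg Subtype.val ((c.transportMap γ).apply_inv u')
  change c.transport γ' u.1 1 = v.1
  rw [hu, ← hv', c.transport_rev γ γ' h v.2]

theorem square_eq_of_rankTwoHomotopic {Γ Γ' : TwoPath VM M} (h : RankTwoHomotopic Γ Γ') :
    c.square Γ = c.square Γ' := by
  refine Square.ext_of_val (c.edge_eq_of_rankOneHomotopic h.down)
    (c.edge_eq_of_rankOneHomotopic h.right) (c.edge_eq_of_rankOneHomotopic h.left)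
    (c.edge_eq_of_rankOneHomotopic h.up) fun u u' hu => ?_
  change c.catHol Γ u.1 = c.catHol Γ' u'.1
  rw [← hu, c.catHol_eq_of_rankTwoHomotopic h u.2]

theorem square_transp (Γ : TwoPath VM M) :
    c.square Γ.transp = ⟨(c.square Γ).filler.transp⟩ :=
  Square.ext_of_val rfl rfl rfl rfl fun _ u' hu =>
    (congrArg (c.catHol Γ.transp) hu).trans (c.catHol_transp Γ u'.2)

theorem square_vrev (Γ : TwoPath VM M) : c.square Γ.vrev = ⟨(c.square Γ).filler.vrev⟩ := by
  refine Square.ext_of_val ?_ (c.edge_rev Γ.right Γ.vrev.right fun _ => rfl)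
    (c.edge_rev Γ.left Γ.vrev.left fun _ => rfl) ?_ fun u u' hu => ?_
  · refine congrArg c.edge (?_ : Γ.vrev.down = Γ.up)
    ext t; exact congrArg (fun s => Γ (t, s)) (sub_zero 1)
  · refine congrArg c.edge (?_ : Γ.vrev.up = Γ.down)
    ext t; exact congrArg (fun s => Γ (t, s)) (sub_self 1)
  · set v := (c.transportMap Γ.left).inv u' with hv
    have hv' : c.transport Γ.left v.1 1 = u'.1 :=
      congrArg Subtype.val ((c.transportMap Γ.left).apply_inv u')
    change c.catHol Γ.vrev u.1 = (c.catHol Γ v.1)⁻¹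
    rw [hu, ← hv', c.catHol_vrev Γ v.2]

theorem square_hrev (Γ : TwoPath VM M) : c.square Γ.hrev = ⟨(c.square Γ).filler.hrev⟩ := by
  have h : Γ.hrev = Γ.transp.vrev.transp := rfl
  rw [h, square_transp, square_vrev, square_transp]
  exact Square.mk_congr _ _ rfl rfl rfl rfl fun u => by
    simp [Filler.hrev, Filler.vrev, Filler.transp]

theorem left_hconcat (Γ Γ' : TwoPath VM M) (h : Γ.right = Γ'.left) :
    (Γ.hconcat Γ' h).left = Γ.left := by
  ext s
  refine (if_pos (by norm_num)).trans (congrArg (fun t => Γ (t, s)) ?_)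
  norm_num

theorem right_hconcat (Γ Γ' : TwoPath VM M) (h : Γ.right = Γ'.left) :
    (Γ.hconcat Γ' h).right = Γ'.right := by
  ext s
  refine (if_neg (by norm_num)).trans (congrArg (fun t => Γ' (t, s)) ?_)
  norm_num

theorem square_hconcat (Γ Γ' : TwoPath VM M) (h : Γ.right = Γ'.left) :
    Square.HComp (c.square Γ) (c.square Γ') (c.square (Γ.hconcat Γ' h)) := by
  have h0 : Γ.down 1 = Γ'.down 0 := congrArg (fun γ : OnePath VM M => γ 0) h
  have h1 : Γ.up 1 = Γ'.up 0 := congrArg (fun γ : OnePath VM M => γ 1) h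
  refine .of_val (congrArg c.edge h) (c.edge_concat Γ.down Γ'.down h0)
    (congrArg c.edge (right_hconcat Γ Γ' h)) (congrArg c.edge (left_hconcat Γ Γ' h))
    (c.edge_concat Γ.up Γ'.up h1) fun u'' u u' hu hu' => ?_
  change c.catHol _ u''.1 = c.catHol Γ' u'.1 * c.catHol Γ u.1
  rw [hu, hu', c.catHol_hconcat Γ Γ' h u.2]
  rfl

/-- Composition with a rank-1 homotopy of an edge does not change the square. -/
theorem square_hconcat_homotopy (Γ J : TwoPath VM M) (h : Γ.right = J.transp.left)
    {γ : OnePath VM M} (hJ : IsRankOneHomotopy J Γ.right γ) :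
    c.square (Γ.hconcat J.transp h) = c.square Γ := by
  have h0 : Γ.down 1 = J.left 0 := congrArg (fun γ : OnePath VM M => γ 0) h
  have h1 : Γ.up 1 = J.right 0 := congrArg (fun γ : OnePath VM M => γ 1) h
  refine Square.ext_of_val (c.edge_concat_of_const Γ.down J.left h0 hJ.left_const) ?_
    (congrArg c.edge (left_hconcat Γ J.transp h))
    (c.edge_concat_of_const Γ.up J.right h1 hJ.right_const) fun u u' hu => ?_
  · refine (congrArg c.edge ((right_hconcat Γ J.transp h).trans hJ.up_eq)).trans ?_
    exact (c.edge_eq_of_rankOneHomotopic ⟨J, hJ⟩).symm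
  · change c.catHol _ u.1 = c.catHol Γ u'.1
    have hr : RankLE (V := VM) 1 J.transp.toFun :=
      hJ.rank.comp J.smooth (g := fun p : ℝ × ℝ => (p.2, p.1)) (by fun_prop)
    rw [hu, c.catHol_hconcat Γ J.transp h u'.2, c.catHol_eq_one_of_rank hr, one_mul]
    exact (c.proj_transport Γ.down u'.2 1).trans h0

theorem square_hconcat_hconcat {Γ J Γ' : TwoPath VM M} (h : Γ.right = J.transp.left)
    (h' : (Γ.hconcat J.transp h).right = Γ'.left) (hJ : IsRankOneHomotopy J Γ.right Γ'.left) :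
    Square.HComp (c.square Γ) (c.square Γ')
      (c.square ((Γ.hconcat J.transp h).hconcat Γ' h')) := by
  have := c.square_hconcat _ _ h'
  rwa [c.square_hconcat_homotopy Γ J h hJ] at this

theorem square_deg₁ (γ : OnePath VM M) :
    c.square γ.deg₁ = (B.doubleGroupoid 𝒢).deg₁ (c.edge γ) :=
  Square.ext_of_val (c.edge_of_const (γ := γ.deg₁.down) fun _ => rfl) rfl rfl
    (c.edge_of_const (γ := γ.deg₁.up) fun _ => rfl) fun u _ _ =>
    c.catHol_eq_one_of_rank (rankLE_deg₁ γ) u.2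

theorem square_deg₂ (γ : OnePath VM M) :
    c.square γ.deg₂ = (B.doubleGroupoid 𝒢).deg₂ (c.edge γ) := by
  have h := c.square_transp γ.deg₁
  rw [c.square_deg₁] at h
  exact h.trans (Square.mk_congr _ _ rfl rfl rfl rfl fun _ => inv_one)

/-- The morphism of double groupoids with thin structure given by parallel transport and
categorical holonomy. -/
def morphism : (thinDoubleGroupoid VM M).Hom (B.doubleGroupoid 𝒢) where
  obj x := x
  edge := Quot.lift c.edge fun _ _ => c.edge_eq_of_rankOneHomotopic
  sq := Quot.lift c.square fun _ _ => c.square_eq_of_rankTwoHomotopic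
  map_src a := by induction a using Quot.ind; rfl
  map_tgt a := by induction a using Quot.ind; rfl
  map_one x := c.edge_of_const fun _ => rfl
  map_comp := by
    rintro _ _ _ ⟨γ, φ, h, rfl, rfl, rfl⟩
    exact c.edge_concat γ φ h
  map_left k := by induction k using Quot.ind; rfl
  map_right k := by induction k using Quot.ind; rfl
  map_down k := by induction k using Quot.ind; rfl
  map_up k := by induction k using Quot.ind; rfl
  map_deg₁ a := by
    induction a using Quot.ind with
    | mk γ => exact c.square_deg₁ γ
  map_deg₂ a := by
    induction a using Quot.ind with
    | mk γ => exact c.square_deg₂ γ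
  map_hcomp := by
    rintro _ _ _ ⟨Γ, J, Γ', h, h', hJ, rfl, rfl, rfl⟩
    exact c.square_hconcat_hconcat h h' hJ
  map_vcomp := by
    rintro _ _ _ ⟨Γ, J, Γ', h, h', hJ, rfl, rfl, rfl⟩
    -- transpose the horizontal case
    have := (c.square_hconcat_hconcat (Γ := Γ.transp) (J := J) (Γ' := Γ'.transp) h h' hJ).transp
    rw [← square_transp, ← square_transp, ← square_transp] at this
    exact this
  map_thin := by
    rintro _ ⟨Γ, h, rfl⟩ u
    exact c.catHol_eq_one_of_rank h u.2
  map_d4 g k := by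
    refine map_d4Fun (fun k => ?_) (fun k => ?_) (fun k => ?_) g k
    · induction k using Quot.ind with
      | mk Γ => exact c.square_hrev Γ
    · induction k using Quot.ind with
      | mk Γ => exact c.square_vrev Γ
    · induction k using Quot.ind with
      | mk Γ => exact c.square_transp Γ

end CategoricalConnection

end BundleMorphism

end ThinHolonomy

end

end

open ThinHolonomy in
theorem mainTheorem3
    {VM : Type*} [NormedAddCommGroup VM] [NormedSpace ℝ VM] [FiniteDimensional ℝ VM]
    {M : Type*} [TopologicalSpace M] [T2Space M] [ChartedSpace VM M] [IsManifold 𝓘(ℝ, VM) ∞ M]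
    {VG : Type*} [NormedAddCommGroup VG] [NormedSpace ℝ VG] [FiniteDimensional ℝ VG]
    {G : Type*} [TopologicalSpace G] [T2Space G] [ChartedSpace VG G] [Group G]
    [LieGroup 𝓘(ℝ, VG) ∞ G]
    {VE : Type*} [NormedAddCommGroup VE] [NormedSpace ℝ VE] [FiniteDimensional ℝ VE]
    {E : Type*} [TopologicalSpace E] [T2Space E] [ChartedSpace VE E] [Group E]
    [LieGroup 𝓘(ℝ, VE) ∞ E]
    (𝒢 : LieCrossedModule VG G VE E) :
    -- categorical connections on principal bundles
    (∀ (VP : Type*) [NormedAddCommGroup VP] [NormedSpace ℝ VP] [FiniteDimensional ℝ VP]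
      (P : Type*) [TopologicalSpace P] [T2Space P] [ChartedSpace VP P] [IsManifold 𝓘(ℝ, VP) ∞ P]
      (B : PrincipalBundle VM M VG G VP P) (c : CategoricalConnection 𝒢 B),
      (∀ Γ Γ' : TwoPath VM M, RankTwoHomotopic Γ Γ' →
        ∀ u : P, B.proj u = Γ (0, 0) → c.catHol Γ u = c.catHol Γ' u) ∧
      ∃ H : (thinDoubleGroupoid VM M).Hom (B.doubleGroupoid 𝒢),
        (∀ x : M, H.obj x = x) ∧
        (∀ (γ : OnePath VM M) (u : B.Fibre (H.edge γ.track : B.Edge).src),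
          ((H.edge γ.track : B.Edge).map u).1 = c.transport γ u.1 1) ∧
        (∀ (Γ : TwoPath VM M) (u : B.Fibre (H.sq Γ.track : PrincipalBundle.Square B 𝒢).x),
          (H.sq Γ.track : PrincipalBundle.Square B 𝒢).filler.f u = c.catHol Γ u.1)) ∧
    -- local connection pairs
    (∀ c : LocalConnectionPair 𝒢 VM M,
      (∀ Γ Γ' : TwoPath VM M, RankTwoHomotopic Γ Γ' → c.surfaceExp Γ = c.surfaceExp Γ') ∧
      ∃ H : (thinDoubleGroupoid VM M).Hom 𝒢.doubleGroupoid,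
        (∀ γ : OnePath VM M, (H.edge γ.track : G) = c.pathExp γ 1) ∧
        (∀ Γ : TwoPath VM M, (H.sq Γ.track : 𝒢.Square).e = c.surfaceExp Γ)) := by
  refine ⟨fun VP _ _ _ P _ _ _ _ B c => ?_, fun c => ?_⟩
  · exact ⟨fun Γ Γ' h u => c.catHol_eq_of_rankTwoHomotopic h, c.morphism, fun _ => rfl,
      fun _ _ => rfl, fun _ _ => rfl⟩
  · exact ⟨fun Γ Γ' => c.surfaceExp_eq_of_rankTwoHomotopic, c.morphism, fun _ => rfl, fun _ => rfl⟩
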